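/- Let $\mathbb T=\mathbb R/2\pi\mathbb Z$, $\widehat f(k)=\frac1{2\pi}\int_0^{2\pi}f(x)e^{-ikx}dx$, $\langle x\rangle=(1+x^2)^{1/2}$, $\|f\|_{H^\sigma}=\big(\sum_{k\in\mathbb Z}\langle k\rangle^{2\sigma}|\widehat f(k)|^2\big)^{1/2}$, and let $(-\Delta)^\alpha$ be the Fourier multiplier with symbol $|k|^{2\alpha}$. Fix $\frac12<\alpha\le1$, $s>\frac34-\frac\alpha2$ and a sign $\varepsilon\in\{1,-1\}$, and consider on $\mathbb T$ the Cauchy problem $$iu_t+(-\Delta)^\alpha u=\varepsilon|u|^2u,\qquad u(0)=u_0\in H^s(\mathbb T).$$ For $b>\frac12$ let $X^{s,b}$ be the space with norm $\|\langle k\rangle^s\langle\tau-|k|^{2\alpha}\rangle^b\,\widehat u(k,\tau)\|_{\ell^2_kL^2_\tau}$, and let $X^{s,b}_T$ be the space of restrictions to $[-T,T]$ with the restriction norm (infimum over extensions). A solution on $[-T,T]$ is a function $u\in C([-T,T];H^s)\cap X^{s,b}_T$ that satisfies the Duhamel formula $$u(t)=e^{it(-\Delta)^\alpha}u_0-i\varepsilon\int_0^te^{i(t-t')(-\Delta)^\alpha}\big(|u|^2u\big)(t')\,dt'\qquad(|t|\le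 T).$$ Call $T\in(0,1]$ a local existence time for $u_0$ with constant $K$ if there is exactly one solution $u$ on $[-T,T]$ and $\|u\|_{X^{s,b}_T}\le K\|u_0\|_{H^s}$. There is $b_0=b_0(\alpha,s)>\frac12$ such that for every $b\in(\frac12,b_0)$ the following holds. 1. There are a constant $K$ and a nonincreasing function $\tau$ such that, for every $u_0\in H^s$, $T=\tau(\|u_0\|_{H^s})$ is a local existence time for $u_0$ with constant $K$. 2. Let $a\le\min(2\alpha-1,\,2s+\alpha-1)$, where the inequality is strict if the minimum equals $2s+\alpha-1$. For every $K$ there is a constant $C$, depending only on $\alpha,s,a,b,K$ and the sign, such that for every $u_0\in H^s$, every local existence time $T$ for $u_0$ with constant $K$, and the solution $u$ on $[-T,T]$, with $P=\frac1\pi\int_0^{2\pi}|u_0(x)|^2dx$, $$u(t)-e^{it(-\Delta)^\alpha-i\varepsilon Pt}u_0\in C([-T,T];H^{s+a})$$ and $$\sup_{|t|\le T}\big\|u(t)-e^{it(-\Delta)^\alpha-i\varepsilon Pt}u_0\big\|_{H^{s+a}}\le C\big(\|u_0\|_{H^s}^3+\|u_0\|_{H^s}^5\big).$$ -/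

import Mathlib

open MeasureTheory Filter Topology
open scoped ENNReal

noncomputable section

namespace FracNLS

instance instTwoPiPos : Fact (0 < 2 * Real.pi) := ⟨Real.two_pi_pos⟩

/-- The torus `ℝ / 2πℤ`. -/
abbrev Torus : Type := AddCircle (2 * Real.pi)

/-- Complex `L²` of the torus. The Fourier coefficients `fourierCoeff f k` are
`(1 / 2π) ∫_0^{2π} f(x) e^{-ikx} dx`. -/
abbrev L2 : Type := Lp ℂ 2 (AddCircle.haarAddCircle : Measure Torus)

/-- The symbol `|k|^{2α}` of `(-Δ)^α`. -/
def symb (α : ℝ) (k : ℤ) : ℝ := |(k : ℝ)| ^ (2 * α)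

/-- The Sobolev norm `(∑_k ⟨k⟩^{2σ} |f̂(k)|²)^{1/2}`, with value `∞` when `f` is not in `H^σ`. -/
def sobolevENorm (σ : ℝ) (f : L2) : ℝ≥0∞ :=
  (∑' k : ℤ, ENNReal.ofReal ((1 + (k : ℝ) ^ 2) ^ σ) * ‖fourierCoeff f k‖ₑ ^ 2) ^ (1 / 2 : ℝ)

/-- `f ∈ H^σ`. -/
def MemSobolev (σ : ℝ) (f : L2) : Prop := sobolevENorm σ f < ∞

/-- The real-valued Sobolev norm of an element of `H^σ`. -/
def sobolevNorm (σ : ℝ) (f : L2) : ℝ := (sobolevENorm σ f).toReal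

/-- `u` is a continuous curve in `H^σ` on the time set `J`. -/
def ContSobolevOn (σ : ℝ) (J : Set ℝ) (u : ℝ → L2) : Prop :=
  (∀ t ∈ J, MemSobolev σ (u t)) ∧
    ∀ t₀ ∈ J, Tendsto (fun t => sobolevENorm σ (u t - u t₀)) (𝓝[J] t₀) (𝓝 0)

theorem memlp_phase_mul (θ : ℤ → ℝ) (f : L2) :
    Memℓp (fun k : ℤ => Complex.exp (Complex.I * (θ k : ℂ)) *
      (fourierBasis (T := 2 * Real.pi)).repr f k) 2 := by
  have h := lp.memℓp ((fourierBasis (T := 2 * Real.pi)).repr f)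
  rw [memℓp_gen_iff (by norm_num)] at h ⊢
  refine h.congr fun k => ?_
  rw [norm_mul, mul_comm Complex.I, Complex.norm_exp_ofReal_mul_I, one_mul]

/-- The Fourier multiplier with symbol `e^{iθ(k)}` on `L²` of the torus. -/
def phaseMultiplier (θ : ℤ → ℝ) (f : L2) : L2 :=
  (fourierBasis (T := 2 * Real.pi)).repr.symm ⟨_, memlp_phase_mul θ f⟩

theorem fourierCoeff_phaseMultiplier (θ : ℤ → ℝ) (f : L2) (k : ℤ) :
    fourierCoeff (phaseMultiplier θ f) k =
      Complex.exp (Complex.I * (θ k : ℂ)) * fourierCoeff f k := by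
  rw [← fourierBasis_repr, ← fourierBasis_repr, phaseMultiplier,
    LinearIsometryEquiv.apply_symm_apply]

/-- The linear propagator `e^{it(-Δ)^α}`. -/
def linProp (α t : ℝ) (f : L2) : L2 := phaseMultiplier (fun k => t * symb α k) f

/-- `P = (1/π) ∫_0^{2π} |f(x)|² dx` (`volume` on the torus has total mass `2π`). -/
def massP (f : L2) : ℝ := (1 / Real.pi) * ∫ x : Torus, ‖f x‖ ^ 2

/-- `u(t) - e^{it(-Δ)^α - iεPt} u₀`, the nonlinear part of the solution up to the phase rotation. -/
def nonlinearPart (α ε : ℝ) (u₀ : L2) (u : ℝ → L2) (t : ℝ) : L2 :=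
  u t - Complex.exp (-(Complex.I * ((ε * massP u₀ * t : ℝ) : ℂ))) • linProp α t u₀

/-- The `X^{s,b}` norm `‖⟨k⟩^s ⟨τ - |k|^{2α}⟩^b U(k,τ)‖_{ℓ²_k L²_τ}` in terms of the space-time
Fourier transform `U`. -/
def bourgainENorm (α s b : ℝ) (U : ℤ → ℝ → ℂ) : ℝ≥0∞ :=
  (∑' k : ℤ, ∫⁻ τ : ℝ,
    ENNReal.ofReal ((1 + (k : ℝ) ^ 2) ^ s * (1 + (τ - symb α k) ^ 2) ^ b) * ‖U k τ‖ₑ ^ 2)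
      ^ (1 / 2 : ℝ)

/-- The function on `ℝ × 𝕋` with space-time Fourier transform `U` agrees with `u` for `|t| ≤ T`.
If `b > 1/2` and the `X^{s,b}` norm of `U` is finite, then each `U(k,·)` is integrable. -/
def IsExtension (T : ℝ) (u : ℝ → L2) (U : ℤ → ℝ → ℂ) : Prop :=
  (∀ k, AEStronglyMeasurable (U k) volume) ∧
    ∀ t ∈ Set.Icc (-T) T, ∀ k : ℤ,
      fourierCoeff (u t) k = ∫ τ : ℝ, Complex.exp (Complex.I * ((t * τ : ℝ) : ℂ)) * U k τ

/-- The restricted norm of `X^{s,b}_T` (for `b > 1/2`): the infimum of the `X^{s,b}` norms of all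
extensions of `u` from `[-T,T]`. It is `∞` when there is no extension in `X^{s,b}`. -/
def bourgainENormOn (α s b T : ℝ) (u : ℝ → L2) : ℝ≥0∞ :=
  ⨅ (U : ℤ → ℝ → ℂ) (_ : IsExtension T u U), bourgainENorm α s b U

/-- `u` solves `i u_t + (-Δ)^α u = ε |u|² u`, `u(0) = u₀`, on `[-T,T]` in the class
`C([-T,T]; H^s) ∩ X^{s,b}_T`. The equation is the Duhamel formula, on the Fourier side. -/
structure IsSolution (α s b ε T : ℝ) (u₀ : L2) (u : ℝ → L2) : Prop where
  init : u 0 = u₀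
  cont : ContSobolevOn s (Set.Icc (-T) T) u
  mem_bourgain : bourgainENormOn α s b T u < ∞
  duhamel : ∀ t ∈ Set.Icc (-T) T, ∀ k : ℤ,
    fourierCoeff (u t) k =
      Complex.exp (Complex.I * ((t * symb α k : ℝ) : ℂ)) * fourierCoeff u₀ k
        - Complex.I * (ε : ℂ) * ∫ t' in (0 : ℝ)..t,
            Complex.exp (Complex.I * (((t - t') * symb α k : ℝ) : ℂ)) *
              fourierCoeff (fun x : Torus => ((‖u t' x‖ ^ 2 : ℝ) : ℂ) * u t' x) k

/-- `T` is a local existence time for the datum `u₀`, as provided by the `X^{s,b}` well-posedness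
theory: `0 < T ≤ 1`, and on `[-T,T]` there is a unique solution, and it satisfies
`‖u‖_{X^{s,b}_T} ≤ K ‖u₀‖_{H^s}`. -/
def IsLocalExistenceTime (α s b ε K : ℝ) (u₀ : L2) (T : ℝ) : Prop :=
  0 < T ∧ T ≤ 1 ∧ ∃ u : ℝ → L2, IsSolution α s b ε T u₀ u ∧
    bourgainENormOn α s b T u ≤ ENNReal.ofReal (K * sobolevNorm s u₀) ∧
    ∀ v : ℝ → L2, IsSolution α s b ε T u₀ v → Set.EqOn v u (Set.Icc (-T) T)

end FracNLS

end

open MeasureTheory Filter Topology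
open scoped ENNReal

noncomputable section

namespace FracNLS

/-! Let c_k(t) = e^{-it|k|^{2α}} û(k,t) be the interaction profile. In these variables the equation
reads c_k' = -iε Σ_{j,l} e^{iΦt} c_{k+j} conj(c_{k+j+l}) c_{k+l}, with Φ = `phase α k j l`. Up to
sign Φ is a second difference of |x|^{2α}. Since |x|^{2α} is uniformly convex on [-M,M], |Φ| ≳
|j||l| M^{2α-2}, where M is the size of the largest frequency (`le_abs_phase`). Resonance occurs
only for j = 0 or l = 0.

Local theory. The X^{s,b} norm is a weighted ℓ² sum over k of H^b norms in time of the profiles. On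
a short interval a profile is a trigonometric series in the rescaled time, so the norm becomes a
weighted ℓ² norm `xn` of a double array of coefficients; `exists_array_of_extension` and
`exists_lhb_undiscr_le` translate between the two pictures. Integrating e^{iΦt} against a function
in H^b gains ⟨Φ⟩^{b-1}. The trilinear sum with this kernel is bounded on the weighted ℓ² space for s
> 1/4 as long as b < 1 - 1/(4α) (`tri_phase_le`), and rescaling produces a factor T^b. A contraction
then gives existence, and marching in small steps gives uniqueness in the full class
(`exists_isSolution`, `IsSolution.eqOn`).

Smoothing. Mass is conserved (`tsum_normSq_ser`), so the terms with j = 0 or l = 0 add up to P c_k -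
|c_k|² c_k. Multiplication by e^{iεPt} removes P c_k, and the nonlinear part has modulus |∫ of the
remaining sum| (`gauge_eq`). The cubic diagonal term lies in H^{3s}. The nonresonant interactions
split in two.

Balanced interactions: at least two inputs are as large as M, or the middle input and both
differences j, l are. The decay ⟨Φ⟩^{-1/2} of an oscillatory integral then suffices for every gain a
< 2s + α - 1 (`tri_balanced_le`).

High-low-low interactions: one input is comparable to k and the other two are much smaller. Here |Φ|
≳ ⟨j⟩⟨k⟩^{2α-1}, and one differentiation by parts in time (`phase_mul_integral_eq`) divides by Φ,
which gains the full 2α - 1. If the time derivative falls on a low input, the factor 1/Φ still does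
all the work. If it falls on the high input, a second oscillation is used: the derivative is itself
smoother by α - 1/2, and a factor ⟨Φ⟩^{-1/2} gains another α - 1/2. When the gauge frequency P
exceeds |Φ|, no integration is needed, since 1 ≤ P/|Φ|.

All bounds are pointwise in k by a majorant independent of t (`exists_fabs_nonlinearPart_le`), so
continuity in H^{s+a} follows by dominated convergence. The quintic term in the estimate comes from
the differentiation by parts and from P ≤ 2‖u₀‖². -/

/-! ### Japanese brackets -/

/-- The Japanese bracket `⟨x⟩ = (1 + x²)^{1/2}`. -/
def jb (x : ℝ) : ℝ := Real.sqrt (1 + x ^ 2)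

lemma one_le_jb (x : ℝ) : 1 ≤ jb x := by
  rw [jb, Real.one_le_sqrt]; nlinarith [sq_nonneg x]

lemma jb_pos (x : ℝ) : 0 < jb x := lt_of_lt_of_le one_pos (one_le_jb x)

lemma jb_sq (x : ℝ) : jb x ^ 2 = 1 + x ^ 2 := Real.sq_sqrt (by positivity)

lemma jb_neg (x : ℝ) : jb (-x) = jb x := by simp [jb]

lemma jb_zero : jb 0 = 1 := by simp [jb]

lemma abs_le_jb (x : ℝ) : |x| ≤ jb x := Real.abs_le_sqrt (by linarith)

lemma jb_le_of_abs_le {x y : ℝ} (h : |x| ≤ |y|) : jb x ≤ jb y :=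
  Real.sqrt_le_sqrt (by linarith [sq_le_sq.mpr h])

lemma jb_le_one_add (x : ℝ) : jb x ≤ 1 + |x| := by
  rw [jb, Real.sqrt_le_left (by positivity)]
  nlinarith [abs_nonneg x, sq_abs x]

lemma jb_le_two_mul_abs {x : ℝ} (h : 1 ≤ |x|) : jb x ≤ 2 * |x| := by
  linarith [jb_le_one_add x]

lemma jb_add_le (x y : ℝ) : jb (x + y) ≤ jb x + jb y := by
  refine le_of_sq_le_sq ?_ (by linarith [jb_pos x, jb_pos y])
  have h : x * y ≤ jb x * jb y := by
    calc x * y ≤ |x * y| := le_abs_self _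
      _ = |x| * |y| := abs_mul _ _
      _ ≤ _ := mul_le_mul (abs_le_jb x) (abs_le_jb y) (abs_nonneg _) (jb_pos x).le
  nlinarith [jb_sq x, jb_sq y, jb_sq (x + y)]
where
  le_of_sq_le_sq {a b : ℝ} (h : a ^ 2 ≤ b ^ 2) (hb : 0 ≤ b) : a ≤ b :=
    le_of_abs_le ((sq_le_sq.mp h).trans (abs_of_nonneg hb).le)

lemma jb_add_le_mul (x y : ℝ) : jb (x + y) ≤ 2 * jb x * jb y := by
  nlinarith [jb_add_le x y, one_le_jb x, one_le_jb y]

lemma jb_mul_le {T : ℝ} (hT : 0 < T) (hT1 : T ≤ 1) (x : ℝ) : T * jb x ≤ jb (T * x) := by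
  refine Real.le_sqrt_of_sq_le ?_
  rw [mul_pow, jb_sq]
  nlinarith [sq_nonneg x]

lemma continuous_jb : Continuous jb := by unfold jb; fun_prop

lemma jb_rpow_pos (x σ : ℝ) : 0 < jb x ^ σ := Real.rpow_pos_of_pos (jb_pos x) σ

lemma jb_rpow_le_rpow {σ σ' : ℝ} (h : σ ≤ σ') (x : ℝ) : jb x ^ σ ≤ jb x ^ σ' :=
  Real.rpow_le_rpow_of_exponent_le (one_le_jb x) h

/-- Peetre's inequality. -/
lemma jb_rpow_add_le (σ x y : ℝ) :
    jb (x + y) ^ σ ≤ 2 ^ |σ| * jb x ^ σ * jb y ^ |σ| := by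
  rcases le_total 0 σ with h | h
  · rw [abs_of_nonneg h, ← Real.mul_rpow (by norm_num) (jb_pos x).le,
      ← Real.mul_rpow (by linarith [jb_pos x]) (jb_pos y).le]
    exact Real.rpow_le_rpow (jb_pos _).le (jb_add_le_mul x y) h
  · rw [abs_of_nonpos h]
    -- For a negative exponent the triangle inequality is applied to x = (x + y) + (-y).
    have h1 : jb x ≤ 2 * jb (x + y) * jb y := by
      have := jb_add_le_mul (x + y) (-y)
      rwa [add_neg_cancel_right, jb_neg] at this
    have h2 : jb x ^ (-σ) ≤ 2 ^ (-σ) * jb (x + y) ^ (-σ) * jb y ^ (-σ) := by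
      rw [← Real.mul_rpow (by norm_num) (jb_pos _).le,
        ← Real.mul_rpow (by linarith [jb_pos (x + y)]) (jb_pos y).le]
      exact Real.rpow_le_rpow (jb_pos _).le h1 (by linarith)
    have h3 : jb (x + y) ^ σ * jb (x + y) ^ (-σ) = 1 := by
      rw [← Real.rpow_add (jb_pos _), add_neg_cancel, Real.rpow_zero]
    have h4 : jb x ^ σ * jb x ^ (-σ) = 1 := by
      rw [← Real.rpow_add (jb_pos _), add_neg_cancel, Real.rpow_zero]
    have h5 := jb_rpow_pos (x + y) σ
    have h6 := jb_rpow_pos x σ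
    calc jb (x + y) ^ σ = jb (x + y) ^ σ * (jb x ^ σ * jb x ^ (-σ)) := by rw [h4, mul_one]
      _ ≤ jb (x + y) ^ σ * (jb x ^ σ * (2 ^ (-σ) * jb (x + y) ^ (-σ) * jb y ^ (-σ))) := by gcongr
      _ = (jb (x + y) ^ σ * jb (x + y) ^ (-σ)) * (2 ^ (-σ) * jb x ^ σ * jb y ^ (-σ)) := by ring
      _ = _ := by rw [h3, one_mul]

/-- The bracket weight `⟨x⟩^σ` as an extended nonnegative real. -/
def wt (σ x : ℝ) : ℝ≥0∞ := ENNReal.ofReal (jb x ^ σ)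

lemma wt_ne_top (σ x : ℝ) : wt σ x ≠ ∞ := ENNReal.ofReal_ne_top

lemma wt_zero (x : ℝ) : wt 0 x = 1 := by simp [wt]

lemma wt_add (σ σ' x : ℝ) : wt (σ + σ') x = wt σ x * wt σ' x := by
  rw [wt, wt, wt, ← ENNReal.ofReal_mul (jb_rpow_pos _ _).le, Real.rpow_add (jb_pos x)]

lemma wt_mul_wt_neg (σ x : ℝ) : wt σ x * wt (-σ) x = 1 := by
  rw [← wt_add, add_neg_cancel, wt_zero]

lemma wt_sq (σ x : ℝ) : wt σ x ^ 2 = wt (2 * σ) x := by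
  rw [sq, ← wt_add, two_mul]

lemma wt_mono {σ σ' : ℝ} (h : σ ≤ σ') (x : ℝ) : wt σ x ≤ wt σ' x :=
  ENNReal.ofReal_le_ofReal (jb_rpow_le_rpow h x)

lemma one_le_wt {σ : ℝ} (h : 0 ≤ σ) (x : ℝ) : 1 ≤ wt σ x := by
  rw [← wt_zero x]; exact wt_mono h x

lemma wt_le_one {σ : ℝ} (h : σ ≤ 0) (x : ℝ) : wt σ x ≤ 1 := by
  rw [← wt_zero x]; exact wt_mono h x

lemma wt_neg_right (σ x : ℝ) : wt σ (-x) = wt σ x := by rw [wt, jb_neg, wt]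

lemma wt_add_le (σ x y : ℝ) :
    wt σ (x + y) ≤ ENNReal.ofReal (2 ^ |σ|) * wt σ x * wt |σ| y := by
  rw [wt, wt, wt, ← ENNReal.ofReal_mul (by positivity),
    ← ENNReal.ofReal_mul (mul_nonneg (by positivity) (jb_rpow_pos _ _).le)]
  exact ENNReal.ofReal_le_ofReal (jb_rpow_add_le σ x y)

lemma wt_eq_ofReal_one_add_sq (σ x : ℝ) : wt σ x ^ 2 = ENNReal.ofReal ((1 + x ^ 2) ^ σ) := by
  rw [wt_sq, wt, jb, Real.sqrt_eq_rpow, ← Real.rpow_mul (by positivity)]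
  congr 2; ring

lemma measurable_wt (σ : ℝ) : Measurable (wt σ) := by
  unfold wt
  exact ((continuous_jb.measurable).pow_const σ).ennreal_ofReal

/-! ### The `ℓ²` norm of a nonnegative sequence -/

/-- The `ℓ²` norm of a family of extended nonnegative reals. -/
def l2 {ι : Type*} (f : ι → ℝ≥0∞) : ℝ≥0∞ := (∑' i, f i ^ 2) ^ (1 / 2 : ℝ)

section l2
variable {ι κ : Type*}

lemma rpow_half_sq (x : ℝ≥0∞) : (x ^ (1 / 2 : ℝ)) ^ 2 = x := by
  rw [← ENNReal.rpow_natCast, ← ENNReal.rpow_mul]; norm_num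

lemma sq_rpow_half (x : ℝ≥0∞) : (x ^ 2) ^ (1 / 2 : ℝ) = x := by
  rw [← ENNReal.rpow_natCast, ← ENNReal.rpow_mul]; norm_num

lemma le_of_sq_le_sq {x y : ℝ≥0∞} (h : x ^ 2 ≤ y ^ 2) : x ≤ y := by
  have := ENNReal.rpow_le_rpow h (by norm_num : (0 : ℝ) ≤ 1 / 2)
  rwa [sq_rpow_half, sq_rpow_half] at this

lemma l2_sq (f : ι → ℝ≥0∞) : l2 f ^ 2 = ∑' i, f i ^ 2 := rpow_half_sq _

lemma l2_mono {f g : ι → ℝ≥0∞} (h : ∀ i, f i ≤ g i) : l2 f ≤ l2 g := by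
  refine ENNReal.rpow_le_rpow (ENNReal.tsum_le_tsum fun i => ?_) (by norm_num)
  gcongr; exact h i

lemma l2_const_mul (c : ℝ≥0∞) (f : ι → ℝ≥0∞) : l2 (fun i => c * f i) = c * l2 f := by
  simp only [l2, mul_pow, ENNReal.tsum_mul_left]
  rw [ENNReal.mul_rpow_of_nonneg _ _ (by norm_num), sq_rpow_half]

lemma l2_equiv (e : ι ≃ κ) (f : κ → ℝ≥0∞) : l2 (fun i => f (e i)) = l2 f := by
  simp only [l2]; rw [e.tsum_eq (fun i => f i ^ 2)]

lemma le_l2 (f : ι → ℝ≥0∞) (i : ι) : f i ≤ l2 f :=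
  le_of_sq_le_sq (by rw [l2_sq]; exact ENNReal.le_tsum (f := fun i => f i ^ 2) i)

/-- Cauchy-Schwarz. -/
lemma tsum_mul_le_l2 (f g : ι → ℝ≥0∞) : ∑' i, f i * g i ≤ l2 f * l2 g := by
  -- With every set measurable, this is Hölder's inequality for the counting measure.
  let _ : MeasurableSpace ι := ⊤
  have h := ENNReal.lintegral_mul_le_Lp_mul_Lq (Measure.count : Measure ι)
    Real.HolderConjugate.two_two (f := f) (g := g) (by fun_prop) (by fun_prop)
  simpa [lintegral_count, l2] using h

/-- Minkowski's inequality. -/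
lemma l2_tsum_le (f : κ → ι → ℝ≥0∞) : l2 (fun i => ∑' a, f a i) ≤ ∑' a, l2 (f a) := by
  refine le_of_sq_le_sq ?_
  rw [l2_sq]
  -- The squared inner sum is opened as a double sum, so that Cauchy-Schwarz in i applies to each
  -- pair (a, c).
  calc ∑' i, (∑' a, f a i) ^ 2 = ∑' i, ∑' a, ∑' c, f a i * f c i := by
        congr 1; ext i
        rw [sq, ← ENNReal.tsum_mul_right]
        congr 1; ext a
        rw [ENNReal.tsum_mul_left]
    _ = ∑' a, ∑' c, ∑' i, f a i * f c i := by
        rw [ENNReal.tsum_comm]; congr 1; ext a; rw [ENNReal.tsum_comm]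
    _ ≤ ∑' a, ∑' c, l2 (f a) * l2 (f c) := by
        gcongr with a c; exact tsum_mul_le_l2 _ _
    _ = (∑' a, l2 (f a)) ^ 2 := by
        rw [sq, ← ENNReal.tsum_mul_right]
        congr 1; ext a
        rw [ENNReal.tsum_mul_left]

lemma l2_add_le (f g : ι → ℝ≥0∞) : l2 (fun i => f i + g i) ≤ l2 f + l2 g := by
  have := l2_tsum_le (fun (c : Bool) i => if c then f i else g i)
  simpa [tsum_bool, add_comm] using this

/-- Young's inequality `ℓ¹ * ℓ² ⊂ ℓ²`. -/
lemma l2_conv_le (f g : ℤ → ℝ≥0∞) :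
    l2 (fun n => ∑' m, f m * g (n - m)) ≤ (∑' m, f m) * l2 g := by
  refine (l2_tsum_le (fun m n => f m * g (n - m))).trans ?_
  rw [← ENNReal.tsum_mul_right]
  refine ENNReal.tsum_le_tsum fun m => ?_
  rw [l2_const_mul]
  exact le_of_eq (congrArg _ (l2_equiv (Equiv.subRight m) g))

end l2

/-! ### Sums of brackets -/

lemma tsum_int_shift (f : ℤ → ℝ≥0∞) (c : ℤ) : ∑' n, f (c + n) = ∑' n, f n :=
  (Equiv.addLeft c).tsum_eq f

lemma tsum_int_shift' (f : ℤ → ℝ≥0∞) (c : ℤ) : ∑' n, f (n + c) = ∑' n, f n :=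
  (Equiv.addRight c).tsum_eq f

/-- A bound for `∑_n ⟨n + x⟩^{-p}`, uniform in the real shift `x`. -/
def bracketSum (p : ℝ) : ℝ≥0∞ := ENNReal.ofReal (2 ^ p) * ∑' n : ℤ, wt (-p) n

lemma bracketSum_lt_top {p : ℝ} (hp : 1 < p) : bracketSum p < ∞ := by
  refine ENNReal.mul_lt_top ENNReal.ofReal_lt_top ?_
  have hs : Summable fun n : ℤ => jb n ^ (-p) := by
    have h0 := (Real.summable_one_div_int_add_rpow 0 p).mpr hp
    refine Summable.of_norm_bounded_eventually h0 ?_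
    filter_upwards [(Set.finite_singleton (0 : ℤ)).compl_mem_cofinite] with n hn
    rw [Real.norm_of_nonneg (jb_rpow_pos _ _).le, add_zero, Real.rpow_neg (jb_pos _).le, one_div]
    have h1 : 0 < |(n : ℝ)| := by simpa using hn
    gcongr
    exact abs_le_jb _
  have := hs.tsum_ofReal_lt_top
  simpa [wt] using this

/-- Replacing x by its integer part changes each bracket by a factor of at most 2, and an integer
shift does not change the sum. -/
lemma tsum_wt_add_le {p : ℝ} (hp : 0 ≤ p) (x : ℝ) : ∑' n : ℤ, wt (-p) (n + x) ≤ bracketSum p := by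
  have hle : ∀ n : ℤ, wt (-p) (n + x) ≤ ENNReal.ofReal (2 ^ p) * wt (-p) ((n + ⌊x⌋ : ℤ)) := by
    intro n
    have h1 : jb ((n + ⌊x⌋ : ℤ) : ℝ) ≤ 2 * jb (n + x) := by
      have h2 := jb_add_le (n + x) (-Int.fract x)
      have h3 : (n : ℝ) + x + -Int.fract x = ((n + ⌊x⌋ : ℤ) : ℝ) := by
        push_cast; rw [Int.fract]; ring
      have h4 : jb (-Int.fract x) ≤ 2 := by
        refine (jb_le_one_add _).trans ?_
        rw [abs_neg, abs_of_nonneg (Int.fract_nonneg x)]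
        linarith [Int.fract_lt_one x]
      by_cases h5 : (n + ⌊x⌋ : ℤ) = 0
      · rw [h5]; simp only [Int.cast_zero, jb_zero]; linarith [one_le_jb (n + x)]
      · have h6 : jb ((n + ⌊x⌋ : ℤ) : ℝ) ^ 2 ≤ (2 * jb (n + x)) ^ 2 := by
          rw [mul_pow, jb_sq, jb_sq, ← h3]
          nlinarith [Int.fract_nonneg x, Int.fract_lt_one x,
            sq_nonneg ((n : ℝ) + x - Int.fract x + 2 * Int.fract x),
            sq_nonneg (3 * ((n : ℝ) + x) + Int.fract x)]
        exact le_of_abs_le ((sq_le_sq.mp h6).trans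
          (abs_of_nonneg (by linarith [jb_pos (n + x)])).le)
    rw [wt, wt, ← ENNReal.ofReal_mul (by positivity)]
    refine ENNReal.ofReal_le_ofReal ?_
    have h7 : (2 * jb (n + x)) ^ (-p) ≤ jb ((n + ⌊x⌋ : ℤ) : ℝ) ^ (-p) :=
      Real.rpow_le_rpow_of_nonpos (jb_pos _) h1 (by linarith)
    rw [Real.mul_rpow (by norm_num) (jb_pos _).le, Real.rpow_neg (by norm_num)] at h7
    calc jb (n + x) ^ (-p) = 2 ^ p * ((2 ^ p)⁻¹ * jb (n + x) ^ (-p)) := by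
          rw [mul_inv_cancel_left₀ (by positivity)]
      _ ≤ _ := by gcongr
  refine (ENNReal.tsum_le_tsum hle).trans ?_
  rw [ENNReal.tsum_mul_left, bracketSum, tsum_int_shift' (fun n : ℤ => wt (-p) n)]

lemma tsum_wt_sub_le {p : ℝ} (hp : 0 ≤ p) (x : ℝ) : ∑' n : ℤ, wt (-p) (x - n) ≤ bracketSum p := by
  refine le_trans (le_of_eq ?_) (tsum_wt_add_le hp (-x))
  congr 1; ext n
  rw [← wt_neg_right]; ring_nf

lemma tsum_wt_int_le {p : ℝ} (hp : 0 ≤ p) : ∑' n : ℤ, wt (-p) n ≤ bracketSum p := by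
  simpa using tsum_wt_add_le hp 0

/-- Young's inequality for products of bracket powers. -/
lemma jb_rpow_mul_le {u v p : ℝ} {x y : ℝ} (hu : 0 ≤ u) (hv : 0 ≤ v) (hp : u + v = p) :
    jb x ^ (-u) * jb y ^ (-v) ≤ jb x ^ (-p) + jb y ^ (-p) := by
  rcases le_total (jb x) (jb y) with h | h
  · have h1 : jb y ^ (-v) ≤ jb x ^ (-v) :=
      Real.rpow_le_rpow_of_nonpos (jb_pos _) h (by linarith)
    have h2 : jb x ^ (-u) * jb x ^ (-v) = jb x ^ (-p) := by
      rw [← Real.rpow_add (jb_pos _)]; congr 1; linarith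
    nlinarith [jb_rpow_pos x (-u), jb_rpow_pos y (-p)]
  · have h1 : jb x ^ (-u) ≤ jb y ^ (-u) :=
      Real.rpow_le_rpow_of_nonpos (jb_pos _) h (by linarith)
    have h2 : jb y ^ (-u) * jb y ^ (-v) = jb y ^ (-p) := by
      rw [← Real.rpow_add (jb_pos _)]; congr 1; linarith
    nlinarith [jb_rpow_pos y (-v), jb_rpow_pos x (-p)]

lemma wt_mul_le {u v p : ℝ} (x y : ℝ) (hu : 0 ≤ u) (hv : 0 ≤ v) (hp : u + v = p) :
    wt (-u) x * wt (-v) y ≤ wt (-p) x + wt (-p) y := by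
  rw [wt, wt, wt, wt, ← ENNReal.ofReal_mul (jb_rpow_pos _ _).le,
    ← ENNReal.ofReal_add (jb_rpow_pos _ _).le (jb_rpow_pos _ _).le]
  exact ENNReal.ofReal_le_ofReal (jb_rpow_mul_le hu hv hp)

/-! ### The resonance function -/

/-- The resonance function of the interaction of the frequencies
`k + j`, `k + j + l`, `k + l` with output frequency `k`. -/
def phase (α : ℝ) (k j l : ℤ) : ℝ :=
  symb α (k + j) - symb α (k + j + l) + symb α (k + l) - symb α k

lemma phase_swap (α : ℝ) (k j l : ℤ) : phase α k j l = phase α k l j := by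
  unfold phase; rw [add_right_comm k j l]; ring

/-- The second derivative of x^p is p(p-1)x^{p-2}, decreasing in x because p ≤ 2, so on (0,M] it is
at least its value at M. The quadratic subtracted has exactly that constant as second derivative. -/
lemma convexOn_rpow_sub_sq {p M : ℝ} (hp : 1 < p) (hp2 : p ≤ 2) :
    ConvexOn ℝ (Set.Icc 0 M) (fun x => x ^ p - p * (p - 1) / 2 * M ^ (p - 2) * x ^ 2) := by
  refine convexOn_of_hasDerivWithinAt2_nonneg
    (f' := fun x => p * x ^ (p - 1) - p * (p - 1) * M ^ (p - 2) * x)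
    (f'' := fun x => p * ((p - 1) * x ^ (p - 2)) - p * (p - 1) * M ^ (p - 2))
    (convex_Icc 0 M) ?_ ?_ ?_ ?_
  · refine ContinuousOn.sub (ContinuousOn.rpow_const continuousOn_id ?_) (by fun_prop)
    intro x _; right; linarith
  · intro x hx
    rw [interior_Icc] at hx
    refine HasDerivAt.hasDerivWithinAt ?_
    have h1 := Real.hasDerivAt_rpow_const (p := p) (Or.inl hx.1.ne')
    have h2 := (hasDerivAt_pow 2 x).const_mul (p * (p - 1) / 2 * M ^ (p - 2))
    refine (h1.sub h2).congr_deriv ?_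
    norm_num; ring
  · intro x hx
    rw [interior_Icc] at hx
    refine HasDerivAt.hasDerivWithinAt ?_
    have h1 := (Real.hasDerivAt_rpow_const (p := p - 1) (Or.inl hx.1.ne')).const_mul p
    have h2 := (hasDerivAt_id x).const_mul (p * (p - 1) * M ^ (p - 2))
    refine (h1.sub h2).congr_deriv ?_
    rw [mul_one, sub_sub]; norm_num
  · intro x hx
    rw [interior_Icc] at hx
    have h1 : M ^ (p - 2) ≤ x ^ (p - 2) :=
      Real.rpow_le_rpow_of_nonpos hx.1 hx.2.le (by linarith)
    have h2 : 0 ≤ p * (p - 1) := by nlinarith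
    nlinarith

/-- Monotonicity is what allows composition with |x|: an increasing convex function of a convex
function is convex. The derivative is p x (x^{p-2} - (p-1) M^{p-2}), nonnegative since p - 1 ≤ 1. -/
lemma monotoneOn_rpow_sub_sq {p M : ℝ} (hp : 1 < p) (hp2 : p ≤ 2) (hM : 0 < M) :
    MonotoneOn (fun x => x ^ p - p * (p - 1) / 2 * M ^ (p - 2) * x ^ 2) (Set.Icc 0 M) := by
  refine monotoneOn_of_hasDerivWithinAt_nonneg
    (f' := fun x => p * x ^ (p - 1) - p * (p - 1) * M ^ (p - 2) * x)
    (convex_Icc 0 M) (convexOn_rpow_sub_sq_continuousOn hp) ?_ ?_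
  · intro x hx
    rw [interior_Icc] at hx
    refine HasDerivAt.hasDerivWithinAt ?_
    have h1 := Real.hasDerivAt_rpow_const (p := p) (Or.inl hx.1.ne')
    have h2 := (hasDerivAt_pow 2 x).const_mul (p * (p - 1) / 2 * M ^ (p - 2))
    refine (h1.sub h2).congr_deriv ?_
    norm_num; ring
  · intro x hx
    rw [interior_Icc] at hx
    have h1 : M ^ (p - 2) ≤ x ^ (p - 2) :=
      Real.rpow_le_rpow_of_nonpos hx.1 hx.2.le (by linarith)
    have h3 : x ^ (p - 1) = x ^ (p - 2) * x := by
      rw [← Real.rpow_add_one hx.1.ne']; congr 1; ring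
    have h4 : 0 < M ^ (p - 2) := Real.rpow_pos_of_pos hM _
    rw [h3]
    have h5 : (p - 1) * M ^ (p - 2) ≤ x ^ (p - 2) := by nlinarith
    have : 0 ≤ p * x * (x ^ (p - 2) - (p - 1) * M ^ (p - 2)) :=
      mul_nonneg (mul_nonneg (by linarith) hx.1.le) (by linarith)
    linarith
where
  convexOn_rpow_sub_sq_continuousOn {p M : ℝ} (hp : 1 < p) :
      ContinuousOn (fun x => x ^ p - p * (p - 1) / 2 * M ^ (p - 2) * x ^ 2) (Set.Icc 0 M) := by
    refine ContinuousOn.sub (ContinuousOn.rpow_const continuousOn_id ?_) (by fun_prop)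
    intro x _; right; linarith

lemma convexOn_abs_rpow_sub_sq {p M : ℝ} (hp : 1 < p) (hp2 : p ≤ 2) (hM : 0 < M) :
    ConvexOn ℝ (Set.Icc (-M) M)
      (fun x => |x| ^ p - p * (p - 1) / 2 * M ^ (p - 2) * x ^ 2) := by
  refine ⟨convex_Icc _ _, fun x hx y hy a b ha hb hab => ?_⟩
  have hx' : |x| ∈ Set.Icc 0 M := ⟨abs_nonneg _, abs_le.mpr hx⟩
  have hy' : |y| ∈ Set.Icc 0 M := ⟨abs_nonneg _, abs_le.mpr hy⟩
  have h1 := (convexOn_rpow_sub_sq hp hp2).2 hx' hy' ha hb hab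
  have h2 : |a • x + b • y| ≤ a • |x| + b • |y| := by
    refine (abs_add_le _ _).trans (le_of_eq ?_)
    simp [abs_mul, abs_of_nonneg ha, abs_of_nonneg hb]
  have h3 : a • |x| + b • |y| ∈ Set.Icc 0 M := (convex_Icc 0 M) hx' hy' ha hb hab
  have h4 := monotoneOn_rpow_sub_sq hp hp2 hM
    ⟨abs_nonneg _, h2.trans h3.2⟩ h3 h2
  simp only [sq_abs] at h1 h4
  exact h4.trans h1

/-- A convex function increases its sum over pairs with a fixed midpoint as they spread out. -/
lemma ConvexOn.add_le_add_of_mem_segment {s : Set ℝ} {h : ℝ → ℝ} (hh : ConvexOn ℝ s h) {x w y z : ℝ}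
    (hx : x ∈ s) (hw : w ∈ s) (hy : y ∈ segment ℝ x w) (hsum : x + w = y + z) :
    h y + h z ≤ h x + h w := by
  obtain ⟨a, b, ha, hb, hab, rfl⟩ := hy
  have hz : z = b • x + a • w := by
    simp only [smul_eq_mul] at hsum ⊢
    have : b = 1 - a := by linarith
    subst this; linarith
  have h1 := hh.2 hx hw ha hb hab
  have h2 := hh.2 hx hw hb ha (by linarith)
  rw [hz]
  simp only [smul_eq_mul] at *
  have : b = 1 - a := by linarith
  subst this
  linarith

/-- The pairs {k, k+j+l} and {k+j, k+l} share their midpoint, and the sign of jl decides which of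
them is the outer one. Convexity of |x|^p - c x² compares the two sums, and the quadratic
contributes exactly 2c·jl with 2c = p(p-1)M^{p-2}. -/
lemma secondDiff_abs_rpow {p M : ℝ} (hp : 1 < p) (hp2 : p ≤ 2) (hM : 0 < M) {k j l : ℝ}
    (h : |k| + |j| + |l| ≤ M) :
    p * (p - 1) * M ^ (p - 2) * (|j| * |l|) ≤
      |(|k + j| ^ p - |k + j + l| ^ p + |k + l| ^ p - |k| ^ p)| := by
  have hc := convexOn_abs_rpow_sub_sq hp hp2 hM
  have mem : ∀ x, |x| ≤ |k| + |j| + |l| → x ∈ Set.Icc (-M) M := fun x hx =>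
    abs_le.mp (hx.trans h)
  have m0 := mem k (by linarith [abs_nonneg j, abs_nonneg l])
  have m1 := mem (k + j) (by linarith [abs_add_le k j, abs_nonneg l])
  have m3 := mem (k + l) (by linarith [abs_add_le k l, abs_nonneg j])
  have m2 := mem (k + j + l) (by linarith [abs_add_le (k + j) l, abs_add_le k j])
  rw [← abs_mul]
  rcases le_total 0 (j * l) with hjl | hjl
  · have hseg : k + j ∈ segment ℝ k (k + j + l) := by
      rw [segment_eq_uIcc, Set.mem_uIcc]
      rcases mul_nonneg_iff.mp hjl with ⟨h1, h2⟩ | ⟨h1, h2⟩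
      · left; constructor <;> linarith
      · right; constructor <;> linarith
    have := ConvexOn.add_le_add_of_mem_segment hc m0 m2 hseg (z := k + l) (by ring)
    rw [abs_of_nonneg hjl]
    refine le_trans ?_ (neg_le_abs _)
    linarith
  · have hseg : k ∈ segment ℝ (k + j) (k + l) := by
      rw [segment_eq_uIcc, Set.mem_uIcc]
      rcases mul_nonpos_iff.mp hjl with ⟨h1, h2⟩ | ⟨h1, h2⟩
      · right; constructor <;> linarith
      · left; constructor <;> linarith
    have := ConvexOn.add_le_add_of_mem_segment hc m1 m3 hseg (z := k + j + l) (by ring)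
    rw [abs_of_nonpos hjl]
    refine le_trans ?_ (le_abs_self _)
    linarith

/-- The size of the largest frequency in an interaction. -/
def freqMax (k j l : ℝ) : ℝ := jb k + jb j + jb l

lemma freqMax_pos (k j l : ℝ) : 0 < freqMax k j l := by
  unfold freqMax; linarith [jb_pos k, jb_pos j, jb_pos l]

lemma one_le_freqMax (k j l : ℝ) : 1 ≤ freqMax k j l := by
  unfold freqMax; linarith [one_le_jb k, jb_pos j, jb_pos l]

/-- The lower bound for the resonance function. -/
lemma le_abs_phase {α : ℝ} (hα : 1 / 2 < α) (hα' : α ≤ 1) (k j l : ℤ) :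
    2 * α * (2 * α - 1) * freqMax k j l ^ (2 * α - 2) * (|(j : ℝ)| * |(l : ℝ)|) ≤
      |phase α k j l| := by
  have := secondDiff_abs_rpow (p := 2 * α) (by linarith) (by linarith) (freqMax_pos k j l)
    (k := k) (j := j) (l := l)
    (by unfold freqMax; linarith [abs_le_jb (k : ℝ), abs_le_jb (j : ℝ), abs_le_jb (l : ℝ)])
  simpa [phase, symb] using this

/-- The resonance function is large away from the resonant set. -/
lemma le_jb_phase {α : ℝ} (hα : 1 / 2 < α) (hα' : α ≤ 1) {k j l : ℤ} (hj : j ≠ 0) (hl : l ≠ 0) :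
    α * (2 * α - 1) / 2 * freqMax k j l ^ (2 * α - 2) * (jb j * jb l) ≤ |phase α k j l| := by
  have h := le_abs_phase hα hα' k j l
  have hj1 : jb (j : ℝ) ≤ 2 * |(j : ℝ)| :=
    jb_le_two_mul_abs (by exact_mod_cast Int.one_le_abs hj)
  have hl1 : jb (l : ℝ) ≤ 2 * |(l : ℝ)| :=
    jb_le_two_mul_abs (by exact_mod_cast Int.one_le_abs hl)
  refine le_trans ?_ h
  have h0 : 0 ≤ α * (2 * α - 1) / 2 * freqMax k j l ^ (2 * α - 2) := by
    have : 0 < freqMax (k : ℝ) j l ^ (2 * α - 2) := Real.rpow_pos_of_pos (freqMax_pos _ _ _) _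
    have : 0 < α * (2 * α - 1) := by nlinarith
    positivity
  calc _ ≤ α * (2 * α - 1) / 2 * freqMax k j l ^ (2 * α - 2) *
        ((2 * |(j : ℝ)|) * (2 * |(l : ℝ)|)) := by
        gcongr
        exact (jb_pos _).le
    _ = _ := by ring

/-! ### Pointwise weight inequalities -/

lemma jb_sub_le (x y : ℝ) : jb (x - y) ≤ jb x + jb y := by
  rw [sub_eq_add_neg, ← jb_neg y]; exact jb_add_le x (-y)

lemma jb_le_mul_of_abs_le {x y C : ℝ} (hC : 1 ≤ C) (h : |x| ≤ C * |y|) : jb x ≤ C * jb y := by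
  refine (Real.sqrt_le_left (by nlinarith [jb_pos y])).mpr ?_
  rw [mul_pow, jb_sq]
  have h1 : x ^ 2 ≤ C ^ 2 * y ^ 2 := by
    rw [← sq_abs x, ← sq_abs y, ← mul_pow]
    exact pow_le_pow_left₀ (abs_nonneg x) h 2
  nlinarith

/-- Away from the high-low-low interactions either two input frequencies are comparable to the
largest one, or the middle one is and both frequency differences are. -/
lemma freqMax_cases {k j l : ℝ} (h1 : ¬ (8 * |k + l| ≤ |k| ∧ 8 * |k + j + l| ≤ |k|))
    (h2 : ¬ (8 * |k + j| ≤ |k| ∧ 8 * |k + j + l| ≤ |k|)) :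
    (freqMax k j l ≤ 2000 * jb (k + j) ∧ freqMax k j l ≤ 2000 * jb (k + l)) ∨
    (freqMax k j l ≤ 2000 * jb (k + j) ∧ freqMax k j l ≤ 2000 * jb (k + j + l)) ∨
    (freqMax k j l ≤ 2000 * jb (k + l) ∧ freqMax k j l ≤ 2000 * jb (k + j + l)) ∨
    (freqMax k j l ≤ 2000 * jb j ∧ freqMax k j l ≤ 2000 * jb l ∧
      freqMax k j l ≤ 2000 * jb (k + j + l)) := by
  unfold freqMax
  have t1 : jb j ≤ jb (k + j) + jb k := by simpa using jb_sub_le (k + j) k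
  have t2 : jb l ≤ jb (k + l) + jb k := by simpa using jb_sub_le (k + l) k
  have t3 : jb l ≤ jb (k + j + l) + jb (k + j) := by simpa using jb_sub_le (k + j + l) (k + j)
  have t4 : jb j ≤ jb (k + j + l) + jb (k + l) := by
    have := jb_sub_le (k + j + l) (k + l)
    rwa [show k + j + l - (k + l) = j by ring] at this
  have t5 : jb (k + j) ≤ jb (k + j + l) + jb (k + l) + jb k := by
    have h := jb_sub_le (k + j + l) (k + l)
    have h' := jb_add_le (k + j + l - (k + l)) k
    rw [show k + j + l - (k + l) + k = k + j by ring] at h'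
    linarith
  have t6 : jb (k + l) ≤ jb (k + j + l) + jb (k + j) + jb k := by
    have h := jb_sub_le (k + j + l) (k + j)
    have h' := jb_add_le (k + j + l - (k + j)) k
    rw [show k + j + l - (k + j) + k = k + l by ring] at h'
    linarith
  have t7 : jb (k + j + l) ≤ jb (k + j) + jb l := jb_add_le _ _
  have t8 : jb (k + j + l) ≤ jb (k + l) + jb j := by
    have := jb_add_le (k + l) j
    rwa [show k + l + j = k + j + l by ring] at this
  have p0 := jb_pos k
  have p1 := jb_pos (k + j)
  have p2 := jb_pos (k + j + l)
  have p3 := jb_pos (k + l)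
  -- If the middle frequency is small against k, the two exclusions make both outer inputs at least
  -- |k|/8. Otherwise the middle one is at least |k|/8, and it is compared with each outer input in
  -- turn. The constants 18, 100 and 2000 are only chosen large enough.
  by_cases c2 : 8 * |k + j + l| ≤ |k|
  · have c1 : |k| ≤ 8 * |k + j| := by
      by_contra h; exact h2 ⟨by linarith, c2⟩
    have c3 : |k| ≤ 8 * |k + l| := by
      by_contra h; exact h1 ⟨by linarith, c2⟩
    have d1 := jb_le_mul_of_abs_le (by norm_num) c1
    have d3 := jb_le_mul_of_abs_le (by norm_num) c3
    by_cases e1 : jb (k + j) ≤ 18 * jb (k + l)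
    · by_cases e2 : jb (k + l) ≤ 18 * jb (k + j)
      · left; constructor <;> linarith
      · right; right; left; constructor <;> linarith
    · right; left; constructor <;> linarith
  · have d2 : jb k ≤ 8 * jb (k + j + l) := jb_le_mul_of_abs_le (by norm_num) (by linarith)
    by_cases e1 : jb (k + j + l) ≤ 100 * jb (k + j)
    · by_cases f : jb (k + j) ≤ 100 * jb (k + j + l)
      · right; left; constructor <;> linarith
      · left; constructor <;> linarith
    · by_cases e3 : jb (k + j + l) ≤ 100 * jb (k + l)
      · by_cases f : jb (k + l) ≤ 100 * jb (k + j + l)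
        · right; right; left; constructor <;> linarith
        · left; constructor <;> linarith
      -- The middle frequency exceeds both outer inputs by a factor 100, so its differences from
      -- them, which are j and l, are comparable to it.
      · right; right; right
        refine ⟨?_, ?_, ?_⟩ <;> linarith

/-- Summable majorant of the interaction weights. -/
def pairWeight (p k j l : ℝ) : ℝ :=
  jb j ^ (-p) * jb l ^ (-p) + jb l ^ (-p) * jb (k + j) ^ (-p) + jb j ^ (-p) * jb (k + l) ^ (-p) +
    jb j ^ (-p) * jb (k + j + l) ^ (-p) + jb l ^ (-p) * jb (k + j + l) ^ (-p) +
    jb (k + j) ^ (-p) * jb (k + l) ^ (-p)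

lemma pairWeight_pos (p k j l : ℝ) : 0 < pairWeight p k j l := by
  unfold pairWeight
  have := fun x => jb_rpow_pos x (-p)
  have h1 := this j
  have h2 := this l
  have h3 := this (k + j)
  have h4 := this (k + l)
  have h5 := this (k + j + l)
  positivity

/-- Two inputs of size M pay for M^{2q}. The exponent relation says M^ρ M^{2a} = M^{2q} M^{-2η}, and
the spare M^{-2η} is spread over the two differences, whose decay ⟨·⟩^{-1} becomes the summable
⟨·⟩^{-(1+η)}. A factor `yk ^ q` remains, to be charged to the third input. -/
lemma rpow_mul_le_of_two_high {M x x' yk yj yl ρ a q η C : ℝ} (hC : 0 ≤ C) (hM : 1 ≤ M)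
    (hx : M ≤ C * x) (hx' : M ≤ C * x') (hx0 : 0 < x) (hx0' : 0 < x')
    (hk : 0 < yk) (hj : 0 < yj) (hl : 0 < yl) (hkM : yk ≤ M) (hjM : yj ≤ M) (hlM : yl ≤ M)
    (ha : 0 ≤ a) (hq : 0 ≤ q) (hη : 0 ≤ η) (h : 2 * a + ρ = 2 * q - 2 * η) :
    M ^ ρ * yj ^ (-1 : ℝ) * yl ^ (-1 : ℝ) * yk ^ (q + 2 * a) ≤
      (C ^ q * C ^ q) * (yj ^ (-(1 + η)) * yl ^ (-(1 + η)) * yk ^ q) * (x ^ q * x' ^ q) := by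
  have hM0 : 0 < M := by linarith
  have e1 : yk ^ (q + 2 * a) = yk ^ q * yk ^ (2 * a) := Real.rpow_add hk _ _
  have e2 : yk ^ (2 * a) ≤ M ^ (2 * a) := Real.rpow_le_rpow hk.le hkM (by linarith)
  have e3 : M ^ ρ * M ^ (2 * a) = (M ^ q * M ^ q) * (M ^ (-η) * M ^ (-η)) := by
    rw [← Real.rpow_add hM0, ← Real.rpow_add hM0, ← Real.rpow_add hM0, ← Real.rpow_add hM0]
    congr 1; linarith
  have e4 : M ^ q ≤ C ^ q * x ^ q := by
    rw [← Real.mul_rpow hC hx0.le]; exact Real.rpow_le_rpow hM0.le hx hq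
  have e5 : M ^ q ≤ C ^ q * x' ^ q := by
    rw [← Real.mul_rpow hC hx0'.le]; exact Real.rpow_le_rpow hM0.le hx' hq
  have e6 : M ^ (-η) ≤ yj ^ (-η) := Real.rpow_le_rpow_of_nonpos hj hjM (by linarith)
  have e7 : M ^ (-η) ≤ yl ^ (-η) := Real.rpow_le_rpow_of_nonpos hl hlM (by linarith)
  have e8 : yj ^ (-(1 + η)) = yj ^ (-1 : ℝ) * yj ^ (-η) := by
    rw [← Real.rpow_add hj]; congr 1; ring
  have e9 : yl ^ (-(1 + η)) = yl ^ (-1 : ℝ) * yl ^ (-η) := by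
    rw [← Real.rpow_add hl]; congr 1; ring
  rw [e1, e8, e9]
  calc M ^ ρ * yj ^ (-1 : ℝ) * yl ^ (-1 : ℝ) * (yk ^ q * yk ^ (2 * a))
      ≤ M ^ ρ * yj ^ (-1 : ℝ) * yl ^ (-1 : ℝ) * (yk ^ q * M ^ (2 * a)) := by gcongr
    _ = (M ^ ρ * M ^ (2 * a)) * (yj ^ (-1 : ℝ) * yl ^ (-1 : ℝ) * yk ^ q) := by ring
    _ = (M ^ q * M ^ q) * (M ^ (-η) * M ^ (-η)) * (yj ^ (-1 : ℝ) * yl ^ (-1 : ℝ) * yk ^ q) := by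
        rw [e3]
    _ ≤ ((C ^ q * x ^ q) * (C ^ q * x' ^ q)) * (yj ^ (-η) * yl ^ (-η)) *
        (yj ^ (-1 : ℝ) * yl ^ (-1 : ℝ) * yk ^ q) := by gcongr
    _ = _ := by ring

lemma add_rpow_le {x y q : ℝ} (hx : 0 < x) (hy : 0 < y) (hq : 0 ≤ q) :
    (x + y) ^ q ≤ 2 ^ q * (x ^ q + y ^ q) := by
  have hxq := Real.rpow_pos_of_pos hx q
  have hyq := Real.rpow_pos_of_pos hy q
  have h2q : (0 : ℝ) < 2 ^ q := by positivity
  rcases le_total x y with h | h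
  · calc (x + y) ^ q ≤ (2 * y) ^ q := Real.rpow_le_rpow (by linarith) (by linarith) hq
      _ = 2 ^ q * y ^ q := Real.mul_rpow (by norm_num) hy.le
      _ ≤ _ := by gcongr; linarith
  · calc (x + y) ^ q ≤ (2 * x) ^ q := Real.rpow_le_rpow (by linarith) (by linarith) hq
      _ = 2 ^ q * x ^ q := Real.mul_rpow (by norm_num) hx.le
      _ ≤ _ := by gcongr; linarith

/-- Moves the growth of order q from x to y; the price is that either bracket may then carry the
decay of order p. -/
lemma jb_rpow_mul_rpow_le {p q x y : ℝ} (hq : 0 ≤ q) (hqp : q ≤ p) :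
    jb x ^ (-p) * jb x ^ q ≤ (jb x ^ (-p) + jb y ^ (-p)) * jb y ^ q := by
  have h := jb_rpow_mul_le (u := p - q) (v := q) (p := p) (x := x) (y := y)
    (by linarith) hq (by ring)
  have e1 : jb x ^ (-p) * jb x ^ q = jb x ^ (-(p - q)) := by
    rw [← Real.rpow_add (jb_pos x)]; congr 1; ring
  have e2 : jb y ^ (-q) * jb y ^ q = 1 := by
    rw [← Real.rpow_add (jb_pos y), neg_add_cancel, Real.rpow_zero]
  calc jb x ^ (-p) * jb x ^ q = jb x ^ (-(p - q)) * jb y ^ (-q) * jb y ^ q := by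
        rw [e1, mul_assoc, e2, mul_one]
    _ ≤ _ := by gcongr; exact (jb_rpow_pos y q).le

/-- Charges the leftover output weight ⟨k⟩^q to the input k + j. Either k is controlled by k + j, or
it is controlled by j, and then the decay in j is exchanged for decay in k + j. -/
lemma pair_mul_rpow_le_left {p q k j l : ℝ} (hq : 0 ≤ q) (hqp : q ≤ p) :
    jb j ^ (-p) * jb l ^ (-p) * jb k ^ q ≤
      2 ^ q * 2 * (jb j ^ (-p) * jb l ^ (-p) + jb l ^ (-p) * jb (k + j) ^ (-p)) *
        jb (k + j) ^ q := by
  have t : jb k ≤ jb (k + j) + jb j := by simpa using jb_sub_le (k + j) j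
  have h1 : jb k ^ q ≤ 2 ^ q * (jb (k + j) ^ q + jb j ^ q) :=
    (Real.rpow_le_rpow (jb_pos k).le t hq).trans (add_rpow_le (jb_pos _) (jb_pos _) hq)
  have h2 := jb_rpow_mul_rpow_le (x := j) (y := k + j) hq hqp
  have pj := jb_rpow_pos j (-p)
  have pl := jb_rpow_pos l (-p)
  have p1 := jb_rpow_pos (k + j) (-p)
  have q1 := jb_rpow_pos (k + j) q
  have h2q : (0 : ℝ) < 2 ^ q := by positivity
  calc jb j ^ (-p) * jb l ^ (-p) * jb k ^ q
      ≤ jb j ^ (-p) * jb l ^ (-p) * (2 ^ q * (jb (k + j) ^ q + jb j ^ q)) := by gcongr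
    _ = 2 ^ q * jb l ^ (-p) * (jb j ^ (-p) * jb (k + j) ^ q + jb j ^ (-p) * jb j ^ q) := by ring
    _ ≤ 2 ^ q * jb l ^ (-p) * (jb j ^ (-p) * jb (k + j) ^ q +
          (jb j ^ (-p) + jb (k + j) ^ (-p)) * jb (k + j) ^ q) := by gcongr
    _ ≤ _ := by
        have : 0 < 2 ^ q * (jb l ^ (-p) * jb (k + j) ^ (-p) * jb (k + j) ^ q) := by positivity
        nlinarith

/-- The same transfer to the middle input, based on k = (k + j + l) - (j + l); now either j or l may
give up its decay. -/
lemma pair_mul_rpow_le_mid {p q k j l : ℝ} (hq : 0 ≤ q) (hqp : q ≤ p) :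
    jb j ^ (-p) * jb l ^ (-p) * jb k ^ q ≤
      2 ^ q * 2 ^ q * 3 * (jb j ^ (-p) * jb l ^ (-p) + jb l ^ (-p) * jb (k + j + l) ^ (-p)
        + jb j ^ (-p) * jb (k + j + l) ^ (-p)) * jb (k + j + l) ^ q := by
  have t : jb k ≤ jb (k + j + l) + (jb j + jb l) := by
    have h1 := jb_sub_le (k + j + l) (j + l)
    rw [show k + j + l - (j + l) = k by ring] at h1
    linarith [jb_add_le j l]
  have h1 : jb k ^ q ≤ 2 ^ q * 2 ^ q * (jb (k + j + l) ^ q + jb j ^ q + jb l ^ q) := by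
    have ha := (Real.rpow_le_rpow (jb_pos k).le t hq).trans
      (add_rpow_le (jb_pos _) (by linarith [jb_pos j, jb_pos l]) hq)
    have hb := add_rpow_le (jb_pos j) (jb_pos l) hq
    have h2q : (1 : ℝ) ≤ 2 ^ q := Real.one_le_rpow (by norm_num) hq
    have hc := jb_rpow_pos (k + j + l) q
    calc jb k ^ q ≤ 2 ^ q * (jb (k + j + l) ^ q + 2 ^ q * (jb j ^ q + jb l ^ q)) := by
          refine ha.trans ?_; gcongr
      _ ≤ 2 ^ q * (2 ^ q * jb (k + j + l) ^ q + 2 ^ q * (jb j ^ q + jb l ^ q)) := by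
          gcongr; nlinarith
      _ = _ := by ring
  have h2 := jb_rpow_mul_rpow_le (x := j) (y := k + j + l) hq hqp
  have h3 := jb_rpow_mul_rpow_le (x := l) (y := k + j + l) hq hqp
  have pj := jb_rpow_pos j (-p)
  have pl := jb_rpow_pos l (-p)
  have p1 := jb_rpow_pos (k + j + l) (-p)
  have q1 := jb_rpow_pos (k + j + l) q
  have h2q : (0 : ℝ) < 2 ^ q := by positivity
  calc jb j ^ (-p) * jb l ^ (-p) * jb k ^ q
      ≤ jb j ^ (-p) * jb l ^ (-p) *
        (2 ^ q * 2 ^ q * (jb (k + j + l) ^ q + jb j ^ q + jb l ^ q)) := by gcongr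
    _ = 2 ^ q * 2 ^ q * (jb j ^ (-p) * jb l ^ (-p) * jb (k + j + l) ^ q +
          jb l ^ (-p) * (jb j ^ (-p) * jb j ^ q) + jb j ^ (-p) * (jb l ^ (-p) * jb l ^ q)) := by
        ring
    _ ≤ 2 ^ q * 2 ^ q * (jb j ^ (-p) * jb l ^ (-p) * jb (k + j + l) ^ q +
          jb l ^ (-p) * ((jb j ^ (-p) + jb (k + j + l) ^ (-p)) * jb (k + j + l) ^ q) +
          jb j ^ (-p) * ((jb l ^ (-p) + jb (k + j + l) ^ (-p)) * jb (k + j + l) ^ q)) := by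
        gcongr
    _ ≤ _ := by
        have a1 : 0 < 2 ^ q * 2 ^ q * (jb l ^ (-p) * jb (k + j + l) ^ (-p) *
          jb (k + j + l) ^ q) := by positivity
        have a2 : 0 < 2 ^ q * 2 ^ q * (jb j ^ (-p) * jb (k + j + l) ^ (-p) *
          jb (k + j + l) ^ q) := by positivity
        nlinarith

/-- The weight inequality for interactions which are not of high-low-low type. -/
lemma weight_le_pairWeight {ρ a q η : ℝ} (ha : 0 ≤ a) (hq : 0 ≤ q) (hη : 0 ≤ η)
    (hqη : q ≤ 1 + η) (h : 2 * a + ρ = 2 * q - 2 * η) :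
    ∃ C : ℝ, 0 < C ∧ ∀ k j l : ℝ, ¬ (8 * |k + l| ≤ |k| ∧ 8 * |k + j + l| ≤ |k|) →
      ¬ (8 * |k + j| ≤ |k| ∧ 8 * |k + j + l| ≤ |k|) →
      freqMax k j l ^ ρ * jb j ^ (-1 : ℝ) * jb l ^ (-1 : ℝ) * jb k ^ (q + 2 * a) ≤
        C * pairWeight (1 + η) k j l * (jb (k + j) ^ q * jb (k + j + l) ^ q * jb (k + l) ^ q) := by
  set p := 1 + η with hp
  set D : ℝ := (2000 : ℝ) ^ q * 2000 ^ q with hD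
  have hD0 : 0 < D := by positivity
  have h2q : (1 : ℝ) ≤ 2 ^ q := Real.one_le_rpow (by norm_num) hq
  set E : ℝ := 2 ^ q * 2 ^ q * 3 with hE
  have hE0 : 0 < E := by positivity
  have hE2 : 2 ^ q * 2 ≤ E := by rw [hE]; nlinarith
  set F : ℝ := 2000 * 2000 * 2000 ^ q with hF
  have hF0 : 0 < F := by positivity
  -- `D` is the loss from two inputs comparable to M, `E` the loss from moving ⟨k⟩^q to the third
  -- input, and `F` serves the case where only the middle input is known to be high.
  refine ⟨D * E + F, by positivity, fun k j l n1 n2 => ?_⟩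
  set M := freqMax k j l with hM
  have hM1 : 1 ≤ M := one_le_freqMax k j l
  have hM0 : 0 < M := by linarith
  have kM : jb k ≤ M := by rw [hM, freqMax]; linarith [jb_pos j, jb_pos l]
  have jM : jb j ≤ M := by rw [hM, freqMax]; linarith [jb_pos k, jb_pos l]
  have lM : jb l ≤ M := by rw [hM, freqMax]; linarith [jb_pos k, jb_pos j]
  have pj := jb_rpow_pos j (-p)
  have pl := jb_rpow_pos l (-p)
  have p1 := jb_rpow_pos (k + j) (-p)
  have p2 := jb_rpow_pos (k + j + l) (-p)
  have p3 := jb_rpow_pos (k + l) (-p)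
  have q1 := jb_rpow_pos (k + j) q
  have q2 := jb_rpow_pos (k + j + l) q
  have q3 := jb_rpow_pos (k + l) q
  have hW := pairWeight_pos p k j l
  have fin : ∀ {A : ℝ} {z y : ℝ}, 0 < z → 0 < y → 0 < A →
      jb j ^ (-p) * jb l ^ (-p) * jb k ^ q ≤ E * A * y → A ≤ pairWeight p k j l →
      D * (jb j ^ (-p) * jb l ^ (-p) * jb k ^ q) * z ≤
        (D * E + F) * pairWeight p k j l * (z * y) := by
    intro A z y hz hy hA h1 h2
    calc D * (jb j ^ (-p) * jb l ^ (-p) * jb k ^ q) * z ≤ D * (E * A * y) * z := by gcongr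
      _ ≤ D * (E * pairWeight p k j l * y) * z := by gcongr
      _ = D * E * pairWeight p k j l * (z * y) := by ring
      _ ≤ _ := by gcongr; linarith
  rcases freqMax_cases n1 n2 with ⟨c1, c2⟩ | ⟨c1, c2⟩ | ⟨c1, c2⟩ | ⟨c1, c2, c3⟩
  · refine (rpow_mul_le_of_two_high (by norm_num) hM1 c1 c2 (jb_pos _) (jb_pos _) (jb_pos _)
      (jb_pos _) (jb_pos _) kM jM lM ha hq hη h).trans ?_
    refine (fin (by positivity) q2 ?_ (pair_mul_rpow_le_mid hq hqη) ?_).trans (le_of_eq (by ring))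
    · positivity
    · unfold pairWeight
      have : 0 < jb l ^ (-p) * jb (k + j) ^ (-p) := by positivity
      have : 0 < jb j ^ (-p) * jb (k + l) ^ (-p) := by positivity
      have : 0 < jb (k + j) ^ (-p) * jb (k + l) ^ (-p) := by positivity
      linarith
  · refine (rpow_mul_le_of_two_high (by norm_num) hM1 c1 c2 (jb_pos _) (jb_pos _) (jb_pos _)
      (jb_pos _) (jb_pos _) kM jM lM ha hq hη h).trans ?_
    have key : jb j ^ (-p) * jb l ^ (-p) * jb k ^ q ≤
        E * (jb l ^ (-p) * jb j ^ (-p) + jb j ^ (-p) * jb (k + l) ^ (-p)) * jb (k + l) ^ q := by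
      rw [mul_comm (jb j ^ (-p)) (jb l ^ (-p))]
      refine (pair_mul_rpow_le_left hq hqη).trans ?_
      gcongr
    refine (fin (by positivity) q3 ?_ key ?_).trans (le_of_eq (by ring))
    · positivity
    · unfold pairWeight
      have : 0 < jb l ^ (-p) * jb (k + j) ^ (-p) := by positivity
      have : 0 < jb j ^ (-p) * jb (k + j + l) ^ (-p) := by positivity
      have : 0 < jb l ^ (-p) * jb (k + j + l) ^ (-p) := by positivity
      have : 0 < jb (k + j) ^ (-p) * jb (k + l) ^ (-p) := by positivity
      linarith
  · refine (rpow_mul_le_of_two_high (by norm_num) hM1 c1 c2 (jb_pos _) (jb_pos _) (jb_pos _)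
      (jb_pos _) (jb_pos _) kM jM lM ha hq hη h).trans ?_
    have key : jb j ^ (-p) * jb l ^ (-p) * jb k ^ q ≤
        E * (jb j ^ (-p) * jb l ^ (-p) + jb l ^ (-p) * jb (k + j) ^ (-p)) * jb (k + j) ^ q := by
      refine (pair_mul_rpow_le_left hq hqη).trans ?_
      gcongr
    refine (fin (by positivity) q1 ?_ key ?_).trans (le_of_eq (by ring))
    · positivity
    · unfold pairWeight
      have : 0 < jb j ^ (-p) * jb (k + l) ^ (-p) := by positivity
      have : 0 < jb j ^ (-p) * jb (k + j + l) ^ (-p) := by positivity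
      have : 0 < jb l ^ (-p) * jb (k + j + l) ^ (-p) := by positivity
      have : 0 < jb (k + j) ^ (-p) * jb (k + l) ^ (-p) := by positivity
      linarith
  -- Here j and l are also of size M, so the kernel itself gives M^{-2}. By the exponent relation
  -- the total power is M^{-2(p-q)} M^q: the middle input takes M^q, and each M^{-(p-q)} is handed
  -- to an outer input, which is at most M.
  · have e1 : jb j ^ (-1 : ℝ) ≤ 2000 * M ^ (-1 : ℝ) := by
      rw [Real.rpow_neg_one, Real.rpow_neg_one, ← div_eq_mul_inv, inv_le_comm₀ (jb_pos j)
        (by positivity), inv_div, div_le_iff₀ (by norm_num)]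
      linarith
    have e2 : jb l ^ (-1 : ℝ) ≤ 2000 * M ^ (-1 : ℝ) := by
      rw [Real.rpow_neg_one, Real.rpow_neg_one, ← div_eq_mul_inv, inv_le_comm₀ (jb_pos l)
        (by positivity), inv_div, div_le_iff₀ (by norm_num)]
      linarith
    have e3 : jb k ^ (q + 2 * a) ≤ M ^ (q + 2 * a) :=
      Real.rpow_le_rpow (jb_pos k).le kM (by linarith)
    have m1 : jb (k + j) ≤ M := by
      rw [hM, freqMax]; linarith [jb_add_le k j, jb_pos l]
    have m3 : jb (k + l) ≤ M := by
      rw [hM, freqMax]; linarith [jb_add_le k l, jb_pos j]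
    have e4 : M ^ (-(p - q)) ≤ jb (k + j) ^ (-(p - q)) :=
      Real.rpow_le_rpow_of_nonpos (jb_pos _) m1 (by linarith)
    have e5 : M ^ (-(p - q)) ≤ jb (k + l) ^ (-(p - q)) :=
      Real.rpow_le_rpow_of_nonpos (jb_pos _) m3 (by linarith)
    have e6 : M ^ q ≤ 2000 ^ q * jb (k + j + l) ^ q := by
      rw [← Real.mul_rpow (by norm_num) (jb_pos _).le]
      exact Real.rpow_le_rpow hM0.le c3 hq
    have e7 : jb (k + j) ^ (-(p - q)) = jb (k + j) ^ (-p) * jb (k + j) ^ q := by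
      rw [← Real.rpow_add (jb_pos _)]; congr 1; ring
    have e8 : jb (k + l) ^ (-(p - q)) = jb (k + l) ^ (-p) * jb (k + l) ^ q := by
      rw [← Real.rpow_add (jb_pos _)]; congr 1; ring
    have e9 : M ^ ρ * M ^ (-1 : ℝ) * M ^ (-1 : ℝ) * M ^ (q + 2 * a) =
        M ^ (-(p - q)) * M ^ (-(p - q)) * M ^ q := by
      simp only [← Real.rpow_add hM0]; congr 1; rw [hp]; linarith
    have W1 : jb (k + j) ^ (-p) * jb (k + l) ^ (-p) ≤ pairWeight p k j l := by
      unfold pairWeight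
      have : 0 < jb j ^ (-p) * jb l ^ (-p) := by positivity
      have : 0 < jb l ^ (-p) * jb (k + j) ^ (-p) := by positivity
      have : 0 < jb j ^ (-p) * jb (k + l) ^ (-p) := by positivity
      have : 0 < jb j ^ (-p) * jb (k + j + l) ^ (-p) := by positivity
      have : 0 < jb l ^ (-p) * jb (k + j + l) ^ (-p) := by positivity
      linarith
    have i1 := jb_rpow_pos j (-1)
    have i2 := jb_rpow_pos l (-1)
    have i3 := jb_rpow_pos k (q + 2 * a)
    calc M ^ ρ * jb j ^ (-1 : ℝ) * jb l ^ (-1 : ℝ) * jb k ^ (q + 2 * a)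
        ≤ M ^ ρ * (2000 * M ^ (-1 : ℝ)) * (2000 * M ^ (-1 : ℝ)) * M ^ (q + 2 * a) := by gcongr
      _ = 2000 * 2000 * (M ^ ρ * M ^ (-1 : ℝ) * M ^ (-1 : ℝ) * M ^ (q + 2 * a)) := by ring
      _ = 2000 * 2000 * (M ^ (-(p - q)) * M ^ (-(p - q)) * M ^ q) := by rw [e9]
      _ ≤ 2000 * 2000 * (jb (k + j) ^ (-(p - q)) * jb (k + l) ^ (-(p - q)) *
            (2000 ^ q * jb (k + j + l) ^ q)) := by
          have := (jb_rpow_pos (k + j) (-(p - q))).le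
          have := (jb_rpow_pos (k + l) (-(p - q))).le
          gcongr
      _ = F * (jb (k + j) ^ (-p) * jb (k + l) ^ (-p)) *
            (jb (k + j) ^ q * jb (k + j + l) ^ q * jb (k + l) ^ q) := by
          rw [e7, e8, hF]; ring
      _ ≤ _ := by
          gcongr
          nlinarith

/-- Summable majorant of the high-low-low interaction weights. -/
def lowPairWeight (p k j l : ℝ) : ℝ :=
  jb j ^ (-p) * jb (k + l) ^ (-p) + jb j ^ (-p) * jb (k + j + l) ^ (-p) +
    jb (k + l) ^ (-p) * jb (k + j + l) ^ (-p)

/-- The three factors have total decay 1 + 2q = 2(q + 1/2). The decay of the largest variable is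
redistributed over the other two so that each of them decays with exponent q + 1/2. A dominant x
splits as 1/2 + 1/2, a dominant y or z as (q - 1/2) + 1/2. -/
lemma triple_le_lowPairWeight {q x y z : ℝ} (hq : 1 / 2 ≤ q)
    (hx : 1 ≤ x) (hy : 1 ≤ y) (hz : 1 ≤ z) :
    x ^ (-1 : ℝ) * y ^ (-q) * z ^ (-q) ≤ x ^ (-(q + 1 / 2)) * y ^ (-(q + 1 / 2)) +
      x ^ (-(q + 1 / 2)) * z ^ (-(q + 1 / 2)) + y ^ (-(q + 1 / 2)) * z ^ (-(q + 1 / 2)) := by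
  have hx0 : 0 < x := by linarith
  have hy0 : 0 < y := by linarith
  have hz0 : 0 < z := by linarith
  have key : ∀ {u v w : ℝ}, 0 < u → 0 < v → 0 < w → u ≤ w → v ≤ w →
      w ^ (-q) ≤ u ^ (-(q - 1 / 2)) * v ^ (-(1 / 2) : ℝ) := by
    intro u v w hu hv hw h1 h2
    rw [show -q = -(q - 1 / 2) + -(1 / 2) by ring, Real.rpow_add hw]
    exact mul_le_mul (Real.rpow_le_rpow_of_nonpos hu h1 (by linarith))
      (Real.rpow_le_rpow_of_nonpos hv h2 (by norm_num)) (by positivity) (by positivity)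
  have sp : ∀ {u : ℝ}, 0 < u → u ^ (-(q + 1 / 2)) = u ^ (-q) * u ^ (-(1 / 2) : ℝ) := by
    intro u hu; rw [← Real.rpow_add hu]; congr 1; ring
  have sp' : x ^ (-(q + 1 / 2)) = x ^ (-1 : ℝ) * x ^ (-(q - 1 / 2)) := by
    rw [← Real.rpow_add hx0]; congr 1; ring
  have P1 : 0 < x ^ (-(q + 1 / 2)) * y ^ (-(q + 1 / 2)) := by positivity
  have P2 : 0 < x ^ (-(q + 1 / 2)) * z ^ (-(q + 1 / 2)) := by positivity
  have P3 : 0 < y ^ (-(q + 1 / 2)) * z ^ (-(q + 1 / 2)) := by positivity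
  by_cases h1 : y ≤ x ∧ z ≤ x
  · have a : x ^ (-1 : ℝ) ≤ y ^ (-(1 / 2) : ℝ) * z ^ (-(1 / 2) : ℝ) := by
      rw [show (-1 : ℝ) = -(1 / 2) + -(1 / 2) by norm_num, Real.rpow_add hx0]
      exact mul_le_mul (Real.rpow_le_rpow_of_nonpos hy0 h1.1 (by norm_num))
        (Real.rpow_le_rpow_of_nonpos hz0 h1.2 (by norm_num)) (by positivity) (by positivity)
    have : x ^ (-1 : ℝ) * y ^ (-q) * z ^ (-q) ≤ y ^ (-(q + 1 / 2)) * z ^ (-(q + 1 / 2)) := by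
      rw [sp hy0, sp hz0]
      calc x ^ (-1 : ℝ) * y ^ (-q) * z ^ (-q)
          ≤ (y ^ (-(1 / 2) : ℝ) * z ^ (-(1 / 2) : ℝ)) * y ^ (-q) * z ^ (-q) := by gcongr
        _ = _ := by ring
    linarith
  · rcases le_total y z with h | h
    · have hxz : x ≤ z := by
        by_contra hc; push Not at hc; exact h1 ⟨h.trans hc.le, hc.le⟩
      have : x ^ (-1 : ℝ) * y ^ (-q) * z ^ (-q) ≤ x ^ (-(q + 1 / 2)) * y ^ (-(q + 1 / 2)) := by
        rw [sp hy0, sp']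
        calc x ^ (-1 : ℝ) * y ^ (-q) * z ^ (-q)
            ≤ x ^ (-1 : ℝ) * y ^ (-q) * (x ^ (-(q - 1 / 2)) * y ^ (-(1 / 2) : ℝ)) := by
              gcongr; exact key hx0 hy0 hz0 hxz h
          _ = _ := by ring
      linarith
    · have hxy : x ≤ y := by
        by_contra hc; push Not at hc; exact h1 ⟨hc.le, h.trans hc.le⟩
      have : x ^ (-1 : ℝ) * y ^ (-q) * z ^ (-q) ≤ x ^ (-(q + 1 / 2)) * z ^ (-(q + 1 / 2)) := by
        rw [sp hz0, sp']
        calc x ^ (-1 : ℝ) * y ^ (-q) * z ^ (-q)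
            ≤ x ^ (-1 : ℝ) * (x ^ (-(q - 1 / 2)) * z ^ (-(1 / 2) : ℝ)) * z ^ (-q) := by
              gcongr; exact key hx0 hz0 hy0 hxy h
          _ = _ := by ring
      linarith

/-! ### Trilinear estimates for positive kernels -/

/-- The weighted norm `(∑_k ⟨k⟩^{2s} X_k²)^{1/2}`. -/
def sob (s : ℝ) (X : ℤ → ℝ≥0∞) : ℝ≥0∞ := l2 fun k : ℤ => wt s k * X k

lemma sob_mono {s : ℝ} {X Y : ℤ → ℝ≥0∞} (h : ∀ k, X k ≤ Y k) : sob s X ≤ sob s Y :=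
  l2_mono fun k => by gcongr; exact h k

lemma sob_le_sob {s s' : ℝ} (h : s ≤ s') (X : ℤ → ℝ≥0∞) : sob s X ≤ sob s' X :=
  l2_mono fun k => by gcongr; exact wt_mono h _

lemma l2_le_sob {s : ℝ} (hs : 0 ≤ s) (X : ℤ → ℝ≥0∞) : l2 X ≤ sob s X :=
  l2_mono fun _ => le_mul_of_one_le_left' (one_le_wt hs _)

lemma sob_const_mul (s : ℝ) (c : ℝ≥0∞) (X : ℤ → ℝ≥0∞) :
    sob s (fun k => c * X k) = c * sob s X := by
  rw [sob, sob, ← l2_const_mul]; congr 1; ext k; ring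

lemma sob_add_le (s : ℝ) (X Y : ℤ → ℝ≥0∞) : sob s (fun k => X k + Y k) ≤ sob s X + sob s Y := by
  refine le_trans (le_of_eq ?_) (l2_add_le _ _)
  rw [sob]; congr 1; ext k; ring

lemma wt_mul_le_sob (s : ℝ) (X : ℤ → ℝ≥0∞) (k : ℤ) : wt s k * X k ≤ sob s X :=
  le_l2 (fun k : ℤ => wt s k * X k) k

lemma le_sob {s : ℝ} (hs : 0 ≤ s) (X : ℤ → ℝ≥0∞) (k : ℤ) : X k ≤ sob s X :=
  (le_l2 X k).trans (l2_le_sob hs X)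

/-- The trilinear sum with kernel `κ`. -/
def tri (κ : ℤ → ℤ → ℤ → ℝ≥0∞) (X Y Z : ℤ → ℝ≥0∞) (k : ℤ) : ℝ≥0∞ :=
  ∑' p : ℤ × ℤ, κ k p.1 p.2 * (X (k + p.1) * Y (k + p.1 + p.2) * Z (k + p.2))

lemma tri_mono {κ κ' : ℤ → ℤ → ℤ → ℝ≥0∞} {X X' Y Y' Z Z' : ℤ → ℝ≥0∞}
    (hκ : ∀ k j l, κ k j l ≤ κ' k j l) (hX : ∀ k, X k ≤ X' k) (hY : ∀ k, Y k ≤ Y' k)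
    (hZ : ∀ k, Z k ≤ Z' k) (k : ℤ) : tri κ X Y Z k ≤ tri κ' X' Y' Z' k := by
  refine ENNReal.tsum_le_tsum fun p => ?_
  gcongr
  · exact hκ _ _ _
  · exact hX _
  · exact hY _
  · exact hZ _

lemma tri_add (κ κ' : ℤ → ℤ → ℤ → ℝ≥0∞) (X Y Z : ℤ → ℝ≥0∞) (k : ℤ) :
    tri (fun k j l => κ k j l + κ' k j l) X Y Z k = tri κ X Y Z k + tri κ' X Y Z k := by
  rw [tri, tri, tri, ← ENNReal.tsum_add]; congr 1; ext p; ring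

lemma tri_swap (κ : ℤ → ℤ → ℤ → ℝ≥0∞) (X Y Z : ℤ → ℝ≥0∞) (k : ℤ) :
    tri (fun k j l => κ k l j) X Y Z k = tri κ Z Y X k := by
  rw [tri, tri, ← (Equiv.prodComm ℤ ℤ).tsum_eq]
  congr 1; ext p
  simp only [Equiv.prodComm_apply, Prod.fst_swap, Prod.snd_swap]
  rw [add_right_comm k p.2 p.1]; ring

/-- The map (k, j, l) ↦ (k + j, k + j + l, k + l) is a bijection of ℤ³, so the three input
frequencies are independent. -/
lemma tsum_triple (f g h : ℤ → ℝ≥0∞) :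
    ∑' k : ℤ, ∑' p : ℤ × ℤ, f (k + p.1) * g (k + p.1 + p.2) * h (k + p.2) =
      (∑' k, f k) * (∑' k, g k) * ∑' k, h k := by
  have e1 : ∀ k : ℤ, ∑' p : ℤ × ℤ, f (k + p.1) * g (k + p.1 + p.2) * h (k + p.2) =
      ∑' l : ℤ, (∑' n : ℤ, f n * g (n + l)) * h (k + l) := by
    intro k
    rw [ENNReal.tsum_prod (f := fun j l => f (k + j) * g (k + j + l) * h (k + l)),
      ENNReal.tsum_comm]
    congr 1; ext l
    rw [ENNReal.tsum_mul_right, tsum_int_shift (fun n => f n * g (n + l)) k]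
  simp_rw [e1]
  rw [ENNReal.tsum_comm]
  have e2 : ∀ l : ℤ, ∑' k : ℤ, (∑' n : ℤ, f n * g (n + l)) * h (k + l) =
      (∑' n : ℤ, f n * g (n + l)) * ∑' k, h k := by
    intro l; rw [ENNReal.tsum_mul_left, tsum_int_shift' h l]
  simp_rw [e2]
  rw [ENNReal.tsum_mul_right, ENNReal.tsum_comm]
  congr 1
  have e3 : ∀ n : ℤ, ∑' l : ℤ, f n * g (n + l) = f n * ∑' k, g k := by
    intro n; rw [ENNReal.tsum_mul_left, tsum_int_shift g n]
  simp_rw [e3]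
  rw [ENNReal.tsum_mul_right]

/-- Cauchy-Schwarz in (j, l) for fixed k. The weights go into a sum of `Θ` bounded uniformly in k,
and the squared inputs sum to a product of norms by `tsum_triple`. The kernel therefore enters only
through its square. -/
lemma l2_trilinear_le {ω ω₁ ω₂ ω₃ : ℤ → ℝ≥0∞} {κ Θ : ℤ → ℤ → ℤ → ℝ≥0∞} {B : ℝ≥0∞}
    (hκ : ∀ k j l, (ω k * κ k j l) ^ 2 ≤ Θ k j l * (ω₁ (k + j) * ω₂ (k + j + l) * ω₃ (k + l)) ^ 2)
    (hΘ : ∀ k, ∑' p : ℤ × ℤ, Θ k p.1 p.2 ≤ B) (X Y Z : ℤ → ℝ≥0∞) :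
    l2 (fun k => ω k * tri κ X Y Z k) ≤ B ^ (1 / 2 : ℝ) *
      (l2 (fun k => ω₁ k * X k) * l2 (fun k => ω₂ k * Y k) * l2 (fun k => ω₃ k * Z k)) := by
  set x := fun k => ω₁ k * X k
  set y := fun k => ω₂ k * Y k
  set z := fun k => ω₃ k * Z k
  have h1 : ∀ k, ω k * tri κ X Y Z k ≤ B ^ (1 / 2 : ℝ) *
      l2 (fun p : ℤ × ℤ => x (k + p.1) * y (k + p.1 + p.2) * z (k + p.2)) := by
    intro k
    calc ω k * tri κ X Y Z k
        = ∑' p : ℤ × ℤ, ω k * κ k p.1 p.2 * (X (k + p.1) * Y (k + p.1 + p.2) * Z (k + p.2)) := by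
          rw [tri, ← ENNReal.tsum_mul_left]; congr 1; ext p; ring
      _ ≤ ∑' p : ℤ × ℤ, Θ k p.1 p.2 ^ (1 / 2 : ℝ) *
            (x (k + p.1) * y (k + p.1 + p.2) * z (k + p.2)) := by
          refine ENNReal.tsum_le_tsum fun p => ?_
          have h2 : ω k * κ k p.1 p.2 ≤ Θ k p.1 p.2 ^ (1 / 2 : ℝ) *
              (ω₁ (k + p.1) * ω₂ (k + p.1 + p.2) * ω₃ (k + p.2)) := by
            refine le_of_sq_le_sq ?_
            rw [mul_pow (_ ^ (1 / 2 : ℝ)), rpow_half_sq]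
            exact hκ _ _ _
          calc _ ≤ Θ k p.1 p.2 ^ (1 / 2 : ℝ) *
              (ω₁ (k + p.1) * ω₂ (k + p.1 + p.2) * ω₃ (k + p.2)) *
              (X (k + p.1) * Y (k + p.1 + p.2) * Z (k + p.2)) := by gcongr
            _ = _ := by simp only [x, y, z]; ring
      _ ≤ l2 (fun p : ℤ × ℤ => Θ k p.1 p.2 ^ (1 / 2 : ℝ)) * l2 _ := tsum_mul_le_l2 _ _
      _ ≤ _ := by
          gcongr
          rw [l2]
          simp_rw [rpow_half_sq]
          exact ENNReal.rpow_le_rpow (hΘ k) (by norm_num)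
  refine (l2_mono h1).trans ?_
  rw [l2_const_mul]
  gcongr
  refine le_of_sq_le_sq ?_
  rw [l2_sq, mul_pow, mul_pow, l2_sq, l2_sq, l2_sq]
  simp_rw [l2_sq, mul_pow]
  exact (tsum_triple (fun k => x k ^ 2) (fun k => y k ^ 2) (fun k => z k ^ 2)).le

section sums
variable {p : ℝ}

lemma ofReal_jb_mul (x y u v : ℝ) :
    ENNReal.ofReal (jb x ^ u * jb y ^ v) = wt u x * wt v y :=
  ENNReal.ofReal_mul (jb_rpow_pos _ _).le

lemma ofReal_mul_jb_triple {c w : ℝ} (hc : 0 ≤ c) (hw : 0 ≤ w) (x y z u v t : ℝ) :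
    ENNReal.ofReal (c * w * (jb x ^ u * jb y ^ v * jb z ^ t)) =
      ENNReal.ofReal c * ENNReal.ofReal w * (wt u x * wt v y * wt t z) := by
  have := (jb_rpow_pos x u).le
  have := (jb_rpow_pos y v).le
  rw [ENNReal.ofReal_mul (by positivity), ENNReal.ofReal_mul hc,
    ENNReal.ofReal_mul (by positivity), ENNReal.ofReal_mul (by positivity)]
  rfl

lemma tsum_wt_shift (hp : 0 ≤ p) (c : ℤ) : ∑' n : ℤ, wt (-p) ((c : ℝ) + n) ≤ bracketSum p := by
  simpa [add_comm] using tsum_wt_add_le hp (c : ℝ)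

lemma tsum_iter_le {f g : ℤ → ℤ → ℝ≥0∞} {B : ℝ≥0∞} (hg : ∀ j, ∑' l, g j l ≤ B)
    (hf : ∑' j, f j 0 ≤ B) (hf' : ∀ j l, f j l = f j 0) :
    ∑' q : ℤ × ℤ, f q.1 q.2 * g q.1 q.2 ≤ B ^ 2 := by
  rw [ENNReal.tsum_prod (f := fun j l => f j l * g j l)]
  calc ∑' j, ∑' l, f j l * g j l = ∑' j, f j 0 * ∑' l, g j l := by
        congr 1; ext j; rw [← ENNReal.tsum_mul_left]; congr 1; ext l; rw [hf' j l]
    _ ≤ ∑' j, f j 0 * B := by gcongr with j; exact hg j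
    _ ≤ B * B := by rw [ENNReal.tsum_mul_right]; gcongr
    _ = B ^ 2 := (sq B).symm

lemma tsum_iter_le' {f g : ℤ → ℤ → ℝ≥0∞} {B : ℝ≥0∞} (hg : ∀ l, ∑' j, g j l ≤ B)
    (hf : ∑' l, f 0 l ≤ B) (hf' : ∀ j l, f j l = f 0 l) :
    ∑' q : ℤ × ℤ, f q.1 q.2 * g q.1 q.2 ≤ B ^ 2 := by
  rw [← (Equiv.prodComm ℤ ℤ).tsum_eq]
  exact tsum_iter_le (f := fun l j => f j l) (g := fun l j => g j l) hg hf (fun l j => hf' j l)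

lemma tsum_pairWeight_le (hp : 0 ≤ p) (k : ℤ) :
    ∑' q : ℤ × ℤ, ENNReal.ofReal (pairWeight p k q.1 q.2) ≤ 6 * bracketSum p ^ 2 := by
  have pos := fun x => (jb_rpow_pos x (-p)).le
  have hsplit : ∀ j l : ℤ, ENNReal.ofReal (pairWeight p k j l) =
      wt (-p) j * wt (-p) l + wt (-p) l * wt (-p) ((k : ℝ) + j) +
      wt (-p) j * wt (-p) ((k : ℝ) + l) + wt (-p) j * wt (-p) ((k : ℝ) + j + l) +
      wt (-p) l * wt (-p) ((k : ℝ) + j + l) + wt (-p) ((k : ℝ) + j) * wt (-p) ((k : ℝ) + l) := by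
    intro j l
    have q1 := pos j
    have q2 := pos l
    have q3 := pos (k + j)
    have q4 := pos (k + l)
    have q5 := pos (k + j + l)
    unfold pairWeight
    rw [ENNReal.ofReal_add (by positivity) (by positivity),
      ENNReal.ofReal_add (by positivity) (by positivity),
      ENNReal.ofReal_add (by positivity) (by positivity),
      ENNReal.ofReal_add (by positivity) (by positivity),
      ENNReal.ofReal_add (by positivity) (by positivity)]
    simp only [ofReal_jb_mul]
  simp_rw [hsplit, ENNReal.tsum_add]
  have s0 : ∑' n : ℤ, wt (-p) n ≤ bracketSum p := tsum_wt_int_le hp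
  have s1 : ∑' n : ℤ, wt (-p) ((k : ℝ) + n) ≤ bracketSum p := tsum_wt_shift hp k
  have s2 : ∀ j : ℤ, ∑' l : ℤ, wt (-p) ((k : ℝ) + j + l) ≤ bracketSum p := fun j => by
    have := tsum_wt_shift hp (k + j); push_cast at this; exact this
  have s3 : ∀ l : ℤ, ∑' j : ℤ, wt (-p) ((k : ℝ) + j + l) ≤ bracketSum p := fun l => by
    have := tsum_wt_shift hp (k + l); push_cast at this
    refine le_trans (le_of_eq ?_) this
    congr 1; ext j; ring_nf
  calc _ ≤ bracketSum p ^ 2 + bracketSum p ^ 2 + bracketSum p ^ 2 + bracketSum p ^ 2 +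
        bracketSum p ^ 2 + bracketSum p ^ 2 := by
        gcongr ?_ + ?_ + ?_ + ?_ + ?_ + ?_
        · exact tsum_iter_le (f := fun j _ => wt (-p) j) (g := fun _ l => wt (-p) l)
            (fun _ => s0) s0 (fun _ _ => rfl)
        · exact tsum_iter_le' (f := fun _ l => wt (-p) l) (g := fun j _ => wt (-p) ((k : ℝ) + j))
            (fun _ => s1) s0 (fun _ _ => rfl)
        · exact tsum_iter_le (f := fun j _ => wt (-p) j) (g := fun _ l => wt (-p) ((k : ℝ) + l))
            (fun _ => s1) s0 (fun _ _ => rfl)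
        · exact tsum_iter_le (f := fun j _ => wt (-p) j)
            (g := fun j l => wt (-p) ((k : ℝ) + j + l)) s2 s0 (fun _ _ => rfl)
        · exact tsum_iter_le' (f := fun _ l => wt (-p) l)
            (g := fun j l => wt (-p) ((k : ℝ) + j + l)) s3 s0 (fun _ _ => rfl)
        · exact tsum_iter_le (f := fun j _ => wt (-p) ((k : ℝ) + j))
            (g := fun _ l => wt (-p) ((k : ℝ) + l)) (fun _ => s1) s1 (fun _ _ => rfl)
    _ = 6 * bracketSum p ^ 2 := by ring

lemma tsum_lowPairWeight_le (hp : 0 ≤ p) (k : ℤ) :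
    ∑' q : ℤ × ℤ, ENNReal.ofReal (lowPairWeight p k q.1 q.2) ≤ 3 * bracketSum p ^ 2 := by
  have pos := fun x => (jb_rpow_pos x (-p)).le
  have hsplit : ∀ j l : ℤ, ENNReal.ofReal (lowPairWeight p k j l) =
      wt (-p) j * wt (-p) ((k : ℝ) + l) + wt (-p) j * wt (-p) ((k : ℝ) + j + l) +
      wt (-p) ((k : ℝ) + l) * wt (-p) ((k : ℝ) + j + l) := by
    intro j l
    have q1 := pos j
    have q4 := pos (k + l)
    have q5 := pos (k + j + l)
    unfold lowPairWeight
    rw [ENNReal.ofReal_add (by positivity) (by positivity),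
      ENNReal.ofReal_add (by positivity) (by positivity)]
    simp only [ofReal_jb_mul]
  simp_rw [hsplit, ENNReal.tsum_add]
  have s0 : ∑' n : ℤ, wt (-p) n ≤ bracketSum p := tsum_wt_int_le hp
  have s1 : ∑' n : ℤ, wt (-p) ((k : ℝ) + n) ≤ bracketSum p := tsum_wt_shift hp k
  have s2 : ∀ j : ℤ, ∑' l : ℤ, wt (-p) ((k : ℝ) + j + l) ≤ bracketSum p := fun j => by
    have := tsum_wt_shift hp (k + j); push_cast at this; exact this
  have s3 : ∀ l : ℤ, ∑' j : ℤ, wt (-p) ((k : ℝ) + j + l) ≤ bracketSum p := fun l => by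
    have := tsum_wt_shift hp (k + l); push_cast at this
    refine le_trans (le_of_eq ?_) this
    congr 1; ext j; ring_nf
  calc _ ≤ bracketSum p ^ 2 + bracketSum p ^ 2 + bracketSum p ^ 2 := by
        gcongr ?_ + ?_ + ?_
        · exact tsum_iter_le (f := fun j _ => wt (-p) j) (g := fun _ l => wt (-p) ((k : ℝ) + l))
            (fun _ => s1) s0 (fun _ _ => rfl)
        · exact tsum_iter_le (f := fun j _ => wt (-p) j)
            (g := fun j l => wt (-p) ((k : ℝ) + j + l)) s2 s0 (fun _ _ => rfl)
        · exact tsum_iter_le' (f := fun _ l => wt (-p) ((k : ℝ) + l))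
            (g := fun j l => wt (-p) ((k : ℝ) + j + l)) s3 s1 (fun _ _ => rfl)
    _ = 3 * bracketSum p ^ 2 := by ring

end sums

/-! ### High-low-low and balanced interactions -/

/-- The high-low-low interactions, in which `k + j` is the only high input frequency. -/
def IsHLL (k j l : ℤ) : Prop := j ≠ 0 ∧ l ≠ 0 ∧ 8 * |k + l| ≤ |k| ∧ 8 * |k + j + l| ≤ |k|

/-- The nonresonant interactions without the high-low-low ones. -/
def IsBalanced (k j l : ℤ) : Prop := j ≠ 0 ∧ l ≠ 0 ∧ ¬ IsHLL k j l ∧ ¬ IsHLL k l j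

/-- The size of the kernel `|Φ|^{-1}` away from the resonances. -/
def kerBound (ρ : ℝ) (k j l : ℤ) : ℝ :=
  freqMax k j l ^ ρ * jb j ^ (-1 : ℝ) * jb l ^ (-1 : ℝ)

lemma kerBound_pos (ρ : ℝ) (k j l : ℤ) : 0 < kerBound ρ k j l := by
  unfold kerBound
  have := freqMax_pos (k : ℝ) j l
  have := jb_rpow_pos j (-1)
  have := jb_rpow_pos l (-1)
  positivity

lemma kerBound_swap (ρ : ℝ) (k j l : ℤ) : kerBound ρ k j l = kerBound ρ k l j := by
  unfold kerBound freqMax; rw [add_right_comm]; ring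

open Classical in
-- The pointwise inequality `weight_le_pairWeight` with q = 2s, inserted in `l2_trilinear_le`. For ρ
-- = 2 - 2α the exponent relation reads η = 2s + α - 1 - a, and summability needs η > 0: this is the
-- origin of the strict restriction a < 2s + α - 1.
lemma tri_balanced_le {ρ a s η : ℝ} (ha : 0 ≤ a) (hs : 0 ≤ s) (hη : 0 < η)
    (hqη : 2 * s ≤ 1 + η) (h : 2 * a + ρ = 4 * s - 2 * η) (D : ℝ) :
    ∃ C : ℝ≥0∞, C < ∞ ∧ ∀ κ : ℤ → ℤ → ℤ → ℝ≥0∞,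
      (∀ k j l, IsBalanced k j l → κ k j l ^ 2 ≤ ENNReal.ofReal (D * kerBound ρ k j l)) →
      ∀ X Y Z : ℤ → ℝ≥0∞,
        sob (s + a) (tri (fun k j l => if IsBalanced k j l then κ k j l else 0) X Y Z) ≤
          C * (sob s X * sob s Y * sob s Z) := by
  obtain ⟨C, hC, hW⟩ := weight_le_pairWeight (ρ := ρ) (a := a) (q := 2 * s) (η := η) ha
    (by linarith) hη.le hqη (by linarith)
  have hB : bracketSum (1 + η) < ∞ := bracketSum_lt_top (by linarith)
  refine ⟨(ENNReal.ofReal (|D| * C) * (6 * bracketSum (1 + η) ^ 2)) ^ (1 / 2 : ℝ), ?_, ?_⟩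
  · refine ENNReal.rpow_lt_top_of_nonneg (by norm_num) (ENNReal.mul_lt_top ENNReal.ofReal_lt_top
      (ENNReal.mul_lt_top (by simp) (ENNReal.pow_lt_top hB))).ne
  intro κ hκ X Y Z
  refine l2_trilinear_le (ω := fun k : ℤ => wt (s + a) k) (ω₁ := fun k : ℤ => wt s k)
    (ω₂ := fun k : ℤ => wt s k) (ω₃ := fun k : ℤ => wt s k)
    (Θ := fun k j l => ENNReal.ofReal (|D| * C) * ENNReal.ofReal (pairWeight (1 + η) k j l))
    ?_ ?_ X Y Z
  · intro k j l
    split_ifs with hb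
    · have n1 : ¬ (8 * |(k : ℝ) + l| ≤ |(k : ℝ)| ∧ 8 * |(k : ℝ) + j + l| ≤ |(k : ℝ)|) :=
        fun hc => hb.2.2.1 ⟨hb.1, hb.2.1, by exact_mod_cast hc.1, by exact_mod_cast hc.2⟩
      have n2 : ¬ (8 * |(k : ℝ) + j| ≤ |(k : ℝ)| ∧ 8 * |(k : ℝ) + j + l| ≤ |(k : ℝ)|) :=
        fun hc => hb.2.2.2 ⟨hb.2.1, hb.1, by exact_mod_cast hc.1, by
          have h2 : 8 * |k + j + l| ≤ |k| := by exact_mod_cast hc.2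
          rwa [add_right_comm] at h2⟩
      have hw := hW k j l n1 n2
      rw [mul_pow]
      simp only [mul_pow, wt_sq]
      have hDk : D * kerBound ρ k j l ≤ |D| * kerBound ρ k j l := by
        have := kerBound_pos ρ k j l
        gcongr; exact le_abs_self D
      calc wt (2 * (s + a)) k * κ k j l ^ 2
          ≤ wt (2 * (s + a)) k * ENNReal.ofReal (|D| * kerBound ρ k j l) := by
            gcongr
            exact (hκ k j l hb).trans (ENNReal.ofReal_le_ofReal hDk)
        _ = ENNReal.ofReal (|D| * (kerBound ρ k j l * jb k ^ (2 * s + 2 * a))) := by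
            rw [wt, ← ENNReal.ofReal_mul (jb_rpow_pos _ _).le]; congr 1; ring_nf
        _ ≤ ENNReal.ofReal (|D| * (C * pairWeight (1 + η) k j l *
              (jb (k + j) ^ (2 * s) * jb (k + j + l) ^ (2 * s) * jb (k + l) ^ (2 * s)))) := by
            exact ENNReal.ofReal_le_ofReal (mul_le_mul_of_nonneg_left hw (abs_nonneg D))
        _ = _ := by
            rw [← mul_assoc |D|, ← mul_assoc |D|, ofReal_mul_jb_triple (by positivity)
              (pairWeight_pos (1 + η) k j l).le]
            simp only [Int.cast_add]
    · simp
  · intro k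
    rw [ENNReal.tsum_mul_left]
    gcongr
    exact tsum_pairWeight_le (by linarith) k

/-- Since k + l and k + j + l are both small against k, so is their difference j; hence k + j and l
have the size of k. -/
lemma IsHLL.bounds {k j l : ℤ} (h : IsHLL k j l) :
    1 ≤ |(k : ℝ)| ∧ |(k : ℝ)| ≤ 2 * |(l : ℝ)| ∧ |(l : ℝ)| ≤ 2 * |(k : ℝ)| ∧
      |(k : ℝ)| ≤ 2 * |(k : ℝ) + j| ∧ |(k : ℝ) + j| ≤ 2 * |(k : ℝ)| ∧ |(j : ℝ)| ≤ |(k : ℝ)| := by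
  obtain ⟨hj, hl, h3, h2⟩ := h
  have hk : k ≠ 0 := by
    rintro rfl
    rw [zero_add, abs_zero] at h3
    have : |l| ≤ 0 := by linarith
    exact hl (abs_eq_zero.mp (le_antisymm this (abs_nonneg l)))
  have h3' : 8 * |(k : ℝ) + l| ≤ |(k : ℝ)| := by exact_mod_cast h3
  have h2' : 8 * |(k : ℝ) + j + l| ≤ |(k : ℝ)| := by exact_mod_cast h2
  have hk1 : 1 ≤ |(k : ℝ)| := by exact_mod_cast Int.one_le_abs hk
  have t1 := abs_sub ((k : ℝ) + l) l
  have t2 := abs_sub ((k : ℝ) + l) k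
  have t3 := abs_sub ((k : ℝ) + j + l) (k + l)
  have t4 := abs_add_le (k : ℝ) j
  have t5 := abs_sub ((k : ℝ) + j) j
  rw [show (k : ℝ) + l - l = k by ring] at t1
  rw [show (k : ℝ) + l - k = l by ring] at t2
  rw [show (k : ℝ) + j + l - (k + l) = j by ring] at t3
  rw [show (k : ℝ) + j - j = k by ring] at t5
  refine ⟨hk1, ?_, ?_, ?_, ?_, ?_⟩ <;> linarith

lemma rpow_le_of_comparable {x y C σ : ℝ} (hx : 0 < x) (hy : 0 < y) (hC : 1 ≤ C)
    (h1 : x ≤ C * y) (h2 : y ≤ C * x) : x ^ σ ≤ C ^ |σ| * y ^ σ := by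
  have hC0 : 0 < C := by linarith
  rcases le_total 0 σ with h | h
  · rw [abs_of_nonneg h, ← Real.mul_rpow hC0.le hy.le]
    exact Real.rpow_le_rpow hx.le h1 h
  · rw [abs_of_nonpos h, Real.rpow_neg hC0.le, ← Real.inv_rpow hC0.le,
      ← Real.mul_rpow (by positivity) hy.le]
    refine Real.rpow_le_rpow_of_nonpos (by positivity) ?_ h
    rw [inv_mul_le_iff₀ hC0]; exact h2

open Classical in
-- Here M, ⟨l⟩ and ⟨k⟩ are comparable, so the squared kernel is of size ⟨k⟩^{ρ-1}⟨j⟩^{-1} and pays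
-- for g derivatives. As k and k + j are comparable, the regularity σ of the high input passes to
-- the output whatever its value; only the low inputs need s > 1/4. The freedom in σ is used when
-- the high input is already smoother than H^s.
lemma tri_hll_le {ρ g s : ℝ} (hρ : 0 ≤ ρ) (hg : 2 * g + ρ ≤ 1) (hs : 1 / 4 < s) (σ D : ℝ) :
    ∃ C : ℝ≥0∞, C < ∞ ∧ ∀ κ : ℤ → ℤ → ℤ → ℝ≥0∞,
      (∀ k j l, IsHLL k j l → κ k j l ^ 2 ≤ ENNReal.ofReal (D * kerBound ρ k j l)) →
      ∀ X Y Z : ℤ → ℝ≥0∞,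
        sob (σ + g) (tri (fun k j l => if IsHLL k j l then κ k j l else 0) X Y Z) ≤
          C * (sob σ X * sob s Y * sob s Z) := by
  have hB : bracketSum (2 * s + 1 / 2) < ∞ := bracketSum_lt_top (by linarith)
  set E : ℝ := 4 ^ ρ * 2 * 2 ^ |2 * σ| with hE
  have hE0 : 0 < E := by positivity
  refine ⟨(ENNReal.ofReal (|D| * E) * (3 * bracketSum (2 * s + 1 / 2) ^ 2)) ^ (1 / 2 : ℝ), ?_, ?_⟩
  · refine ENNReal.rpow_lt_top_of_nonneg (by norm_num) (ENNReal.mul_lt_top ENNReal.ofReal_lt_top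
      (ENNReal.mul_lt_top (by simp) (ENNReal.pow_lt_top hB))).ne
  intro κ hκ X Y Z
  refine l2_trilinear_le (ω := fun k : ℤ => wt (σ + g) k) (ω₁ := fun k : ℤ => wt σ k)
    (ω₂ := fun k : ℤ => wt s k) (ω₃ := fun k : ℤ => wt s k)
    (Θ := fun k j l => ENNReal.ofReal (|D| * E) *
      ENNReal.ofReal (lowPairWeight (2 * s + 1 / 2) k j l))
    ?_ ?_ X Y Z
  · intro k j l
    split_ifs with hb
    · obtain ⟨b0, b1, b2, b3, b4, b5⟩ := hb.bounds
      have J0 := jb_pos k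
      have Jl := jb_pos l
      have Jj := jb_pos j
      have J1 := jb_pos (k + j)
      have c1 := jb_le_mul_of_abs_le (by norm_num) b1
      have c2 := jb_le_mul_of_abs_le (by norm_num) b2
      have c3 := jb_le_mul_of_abs_le (by norm_num) b3
      have c4 := jb_le_mul_of_abs_le (by norm_num) b4
      have c5 := jb_le_of_abs_le b5
      have f1 : freqMax k j l ^ ρ ≤ 4 ^ ρ * jb k ^ ρ := by
        rw [← Real.mul_rpow (by norm_num) J0.le]
        refine Real.rpow_le_rpow (freqMax_pos _ _ _).le ?_ hρ
        unfold freqMax; linarith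
      have f2 : jb l ^ (-1 : ℝ) ≤ 2 * jb k ^ (-1 : ℝ) := by
        rw [Real.rpow_neg_one, Real.rpow_neg_one, ← div_eq_mul_inv, inv_le_comm₀ Jl
          (by positivity), inv_div, div_le_iff₀ (by norm_num)]
        linarith
      have f3 : jb k ^ (2 * σ) ≤ 2 ^ |2 * σ| * jb (k + j) ^ (2 * σ) :=
        rpow_le_of_comparable J0 J1 (by norm_num) c3 c4
      have f4 : jb k ^ ρ * jb k ^ (-1 : ℝ) * jb k ^ (2 * g) ≤ 1 := by
        rw [← Real.rpow_add J0, ← Real.rpow_add J0]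
        exact Real.rpow_le_one_of_one_le_of_nonpos (one_le_jb _) (by linarith)
      have f5 := triple_le_lowPairWeight (q := 2 * s) (x := jb j) (y := jb (k + l))
        (z := jb (k + j + l)) (by linarith) (one_le_jb _) (one_le_jb _) (one_le_jb _)
      have n0 := jb_rpow_pos j (-1)
      have nl := jb_rpow_pos l (-1)
      have nk := jb_rpow_pos k (-1)
      have n1 := jb_rpow_pos (k + j) (2 * σ)
      have n2 := jb_rpow_pos (k + j + l) (2 * s)
      have n3 := jb_rpow_pos (k + l) (2 * s)
      have ng := jb_rpow_pos k (2 * g)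
      have nσ := jb_rpow_pos k (2 * σ)
      have g2 : jb (k + j + l) ^ (-(2 * s)) * jb (k + j + l) ^ (2 * s) = 1 := by
        rw [← Real.rpow_add (jb_pos _), neg_add_cancel, Real.rpow_zero]
      have g3 : jb (k + l) ^ (-(2 * s)) * jb (k + l) ^ (2 * s) = 1 := by
        rw [← Real.rpow_add (jb_pos _), neg_add_cancel, Real.rpow_zero]
      have hw : kerBound ρ k j l * jb k ^ (2 * σ + 2 * g) ≤
          E * lowPairWeight (2 * s + 1 / 2) k j l *
          (jb (k + j) ^ (2 * σ) * jb (k + j + l) ^ (2 * s) * jb (k + l) ^ (2 * s)) := by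
        rw [Real.rpow_add J0, kerBound]
        calc freqMax k j l ^ ρ * jb j ^ (-1 : ℝ) * jb l ^ (-1 : ℝ) *
              (jb k ^ (2 * σ) * jb k ^ (2 * g))
            ≤ (4 ^ ρ * jb k ^ ρ) * jb j ^ (-1 : ℝ) * (2 * jb k ^ (-1 : ℝ)) *
              ((2 ^ |2 * σ| * jb (k + j) ^ (2 * σ)) * jb k ^ (2 * g)) := by gcongr
          _ = E * (jb k ^ ρ * jb k ^ (-1 : ℝ) * jb k ^ (2 * g)) * jb j ^ (-1 : ℝ) *
              jb (k + j) ^ (2 * σ) := by rw [hE]; ring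
          _ ≤ E * 1 * jb j ^ (-1 : ℝ) * jb (k + j) ^ (2 * σ) := by gcongr
          _ = E * (jb j ^ (-1 : ℝ) * jb (k + l) ^ (-(2 * s)) * jb (k + j + l) ^ (-(2 * s))) *
              (jb (k + j) ^ (2 * σ) * jb (k + j + l) ^ (2 * s) * jb (k + l) ^ (2 * s)) := by
              rw [show E * (jb j ^ (-1 : ℝ) * jb (k + l) ^ (-(2 * s)) *
                jb (k + j + l) ^ (-(2 * s))) * (jb (k + j) ^ (2 * σ) * jb (k + j + l) ^ (2 * s) *
                jb (k + l) ^ (2 * s)) = E * jb j ^ (-1 : ℝ) * jb (k + j) ^ (2 * σ) *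
                (jb (k + j + l) ^ (-(2 * s)) * jb (k + j + l) ^ (2 * s)) *
                (jb (k + l) ^ (-(2 * s)) * jb (k + l) ^ (2 * s)) by ring, g2, g3]
              ring
          _ ≤ _ := by
              gcongr
              exact f5
      rw [mul_pow]
      simp only [mul_pow, wt_sq]
      have hDk : D * kerBound ρ k j l ≤ |D| * kerBound ρ k j l := by
        have := kerBound_pos ρ k j l
        gcongr; exact le_abs_self D
      calc wt (2 * (σ + g)) k * κ k j l ^ 2
          ≤ wt (2 * (σ + g)) k * ENNReal.ofReal (|D| * kerBound ρ k j l) := by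
            gcongr
            exact (hκ k j l hb).trans (ENNReal.ofReal_le_ofReal hDk)
        _ = ENNReal.ofReal (|D| * (kerBound ρ k j l * jb k ^ (2 * σ + 2 * g))) := by
            rw [wt, ← ENNReal.ofReal_mul (jb_rpow_pos _ _).le]; congr 1; ring_nf
        _ ≤ ENNReal.ofReal (|D| * (E * lowPairWeight (2 * s + 1 / 2) k j l *
              (jb (k + j) ^ (2 * σ) * jb (k + j + l) ^ (2 * s) * jb (k + l) ^ (2 * s)))) := by
            refine ENNReal.ofReal_le_ofReal ?_
            gcongr
        _ = _ := by
            have q0 : 0 ≤ lowPairWeight (2 * s + 1 / 2) k j l := by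
              unfold lowPairWeight
              have := fun x => (jb_rpow_pos x (-(2 * s + 1 / 2))).le
              have h1 := this j
              have h2 := this (k + l)
              have h3 := this (k + j + l)
              positivity
            rw [← mul_assoc |D|, ← mul_assoc |D|, ofReal_mul_jb_triple (by positivity) q0]
            simp only [Int.cast_add]
    · simp
  · intro k
    rw [ENNReal.tsum_mul_left]
    gcongr
    exact tsum_lowPairWeight_le (by linarith) k

/-! ### Powers of the resonance function as kernels -/

lemma jb_phase_inv_le {α : ℝ} (hα : 1 / 2 < α) (hα' : α ≤ 1) {k j l : ℤ} (hj : j ≠ 0)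
    (hl : l ≠ 0) :
    |phase α k j l|⁻¹ ≤ 2 / (α * (2 * α - 1)) * kerBound (2 - 2 * α) k j l := by
  have h := le_jb_phase hα hα' (k := k) hj hl
  have hM := freqMax_pos (k : ℝ) j l
  have hMp : 0 < freqMax (k : ℝ) j l ^ (2 * α - 2) := Real.rpow_pos_of_pos hM _
  have hc : 0 < α * (2 * α - 1) := by nlinarith
  have hJ := mul_pos (jb_pos j) (jb_pos l)
  have hpos : 0 < α * (2 * α - 1) / 2 * freqMax k j l ^ (2 * α - 2) * (jb j * jb l) := by
    positivity
  refine (inv_anti₀ hpos h).trans (le_of_eq ?_)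
  rw [kerBound, Real.rpow_neg_one, Real.rpow_neg_one, show 2 - 2 * α = -(2 * α - 2) by ring,
    Real.rpow_neg hM.le, mul_inv, mul_inv, mul_inv, inv_div]
  ring

lemma phase_ne_zero {α : ℝ} (hα : 1 / 2 < α) (hα' : α ≤ 1) {k j l : ℤ} (hj : j ≠ 0)
    (hl : l ≠ 0) : phase α k j l ≠ 0 := by
  have h := le_jb_phase hα hα' (k := k) hj hl
  have hMp : 0 < freqMax (k : ℝ) j l ^ (2 * α - 2) := Real.rpow_pos_of_pos (freqMax_pos _ _ _) _
  have hc : 0 < α * (2 * α - 1) := by nlinarith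
  have hJ := mul_pos (jb_pos j) (jb_pos l)
  have hpos : 0 < α * (2 * α - 1) / 2 * freqMax k j l ^ (2 * α - 2) * (jb j * jb l) := by
    positivity
  exact abs_pos.mp (hpos.trans_le h)

lemma jb_phase_rpow_neg_one_le {α : ℝ} (hα : 1 / 2 < α) (hα' : α ≤ 1) {k j l : ℤ} (hj : j ≠ 0)
    (hl : l ≠ 0) :
    jb (phase α k j l) ^ (-1 : ℝ) ≤ 2 / (α * (2 * α - 1)) * kerBound (2 - 2 * α) k j l := by
  refine le_trans ?_ (jb_phase_inv_le hα hα' hj hl)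
  rw [Real.rpow_neg_one]
  exact inv_anti₀ (abs_pos.mpr (phase_ne_zero hα hα' hj hl)) (abs_le_jb _)

lemma wt_phase_sq_le {α : ℝ} (hα : 1 / 2 < α) (hα' : α ≤ 1) {k j l : ℤ} (hj : j ≠ 0)
    (hl : l ≠ 0) :
    wt (-(1 / 2)) (phase α k j l) ^ 2 ≤
      ENNReal.ofReal (2 / (α * (2 * α - 1)) * kerBound (2 - 2 * α) k j l) := by
  rw [wt_sq, show (2 : ℝ) * -(1 / 2) = -1 by norm_num]
  exact ENNReal.ofReal_le_ofReal (jb_phase_rpow_neg_one_le hα hα' hj hl)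

/-- The bound for ⟨Φ⟩^{-1} is raised to the power 2 - 2b ≤ 1. The missing decay of order 2b - 1 in
⟨j⟩ and ⟨l⟩ is charged to M, and the net effect is to replace α by α(2 - 2b). -/
lemma wt_phase_sq_le_of_lt {α b : ℝ} (hα : 1 / 2 < α) (hα' : α ≤ 1) (hb : 1 / 2 ≤ b) (hb1 : b ≤ 1)
    {k j l : ℤ} (hj : j ≠ 0) (hl : l ≠ 0) :
    wt (b - 1) (phase α k j l) ^ 2 ≤
      ENNReal.ofReal ((2 / (α * (2 * α - 1))) ^ (2 - 2 * b) *
        kerBound (2 - 2 * (α * (2 - 2 * b))) k j l) := by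
  rw [wt_sq]
  refine ENNReal.ofReal_le_ofReal ?_
  have h1 := jb_phase_rpow_neg_one_le hα hα' (k := k) hj hl
  have hM := freqMax_pos (k : ℝ) j l
  have hc : 0 < α * (2 * α - 1) := by nlinarith
  have hker : kerBound (2 - 2 * α) k j l ^ (2 - 2 * b) ≤
      kerBound (2 - 2 * (α * (2 - 2 * b))) k j l := by
    have pj := jb_pos j
    have pl := jb_pos l
    have jM : jb j ≤ freqMax k j l := by unfold freqMax; linarith [jb_pos k]
    have lM : jb l ≤ freqMax k j l := by unfold freqMax; linarith [jb_pos k]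
    unfold kerBound
    have i1 := Real.rpow_pos_of_pos hM (2 - 2 * α)
    have i2 := jb_rpow_pos j (-1)
    have i3 := jb_rpow_pos l (-1)
    rw [Real.mul_rpow (by positivity) i3.le, Real.mul_rpow i1.le i2.le, ← Real.rpow_mul hM.le,
      ← Real.rpow_mul pj.le, ← Real.rpow_mul pl.le]
    have e1 : jb j ^ (-1 * (2 - 2 * b)) ≤ jb j ^ (-1 : ℝ) * freqMax k j l ^ (2 * b - 1) := by
      rw [show -1 * (2 - 2 * b) = -1 + (2 * b - 1) by ring, Real.rpow_add pj]
      gcongr; linarith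
    have e2 : jb l ^ (-1 * (2 - 2 * b)) ≤ jb l ^ (-1 : ℝ) * freqMax k j l ^ (2 * b - 1) := by
      rw [show -1 * (2 - 2 * b) = -1 + (2 * b - 1) by ring, Real.rpow_add pl]
      gcongr; linarith
    have e3 : freqMax k j l ^ (2 - 2 * (α * (2 - 2 * b))) =
        freqMax k j l ^ ((2 - 2 * α) * (2 - 2 * b)) * freqMax k j l ^ (2 * b - 1) *
          freqMax k j l ^ (2 * b - 1) := by
      rw [← Real.rpow_add hM, ← Real.rpow_add hM]; congr 1; ring
    calc _ ≤ freqMax k j l ^ ((2 - 2 * α) * (2 - 2 * b)) *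
          (jb j ^ (-1 : ℝ) * freqMax k j l ^ (2 * b - 1)) *
          (jb l ^ (-1 : ℝ) * freqMax k j l ^ (2 * b - 1)) := by gcongr
      _ = _ := by rw [e3]; ring
  calc jb (phase α k j l) ^ (2 * (b - 1))
      = (jb (phase α k j l) ^ (-1 : ℝ)) ^ (2 - 2 * b) := by
        rw [← Real.rpow_mul (jb_pos _).le]; congr 1; ring
    _ ≤ (2 / (α * (2 * α - 1)) * kerBound (2 - 2 * α) k j l) ^ (2 - 2 * b) :=
        Real.rpow_le_rpow (jb_rpow_pos _ _).le h1 (by linarith)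
    _ = (2 / (α * (2 * α - 1))) ^ (2 - 2 * b) * kerBound (2 - 2 * α) k j l ^ (2 - 2 * b) :=
        Real.mul_rpow (by positivity) (kerBound_pos _ _ _ _).le
    _ ≤ _ := by gcongr

open Classical in
-- Balanced interactions plus the high-low-low ones, which occur in two forms exchanged by
-- `tri_swap`. The condition 2a + ρ ≤ 1 is forced by the latter: for ρ = 2 - 2α it limits the gain
-- from half a power of Φ to α - 1/2.
lemma tri_nonresonant_le {ρ a s η : ℝ} (hρ : 0 ≤ ρ) (ha : 0 ≤ a) (hs : 1 / 4 < s) (hη : 0 < η)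
    (hqη : 2 * s ≤ 1 + η) (h : 2 * a + ρ = 4 * s - 2 * η) (hg : 2 * a + ρ ≤ 1) (D : ℝ) :
    ∃ C : ℝ≥0∞, C < ∞ ∧ ∀ κ : ℤ → ℤ → ℤ → ℝ≥0∞,
      (∀ k j l, j ≠ 0 → l ≠ 0 → κ k j l ^ 2 ≤ ENNReal.ofReal (D * kerBound ρ k j l)) →
      ∀ X Y Z : ℤ → ℝ≥0∞,
        sob (s + a) (tri (fun k j l => if j ≠ 0 ∧ l ≠ 0 then κ k j l else 0) X Y Z) ≤
          C * (sob s X * sob s Y * sob s Z) := by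
  obtain ⟨C₁, hC₁, h₁⟩ := tri_balanced_le ha (by linarith) hη hqη h D
  obtain ⟨C₂, hC₂, h₂⟩ := tri_hll_le (s := s) hρ hg hs s D
  refine ⟨C₁ + C₂ + C₂, by simp [hC₁, hC₂], fun κ hκ X Y Z => ?_⟩
  have hle : ∀ k, tri (fun k j l => if j ≠ 0 ∧ l ≠ 0 then κ k j l else 0) X Y Z k ≤
      tri (fun k j l => if IsBalanced k j l then κ k j l else 0) X Y Z k +
      tri (fun k j l => if IsHLL k j l then κ k j l else 0) X Y Z k +
      tri (fun k j l => if IsHLL k j l then κ k l j else 0) Z Y X k := by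
    intro k
    rw [← tri_swap (fun k j l => if IsHLL k j l then κ k l j else 0), ← tri_add, ← tri_add]
    refine tri_mono (fun k j l => ?_) (fun _ => le_rfl) (fun _ => le_rfl) (fun _ => le_rfl) k
    by_cases hn : j ≠ 0 ∧ l ≠ 0
    · rw [if_pos hn]
      by_cases h1 : IsHLL k j l
      · rw [if_pos h1]; exact le_add_right le_add_self
      · by_cases h2 : IsHLL k l j
        · rw [if_pos h2]; exact le_add_self
        · have hb : IsBalanced k j l := ⟨hn.1, hn.2, h1, h2⟩
          rw [if_pos hb]
          exact le_add_right le_self_add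
    · rw [if_neg hn]; exact zero_le
  refine (sob_mono hle).trans ((sob_add_le _ _ _).trans (add_le_add (sob_add_le _ _ _) le_rfl)
    |>.trans ?_)
  have b1 := h₁ κ (fun k j l hb => hκ k j l hb.1 hb.2.1) X Y Z
  have b2 := h₂ κ (fun k j l hb => hκ k j l hb.1 hb.2.1) X Y Z
  have b3 := h₂ (fun k j l => κ k l j) (fun k j l hb => by
    rw [kerBound_swap]; exact hκ k l j hb.2.1 hb.1) Z Y X
  calc _ ≤ C₁ * (sob s X * sob s Y * sob s Z) + C₂ * (sob s X * sob s Y * sob s Z) +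
        C₂ * (sob s Z * sob s Y * sob s X) := by gcongr
    _ = _ := by ring

/-- The resonant interactions. -/
lemma tri_resonant_le {s : ℝ} (hs : 0 ≤ s) (X Y Z : ℤ → ℝ≥0∞) :
    sob s (tri (fun _ j l => if j ≠ 0 ∧ l ≠ 0 then 0 else 1) X Y Z) ≤
      2 * (sob s X * sob s Y * sob s Z) := by
  have key : ∀ (X Y Z : ℤ → ℝ≥0∞) (k : ℤ), tri (fun _ j _ => if j = 0 then 1 else 0) X Y Z k ≤
      (sob s Y * sob s Z) * X k := by
    intro X Y Z k
    rw [tri, ENNReal.tsum_prod (f := fun j l => (if j = 0 then (1 : ℝ≥0∞) else 0) *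
      (X (k + j) * Y (k + j + l) * Z (k + l)))]
    rw [tsum_eq_single 0 (fun j hj => by simp [hj])]
    simp only [if_true, one_mul, add_zero, mul_assoc]
    rw [ENNReal.tsum_mul_left, mul_comm (X k), ← mul_assoc (sob s Y)]
    gcongr
    rw [tsum_int_shift (fun l => Y l * Z l)]
    refine (tsum_mul_le_l2 Y Z).trans ?_
    gcongr <;> exact l2_le_sob hs _
  have hle : ∀ k, tri (fun _ j l => if j ≠ 0 ∧ l ≠ 0 then 0 else 1) X Y Z k ≤
      (sob s Y * sob s Z) * X k + (sob s Y * sob s X) * Z k := by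
    intro k
    refine le_trans ?_ (add_le_add (key X Y Z k) (key Z Y X k))
    rw [← tri_swap (fun _ j _ => if j = 0 then 1 else 0) X Y Z k, ← tri_add]
    refine tri_mono (fun k j l => ?_) (fun _ => le_rfl) (fun _ => le_rfl) (fun _ => le_rfl) k
    by_cases h1 : j = 0
    · simp [h1]
    · by_cases h2 : l = 0 <;> simp [h1, h2]
  refine (sob_mono hle).trans ((sob_add_le _ _ _).trans ?_)
  rw [sob_const_mul, sob_const_mul]
  exact le_of_eq (by ring)

/-- The trilinear estimate behind local well-posedness. -/
lemma tri_phase_le {α b s : ℝ} (hα : 1 / 2 < α) (hα' : α ≤ 1) (hb : 1 / 2 < b)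
    (hb' : b < 1 - 1 / (4 * α)) (hs : 1 / 4 < s) :
    ∃ C : ℝ≥0∞, C < ∞ ∧ ∀ X Y Z : ℤ → ℝ≥0∞,
        sob s (tri (fun k j l => wt (b - 1) (phase α k j l)) X Y Z) ≤
          C * (sob s X * sob s Y * sob s Z) := by
  -- The effective dispersion exponent for the kernel ⟨Φ⟩^{b-1}; the upper bound on b is equivalent
  -- to `1 / 2 < α'`.
  set α' := α * (2 - 2 * b) with hα'def
  have hb1 : b < 1 := by
    have : 0 < 1 / (4 * α) := by positivity
    linarith
  have h1 : 1 / 2 < α' := by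
    have : 1 / (4 * α) < 1 - b := by linarith
    rw [div_lt_iff₀ (by linarith)] at this
    rw [hα'def]; nlinarith
  have h2 : α' ≤ 1 := by rw [hα'def]; nlinarith
  -- No gain is asked for here, and η is determined by the exponent relation. It is positive because
  -- s > 1/4 and α' > 1/2.
  obtain ⟨C, hC, h⟩ := tri_nonresonant_le (ρ := 2 - 2 * α') (a := 0) (s := s)
    (η := 2 * s + α' - 1) (by linarith) le_rfl hs (by linarith) (by linarith) (by linarith)
    (by linarith) ((2 / (α * (2 * α - 1))) ^ (2 - 2 * b))
  refine ⟨C + 2, by simp [hC], fun X Y Z => ?_⟩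
  have hle : ∀ k, tri (fun k j l => wt (b - 1) (phase α k j l)) X Y Z k ≤
      tri (fun k j l => if j ≠ 0 ∧ l ≠ 0 then wt (b - 1) (phase α k j l) else 0) X Y Z k +
      tri (fun _ j l => if j ≠ 0 ∧ l ≠ 0 then 0 else 1) X Y Z k := by
    intro k
    rw [← tri_add]
    refine tri_mono (fun k j l => ?_) (fun _ => le_rfl) (fun _ => le_rfl) (fun _ => le_rfl) k
    split_ifs
    · simp
    · rw [zero_add]; exact wt_le_one (by linarith) _
  refine (sob_mono hle).trans ((sob_add_le _ _ _).trans ?_)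
  rw [add_mul]
  gcongr
  · have := h (fun k j l => wt (b - 1) (phase α k j l))
      (fun k j l hj hl => wt_phase_sq_le_of_lt hα hα' hb.le hb1.le hj hl) X Y Z
    simpa using this
  · exact tri_resonant_le (by linarith) X Y Z

/-! ### Exponentials and a time cutoff -/

/-- `e^{ix}`. -/
def cis (x : ℝ) : ℂ := Complex.exp (Complex.I * (x : ℂ))

lemma cis_add (x y : ℝ) : cis (x + y) = cis x * cis y := by
  rw [cis, cis, cis, ← Complex.exp_add]; push_cast; ring_nf

lemma cis_zero : cis 0 = 1 := by simp [cis]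

lemma norm_cis (x : ℝ) : ‖cis x‖ = 1 := by
  rw [cis, mul_comm, Complex.norm_exp_ofReal_mul_I]

lemma enorm_cis (x : ℝ) : ‖cis x‖ₑ = 1 := by
  rw [← ofReal_norm, norm_cis, ENNReal.ofReal_one]

lemma conj_cis (x : ℝ) : (starRingEnd ℂ) (cis x) = cis (-x) := by
  rw [cis, cis, ← Complex.exp_conj]; simp

lemma cis_mul_cis_neg (x : ℝ) : cis x * cis (-x) = 1 := by
  rw [← cis_add, add_neg_cancel, cis_zero]

lemma cis_ne_zero (x : ℝ) : cis x ≠ 0 := Complex.exp_ne_zero _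

@[fun_prop]
lemma continuous_cis : Continuous cis := by unfold cis; fun_prop

lemma hasDerivAt_cis (x : ℝ) : HasDerivAt cis (Complex.I * cis x) x := by
  have h := ((Complex.ofRealCLM.hasDerivAt (x := x)).const_mul Complex.I).cexp
  have h2 : HasDerivAt (fun y : ℝ => Complex.exp (Complex.I * (y : ℂ)))
      (Complex.I * Complex.exp (Complex.I * (x : ℂ))) x := by simpa [mul_comm] using h
  exact h2

open scoped FourierTransform SchwartzMap

/-- Poisson summation for a modulated function supported in a fundamental domain. -/
lemma hasSum_fourier_mul_cis {ψ : 𝓢(ℝ, ℂ)} (hψ : ∀ x, 1 / 2 ≤ |x| → ψ x = 0) (ν r : ℝ)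
    (hr : |r| ≤ 1) :
    HasSum (fun n : ℤ => 𝓕 ψ ((n : ℝ) - ν) * cis (n * r)) (ψ (r / (2 * Real.pi)) * cis (ν * r)) := by
  set x := r / (2 * Real.pi) with hx
  have hπ := Real.pi_gt_three
  have hrx : r = 2 * Real.pi * x := by rw [hx]; field_simp
  set f : ℝ → ℂ := fun y => cis (2 * Real.pi * ν * y) * ψ y with hf
  have hfc : Continuous f := by rw [hf]; fun_prop
  have hFf : ∀ w : ℝ, 𝓕 f w = 𝓕 ψ (w - ν) := by
    intro w
    rw [SchwartzMap.fourier_coe, Real.fourier_real_eq_integral_exp_smul,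
      Real.fourier_real_eq_integral_exp_smul]
    congr 1; ext v
    rw [hf]
    simp only [smul_eq_mul, cis, ← mul_assoc, ← Complex.exp_add]
    congr 2; push_cast; ring
  have hO : f =O[cocompact ℝ] (fun y : ℝ => |y| ^ (-2 : ℝ)) := by
    have h1 := ψ.isBigO_cocompact_rpow (-2)
    refine Asymptotics.IsBigO.trans (Asymptotics.IsBigO.of_bound 1 ?_) h1
    filter_upwards with y
    rw [hf]; simp [norm_cis]
  have hS : Summable fun n : ℤ => 𝓕 f n := by
    simp_rw [hFf]
    have h1 := (𝓕 ψ).isBigO_cocompact_rpow (-2)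
    obtain ⟨C, hC, hb⟩ := (𝓕 ψ).decay 2 0
    obtain ⟨C', hC', hb'⟩ := (𝓕 ψ).decay 0 0
    have h2 := (Real.summable_one_div_int_add_rpow (-ν) 2).mpr one_lt_two
    refine Summable.of_norm_bounded_eventually (h2.mul_left C) ?_
    -- At most one integer equals ν; away from it the quadratic decay of the transform can be
    -- divided out.
    have hfin : {n : ℤ | ¬ (0 < |(n : ℝ) + -ν|)}.Finite := by
      refine Set.Finite.subset (Set.finite_singleton ⌊ν⌋) fun n hn => ?_
      simp only [Set.mem_ofPred_eq, not_lt, abs_nonpos_iff] at hn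
      have : (n : ℝ) = ν := by linarith
      rw [Set.mem_singleton_iff, ← this, Int.floor_intCast]
    filter_upwards [hfin.compl_mem_cofinite] with n hn
    simp only [Set.mem_compl_iff, Set.mem_ofPred_eq, not_not] at hn
    have := hb (n - ν)
    rw [norm_iteratedFDeriv_zero, Real.norm_eq_abs] at this
    rw [mul_one_div, le_div_iff₀ (by positivity)]
    rw [← sub_eq_add_neg, mul_comm]
    exact_mod_cast this
  have key := Real.tsum_eq_tsum_fourier_of_rpow_decay_of_summable hfc one_lt_two hO hS x
  -- As |x| ≤ 1/2, every shift by a nonzero integer leaves the support, and the periodization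
  -- reduces to one term.
  have hleft : ∑' n : ℤ, f (x + n) = ψ x * cis (ν * r) := by
    rw [tsum_eq_single 0]
    · rw [hf]; simp only [Int.cast_zero, add_zero]; rw [mul_comm, hrx]; ring_nf
    · intro n hn
      have h1 : 1 / 2 ≤ |x + n| := by
        have h2 : (1 : ℝ) ≤ |(n : ℝ)| := by exact_mod_cast Int.one_le_abs hn
        have h3 : |x| ≤ 1 / 2 := by
          rw [hx, abs_div, abs_of_pos (by positivity : 0 < 2 * Real.pi),
            div_le_div_iff₀ (by positivity) (by norm_num)]
          linarith
        have h4 := abs_sub (x + n) x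
        rw [add_sub_cancel_left] at h4
        linarith
      rw [hf]; simp [hψ _ h1]
  have hterm : ∀ n : ℤ, 𝓕 f n * fourier n (x : UnitAddCircle) =
      𝓕 ψ ((n : ℝ) - ν) * cis (n * r) := by
    intro n
    rw [hFf, fourier_coe_apply, cis, hrx]
    congr 2; push_cast; simp; ring
  rw [← hleft, key]
  simp_rw [hterm]
  refine Summable.hasSum ?_
  refine Summable.of_norm ?_
  simp_rw [hFf] at hS
  simpa [norm_cis] using hS.norm

lemma norm_le_jb_of_schwartz (f : 𝓢(ℝ, ℂ)) (m : ℕ) :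
    ∃ C : ℝ, 0 < C ∧ ∀ x, ‖f x‖ ≤ C * jb x ^ (-(m : ℝ)) := by
  obtain ⟨C, hC, hb⟩ := f.decay m 0
  obtain ⟨C', hC', hb'⟩ := f.decay 0 0
  refine ⟨2 ^ m * (C + C'), by positivity, fun x => ?_⟩
  have h1 := hb x
  have h2 := hb' x
  rw [norm_iteratedFDeriv_zero, Real.norm_eq_abs] at h1 h2
  rw [pow_zero, one_mul] at h2
  rw [Real.rpow_neg (jb_pos x).le, Real.rpow_natCast, ← div_eq_mul_inv,
    le_div_iff₀ (pow_pos (jb_pos x) m)]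
  rcases le_total 1 |x| with h | h
  · have h3 : jb x ^ m ≤ (2 * |x|) ^ m :=
      pow_le_pow_left₀ (jb_pos x).le (jb_le_two_mul_abs h) m
    calc ‖f x‖ * jb x ^ m ≤ ‖f x‖ * (2 * |x|) ^ m := by gcongr
      _ = 2 ^ m * (|x| ^ m * ‖f x‖) := by rw [mul_pow]; ring
      _ ≤ _ := by gcongr; linarith
  · have h3 : jb x ^ m ≤ 2 ^ m :=
      pow_le_pow_left₀ (jb_pos x).le (by linarith [jb_le_one_add x]) m
    calc ‖f x‖ * jb x ^ m ≤ (C + C') * 2 ^ m :=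
        mul_le_mul (by linarith) h3 (pow_pos (jb_pos x) m).le (by positivity)
      _ = _ := by ring

/-- The Fourier transform `h` of a cutoff which is `1` on `[-1,1]`, together with the Fourier
coefficients `ρ` of a periodic function which agrees with the identity there. -/
theorem exists_timeCutoff : ∃ (h : ℝ → ℂ) (ρ : ℤ → ℂ) (C : ℝ), Continuous h ∧ 0 < C ∧
    (∀ x, ‖h x‖ ≤ C * jb x ^ (-3 : ℝ)) ∧ (∀ n : ℤ, ‖ρ n‖ ≤ C * jb n ^ (-2 : ℝ)) ∧
    (∀ ν r : ℝ, |r| ≤ 1 → HasSum (fun n : ℤ => h (n - ν) * cis (n * r)) (cis (ν * r))) ∧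
    (∀ r : ℝ, |r| ≤ 1 → HasSum (fun n : ℤ => ρ n * cis (n * r)) (r : ℂ)) ∧
    (∀ t : ℝ, |t| ≤ 1 → ∫ τ, cis (t * τ) * h τ = 1) := by
  have hπ := Real.pi_gt_three
  have hπ4 := Real.pi_le_four
  -- 1/(2π) < 1/3, so the bump is 1 at r/(2π) whenever |r| ≤ 1; and 2/5 < 1/2 keeps its support
  -- inside one period.
  let B : ContDiffBump (0 : ℝ) := ⟨1 / 3, 2 / 5, by norm_num, by norm_num⟩
  have hBs : ContDiff ℝ (⊤ : ℕ∞) (fun x => (B x : ℂ)) := Complex.ofRealCLM.contDiff.comp B.contDiff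
  have hBc : HasCompactSupport (fun x => (B x : ℂ)) :=
    B.hasCompactSupport.comp_left (g := fun y : ℝ => (y : ℂ)) Complex.ofReal_zero
  let ψ : 𝓢(ℝ, ℂ) := hBc.toSchwartzMap hBs
  have hBs' : ContDiff ℝ (⊤ : ℕ∞) (fun x : ℝ => ((2 * Real.pi * x : ℝ) : ℂ) * (B x : ℂ)) :=
    (Complex.ofRealCLM.contDiff.comp (contDiff_const.mul contDiff_id)).mul hBs
  have hBc' : HasCompactSupport (fun x : ℝ => ((2 * Real.pi * x : ℝ) : ℂ) * (B x : ℂ)) :=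
    hBc.mul_left
  let ψ' : 𝓢(ℝ, ℂ) := hBc'.toSchwartzMap hBs'
  have zero : ∀ x : ℝ, 1 / 2 ≤ |x| → (B x : ℂ) = 0 := by
    intro x hx
    have : B x = 0 := B.zero_of_le_dist (by
      rw [Real.dist_eq, sub_zero]
      exact le_trans (by norm_num : (2 / 5 : ℝ) ≤ 1 / 2) hx)
    rw [this, Complex.ofReal_zero]
  have one : ∀ r : ℝ, |r| ≤ 1 → (B (r / (2 * Real.pi)) : ℂ) = 1 := by
    intro r hr
    have : B (r / (2 * Real.pi)) = 1 := B.one_of_mem_closedBall (by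
      rw [Metric.mem_closedBall, Real.dist_eq, sub_zero, abs_div,
        abs_of_pos (by positivity : 0 < 2 * Real.pi)]
      refine (div_le_div_iff₀ (by positivity) (by norm_num : (0 : ℝ) < 3)).mpr ?_
      linarith)
    rw [this, Complex.ofReal_one]
  obtain ⟨C₁, hC₁, h₁⟩ := norm_le_jb_of_schwartz (𝓕 ψ) 3
  obtain ⟨C₂, hC₂, h₂⟩ := norm_le_jb_of_schwartz (𝓕 ψ') 2
  refine ⟨fun x => 𝓕 ψ x, fun n => 𝓕 ψ' n, C₁ + C₂, (𝓕 ψ).continuous, by positivity, ?_, ?_, ?_, ?_, ?_⟩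
  · intro x
    refine (h₁ x).trans ?_
    have := jb_rpow_pos x (-3)
    push_cast
    nlinarith
  · intro n
    refine (h₂ n).trans ?_
    have := jb_rpow_pos n (-2)
    push_cast
    nlinarith
  · intro ν r hr
    have := hasSum_fourier_mul_cis (ψ := ψ) zero ν r hr
    rwa [show ψ (r / (2 * Real.pi)) = (B (r / (2 * Real.pi)) : ℂ) from rfl, one r hr,
      one_mul] at this
  · intro r hr
    have := hasSum_fourier_mul_cis (ψ := ψ') (fun x hx => by
      change ((2 * Real.pi * x : ℝ) : ℂ) * (B x : ℂ) = 0
      rw [zero x hx, mul_zero]) 0 r hr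
    rw [show ψ' (r / (2 * Real.pi)) = ((2 * Real.pi * (r / (2 * Real.pi)) : ℝ) : ℂ) *
      (B (r / (2 * Real.pi)) : ℂ) from rfl, one r hr, zero_mul, cis_zero, mul_one, mul_one,
      mul_div_cancel₀ _ (by positivity : 2 * Real.pi ≠ 0)] at this
    simpa using this
  · intro t ht
    have hinv := ψ.continuous.fourierInv_fourier_eq ψ.integrable
      (by rw [← SchwartzMap.fourier_coe]; exact (𝓕 ψ).integrable)
    have := congrFun hinv (t / (2 * Real.pi))
    rw [Real.fourierInv_eq', show ψ (t / (2 * Real.pi)) = (B (t / (2 * Real.pi)) : ℂ) from rfl,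
      one t ht] at this
    rw [← this]
    congr 1; ext τ
    rw [← SchwartzMap.fourier_coe, smul_eq_mul, cis]
    congr 2
    simp only [RCLike.inner_apply, conj_trivial]
    push_cast
    field_simp

/-! ### Periodic functions of time with coefficients in `H^b` -/

lemma summable_norm_of_tsum_enorm_lt_top {ι : Type*} {f : ι → ℂ} (h : ∑' i, ‖f i‖ₑ < ∞) :
    Summable fun i => ‖f i‖ := tsum_enorm_ne_top_iff_summable_norm.mp h.ne

lemma hasSum_integral_of_bound {ι : Type*} [Countable ι] {F : ι → ℝ → ℂ} {B : ι → ℝ}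
    (hF : ∀ i, Continuous (F i)) (hB : ∀ i t, ‖F i t‖ ≤ B i) (hs : Summable B) (a b : ℝ) :
    HasSum (fun i => ∫ t in a..b, F i t) (∫ t in a..b, ∑' i, F i t) := by
  refine intervalIntegral.hasSum_integral_of_dominated_convergence (fun i _ => B i)
    (fun i => (hF i).aestronglyMeasurable) (fun i => ae_of_all _ fun t _ => hB i t)
    (ae_of_all _ fun _ _ => hs) ?_ (ae_of_all _ fun t _ => ?_)
  · exact intervalIntegrable_const
  · exact (Summable.of_norm_bounded hs fun i => hB i t).hasSum

lemma sob_neg (s : ℝ) (X : ℤ → ℝ≥0∞) : sob s (fun n => X (-n)) = sob s X := by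
  rw [sob, sob, ← l2_equiv (Equiv.neg ℤ) (fun n : ℤ => wt s n * X n)]
  congr 1; ext n; simp [wt_neg_right]

/-- The constant in `ℓ²` duality with bracket weights. -/
def bracketL2 (b : ℝ) : ℝ≥0∞ := bracketSum (2 * b) ^ (1 / 2 : ℝ)

lemma bracketL2_lt_top {b : ℝ} (hb : 1 / 2 < b) : bracketL2 b < ∞ :=
  ENNReal.rpow_lt_top_of_nonneg (by norm_num) (bracketSum_lt_top (by linarith)).ne

lemma l2_wt_neg_add_le {b : ℝ} (hb : 0 ≤ b) (x : ℝ) :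
    l2 (fun n : ℤ => wt (-b) (n + x)) ≤ bracketL2 b := by
  refine ENNReal.rpow_le_rpow ?_ (by norm_num)
  simp_rw [wt_sq, mul_neg]
  exact tsum_wt_add_le (by linarith) x

/-- The embedding of H^b into absolutely convergent series, by Cauchy-Schwarz against ⟨n⟩^{-b}. The
constant is finite once b > 1/2. -/
lemma tsum_le_sob {b : ℝ} (hb : 0 ≤ b) (x : ℤ → ℝ≥0∞) : ∑' n, x n ≤ bracketL2 b * sob b x := by
  calc ∑' n, x n = ∑' n : ℤ, wt (-b) n * (wt b n * x n) := by
        congr 1; ext n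
        rw [← mul_assoc, mul_comm (wt (-b) _), wt_mul_wt_neg, one_mul]
    _ ≤ l2 (fun n : ℤ => wt (-b) n) * sob b x := tsum_mul_le_l2 _ _
    _ ≤ _ := by gcongr; simpa using l2_wt_neg_add_le hb 0

lemma wt_le_add {b : ℝ} (hb : 0 ≤ b) (x y : ℝ) :
    wt b (x + y) ≤ ENNReal.ofReal (2 ^ b) * (wt b x + wt b y) := by
  rw [wt, wt, wt, ← ENNReal.ofReal_add (jb_rpow_pos _ _).le (jb_rpow_pos _ _).le,
    ← ENNReal.ofReal_mul (by positivity)]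
  exact ENNReal.ofReal_le_ofReal ((Real.rpow_le_rpow (jb_pos _).le (jb_add_le x y) hb).trans
    (add_rpow_le (jb_pos _) (jb_pos _) hb))

lemma tsum_conv_comm (x y : ℤ → ℝ≥0∞) (n : ℤ) :
    ∑' m, x m * y (n - m) = ∑' m, y m * x (n - m) := by
  rw [← (Equiv.subLeft n).tsum_eq (fun m => y m * x (n - m))]
  congr 1; ext m; simp [mul_comm]

/-- The constant in the algebra property of `H^b`. -/
def algConst (b : ℝ) : ℝ≥0∞ := ENNReal.ofReal (2 ^ b) * (2 * bracketL2 b)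

lemma algConst_lt_top {b : ℝ} (hb : 1 / 2 < b) : algConst b < ∞ :=
  ENNReal.mul_lt_top ENNReal.ofReal_lt_top (ENNReal.mul_lt_top (by simp) (bracketL2_lt_top hb))

/-- ⟨n⟩^b ≲ ⟨m⟩^b + ⟨n-m⟩^b puts the weight on one factor; the other is measured in ℓ¹, which H^b
controls, and Young's inequality applies. -/
lemma sob_conv_le {b : ℝ} (hb : 0 ≤ b) (x y : ℤ → ℝ≥0∞) :
    sob b (fun n => ∑' m, x m * y (n - m)) ≤ algConst b * (sob b x * sob b y) := by
  have hle : ∀ n : ℤ, wt b n * ∑' m, x m * y (n - m) ≤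
      ENNReal.ofReal (2 ^ b) * ((∑' m, y m * (fun m : ℤ => wt b m * x m) (n - m)) +
        ∑' m, x m * (fun m : ℤ => wt b m * y m) (n - m)) := by
    intro n
    rw [← tsum_conv_comm (fun m : ℤ => wt b m * x m) y n, ← ENNReal.tsum_add,
      ← ENNReal.tsum_mul_left, ← ENNReal.tsum_mul_left]
    refine ENNReal.tsum_le_tsum fun m => ?_
    have h1 := wt_le_add hb (m : ℝ) ((n - m : ℤ) : ℝ)
    rw [show (m : ℝ) + ((n - m : ℤ) : ℝ) = n by push_cast; ring] at h1
    calc wt b n * (x m * y (n - m)) ≤ ENNReal.ofReal (2 ^ b) *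
          (wt b (m : ℝ) + wt b ((n - m : ℤ) : ℝ)) * (x m * y (n - m)) := by gcongr
      _ = _ := by ring
  refine (l2_mono hle).trans ?_
  rw [l2_const_mul]
  calc _ ≤ ENNReal.ofReal (2 ^ b) * ((∑' m, y m) * sob b x + (∑' m, x m) * sob b y) := by
        gcongr
        refine (l2_add_le _ _).trans ?_
        gcongr
        · exact l2_conv_le _ _
        · exact l2_conv_le _ _
    _ ≤ ENNReal.ofReal (2 ^ b) * ((bracketL2 b * sob b y) * sob b x +
          (bracketL2 b * sob b x) * sob b y) := by
        gcongr <;> exact tsum_le_sob hb _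
    _ = _ := by rw [algConst]; ring

/-- The `H^b` norm of the coefficient sequence of a periodic function of time. -/
def hb (b : ℝ) (g : ℤ → ℂ) : ℝ≥0∞ := sob b fun n => ‖g n‖ₑ

/-- The trigonometric series with coefficients `g`. -/
def ser (g : ℤ → ℂ) (r : ℝ) : ℂ := ∑' n : ℤ, g n * cis (n * r)

section series
variable {b : ℝ} {f g : ℤ → ℂ}

lemma summable_norm_of_hb (hb0 : 1 / 2 < b) (hg : hb b g < ∞) : Summable fun n => ‖g n‖ :=
  summable_norm_of_tsum_enorm_lt_top ((tsum_le_sob (by linarith) _).trans_lt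
    (ENNReal.mul_lt_top (bracketL2_lt_top hb0) hg))

lemma summable_ser (hg : Summable fun n => ‖g n‖) (r : ℝ) :
    Summable fun n : ℤ => g n * cis (n * r) :=
  Summable.of_norm (by simpa [norm_cis] using hg)

lemma enorm_ser_le (r : ℝ) : ‖ser g r‖ₑ ≤ ∑' n, ‖g n‖ₑ := by
  refine enorm_tsum_le_tsum_enorm.trans (le_of_eq ?_)
  simp [enorm_mul, enorm_cis]

lemma enorm_ser_le_hb (hb0 : 0 ≤ b) (r : ℝ) : ‖ser g r‖ₑ ≤ bracketL2 b * hb b g :=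
  (enorm_ser_le r).trans (tsum_le_sob hb0 _)

lemma continuous_ser (hg : Summable fun n => ‖g n‖) : Continuous (ser g) := by
  refine continuous_tsum (fun n => by fun_prop) hg fun n r => ?_
  simp [norm_cis]

/-- Convolution of coefficient sequences. -/
def cv (f g : ℤ → ℂ) (n : ℤ) : ℂ := ∑' m, f m * g (n - m)

lemma enorm_cv_le (f g : ℤ → ℂ) (n : ℤ) : ‖cv f g n‖ₑ ≤ ∑' m, ‖f m‖ₑ * ‖g (n - m)‖ₑ := by
  refine enorm_tsum_le_tsum_enorm.trans (le_of_eq ?_)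
  simp [enorm_mul]

lemma hb_cv_le (hb0 : 0 ≤ b) : hb b (cv f g) ≤ algConst b * (hb b f * hb b g) :=
  (sob_mono (enorm_cv_le f g)).trans (sob_conv_le hb0 _ _)

/-- The shear `(n, m) ↦ (m, n - m)`. -/
def shear : ℤ × ℤ ≃ ℤ × ℤ where
  toFun p := (p.2, p.1 - p.2)
  invFun p := (p.1 + p.2, p.1)
  left_inv p := by ext <;> simp
  right_inv p := by ext <;> simp

lemma summable_cv (hf : Summable fun n => ‖f n‖) (hg : Summable fun n => ‖g n‖) :
    Summable fun n => ‖cv f g n‖ := by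
  refine summable_norm_of_tsum_enorm_lt_top ?_
  calc ∑' n, ‖cv f g n‖ₑ ≤ ∑' n, ∑' m, ‖f m‖ₑ * ‖g (n - m)‖ₑ :=
        ENNReal.tsum_le_tsum (enorm_cv_le f g)
    _ = (∑' m, ‖f m‖ₑ) * ∑' n, ‖g n‖ₑ := by
        rw [ENNReal.tsum_comm, ← ENNReal.tsum_mul_right]
        congr 1; ext m
        rw [ENNReal.tsum_mul_left]
        exact congrArg _ ((Equiv.subRight m).tsum_eq fun n => ‖g n‖ₑ)
    _ < ∞ := ENNReal.mul_lt_top (tsum_enorm_ne_top_iff_summable_norm.mpr hf).lt_top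
        (tsum_enorm_ne_top_iff_summable_norm.mpr hg).lt_top

lemma summable_cv_term (hf : Summable fun n => ‖f n‖) (hg : Summable fun n => ‖g n‖) (n : ℤ) :
    Summable fun m => f m * g (n - m) := by
  have h := summable_mul_of_summable_norm hf hg
  have h2 := (shear.summable_iff (f := fun p : ℤ × ℤ => f p.1 * g p.2)).mpr h
  exact h2.prod_factor n

lemma ser_cv (hf : Summable fun n => ‖f n‖) (hg : Summable fun n => ‖g n‖) (r : ℝ) :
    ser (cv f g) r = ser f r * ser g r := by
  have hf' : Summable fun n : ℤ => ‖f n * cis (n * r)‖ := by simpa [norm_cis] using hf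
  have hg' : Summable fun n : ℤ => ‖g n * cis (n * r)‖ := by simpa [norm_cis] using hg
  rw [ser, ser, ser, tsum_mul_tsum_of_summable_norm hf' hg']
  rw [← shear.tsum_eq]
  have h2 := (shear.summable_iff).mpr (summable_mul_of_summable_norm hf' hg')
  refine Eq.trans ?_ (Summable.tsum_prod h2).symm
  congr 1; ext n
  simp only [Function.comp]
  rw [cv, ← tsum_mul_right]
  congr 1; ext m
  simp only [shear, Equiv.coe_fn_mk, Int.cast_sub]
  rw [show (n : ℝ) * r = m * r + (n - m) * r by ring, cis_add]
  ring

/-- The coefficients of the complex conjugate. -/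
def cj (g : ℤ → ℂ) (n : ℤ) : ℂ := (starRingEnd ℂ) (g (-n))

lemma enorm_cj (n : ℤ) : ‖cj g n‖ₑ = ‖g (-n)‖ₑ := by
  rw [cj, ← ofReal_norm, RCLike.norm_conj, ofReal_norm]

lemma hb_cj : hb b (cj g) = hb b g := by
  rw [hb, hb, ← sob_neg]; congr 1; ext n; rw [enorm_cj, neg_neg]

lemma summable_cj (hg : Summable fun n => ‖g n‖) : Summable fun n => ‖cj g n‖ := by
  have := (Equiv.neg ℤ).summable_iff.mpr hg
  simpa [cj, Function.comp_def] using this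

lemma ser_cj (r : ℝ) : ser (cj g) r = (starRingEnd ℂ) (ser g r) := by
  rw [ser, ser, Complex.conj_tsum, ← (Equiv.neg ℤ).tsum_eq]
  congr 1; ext n
  simp [cj, conj_cis]

end series

/-! ### Oscillatory integrals -/

lemma integral_cis {μ : ℝ} (hμ : μ ≠ 0) (t : ℝ) :
    ∫ r in (0 : ℝ)..t, cis (μ * r) = (cis (μ * t) - 1) / (Complex.I * μ) := by
  have hμ' : Complex.I * (μ : ℂ) ≠ 0 := by simp [hμ]
  have hd : ∀ r, HasDerivAt (fun r => cis (μ * r) / (Complex.I * μ)) (cis (μ * r)) r := by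
    intro r
    have h1 : HasDerivAt (fun r : ℝ => μ * r) μ r := by
      simpa using (hasDerivAt_id r).const_mul μ
    have h2 := ((hasDerivAt_cis (μ * r)).scomp r h1).div_const (Complex.I * μ)
    refine h2.congr_deriv ?_
    have hμc : (μ : ℂ) ≠ 0 := by exact_mod_cast hμ
    rw [Complex.real_smul]
    field_simp
  rw [intervalIntegral.integral_eq_sub_of_hasDerivAt (fun r _ => hd r)
    (Continuous.intervalIntegrable (by fun_prop) _ _)]
  simp [cis_zero, sub_div]

lemma norm_integral_cis_le (μ : ℝ) {t : ℝ} (ht : |t| ≤ 1) :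
    ‖∫ r in (0 : ℝ)..t, cis (μ * r)‖ ≤ 4 * jb μ ^ (-1 : ℝ) := by
  rw [Real.rpow_neg_one, ← div_eq_mul_inv, le_div_iff₀ (jb_pos μ)]
  rcases le_total 1 |μ| with h | h
  · have hμ : μ ≠ 0 := by rintro rfl; simp at h; linarith
    rw [integral_cis hμ, norm_div, norm_mul, Complex.norm_I, one_mul, Complex.norm_real,
      Real.norm_eq_abs, div_mul_eq_mul_div, div_le_iff₀ (by linarith)]
    have h1 : ‖cis (μ * t) - 1‖ ≤ 2 := by
      refine (norm_sub_le _ _).trans ?_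
      rw [norm_cis, norm_one]; norm_num
    nlinarith [jb_le_two_mul_abs h, jb_pos μ]
  · have h1 : ‖∫ r in (0 : ℝ)..t, cis (μ * r)‖ ≤ 1 * |t - 0| :=
      intervalIntegral.norm_integral_le_of_norm_le_const fun r _ => (norm_cis _).le
    rw [sub_zero, one_mul] at h1
    nlinarith [jb_le_one_add μ, jb_pos μ, norm_nonneg (∫ r in (0 : ℝ)..t, cis (μ * r))]

/-- The constant in the oscillatory integral estimate. -/
def oscConst (b : ℝ) : ℝ≥0∞ := ENNReal.ofReal (2 ^ (1 / 2 : ℝ)) * (2 * bracketSum (2 * b)) ^ (1 / 2 : ℝ)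

lemma oscConst_lt_top {b : ℝ} (hb : 1 / 2 < b) : oscConst b < ∞ := by
  refine ENNReal.mul_lt_top ENNReal.ofReal_lt_top (ENNReal.rpow_lt_top_of_nonneg (by norm_num) ?_)
  exact (ENNReal.mul_lt_top (by simp) (bracketSum_lt_top (by linarith))).ne

/-- Half of the decay is extracted by Peetre's inequality, ⟨ν+m⟩^{-1/2} ≲ ⟨ν⟩^{-1/2}⟨m⟩^{1/2}. The
other half together with the surplus ⟨m⟩^{-(b-1/2)} forms a sequence whose ℓ² norm is bounded
uniformly in ν, the squared exponents adding up to 2b. -/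
lemma tsum_wt_mul_le {b : ℝ} (hb : 1 / 2 ≤ b) (ν : ℝ) (x : ℤ → ℝ≥0∞) :
    ∑' m : ℤ, wt (-1) (ν + m) * x m ≤ oscConst b * wt (-(1 / 2)) ν * sob b x := by
  have h1 : ∀ m : ℤ, wt (-1) (ν + m) ≤ ENNReal.ofReal (2 ^ (1 / 2 : ℝ)) * wt (-(1 / 2)) ν *
      (wt (-(1 / 2)) (m + ν) * wt (1 / 2) m) := by
    intro m
    have h2 := wt_add_le (-(1 / 2)) ν m
    rw [abs_neg, abs_of_pos (by norm_num : (0 : ℝ) < 1 / 2)] at h2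
    calc wt (-1) (ν + m) = wt (-(1 / 2)) (ν + m) * wt (-(1 / 2)) (ν + m) := by
          rw [← wt_add]; norm_num
      _ ≤ _ := by
          refine (mul_le_mul' le_rfl h2).trans (le_of_eq ?_)
          rw [add_comm ν]; ring
  calc ∑' m : ℤ, wt (-1) (ν + m) * x m
      ≤ ∑' m : ℤ, ENNReal.ofReal (2 ^ (1 / 2 : ℝ)) * wt (-(1 / 2)) ν *
        ((wt (-(1 / 2)) (m + ν) * wt (-(b - 1 / 2)) m) * (wt b m * x m)) := by
        refine ENNReal.tsum_le_tsum fun m => ?_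
        calc wt (-1) (ν + m) * x m ≤ ENNReal.ofReal (2 ^ (1 / 2 : ℝ)) * wt (-(1 / 2)) ν *
              (wt (-(1 / 2)) (m + ν) * wt (1 / 2) m) * x m := by gcongr; exact h1 m
          _ = _ := by
              rw [show wt (1 / 2) (m : ℝ) = wt (-(b - 1 / 2)) m * wt b m by
                rw [← wt_add]; congr 1; ring]
              ring
    _ = ENNReal.ofReal (2 ^ (1 / 2 : ℝ)) * wt (-(1 / 2)) ν *
        ∑' m : ℤ, (wt (-(1 / 2)) (m + ν) * wt (-(b - 1 / 2)) m) * (wt b m * x m) :=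
        ENNReal.tsum_mul_left
    _ ≤ ENNReal.ofReal (2 ^ (1 / 2 : ℝ)) * wt (-(1 / 2)) ν *
        (l2 (fun m : ℤ => wt (-(1 / 2)) (m + ν) * wt (-(b - 1 / 2)) m) * sob b x) := by
        gcongr; exact tsum_mul_le_l2 _ _
    _ ≤ ENNReal.ofReal (2 ^ (1 / 2 : ℝ)) * wt (-(1 / 2)) ν *
        ((2 * bracketSum (2 * b)) ^ (1 / 2 : ℝ) * sob b x) := by
        gcongr
        refine ENNReal.rpow_le_rpow ?_ (by norm_num)
        calc ∑' m : ℤ, (wt (-(1 / 2)) (m + ν) * wt (-(b - 1 / 2)) m) ^ 2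
            ≤ ∑' m : ℤ, (wt (-(2 * b)) (m + ν) + wt (-(2 * b)) m) := by
              refine ENNReal.tsum_le_tsum fun m => ?_
              rw [mul_pow, wt_sq, wt_sq, mul_neg, mul_neg]
              exact wt_mul_le _ _ (by norm_num) (by linarith) (by ring)
          _ ≤ bracketSum (2 * b) + bracketSum (2 * b) := by
              rw [ENNReal.tsum_add]
              gcongr
              · exact tsum_wt_add_le (by linarith) ν
              · exact tsum_wt_int_le (by linarith)
          _ = _ := (two_mul _).symm
    _ = _ := by rw [oscConst]; ring

/-- Oscillatory integrals of functions in `H^b` decay like `⟨ν⟩^{-1/2}`. -/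
lemma enorm_integral_cis_mul_ser_le {b : ℝ} (hb0 : 1 / 2 < b) {g : ℤ → ℂ} (hg : hb b g < ∞) (ν : ℝ)
    {t : ℝ} (ht : |t| ≤ 1) :
    ‖∫ r in (0 : ℝ)..t, cis (ν * r) * ser g r‖ₑ ≤ 4 * oscConst b * wt (-(1 / 2)) ν * hb b g := by
  have hs := summable_norm_of_hb hb0 hg
  have h1 : HasSum (fun n : ℤ => ∫ r in (0 : ℝ)..t, g n * cis ((ν + n) * r))
      (∫ r in (0 : ℝ)..t, ∑' n : ℤ, g n * cis ((ν + n) * r)) :=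
    hasSum_integral_of_bound (fun n => by fun_prop) (fun n r => by simp [norm_cis]) hs _ _
  have h2 : ∀ r, ∑' n : ℤ, g n * cis ((ν + n) * r) = cis (ν * r) * ser g r := by
    intro r
    rw [ser, ← tsum_mul_left]
    congr 1; ext n
    rw [add_mul, cis_add]; ring
  simp_rw [h2] at h1
  rw [← h1.tsum_eq]
  refine enorm_tsum_le_tsum_enorm.trans ?_
  calc ∑' n : ℤ, ‖∫ r in (0 : ℝ)..t, g n * cis ((ν + n) * r)‖ₑ
      ≤ ∑' n : ℤ, 4 * (wt (-1) (ν + n) * ‖g n‖ₑ) := by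
        refine ENNReal.tsum_le_tsum fun n => ?_
        rw [intervalIntegral.integral_const_mul, enorm_mul, mul_comm ‖g n‖ₑ, ← mul_assoc]
        gcongr
        rw [← ofReal_norm, wt, ← ENNReal.ofReal_ofNat, ← ENNReal.ofReal_mul (by norm_num)]
        exact ENNReal.ofReal_le_ofReal (norm_integral_cis_le _ ht)
    _ = 4 * ∑' n : ℤ, wt (-1) (ν + n) * ‖g n‖ₑ := ENNReal.tsum_mul_left
    _ ≤ 4 * (oscConst b * wt (-(1 / 2)) ν * hb b g) := by
        gcongr; exact tsum_wt_mul_le hb0.le ν _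
    _ = _ := by ring

/-! ### The integration kernel on coefficient sequences -/

/-- The Fourier transform of a fixed time cutoff. -/
def cutHat : ℝ → ℂ := exists_timeCutoff.choose

/-- Coefficients of a periodic function equal to `r` for `|r| ≤ 1`. -/
def cutId : ℤ → ℂ := exists_timeCutoff.choose_spec.choose

/-- The constant in the decay of `cutHat` and `cutId`. -/
def cutC : ℝ≥0∞ := ENNReal.ofReal exists_timeCutoff.choose_spec.choose_spec.choose

lemma cutC_lt_top : cutC < ∞ := ENNReal.ofReal_lt_top

lemma continuous_cutHat : Continuous cutHat :=
  exists_timeCutoff.choose_spec.choose_spec.choose_spec.1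

lemma enorm_cutHat_le (x : ℝ) : ‖cutHat x‖ₑ ≤ cutC * wt (-3) x := by
  obtain ⟨-, h0, h, -⟩ := exists_timeCutoff.choose_spec.choose_spec.choose_spec
  rw [← ofReal_norm, cutC, wt, ← ENNReal.ofReal_mul h0.le]
  exact ENNReal.ofReal_le_ofReal (h x)

lemma enorm_cutId_le (n : ℤ) : ‖cutId n‖ₑ ≤ cutC * wt (-2) n := by
  obtain ⟨-, h0, -, h, -⟩ := exists_timeCutoff.choose_spec.choose_spec.choose_spec
  rw [← ofReal_norm, cutC, wt, ← ENNReal.ofReal_mul h0.le]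
  exact ENNReal.ofReal_le_ofReal (h n)

lemma hasSum_cutHat (ν : ℝ) {r : ℝ} (hr : |r| ≤ 1) :
    HasSum (fun n : ℤ => cutHat (n - ν) * cis (n * r)) (cis (ν * r)) :=
  exists_timeCutoff.choose_spec.choose_spec.choose_spec.2.2.2.2.1 ν r hr

lemma hasSum_cutId {r : ℝ} (hr : |r| ≤ 1) :
    HasSum (fun n : ℤ => cutId n * cis (n * r)) (r : ℂ) :=
  exists_timeCutoff.choose_spec.choose_spec.choose_spec.2.2.2.2.2.1 r hr

lemma integral_cis_mul_cutHat {t : ℝ} (ht : |t| ≤ 1) : ∫ τ, cis (t * τ) * cutHat τ = 1 :=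
  exists_timeCutoff.choose_spec.choose_spec.choose_spec.2.2.2.2.2.2 t ht

lemma tsum_cutHat_le (ν : ℝ) : ∑' n : ℤ, ‖cutHat (n - ν)‖ₑ ≤ cutC * bracketSum 3 := by
  calc ∑' n : ℤ, ‖cutHat (n - ν)‖ₑ ≤ ∑' n : ℤ, cutC * wt (-3) (n + -ν) :=
        ENNReal.tsum_le_tsum fun n => enorm_cutHat_le _
    _ ≤ _ := by
        rw [ENNReal.tsum_mul_left]; gcongr; exact tsum_wt_add_le (by norm_num) _

lemma summable_cutHat (ν : ℝ) : Summable fun n : ℤ => ‖cutHat (n - ν)‖ :=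
  summable_norm_of_tsum_enorm_lt_top ((tsum_cutHat_le ν).trans_lt
    (ENNReal.mul_lt_top cutC_lt_top (bracketSum_lt_top (by norm_num))))

/-- The coefficients of the oscillating part of `∫_0^r e^{iνr'} dr'`. -/
def oscCoeff (ν : ℝ) (n : ℤ) : ℂ := cutHat (n - ν) / (Complex.I * n)

/-- The coefficients `K(n, ν)` of a periodic extension of `r ↦ ∫_0^r e^{iνr'} dr'`. -/
def intKer (n : ℤ) (ν : ℝ) : ℂ :=
  oscCoeff ν n - (if n = 0 then ∑' m, oscCoeff ν m else 0) + cutHat (0 - ν) * cutId n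

/-- The majorant of the integration kernel. -/
def intMaj (n : ℤ) (ν : ℝ) : ℝ≥0∞ := wt (-1) ν * (wt (-2) n + wt (-2) (n - ν))

lemma enorm_oscCoeff_le (ν : ℝ) (n : ℤ) :
    ‖oscCoeff ν n‖ₑ ≤ 4 * cutC * (wt (-1) ν * wt (-2) (n - ν)) := by
  -- Division by zero makes `oscCoeff ν 0` vanish; the zero mode, which integrates to a multiple of
  -- r, is carried by `cutId` instead.
  rcases eq_or_ne n 0 with rfl | hn
  · simp [oscCoeff]
  have h1 : ‖(Complex.I * (n : ℂ))⁻¹‖ₑ ≤ 2 * wt (-1) n := by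
    rw [← ofReal_norm, wt, ← ENNReal.ofReal_ofNat, ← ENNReal.ofReal_mul (by norm_num)]
    refine ENNReal.ofReal_le_ofReal ?_
    rw [norm_inv, norm_mul, Complex.norm_I, one_mul, Complex.norm_intCast, Real.rpow_neg_one,
      ← div_eq_mul_inv]
    have h2 : (1 : ℝ) ≤ |(n : ℝ)| := by exact_mod_cast Int.one_le_abs hn
    rw [inv_eq_one_div, div_le_div_iff₀ (by linarith) (jb_pos _)]
    linarith [jb_le_two_mul_abs h2]
  -- One power of the decay of the cutoff in n - ν converts decay in n into decay in ν.
  have h3 : wt (-1) (n : ℝ) ≤ 2 * wt (-1) ν * wt 1 (n - ν) := by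
    have := wt_add_le (-1) ν (n - ν)
    simpa using this
  calc ‖oscCoeff ν n‖ₑ = ‖cutHat (n - ν)‖ₑ * ‖(Complex.I * (n : ℂ))⁻¹‖ₑ := by
        rw [oscCoeff, div_eq_mul_inv, enorm_mul]
    _ ≤ (cutC * wt (-3) (n - ν)) * (2 * (2 * wt (-1) ν * wt 1 (n - ν))) := by
        gcongr
        · exact enorm_cutHat_le _
        · exact h1.trans (by gcongr)
    _ = _ := by
        rw [show wt (-2) ((n : ℝ) - ν) = wt (-3) (n - ν) * wt 1 (n - ν) by
          rw [← wt_add]; norm_num]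
        ring

lemma tsum_oscCoeff_le (ν : ℝ) :
    ∑' n, ‖oscCoeff ν n‖ₑ ≤ 4 * cutC * (wt (-1) ν * bracketSum 2) := by
  refine (ENNReal.tsum_le_tsum (enorm_oscCoeff_le ν)).trans ?_
  rw [ENNReal.tsum_mul_left, ENNReal.tsum_mul_left]
  gcongr
  simpa [sub_eq_add_neg] using tsum_wt_add_le (p := 2) (by norm_num) (-ν)

lemma summable_oscCoeff (ν : ℝ) : Summable fun n => ‖oscCoeff ν n‖ :=
  summable_norm_of_tsum_enorm_lt_top ((tsum_oscCoeff_le ν).trans_lt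
    (ENNReal.mul_lt_top (ENNReal.mul_lt_top (by simp) cutC_lt_top)
      (ENNReal.mul_lt_top (wt_ne_top _ _).lt_top (bracketSum_lt_top (by norm_num)))))

/-- The constant in the bound for the integration kernel. -/
def intC : ℝ≥0∞ := 4 * cutC + 4 * cutC * bracketSum 2 + cutC * cutC

lemma intC_lt_top : intC < ∞ := by
  have := cutC_lt_top
  have h2 := bracketSum_lt_top (p := 2) (by norm_num)
  have h4 : 4 * cutC < ∞ := ENNReal.mul_lt_top (by simp) this
  exact ENNReal.add_lt_top.mpr ⟨ENNReal.add_lt_top.mpr ⟨h4, ENNReal.mul_lt_top h4 h2⟩,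
    ENNReal.mul_lt_top this this⟩

lemma enorm_intKer_le (n : ℤ) (ν : ℝ) : ‖intKer n ν‖ₑ ≤ intC * intMaj n ν := by
  have h1 : ‖if n = 0 then ∑' m, oscCoeff ν m else 0‖ₑ ≤
      4 * cutC * bracketSum 2 * (wt (-1) ν * wt (-2) n) := by
    split_ifs with hn
    · subst hn
      refine enorm_tsum_le_tsum_enorm.trans ((tsum_oscCoeff_le ν).trans (le_of_eq ?_))
      simp [wt, jb_zero]; ring
    · simp
  have h2 : ‖cutHat (0 - ν) * cutId n‖ₑ ≤ cutC * cutC * (wt (-1) ν * wt (-2) n) := by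
    rw [enorm_mul]
    calc _ ≤ (cutC * wt (-1) ν) * (cutC * wt (-2) n) := by
          gcongr
          · refine (enorm_cutHat_le _).trans ?_
            rw [zero_sub, wt_neg_right]
            gcongr; exact wt_mono (by norm_num) _
          · exact enorm_cutId_le n
      _ = _ := by ring
  calc ‖intKer n ν‖ₑ ≤ ‖oscCoeff ν n‖ₑ + ‖if n = 0 then ∑' m, oscCoeff ν m else 0‖ₑ +
        ‖cutHat (0 - ν) * cutId n‖ₑ := by
        refine (enorm_add_le _ _).trans ?_
        gcongr
        exact enorm_sub_le
    _ ≤ 4 * cutC * (wt (-1) ν * wt (-2) (n - ν)) +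
        4 * cutC * bracketSum 2 * (wt (-1) ν * wt (-2) n) +
        cutC * cutC * (wt (-1) ν * wt (-2) n) :=
        add_le_add (add_le_add (enorm_oscCoeff_le ν n) h1) h2
    _ ≤ 4 * cutC * intMaj n ν + 4 * cutC * bracketSum 2 * intMaj n ν +
        cutC * cutC * intMaj n ν := by
        have a1 : wt (-1) ν * wt (-2) (n - ν) ≤ intMaj n ν := by
          rw [intMaj]; gcongr; exact le_add_self
        have a2 : wt (-1) ν * wt (-2) n ≤ intMaj n ν := by
          rw [intMaj]; gcongr; exact le_self_add
        gcongr
    _ = _ := by rw [intC]; ring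

/-- The periodic expansion of e^{iνr'} is integrated termwise. A mode n ≠ 0 gives (e^{inr} -
1)/(in), the constants are collected in the zero coefficient, and the mode n = 0 gives a multiple of
r, replaced by its periodic substitute on |r| ≤ 1. -/
lemma hasSum_intKer (ν : ℝ) {r : ℝ} (hr : |r| ≤ 1) :
    HasSum (fun n : ℤ => intKer n ν * cis (n * r)) (∫ r' in (0 : ℝ)..r, cis (ν * r')) := by
  have hle : ∀ r' ∈ Set.uIcc 0 r, |r'| ≤ 1 := by
    intro r' hr'
    have := Set.abs_sub_left_of_mem_uIcc hr'
    simp only [sub_zero] at this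
    exact this.trans hr
  have h1 : HasSum (fun n : ℤ => ∫ r' in (0 : ℝ)..r, cutHat (n - ν) * cis (n * r'))
      (∫ r' in (0 : ℝ)..r, ∑' n : ℤ, cutHat (n - ν) * cis (n * r')) :=
    hasSum_integral_of_bound (fun n => by fun_prop) (fun n r => by simp [norm_cis])
      (summable_cutHat ν) _ _
  rw [intervalIntegral.integral_congr (fun r' hr' => (hasSum_cutHat ν (hle r' hr')).tsum_eq)] at h1
  have h2 : (fun n : ℤ => ∫ r' in (0 : ℝ)..r, cutHat (n - ν) * cis (n * r')) =
      fun n : ℤ => (oscCoeff ν n * cis (n * r) - oscCoeff ν n) +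
        (if n = 0 then cutHat (0 - ν) * r else 0) := by
    ext n
    rw [intervalIntegral.integral_const_mul]
    rcases eq_or_ne n 0 with rfl | hn
    · simp [oscCoeff, cis_zero]
    · rw [integral_cis (by exact_mod_cast hn), if_neg hn, add_zero, oscCoeff]
      push_cast
      ring
  rw [h2] at h1
  have hs := (summable_oscCoeff ν).of_norm
  have h3 : HasSum (fun n : ℤ => (oscCoeff ν n * cis (n * r) - oscCoeff ν n))
      ((∑' n : ℤ, oscCoeff ν n * cis (n * r)) - ∑' n, oscCoeff ν n) :=
    (summable_ser (summable_oscCoeff ν) r).hasSum.sub hs.hasSum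
  have h4 : HasSum (fun n : ℤ => (if n = 0 then cutHat (0 - ν) * r else 0))
      (cutHat (0 - ν) * r) := hasSum_ite_eq (0 : ℤ) _
  rw [h1.unique (h3.add h4)]
  have h5 : HasSum (fun n : ℤ => if n = 0 then ∑' m, oscCoeff ν m else 0)
      (∑' m, oscCoeff ν m) := hasSum_ite_eq (0 : ℤ) _
  have h6 := ((summable_ser (summable_oscCoeff ν) r).hasSum.sub h5).add
    ((hasSum_cutId hr).mul_left (cutHat (0 - ν)))
  refine (congrArg (fun f => HasSum f _) (funext fun n => ?_)).mpr h6
  rw [intKer]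
  rcases eq_or_ne n 0 with rfl | hn
  · simp [cis_zero]
  · rw [if_neg hn]; ring

/-- The constant in the bound for the integration operator. -/
def duhC (b : ℝ) : ℝ≥0∞ := bracketL2 (2 - b) * oscConst b +
  ENNReal.ofReal (2 ^ b) * ENNReal.ofReal (2 ^ (1 - b)) * bracketSum (2 - b)

lemma duhC_lt_top {b : ℝ} (hb : 1 / 2 < b) (hb1 : b < 1) : duhC b < ∞ :=
  ENNReal.add_lt_top.mpr ⟨ENNReal.mul_lt_top (bracketL2_lt_top (by linarith)) (oscConst_lt_top hb),
    ENNReal.mul_lt_top (ENNReal.mul_lt_top ENNReal.ofReal_lt_top ENNReal.ofReal_lt_top)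
      (bracketSum_lt_top (by linarith))⟩

/-- Integration gains one power of the frequency ν + m, and the H^b weight takes b of it back. The
part of `intMaj` concentrated at n = 0 gives the better factor ⟨ν⟩^{-1/2}. On the part near n = ν +
m there remains ⟨ν+m⟩^{b-1} ≲ ⟨ν⟩^{b-1}⟨m⟩^{1-b}, and the weight ⟨m⟩^b absorbs the last factor
because 1 - b ≤ b. -/
lemma sob_intMaj_le {b : ℝ} (hb : 1 / 2 < b) (hb1 : b < 1) (ν : ℝ) (x : ℤ → ℝ≥0∞) :
    sob b (fun n => ∑' m : ℤ, intMaj n (ν + m) * x m) ≤ duhC b * wt (b - 1) ν * sob b x := by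
  have h0 : ∀ n : ℤ, ∑' m : ℤ, intMaj n (ν + m) * x m =
      wt (-2) n * (∑' m : ℤ, wt (-1) (ν + m) * x m) +
        ∑' m : ℤ, wt (-2) (n - (ν + m)) * (wt (-1) (ν + m) * x m) := by
    intro n
    rw [← ENNReal.tsum_mul_left, ← ENNReal.tsum_add]
    congr 1; ext m; rw [intMaj]; ring
  have h1 : sob b (fun n : ℤ => wt (-2) n * (∑' m : ℤ, wt (-1) (ν + m) * x m)) ≤
      bracketL2 (2 - b) * oscConst b * (wt (b - 1) ν * sob b x) := by
    calc _ = (∑' m : ℤ, wt (-1) (ν + m) * x m) * l2 (fun n : ℤ => wt (-(2 - b)) n) := by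
          rw [← l2_const_mul, sob]
          congr 1; ext n
          rw [show -(2 - b) = b + -2 by ring, wt_add]; ring
      _ ≤ (oscConst b * wt (b - 1) ν * sob b x) * bracketL2 (2 - b) := by
          gcongr
          · refine (tsum_wt_mul_le hb.le ν x).trans ?_
            gcongr; exact wt_mono (by linarith) _
          · simpa using l2_wt_neg_add_le (b := 2 - b) (by linarith) 0
      _ = _ := by ring
  have h2 : sob b (fun n : ℤ => ∑' m : ℤ, wt (-2) (n - (ν + m)) * (wt (-1) (ν + m) * x m)) ≤
      ENNReal.ofReal (2 ^ b) * ENNReal.ofReal (2 ^ (1 - b)) * bracketSum (2 - b) *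
        (wt (b - 1) ν * sob b x) := by
    have h3 : ∀ n : ℤ, wt b n * ∑' m : ℤ, wt (-2) (n - (ν + m)) * (wt (-1) (ν + m) * x m) ≤
        (ENNReal.ofReal (2 ^ b) * ENNReal.ofReal (2 ^ (1 - b)) * wt (b - 1) ν) *
          ∑' m : ℤ, (fun m : ℤ => wt (-(2 - b)) (m - ν)) m *
            (fun m : ℤ => wt b m * x m) (n - m) := by
      intro n
      rw [tsum_conv_comm (fun m : ℤ => wt (-(2 - b)) (m - ν)) (fun m : ℤ => wt b m * x m),
        ← ENNReal.tsum_mul_left, ← ENNReal.tsum_mul_left]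
      refine ENNReal.tsum_le_tsum fun m => ?_
      have p1 := wt_add_le b (n - (ν + m)) (ν + m)
      rw [abs_of_pos (by linarith), sub_add_cancel] at p1
      have p2 := wt_add_le (b - 1) ν m
      rw [abs_of_neg (by linarith), neg_sub] at p2
      calc wt b n * (wt (-2) (n - (ν + m)) * (wt (-1) (ν + m) * x m))
          ≤ (ENNReal.ofReal (2 ^ b) * wt b (n - (ν + m)) * wt b (ν + m)) *
            (wt (-2) (n - (ν + m)) * (wt (-1) (ν + m) * x m)) := by gcongr
        _ = ENNReal.ofReal (2 ^ b) * wt (-(2 - b)) (n - (ν + m)) * (wt (b - 1) (ν + m) * x m) := by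
            rw [show -(2 - b) = b + -2 by ring, sub_eq_add_neg b 1, wt_add, wt_add]; ring
        _ ≤ ENNReal.ofReal (2 ^ b) * wt (-(2 - b)) (n - (ν + m)) *
            ((ENNReal.ofReal (2 ^ (1 - b)) * wt (b - 1) ν * wt b m) * x m) := by
            gcongr
            refine p2.trans ?_
            gcongr
            exact wt_mono (by linarith) _
        _ = _ := by
            push_cast
            rw [show (n : ℝ) - m - ν = n - (ν + m) by ring]
            ring
    refine (l2_mono h3).trans ?_
    rw [l2_const_mul]
    calc _ ≤ (ENNReal.ofReal (2 ^ b) * ENNReal.ofReal (2 ^ (1 - b)) * wt (b - 1) ν) *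
          (bracketSum (2 - b) * sob b x) := by
          gcongr
          refine (l2_conv_le (fun m : ℤ => wt (-(2 - b)) (m - ν))
            (fun m : ℤ => wt b m * x m)).trans ?_
          rw [← sob]
          gcongr
          simpa [sub_eq_add_neg] using tsum_wt_add_le (p := 2 - b) (by linarith) (-ν)
      _ = _ := by ring
  simp_rw [h0]
  refine (sob_add_le _ _ _).trans ((add_le_add h1 h2).trans (le_of_eq ?_))
  rw [duhC]; ring

/-! ### Passage between the line and coefficient sequences -/

/-- The integral of `⟨σ⟩^{-p}`. -/
def lineSum (p : ℝ) : ℝ≥0∞ := ∫⁻ σ : ℝ, wt (-p) σ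

lemma lineSum_lt_top {p : ℝ} (hp : 1 < p) : lineSum p < ∞ := by
  have h := integrable_rpow_neg_one_add_norm_sq (E := ℝ) (μ := volume) (r := p) (by simpa using hp)
  have h2 := h.lintegral_lt_top
  refine lt_of_le_of_lt (le_of_eq ?_) h2
  refine lintegral_congr fun σ => ?_
  rw [wt, jb, Real.sqrt_eq_rpow, ← Real.rpow_mul (by positivity)]
  congr 2
  · simp
  · ring

lemma lintegral_comp_mul {T : ℝ} (hT : 0 < T) {f : ℝ → ℝ≥0∞} (hf : Measurable f) :
    ∫⁻ σ, f (T * σ) = ENNReal.ofReal T⁻¹ * ∫⁻ σ, f σ := by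
  rw [← lintegral_map hf (measurable_const_mul T), Real.map_volume_mul_left hT.ne',
    lintegral_smul_measure, abs_of_pos (inv_pos.mpr hT), smul_eq_mul]

lemma lintegral_wt_comp {T : ℝ} (hT : 0 < T) (p x : ℝ) :
    ∫⁻ σ, wt (-p) (T * σ - x) = ENNReal.ofReal T⁻¹ * lineSum p := by
  rw [lintegral_comp_mul hT (f := fun σ => wt (-p) (σ - x))
    ((measurable_wt _).comp (measurable_id.sub_const x)),
    lintegral_sub_right_eq_self (fun σ => wt (-p) σ), lineSum]

lemma lintegral_mul_sq_le {f g : ℝ → ℝ≥0∞} (hf : AEMeasurable f) (hg : AEMeasurable g) :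
    (∫⁻ σ, f σ * g σ) ^ 2 ≤ (∫⁻ σ, f σ ^ 2) * ∫⁻ σ, g σ ^ 2 := by
  have h := ENNReal.lintegral_mul_le_Lp_mul_Lq volume Real.HolderConjugate.two_two hf hg
  simp only [Pi.mul_apply, ENNReal.rpow_ofNat] at h
  calc (∫⁻ σ, f σ * g σ) ^ 2 ≤ ((∫⁻ σ, f σ ^ 2) ^ (1 / 2 : ℝ) * (∫⁻ σ, g σ ^ 2) ^ (1 / 2 : ℝ)) ^ 2 := by
        gcongr
    _ = _ := by rw [mul_pow, rpow_half_sq, rpow_half_sq]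

/-- The `H^b` norm of a function on the line in terms of its Fourier transform. -/
def lhb (b : ℝ) (C : ℝ → ℂ) : ℝ≥0∞ := (∫⁻ σ : ℝ, (wt b σ * ‖C σ‖ₑ) ^ 2) ^ (1 / 2 : ℝ)

lemma lhb_sq (b : ℝ) (C : ℝ → ℂ) : lhb b C ^ 2 = ∫⁻ σ : ℝ, (wt b σ * ‖C σ‖ₑ) ^ 2 := rpow_half_sq _

lemma integrable_of_lhb {b : ℝ} (hb : 1 / 2 < b) {C : ℝ → ℂ} (hC : AEStronglyMeasurable C)
    (h : lhb b C < ∞) : Integrable C := by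
  refine ⟨hC, ?_⟩
  have h1 := lintegral_mul_sq_le (f := wt (-b)) (g := fun σ => wt b σ * ‖C σ‖ₑ)
    (measurable_wt _).aemeasurable ((measurable_wt _).aemeasurable.mul hC.enorm)
  rw [← lhb_sq] at h1
  simp_rw [wt_sq, ← mul_assoc, mul_comm (wt (-b) _), wt_mul_wt_neg, one_mul, mul_neg] at h1
  by_contra hcon
  rw [HasFiniteIntegral, not_lt, top_le_iff] at hcon
  rw [hcon] at h1
  refine absurd h1 (not_le.mpr ?_)
  rw [ENNReal.top_pow two_ne_zero]
  exact ENNReal.mul_lt_top (lineSum_lt_top (p := 2 * b) (by linarith)) (ENNReal.pow_lt_top h)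

/-- Coefficients of a periodic function equal to `r ↦ ∫ e^{iTrσ} C(σ) dσ` for `|r| ≤ 1`. -/
def discr (T : ℝ) (C : ℝ → ℂ) (n : ℤ) : ℂ := ∫ σ : ℝ, C σ * cutHat (n - T * σ)

/-- For |r| ≤ 1 each exponential e^{irTσ} has the absolutely convergent expansion of
`hasSum_cutHat`, which may be integrated against C term by term. -/
lemma ser_discr {T : ℝ} {C : ℝ → ℂ} (hC : Integrable C) {r : ℝ} (hr : |r| ≤ 1) :
    ser (discr T C) r = ∫ σ : ℝ, cis (r * T * σ) * C σ := by
  have hm : ∀ n : ℤ, AEStronglyMeasurable (fun σ => C σ * cutHat (n - T * σ) * cis (n * r)) := by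
    intro n
    refine (hC.1.mul (Continuous.aestronglyMeasurable ?_)).mul_const _
    exact continuous_cutHat.comp (by fun_prop)
  have hfin : ∑' n : ℤ, ∫⁻ σ, ‖C σ * cutHat (n - T * σ) * cis (n * r)‖ₑ ≠ ∞ := by
    rw [← lintegral_tsum fun n => (hm n).enorm]
    refine ne_of_lt (lt_of_le_of_lt (b := (∫⁻ σ, ‖C σ‖ₑ) * (cutC * bracketSum 3)) ?_ ?_)
    · rw [← lintegral_mul_const'' _ hC.1.enorm]
      refine lintegral_mono fun σ => ?_
      simp only [enorm_mul, enorm_cis, mul_one, ENNReal.tsum_mul_left]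
      gcongr
      exact tsum_cutHat_le _
    · exact ENNReal.mul_lt_top hC.2 (ENNReal.mul_lt_top cutC_lt_top (bracketSum_lt_top (by norm_num)))
  have h := integral_tsum hm hfin
  rw [ser]
  simp_rw [discr, ← integral_mul_const]
  rw [← h]
  congr 1; ext σ
  simp_rw [mul_assoc, tsum_mul_left]
  rw [(hasSum_cutHat (T * σ) hr).tsum_eq, mul_comm]
  congr 2; ring

/-- The point is that M does not depend on T: restricting an H^b function to a short interval and
stretching it to unit length costs nothing when b > 1/2. Each coefficient is estimated by
Cauchy-Schwarz in σ, and the decay in n - Tσ makes the squares summable in n. -/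
lemma exists_hb_discr_le {b : ℝ} (hb0 : 1 / 2 < b) (hb1 : b < 1) :
    ∃ M : ℝ≥0∞, M < ∞ ∧ ∀ (T : ℝ) (C : ℝ → ℂ), 0 < T → T ≤ 1 → AEStronglyMeasurable C →
      hb b (discr T C) ≤ M * lhb b C := by
  set Q : ℝ≥0∞ := ENNReal.ofReal (2 ^ (2 * b)) * (lineSum (2 * b) + lineSum (3 - b)) with hQ
  have hQt : Q < ∞ := ENNReal.mul_lt_top ENNReal.ofReal_lt_top (ENNReal.add_lt_top.mpr
    ⟨lineSum_lt_top (by linarith), lineSum_lt_top (by linarith)⟩)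
  set M2 : ℝ≥0∞ := (cutC * ENNReal.ofReal (2 ^ b)) ^ 2 * Q * bracketSum (3 - b) with hM2
  have hM2t : M2 < ∞ := ENNReal.mul_lt_top (ENNReal.mul_lt_top (ENNReal.pow_lt_top
    (ENNReal.mul_lt_top cutC_lt_top ENNReal.ofReal_lt_top)) hQt) (bracketSum_lt_top (by linarith))
  refine ⟨M2 ^ (1 / 2 : ℝ), ENNReal.rpow_lt_top_of_nonneg (by norm_num) hM2t.ne,
    fun T C hT hT1 hC => le_of_sq_le_sq ?_⟩
  rw [mul_pow, rpow_half_sq, hb, sob, l2_sq]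
  have hmeas : ∀ γ (n : ℤ), Measurable fun σ : ℝ => wt γ (n - T * σ) := fun γ n =>
    (measurable_wt γ).comp (by fun_prop)
  have hmeas' : ∀ γ, Measurable fun σ : ℝ => wt γ (T * σ) := fun γ =>
    (measurable_wt γ).comp (by fun_prop)
  have key : ∀ n : ℤ, (wt b n * ‖discr T C n‖ₑ) ^ 2 ≤ (cutC * ENNReal.ofReal (2 ^ b)) ^ 2 * Q *
      ∫⁻ σ, wt (-(3 - b)) (n - T * σ) * (wt b σ * ‖C σ‖ₑ) ^ 2 := by
    intro n
    have h1 : wt b n * ‖discr T C n‖ₑ ≤ cutC * ENNReal.ofReal (2 ^ b) *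
        ∫⁻ σ, (wt (-(3 - b) / 2) (n - T * σ) * (wt b (T * σ) * wt (-b) σ)) *
          (wt (-(3 - b) / 2) (n - T * σ) * (wt b σ * ‖C σ‖ₑ)) := by
      calc wt b n * ‖discr T C n‖ₑ ≤ wt b n * ∫⁻ σ, ‖C σ * cutHat (n - T * σ)‖ₑ := by
            gcongr; exact enorm_integral_le_lintegral_enorm _
        _ = ∫⁻ σ, wt b n * ‖C σ * cutHat (n - T * σ)‖ₑ := by
            rw [lintegral_const_mul' _ _ (wt_ne_top _ _)]
        _ ≤ _ := by
            rw [← lintegral_const_mul' _ _ (ENNReal.mul_lt_top cutC_lt_top ENNReal.ofReal_lt_top).ne]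
            refine lintegral_mono fun σ => ?_
            have p1 := wt_add_le b (n - T * σ) (T * σ)
            rw [abs_of_pos (by linarith), sub_add_cancel] at p1
            calc wt b n * ‖C σ * cutHat (n - T * σ)‖ₑ
                ≤ (ENNReal.ofReal (2 ^ b) * wt b (n - T * σ) * wt b (T * σ)) *
                  (‖C σ‖ₑ * (cutC * wt (-3) (n - T * σ))) := by
                  rw [enorm_mul]
                  gcongr
                  exact enorm_cutHat_le _
              _ = cutC * ENNReal.ofReal (2 ^ b) * (wt (b + -3) (n - T * σ) * wt b (T * σ) *
                  (wt b σ * wt (-b) σ) * ‖C σ‖ₑ) := by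
                  rw [wt_mul_wt_neg, wt_add]; ring
              _ = _ := by
                  rw [show b + -3 = -(3 - b) / 2 + -(3 - b) / 2 by ring, wt_add]; ring
    have h2 : ∫⁻ σ, (wt (-(3 - b) / 2) (n - T * σ) * (wt b (T * σ) * wt (-b) σ)) ^ 2 ≤ Q := by
      calc _ ≤ ∫⁻ σ, ENNReal.ofReal (2 ^ (2 * b)) * (wt (-(2 * b)) σ +
              ENNReal.ofReal T * wt (-(3 - b)) (T * σ - n)) := by
            refine lintegral_mono fun σ => ?_
            rw [mul_pow, mul_pow, wt_sq, wt_sq, wt_sq]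
            -- The uniformity in T is decided here. The constant term is integrable against
            -- ⟨σ⟩^{-2b}; the growing term cancels that weight, but its factor T, from T^{2b} ≤ T,
            -- compensates the Jacobian 1/T of the remaining integral in Tσ.
            have q1 : wt (2 * b) (T * σ) ≤ ENNReal.ofReal (2 ^ (2 * b)) *
                (1 + ENNReal.ofReal T * wt (2 * b) σ) := by
              rw [wt, wt, ← ENNReal.ofReal_mul hT.le, ← ENNReal.ofReal_one,
                ← ENNReal.ofReal_add zero_le_one (mul_nonneg hT.le (jb_rpow_pos _ _).le),
                ← ENNReal.ofReal_mul (by positivity)]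
              refine ENNReal.ofReal_le_ofReal ?_
              have e1 : jb (T * σ) ≤ 1 + T * jb σ := by
                refine (jb_le_one_add _).trans ?_
                rw [abs_mul, abs_of_pos hT]
                nlinarith [abs_le_jb σ]
              calc jb (T * σ) ^ (2 * b) ≤ (1 + T * jb σ) ^ (2 * b) :=
                    Real.rpow_le_rpow (jb_pos _).le e1 (by linarith)
                _ ≤ 2 ^ (2 * b) * (1 ^ (2 * b) + (T * jb σ) ^ (2 * b)) :=
                    add_rpow_le one_pos (mul_pos hT (jb_pos _)) (by linarith)
                _ ≤ _ := by
                    rw [Real.one_rpow, Real.mul_rpow hT.le (jb_pos _).le]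
                    have e2 : T ^ (2 * b) ≤ T := by
                      simpa using Real.rpow_le_rpow_of_exponent_ge hT hT1 (by linarith : 1 ≤ 2 * b)
                    have := jb_rpow_pos σ (2 * b)
                    gcongr
            have q2 : wt (2 * (-(3 - b) / 2)) (n - T * σ) = wt (-(3 - b)) (T * σ - n) := by
              rw [← wt_neg_right]; congr 1 <;> ring
            rw [q2]
            calc wt (-(3 - b)) (T * σ - n) * (wt (2 * b) (T * σ) * wt (2 * -b) σ)
                ≤ wt (-(3 - b)) (T * σ - n) * ((ENNReal.ofReal (2 ^ (2 * b)) *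
                (1 + ENNReal.ofReal T * wt (2 * b) σ)) * wt (2 * -b) σ) := by gcongr
              _ = ENNReal.ofReal (2 ^ (2 * b)) * (wt (-(3 - b)) (T * σ - n) * wt (-(2 * b)) σ +
                  ENNReal.ofReal T * wt (-(3 - b)) (T * σ - n) *
                    (wt (2 * b) σ * wt (-(2 * b)) σ)) := by
                  rw [mul_neg]; ring
              _ ≤ _ := by
                  rw [wt_mul_wt_neg, mul_one]
                  gcongr
                  exact mul_le_of_le_one_left' (wt_le_one (by linarith) _)
        _ = ENNReal.ofReal (2 ^ (2 * b)) * (lineSum (2 * b) +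
              ENNReal.ofReal T * (ENNReal.ofReal T⁻¹ * lineSum (3 - b))) := by
            rw [lintegral_const_mul' _ _ ENNReal.ofReal_ne_top,
              lintegral_add_left (measurable_wt _), lintegral_const_mul' _ _ ENNReal.ofReal_ne_top,
              lintegral_wt_comp hT]
            rfl
        _ = Q := by
            rw [← mul_assoc (ENNReal.ofReal T), ← ENNReal.ofReal_mul hT.le,
              mul_inv_cancel₀ hT.ne', ENNReal.ofReal_one, one_mul]
    calc (wt b n * ‖discr T C n‖ₑ) ^ 2 ≤ (cutC * ENNReal.ofReal (2 ^ b) *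
        ∫⁻ σ, (wt (-(3 - b) / 2) (n - T * σ) * (wt b (T * σ) * wt (-b) σ)) *
          (wt (-(3 - b) / 2) (n - T * σ) * (wt b σ * ‖C σ‖ₑ))) ^ 2 := by gcongr
      _ ≤ (cutC * ENNReal.ofReal (2 ^ b)) ^ 2 * (Q *
          ∫⁻ σ, (wt (-(3 - b) / 2) (n - T * σ) * (wt b σ * ‖C σ‖ₑ)) ^ 2) := by
          rw [mul_pow]
          gcongr
          refine (lintegral_mul_sq_le ?_ ?_).trans (by gcongr)
          · exact ((hmeas _ n).mul ((hmeas' _).mul (measurable_wt _))).aemeasurable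
          · exact (hmeas _ n).aemeasurable.mul ((measurable_wt _).aemeasurable.mul hC.enorm)
      _ = _ := by
          rw [mul_assoc _ Q]
          congr 3; ext σ
          rw [mul_pow, wt_sq]
          congr 2; ring
  calc ∑' n : ℤ, (wt b n * ‖discr T C n‖ₑ) ^ 2
      ≤ ∑' n : ℤ, (cutC * ENNReal.ofReal (2 ^ b)) ^ 2 * Q *
      ∫⁻ σ, wt (-(3 - b)) (n - T * σ) * (wt b σ * ‖C σ‖ₑ) ^ 2 := ENNReal.tsum_le_tsum key
    _ = (cutC * ENNReal.ofReal (2 ^ b)) ^ 2 * Q *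
      ∫⁻ σ, (∑' n : ℤ, wt (-(3 - b)) (n - T * σ)) * (wt b σ * ‖C σ‖ₑ) ^ 2 := by
        rw [ENNReal.tsum_mul_left, ← lintegral_tsum]
        · simp_rw [ENNReal.tsum_mul_right]
        · intro n
          exact (hmeas _ n).aemeasurable.mul (((measurable_wt _).aemeasurable.mul hC.enorm).pow_const _)
    _ ≤ (cutC * ENNReal.ofReal (2 ^ b)) ^ 2 * Q * (bracketSum (3 - b) * lhb b C ^ 2) := by
        rw [lhb_sq, ← lintegral_const_mul' _ _ (bracketSum_lt_top (by linarith)).ne]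
        gcongr with σ
        simpa [sub_eq_add_neg] using tsum_wt_add_le (p := 3 - b) (by linarith) (-(T * σ))
    _ = _ := by rw [hM2]; ring

/-- A function on the line whose inverse Fourier transform is `t ↦ ∑ a(n) e^{int/T}` for
`|t| ≤ T`. -/
def undiscr (T : ℝ) (a : ℤ → ℂ) (τ : ℝ) : ℂ := T * ∑' n : ℤ, a n * cutHat (T * τ - n)

lemma measurable_undiscr (T : ℝ) (a : ℤ → ℂ) : Measurable (undiscr T a) := by
  refine Measurable.const_mul ?_ _
  exact Measurable.tsum fun n => (continuous_const.mul
    (continuous_cutHat.comp (by fun_prop))).measurable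

/-- After rescaling by T and translating by n, each term is an exponential times the inverse
transform of the cutoff, which equals 1 at t/T. -/
lemma integral_undiscr {T : ℝ} (hT : 0 < T) {a : ℤ → ℂ} (ha : Summable fun n => ‖a n‖) {t : ℝ}
    (ht : |t| ≤ T) : ∫ τ, cis (t * τ) * undiscr T a τ = ser a (t / T) := by
  have hm : ∀ n : ℤ, AEStronglyMeasurable
      (fun τ => cis (t * τ) * (T * (a n * cutHat (T * τ - n)))) volume := fun n =>
    (Continuous.mul (by fun_prop) (continuous_const.mul (continuous_const.mul
      (continuous_cutHat.comp (by fun_prop))))).aestronglyMeasurable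
  have hfin : ∑' n : ℤ, ∫⁻ τ, ‖cis (t * τ) * (T * (a n * cutHat (T * τ - n)))‖ₑ ≠ ∞ := by
    refine ne_of_lt (lt_of_le_of_lt (b := ∑' n : ℤ, ‖a n‖ₑ * (‖(T : ℂ)‖ₑ *
      (cutC * (ENNReal.ofReal T⁻¹ * lineSum 3)))) ?_ ?_)
    · refine ENNReal.tsum_le_tsum fun n => ?_
      have hc : ‖a n‖ₑ * (‖(T : ℂ)‖ₑ * cutC) ≠ ∞ :=
        (ENNReal.mul_lt_top enorm_lt_top (ENNReal.mul_lt_top enorm_lt_top cutC_lt_top)).ne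
      rw [← lintegral_wt_comp hT 3 n, ← mul_assoc, ← mul_assoc, mul_assoc ‖a n‖ₑ,
        ← lintegral_const_mul' _ _ hc]
      refine lintegral_mono fun τ => ?_
      rw [enorm_mul, enorm_cis, one_mul, enorm_mul, enorm_mul]
      calc _ ≤ ‖(T : ℂ)‖ₑ * (‖a n‖ₑ * (cutC * wt (-3) (T * τ - n))) := by
            gcongr; exact enorm_cutHat_le _
        _ = _ := by ring
    · rw [ENNReal.tsum_mul_right]
      exact ENNReal.mul_lt_top (tsum_enorm_ne_top_iff_summable_norm.mpr ha).lt_top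
        (ENNReal.mul_lt_top enorm_lt_top (ENNReal.mul_lt_top cutC_lt_top
          (ENNReal.mul_lt_top ENNReal.ofReal_lt_top (lineSum_lt_top (by norm_num)))))
  have h := integral_tsum hm hfin
  simp_rw [tsum_mul_left] at h
  simp_rw [undiscr]
  rw [h, ser]
  congr 1; ext n
  have hr : |t / T| ≤ 1 := by rwa [abs_div, abs_of_pos hT, div_le_one hT]
  have h1 := Measure.integral_comp_mul_left
    (fun y => cis (t / T * y) * (T * (a n * cutHat (y - n)))) T
  have h2 := integral_sub_right_eq_self (μ := volume)
    (fun y => cis (t / T * (y + n)) * (T * (a n * cutHat y))) (n : ℝ)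
  simp only [sub_add_cancel] at h2
  have h3 : (fun τ => cis (t * τ) * (T * (a n * cutHat (T * τ - n)))) =
      fun τ => (fun y => cis (t / T * y) * (T * (a n * cutHat (y - n)))) (T * τ) := by
    ext τ
    have : t * τ = t / T * (T * τ) := by field_simp
    simp only [this]
  rw [h3, h1, h2, abs_of_pos (inv_pos.mpr hT)]
  have h4 : (fun y => cis (t / T * (y + n)) * (T * (a n * cutHat y))) =
      fun y => (T * (a n * cis (n * (t / T)))) * (cis (t / T * y) * cutHat y) := by
    ext y
    rw [mul_add, cis_add, mul_comm (t / T) (n : ℝ)]; ring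
  rw [h4, integral_const_mul, integral_cis_mul_cutHat hr, mul_one, Complex.real_smul, ← mul_assoc]
  push_cast
  rw [inv_mul_cancel₀ (by exact_mod_cast hT.ne'), one_mul]

/-- The power of T is the scaling of H^b: T^{-b} from the weight, T from the prefactor in `undiscr`,
and T^{-1/2} from the L² norm in Tτ. -/
lemma exists_lhb_undiscr_le {b : ℝ} (hb0 : 0 ≤ b) (hb1 : b < 1) :
    ∃ M : ℝ≥0∞, M < ∞ ∧ ∀ (T : ℝ) (a : ℤ → ℂ), 0 < T → T ≤ 1 →
      lhb b (undiscr T a) ≤ M * ENNReal.ofReal (T ^ (1 / 2 - b)) * hb b a := by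
  set M2 : ℝ≥0∞ := (cutC * ENNReal.ofReal (2 ^ b)) ^ 2 * (bracketSum (3 - b) * lineSum (3 - b))
    with hM2
  have hM2t : M2 < ∞ := ENNReal.mul_lt_top (ENNReal.pow_lt_top
    (ENNReal.mul_lt_top cutC_lt_top ENNReal.ofReal_lt_top))
    (ENNReal.mul_lt_top (bracketSum_lt_top (by linarith)) (lineSum_lt_top (by linarith)))
  refine ⟨M2 ^ (1 / 2 : ℝ), ENNReal.rpow_lt_top_of_nonneg (by norm_num) hM2t.ne,
    fun T a hT hT1 => le_of_sq_le_sq ?_⟩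
  rw [mul_pow, mul_pow, rpow_half_sq, lhb_sq, hb, sob, l2_sq]
  set x : ℤ → ℝ≥0∞ := fun n => wt b n * ‖a n‖ₑ with hx
  have key : ∀ τ, (wt b τ * ‖undiscr T a τ‖ₑ) ^ 2 ≤
      (ENNReal.ofReal (T ^ (1 - b)) * (cutC * ENNReal.ofReal (2 ^ b))) ^ 2 * bracketSum (3 - b) *
        ∑' n : ℤ, wt (-(3 - b)) (T * τ - n) * x n ^ 2 := by
    intro τ
    have h1 : wt b τ ≤ ENNReal.ofReal (T ^ (-b)) * wt b (T * τ) := by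
      rw [wt, wt, ← ENNReal.ofReal_mul (by positivity)]
      refine ENNReal.ofReal_le_ofReal ?_
      rw [Real.rpow_neg hT.le, ← Real.inv_rpow hT.le, ← Real.mul_rpow (by positivity) (jb_pos _).le]
      refine Real.rpow_le_rpow (jb_pos _).le ?_ hb0
      rw [inv_mul_eq_div, le_div_iff₀ hT, mul_comm]
      exact jb_mul_le hT hT1 τ
    have h2 : wt b τ * ‖undiscr T a τ‖ₑ ≤
        ENNReal.ofReal (T ^ (1 - b)) * (cutC * ENNReal.ofReal (2 ^ b)) *
          ∑' n : ℤ, wt (-(3 - b) / 2) (T * τ - n) * (wt (-(3 - b) / 2) (T * τ - n) * x n) := by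
      have h3 : ‖undiscr T a τ‖ₑ ≤ ENNReal.ofReal T * ∑' n : ℤ, ‖a n‖ₑ * (cutC * wt (-3) (T * τ - n)) := by
        rw [undiscr, enorm_mul]
        gcongr
        · rw [← ofReal_norm, Complex.norm_real, Real.norm_of_nonneg hT.le]
        · refine enorm_tsum_le_tsum_enorm.trans (ENNReal.tsum_le_tsum fun n => ?_)
          rw [enorm_mul]; gcongr; exact enorm_cutHat_le _
      calc wt b τ * ‖undiscr T a τ‖ₑ ≤ (ENNReal.ofReal (T ^ (-b)) * wt b (T * τ)) *
            (ENNReal.ofReal T * ∑' n : ℤ, ‖a n‖ₑ * (cutC * wt (-3) (T * τ - n))) := by gcongr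
        _ = ENNReal.ofReal (T ^ (1 - b)) *
            ∑' n : ℤ, wt b (T * τ) * (‖a n‖ₑ * (cutC * wt (-3) (T * τ - n))) := by
            rw [ENNReal.tsum_mul_left, show 1 - b = -b + 1 by ring, Real.rpow_add hT,
              Real.rpow_one, ENNReal.ofReal_mul (by positivity)]
            ring
        _ ≤ _ := by
            rw [mul_assoc]
            refine mul_le_mul' le_rfl ?_
            rw [← ENNReal.tsum_mul_left]
            refine ENNReal.tsum_le_tsum fun n => ?_
            have p1 := wt_add_le b n (T * τ - n)
            rw [abs_of_nonneg hb0, add_sub_cancel] at p1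
            calc wt b (T * τ) * (‖a n‖ₑ * (cutC * wt (-3) (T * τ - n)))
                ≤ (ENNReal.ofReal (2 ^ b) * wt b n * wt b (T * τ - n)) *
                  (‖a n‖ₑ * (cutC * wt (-3) (T * τ - n))) := by gcongr
              _ = cutC * ENNReal.ofReal (2 ^ b) * (wt (b + -3) (T * τ - n) * x n) := by
                  rw [wt_add, hx]; ring
              _ = _ := by
                  rw [show b + -3 = -(3 - b) / 2 + -(3 - b) / 2 by ring, wt_add]; ring
    have h4 : (∑' n : ℤ, wt (-(3 - b) / 2) (T * τ - n) * (wt (-(3 - b) / 2) (T * τ - n) * x n)) ^ 2 ≤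
        bracketSum (3 - b) * ∑' n : ℤ, wt (-(3 - b)) (T * τ - n) * x n ^ 2 := by
      calc _ ≤ (l2 (fun n : ℤ => wt (-(3 - b) / 2) (T * τ - n)) *
            l2 (fun n : ℤ => wt (-(3 - b) / 2) (T * τ - n) * x n)) ^ 2 := by
            gcongr; exact tsum_mul_le_l2 _ _
        _ ≤ _ := by
            rw [mul_pow, l2_sq, l2_sq]
            simp_rw [mul_pow, wt_sq]
            rw [show 2 * (-(3 - b) / 2) = -(3 - b) by ring]
            gcongr
            exact tsum_wt_sub_le (by linarith) _
    calc (wt b τ * ‖undiscr T a τ‖ₑ) ^ 2 ≤ (ENNReal.ofReal (T ^ (1 - b)) *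
          (cutC * ENNReal.ofReal (2 ^ b)) *
          ∑' n : ℤ, wt (-(3 - b) / 2) (T * τ - n) * (wt (-(3 - b) / 2) (T * τ - n) * x n)) ^ 2 := by
          gcongr
      _ ≤ _ := by rw [mul_pow, mul_assoc _ (bracketSum _)]; gcongr
  have hcf : (ENNReal.ofReal (T ^ (1 - b)) * (cutC * ENNReal.ofReal (2 ^ b))) ^ 2 *
      bracketSum (3 - b) ≠ ∞ :=
    (ENNReal.mul_lt_top (ENNReal.pow_lt_top (ENNReal.mul_lt_top ENNReal.ofReal_lt_top
      (ENNReal.mul_lt_top cutC_lt_top ENNReal.ofReal_lt_top))) (bracketSum_lt_top (by linarith))).ne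
  calc ∫⁻ τ, (wt b τ * ‖undiscr T a τ‖ₑ) ^ 2 ≤ ∫⁻ τ,
      (ENNReal.ofReal (T ^ (1 - b)) * (cutC * ENNReal.ofReal (2 ^ b))) ^ 2 * bracketSum (3 - b) *
        ∑' n : ℤ, wt (-(3 - b)) (T * τ - n) * x n ^ 2 := lintegral_mono key
    _ = (ENNReal.ofReal (T ^ (1 - b)) * (cutC * ENNReal.ofReal (2 ^ b))) ^ 2 * bracketSum (3 - b) *
        ((ENNReal.ofReal T⁻¹ * lineSum (3 - b)) * ∑' n : ℤ, x n ^ 2) := by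
        rw [lintegral_const_mul' _ _ hcf, lintegral_tsum]
        · congr 1
          rw [← ENNReal.tsum_mul_left]
          congr 1; ext n
          have hm : Measurable fun τ : ℝ => wt (-(3 - b)) (T * τ - n) :=
            (measurable_wt _).comp (by fun_prop)
          rw [lintegral_mul_const _ hm, lintegral_wt_comp hT]
        · intro n
          have hm : Measurable fun τ : ℝ => wt (-(3 - b)) (T * τ - n) :=
            (measurable_wt _).comp (by fun_prop)
          exact (hm.mul_const _).aemeasurable
    _ = _ := by
        have e : ENNReal.ofReal (T ^ (1 - b)) ^ 2 * ENNReal.ofReal T⁻¹ =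
            ENNReal.ofReal (T ^ (1 / 2 - b)) ^ 2 := by
          rw [← ENNReal.ofReal_pow (by positivity), ← ENNReal.ofReal_pow (by positivity),
            ← ENNReal.ofReal_mul (by positivity), ← Real.rpow_neg_one, ← Real.rpow_natCast,
            ← Real.rpow_natCast, ← Real.rpow_mul hT.le, ← Real.rpow_mul hT.le, ← Real.rpow_add hT]
          congr 2; push_cast; ring
        rw [← e, hM2]; ring

/-! ### Fourier coefficients of the cubic nonlinearity -/

/-- The correlation of two sequences. -/
def corr (X Y : ℤ → ℝ≥0∞) (l : ℤ) : ℝ≥0∞ := ∑' p, X p * Y (p + l)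

lemma tsum_prod_swap (f : ℤ × ℤ → ℝ≥0∞) : ∑' p, f p = ∑' l, ∑' j, f (j, l) := by
  rw [← (Equiv.prodComm ℤ ℤ).tsum_eq f, ENNReal.tsum_prod']; rfl

lemma tri_one_eq (X Y Z : ℤ → ℝ≥0∞) (k : ℤ) :
    tri (fun _ _ _ => 1) X Y Z k = ∑' l, Z (k + l) * corr X Y l := by
  rw [tri, tsum_prod_swap]
  congr 1; ext l
  simp only [one_mul]
  rw [ENNReal.tsum_mul_right, mul_comm, corr,
    ← tsum_int_shift (fun p => X p * Y (p + l)) k]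

/-- The constant in the product estimate `H^σ · H^σ ⊂ L²`. -/
def corrC (σ : ℝ) : ℝ≥0∞ := (2 * bracketSum (4 * σ)) ^ (1 / 2 : ℝ)

lemma corrC_lt_top {σ : ℝ} (h : 1 / 4 < σ) : corrC σ < ∞ :=
  ENNReal.rpow_lt_top_of_nonneg (by norm_num)
    (ENNReal.mul_lt_top (by simp) (bracketSum_lt_top (by linarith))).ne

/-- Cauchy-Schwarz in p against ⟨p⟩^{-σ}⟨p+l⟩^{-σ}, whose squares sum to at most 2 Σ⟨·⟩^{-4σ} up to
the shift constant, uniformly in l. The constant is finite when σ > 1/4. -/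
lemma l2_corr_le {σ : ℝ} (hσ : 0 ≤ σ) (X Y : ℤ → ℝ≥0∞) :
    l2 (corr X Y) ≤ corrC σ * (sob σ X * sob σ Y) := by
  refine le_of_sq_le_sq ?_
  rw [mul_pow, mul_pow, corrC, rpow_half_sq, sob, sob, l2_sq, l2_sq, l2_sq]
  set x := fun k : ℤ => wt σ k * X k
  set y := fun k : ℤ => wt σ k * Y k
  have key : ∀ l, corr X Y l ^ 2 ≤ 2 * bracketSum (4 * σ) * ∑' p, x p ^ 2 * y (p + l) ^ 2 := by
    intro l
    have h1 : corr X Y l = ∑' p : ℤ, (wt (-σ) p * wt (-σ) (p + l : ℤ)) * (x p * y (p + l)) := by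
      rw [corr]
      congr 1; ext p
      calc X p * Y (p + l) = (wt σ p * wt (-σ) p) * (wt σ (p + l : ℤ) * wt (-σ) (p + l : ℤ)) *
            (X p * Y (p + l)) := by rw [wt_mul_wt_neg, wt_mul_wt_neg]; ring
        _ = _ := by simp only [x, y]; ring
    rw [h1]
    calc _ ≤ (l2 (fun p : ℤ => wt (-σ) p * wt (-σ) (p + l : ℤ)) *
          l2 (fun p => x p * y (p + l))) ^ 2 := by gcongr; exact tsum_mul_le_l2 _ _
      _ ≤ _ := by
          rw [mul_pow, l2_sq, l2_sq]
          simp_rw [mul_pow, wt_sq]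
          gcongr
          calc ∑' p : ℤ, wt (2 * -σ) p * wt (2 * -σ) (p + l : ℤ)
              ≤ ∑' p : ℤ, (wt (-(4 * σ)) p + wt (-(4 * σ)) (p + (l : ℝ))) := by
                refine ENNReal.tsum_le_tsum fun p => ?_
                rw [mul_neg]; push_cast
                exact wt_mul_le _ _ (by linarith) (by linarith) (by ring)
            _ ≤ bracketSum (4 * σ) + bracketSum (4 * σ) := by
                rw [ENNReal.tsum_add]
                gcongr
                · exact tsum_wt_int_le (by linarith)
                · exact tsum_wt_add_le (by linarith) _
            _ = _ := (two_mul _).symm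
  calc ∑' l, corr X Y l ^ 2 ≤ ∑' l, 2 * bracketSum (4 * σ) * ∑' p, x p ^ 2 * y (p + l) ^ 2 :=
        ENNReal.tsum_le_tsum key
    _ = _ := by
        rw [ENNReal.tsum_mul_left, ENNReal.tsum_comm]
        simp_rw [ENNReal.tsum_mul_left, fun p => tsum_int_shift (fun l => y l ^ 2) p]
        rw [ENNReal.tsum_mul_right]

lemma tri_one_le {σ : ℝ} (hσ : 0 ≤ σ) (X Y Z : ℤ → ℝ≥0∞) (k : ℤ) :
    tri (fun _ _ _ => 1) X Y Z k ≤ corrC σ * (sob σ X * sob σ Y * sob σ Z) := by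
  rw [tri_one_eq]
  calc _ ≤ l2 (fun l => Z (k + l)) * l2 (corr X Y) := tsum_mul_le_l2 _ _
    _ ≤ sob σ Z * (corrC σ * (sob σ X * sob σ Y)) := by
        gcongr
        · exact (l2_equiv (Equiv.addLeft k) Z).le.trans (l2_le_sob hσ Z)
        · exact l2_corr_le hσ X Y
    _ = _ := by ring

-- Parseval's identity, the L⁴ bound and the cubic convolution formula

local notation "μ₀" => (AddCircle.haarAddCircle : Measure Torus)

/-- Parseval's identity. -/
lemma hasSum_conj_mul_fourierCoeff {F G : Torus → ℂ} (hF : MemLp F 2 μ₀) (hG : MemLp G 2 μ₀) :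
    HasSum (fun n : ℤ => (starRingEnd ℂ) (fourierCoeff F n) * fourierCoeff G n)
      (∫ x, (starRingEnd ℂ) (F x) * G x ∂μ₀) := by
  have h := (fourierBasis (T := 2 * Real.pi)).hasSum_inner_mul_inner (hF.toLp F) (hG.toLp G)
  have e1 : ∀ n, fourierCoeff (hF.toLp F) n = fourierCoeff F n := fun n =>
    congrFun (fourierCoeff_congr_ae hF.coeFn_toLp) n
  have e2 : ∀ n, fourierCoeff (hG.toLp G) n = fourierCoeff G n := fun n =>
    congrFun (fourierCoeff_congr_ae hG.coeFn_toLp) n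
  have e3 : inner ℂ (hF.toLp F) (hG.toLp G) = ∫ x, (starRingEnd ℂ) (F x) * G x ∂μ₀ := by
    rw [L2.inner_def]
    refine integral_congr_ae ?_
    filter_upwards [hF.coeFn_toLp, hG.coeFn_toLp] with x h1 h2
    rw [h1, h2, RCLike.inner_apply, mul_comm]
  rw [e3] at h
  refine (congrArg (fun f => HasSum f _) (funext fun n => ?_)).mpr h
  rw [← inner_conj_symm (hF.toLp F), ← HilbertBasis.repr_apply_apply,
    ← HilbertBasis.repr_apply_apply, fourierBasis_repr, fourierBasis_repr, e1, e2]

lemma memLp_fourier_mul {F : Torus → ℂ} {p : ℝ≥0∞} (hF : MemLp F p μ₀) (k : ℤ) :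
    MemLp (fun x => fourier k x * F x) p μ₀ := by
  refine hF.of_le_mul (c := 1) ?_ (ae_of_all _ fun x => ?_)
  · exact (fourier k).continuous.aestronglyMeasurable.mul hF.1
  · rw [norm_mul, fourier_apply, Circle.norm_coe]

lemma fourierCoeff_fourier_mul (F : Torus → ℂ) (m n : ℤ) :
    fourierCoeff (fun x => fourier m x * F x) n = fourierCoeff F (n - m) := by
  simp only [fourierCoeff, smul_eq_mul, ← mul_assoc, ← fourier_add]
  congr 1; ext x; congr 3; ring

lemma fourierCoeff_conj (F : Torus → ℂ) (n : ℤ) :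
    fourierCoeff (fun x => (starRingEnd ℂ) (F x)) n = (starRingEnd ℂ) (fourierCoeff F (-n)) := by
  simp only [fourierCoeff, smul_eq_mul]
  rw [← integral_conj]
  congr 1; ext x
  rw [map_mul, ← fourier_neg, neg_neg]

/-- Coefficients of `|F|²`. -/
lemma hasSum_fourierCoeff_normSq {F : Torus → ℂ} (hF : MemLp F 2 μ₀) (m : ℤ) :
    HasSum (fun p : ℤ => (starRingEnd ℂ) (fourierCoeff F p) * fourierCoeff F (p + m))
      (fourierCoeff (fun x => ((‖F x‖ ^ 2 : ℝ) : ℂ)) m) := by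
  have h := hasSum_conj_mul_fourierCoeff (memLp_fourier_mul hF m) hF
  have e : ∫ x, (starRingEnd ℂ) (fourier m x * F x) * F x ∂μ₀ =
      fourierCoeff (fun x => ((‖F x‖ ^ 2 : ℝ) : ℂ)) m := by
    rw [fourierCoeff]
    congr 1; ext x
    rw [map_mul, ← fourier_neg, smul_eq_mul, mul_assoc, ← Complex.normSq_eq_conj_mul_self,
      Complex.normSq_eq_norm_sq]
  rw [e] at h
  simp_rw [fourierCoeff_fourier_mul] at h
  have := (Equiv.addRight m).hasSum_iff.mpr h
  simpa [Function.comp_def] using this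

lemma enorm_fourierCoeff_normSq_le {F : Torus → ℂ} (hF : MemLp F 2 μ₀) (m : ℤ) :
    ‖fourierCoeff (fun x => ((‖F x‖ ^ 2 : ℝ) : ℂ)) m‖ₑ ≤
      corr (fun k => ‖fourierCoeff F k‖ₑ) (fun k => ‖fourierCoeff F k‖ₑ) m := by
  rw [← (hasSum_fourierCoeff_normSq hF m).tsum_eq, corr]
  refine enorm_tsum_le_tsum_enorm.trans (le_of_eq ?_)
  congr 1; ext p
  rw [enorm_mul, ← ofReal_norm, RCLike.norm_conj, ofReal_norm]

/-- Parseval's identity for the norm. -/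
lemma tsum_enorm_fourierCoeff_sq {F : Torus → ℂ} (hF : MemLp F 2 μ₀) :
    ∑' n, ‖fourierCoeff F n‖ₑ ^ 2 = ∫⁻ x, ‖F x‖ₑ ^ 2 ∂μ₀ := by
  have h := hasSum_sq_fourierCoeff (hF.toLp F)
  have e1 : ∀ n, fourierCoeff (hF.toLp F) n = fourierCoeff F n := fun n =>
    congrFun (fourierCoeff_congr_ae hF.coeFn_toLp) n
  simp_rw [e1] at h
  have e2 : ∫ x, ‖hF.toLp F x‖ ^ 2 ∂μ₀ = ∫ x, ‖F x‖ ^ 2 ∂μ₀ := by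
    refine integral_congr_ae ?_
    filter_upwards [hF.coeFn_toLp] with x h1
    rw [h1]
  rw [e2] at h
  have h3 := ENNReal.ofReal_tsum_of_nonneg (fun n => by positivity) h.summable
  rw [h.tsum_eq, ofReal_integral_eq_lintegral_ofReal (hF.integrable_norm_pow two_ne_zero)
    (ae_of_all _ fun x => by positivity)] at h3
  simp_rw [ENNReal.ofReal_pow (norm_nonneg _), ofReal_norm] at h3
  exact h3.symm

/-- Functions with coefficients in `H^s`, `s > 1/4`, are in `L⁴`. -/
lemma lintegral_pow_four_lt_top {s : ℝ} (hs : 1 / 4 < s) (f : L2)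
    (hf : sob s (fun k => ‖fourierCoeff f k‖ₑ) < ∞) : ∫⁻ x, ‖f x‖ₑ ^ 4 ∂μ₀ < ∞ := by
  set A := fun k => ‖fourierCoeff f k‖ₑ with hA
  set B := (corrC s * (sob s A * sob s A)) ^ 2 with hB
  have hBt : B < ∞ := ENNReal.pow_lt_top (ENNReal.mul_lt_top (corrC_lt_top hs)
    (ENNReal.mul_lt_top hf hf))
  set S : ℕ → Finset ℤ := fun N => Finset.Icc (-(N : ℤ)) N with hS
  set F : ℕ → C(Torus, ℂ) := fun N => ∑ n ∈ S N, fourierCoeff f n • fourier n with hF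
  have hmem : ∀ N, MemLp (F N) 2 μ₀ := fun N =>
    ((F N).continuous.memLp_of_hasCompactSupport (HasCompactSupport.of_compactSpace _))
  have hcoef : ∀ N k, fourierCoeff (F N) k = if k ∈ S N then fourierCoeff f k else 0 := by
    intro N k
    have h1 : (F N : Torus → ℂ) = ∑ n ∈ S N, fun x => fourierCoeff f n • fourier n x := by
      ext x; simp [hF]
    rw [h1, fourierCoeff.sum _ _ fun n _ => ?_]
    · simp only [Finset.sum_apply]
      have h2 : ∀ n, fourierCoeff (fun x : Torus => fourierCoeff f n • fourier n x) k =
          if k = n then fourierCoeff f n else 0 := by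
        intro n
        refine (fourierCoeff.const_smul (fun x => fourier n x) (fourierCoeff f n) k).trans ?_
        rw [fourierCoeff_fourier]
        by_cases h : k = n
        · subst h; simp
        · simp [h]
      simp_rw [h2]
      rw [Finset.sum_ite_eq]
    · exact (Continuous.integrable_of_hasCompactSupport (by fun_prop)
        (HasCompactSupport.of_compactSpace _))
  -- By Parseval the L⁴ integral of a truncation is the ℓ² norm squared of the coefficients of its
  -- squared modulus. These are dominated by the correlation of the full sequence, hence the bound
  -- is uniform in N.
  have hbound : ∀ N, ∫⁻ x, ‖F N x‖ₑ ^ 4 ∂μ₀ ≤ B := by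
    intro N
    have hm2 : MemLp (fun x => ((‖F N x‖ ^ 2 : ℝ) : ℂ)) 2 μ₀ :=
      Continuous.memLp_of_hasCompactSupport (by fun_prop) (HasCompactSupport.of_compactSpace _)
    have h1 := tsum_enorm_fourierCoeff_sq hm2
    have h2 : ∀ x, ‖((‖F N x‖ ^ 2 : ℝ) : ℂ)‖ₑ ^ 2 = ‖F N x‖ₑ ^ 4 := by
      intro x
      rw [← ofReal_norm, Complex.norm_real, norm_pow, norm_norm, ← ENNReal.ofReal_pow (by positivity),
        ← ofReal_norm (F N x), ← ENNReal.ofReal_pow (by positivity)]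
      congr 1; ring
    simp_rw [h2] at h1
    rw [← h1, hB]
    have h3 : l2 (corr (fun k => ‖fourierCoeff (F N) k‖ₑ) (fun k => ‖fourierCoeff (F N) k‖ₑ)) ≤
        corrC s * (sob s A * sob s A) := by
      refine (l2_corr_le (by linarith) _ _).trans ?_
      have : sob s (fun k => ‖fourierCoeff (F N) k‖ₑ) ≤ sob s A := by
        refine sob_mono fun k => ?_
        rw [hcoef, hA]
        split_ifs <;> simp
      gcongr
    refine le_trans ?_ (pow_le_pow_left' h3 2)
    rw [l2_sq]
    gcongr with n
    exact enorm_fourierCoeff_normSq_le (hmem N) n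
  have hconv : Tendsto (fun N => ContinuousMap.toLp (E := ℂ) 2 μ₀ ℂ (F N)) atTop (𝓝 f) := by
    have h1 := hasSum_fourier_series_L2 f
    have h2 : Tendsto S atTop atTop := by
      refine tendsto_atTop_finset_of_monotone (fun N M h => ?_) (fun x => ⟨x.natAbs, ?_⟩)
      · intro x; simp only [hS, Finset.mem_Icc]; omega
      · simp only [hS, Finset.mem_Icc]; omega
    have h3 := h1.comp h2
    refine h3.congr fun N => ?_
    simp only [Function.comp, hF, map_sum, map_smul]
  have hTM := tendstoInMeasure_of_tendsto_Lp hconv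
  obtain ⟨ns, -, hns⟩ := hTM.exists_seq_tendsto_ae
  have hns' : ∀ᵐ x ∂μ₀, Tendsto (fun i => F (ns i) x) atTop (𝓝 (f x)) := by
    have : ∀ᵐ x ∂μ₀, ∀ N, ContinuousMap.toLp (E := ℂ) 2 μ₀ ℂ (F N) x = F N x :=
      ae_all_iff.mpr fun N => ContinuousMap.coeFn_toLp μ₀ (F N)
    filter_upwards [hns, this] with x h1 h2
    exact h1.congr fun i => h2 _
  refine lt_of_le_of_lt ?_ hBt
  -- Fatou's lemma along a subsequence of truncations that converges almost everywhere.
  calc ∫⁻ x, ‖f x‖ₑ ^ 4 ∂μ₀ ≤ ∫⁻ x, liminf (fun i => ‖F (ns i) x‖ₑ ^ 4) atTop ∂μ₀ := by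
        refine lintegral_mono_ae ?_
        filter_upwards [hns'] with x hx
        have := ((ENNReal.continuous_pow 4).tendsto _).comp ((continuous_enorm.tendsto _).comp hx)
        exact this.liminf_eq.ge
    _ ≤ liminf (fun i => ∫⁻ x, ‖F (ns i) x‖ₑ ^ 4 ∂μ₀) atTop :=
        lintegral_liminf_le fun i => by
          have := (F (ns i)).continuous
          exact (this.enorm.measurable.pow_const 4)
    _ ≤ liminf (fun _ => B) atTop := liminf_le_liminf (Eventually.of_forall fun i => hbound _)
    _ = B := liminf_const _

lemma summable_cubic {s : ℝ} (hs : 1 / 4 < s) {c : ℤ → ℂ} (hc : sob s (fun k => ‖c k‖ₑ) < ∞)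
    (k : ℤ) : Summable fun p : ℤ × ℤ =>
      c (k + p.1) * (starRingEnd ℂ) (c (k + p.1 + p.2)) * c (k + p.2) := by
  refine (summable_norm_of_tsum_enorm_lt_top (lt_of_le_of_lt ?_ (lt_of_le_of_lt
    (tri_one_le (σ := s) (by linarith) (fun k => ‖c k‖ₑ) (fun k => ‖c k‖ₑ) (fun k => ‖c k‖ₑ) k)
    (ENNReal.mul_lt_top (corrC_lt_top hs) (ENNReal.mul_lt_top (ENNReal.mul_lt_top hc hc) hc))))).of_norm
  refine ENNReal.tsum_le_tsum fun p => le_of_eq ?_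
  rw [one_mul, enorm_mul, enorm_mul, ← ofReal_norm ((starRingEnd ℂ) _), RCLike.norm_conj, ofReal_norm]

/-- The coefficient is the L² pairing of |f|² with e^{ikx} conj(f); the L⁴ bound puts |f|² in L², so
Parseval applies. The coefficients of |f|² are expanded by Parseval once more, and the iterated sum
is a double sum by absolute convergence. -/
theorem fourierCoeff_cubic {s : ℝ} (hs : 1 / 4 < s) (f : L2)
    (hf : sob s (fun k => ‖fourierCoeff f k‖ₑ) < ∞) (k : ℤ) :
    fourierCoeff (fun x : Torus => ((‖f x‖ ^ 2 : ℝ) : ℂ) * f x) k =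
      ∑' p : ℤ × ℤ, fourierCoeff f (k + p.1) *
        (starRingEnd ℂ) (fourierCoeff f (k + p.1 + p.2)) * fourierCoeff f (k + p.2) := by
  have hfm : MemLp f 2 μ₀ := Lp.memLp f
  have hg : MemLp (fun x => ((‖f x‖ ^ 2 : ℝ) : ℂ)) 2 μ₀ := by
    have hm : AEStronglyMeasurable (fun x => ((‖f x‖ ^ 2 : ℝ) : ℂ)) μ₀ :=
      Complex.continuous_ofReal.comp_aestronglyMeasurable (hfm.1.norm.pow 2)
    rw [memLp_two_iff_integrable_sq_norm hm]
    refine ⟨hm.norm.pow 2, lt_of_le_of_lt (le_of_eq ?_) (lintegral_pow_four_lt_top hs f hf)⟩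
    refine lintegral_congr fun x => ?_
    rw [← ofReal_norm, ← ofReal_norm, ← ENNReal.ofReal_pow (norm_nonneg _)]
    congr 1
    simp only [Complex.norm_real, norm_pow, norm_norm]
    ring
  have hh : MemLp (fun x => fourier k x * (starRingEnd ℂ) (f x)) 2 μ₀ :=
    memLp_fourier_mul hfm.star k
  have h := hasSum_conj_mul_fourierCoeff hh hg
  have e : ∫ x, (starRingEnd ℂ) (fourier k x * (starRingEnd ℂ) (f x)) * ((‖f x‖ ^ 2 : ℝ) : ℂ) ∂μ₀ =
      fourierCoeff (fun x : Torus => ((‖f x‖ ^ 2 : ℝ) : ℂ) * f x) k := by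
    rw [fourierCoeff]
    congr 1; ext x
    rw [map_mul, Complex.conj_conj, ← fourier_neg, smul_eq_mul]; ring
  rw [e] at h
  simp_rw [fourierCoeff_fourier_mul, fourierCoeff_conj, Complex.conj_conj] at h
  rw [← h.tsum_eq, ← (Equiv.neg ℤ).tsum_eq]
  have hsum := summable_cubic hs hf k
  rw [← (Equiv.prodComm ℤ ℤ).tsum_eq]
  have hsum' := (Equiv.prodComm ℤ ℤ).summable_iff.mpr hsum
  refine Eq.trans ?_ (Summable.tsum_prod hsum').symm
  congr 1; ext l
  simp only [Function.comp, Equiv.prodComm_apply, Prod.swap_prod_mk, Equiv.neg_apply, neg_sub,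
    sub_neg_eq_add]
  rw [← (hasSum_fourierCoeff_normSq hfm (-l)).tsum_eq, tsum_mul_right, mul_comm,
    ← (Equiv.addLeft (k + l)).tsum_eq]
  congr 1
  congr 1; ext j
  simp only [Equiv.coe_addLeft]
  rw [mul_comm]; congr 2
  · ring
  · congr 1; ring

/-! ### The trilinear Duhamel operator on coefficient arrays -/

/-- The norm of a coefficient array. -/
def xn (s b : ℝ) (a : ℤ → ℤ → ℂ) : ℝ≥0∞ := sob s fun k => hb b (a k)

lemma hb_le_xn {s : ℝ} (hs : 0 ≤ s) (b : ℝ) (a : ℤ → ℤ → ℂ) (k : ℤ) : hb b (a k) ≤ xn s b a :=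
  le_sob hs _ k

/-- Integration of `e^{iνr}` times a trigonometric series, on the level of coefficients. -/
def duh (ν : ℝ) (g : ℤ → ℂ) (n : ℤ) : ℂ := ∑' m : ℤ, intKer n (ν + m) * g m

lemma tsum_enorm_duh_le (ν : ℝ) (g : ℤ → ℂ) (n : ℤ) :
    ∑' m : ℤ, ‖intKer n (ν + m) * g m‖ₑ ≤ intC * ∑' m : ℤ, intMaj n (ν + m) * ‖g m‖ₑ := by
  rw [← ENNReal.tsum_mul_left]
  refine ENNReal.tsum_le_tsum fun m => ?_
  rw [enorm_mul, ← mul_assoc]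
  gcongr
  exact enorm_intKer_le _ _

section duh
variable {b : ℝ} (hb0 : 1 / 2 < b) (hb1 : b < 1)
include hb0 hb1

lemma sob_duh_majorant_le (ν : ℝ) (g : ℤ → ℂ) :
    sob b (fun n => ∑' m : ℤ, ‖intKer n (ν + m) * g m‖ₑ) ≤
      intC * duhC b * (wt (b - 1) ν * hb b g) := by
  refine (sob_mono (tsum_enorm_duh_le ν g)).trans ?_
  rw [sob_const_mul, mul_assoc]
  gcongr
  exact (sob_intMaj_le hb0 hb1 ν _).trans (by rw [mul_assoc, hb])

lemma hb_duh_le (ν : ℝ) (g : ℤ → ℂ) :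
    hb b (duh ν g) ≤ intC * duhC b * (wt (b - 1) ν * hb b g) :=
  (sob_mono fun _ => enorm_tsum_le_tsum_enorm).trans (sob_duh_majorant_le hb0 hb1 ν g)

variable {g : ℤ → ℂ} (hg : hb b g < ∞)
include hg

lemma duh_bound_lt_top (ν : ℝ) : intC * duhC b * (wt (b - 1) ν * hb b g) < ∞ :=
  ENNReal.mul_lt_top (ENNReal.mul_lt_top intC_lt_top (duhC_lt_top hb0 hb1))
    (ENNReal.mul_lt_top (wt_ne_top _ _).lt_top hg)

lemma summable_duh_prod (ν : ℝ) :
    Summable fun p : ℤ × ℤ => ‖intKer p.1 (ν + p.2) * g p.2‖ := by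
  refine summable_norm_of_tsum_enorm_lt_top ?_
  rw [ENNReal.tsum_prod']
  exact lt_of_le_of_lt (tsum_le_sob (b := b) (by linarith) _) (ENNReal.mul_lt_top
    (bracketL2_lt_top hb0) ((sob_duh_majorant_le hb0 hb1 ν g).trans_lt
      (duh_bound_lt_top hb0 hb1 hg ν)))

lemma summable_duh (ν : ℝ) (n : ℤ) : Summable fun m : ℤ => intKer n (ν + m) * g m :=
  (summable_duh_prod hb0 hb1 hg ν).of_norm.prod_factor n

omit hb1 in
lemma hasSum_integral_cis_mul_ser (ν r : ℝ) :
    HasSum (fun m : ℤ => (∫ r' in (0 : ℝ)..r, cis ((ν + m) * r')) * g m)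
      (∫ r' in (0 : ℝ)..r, cis (ν * r') * ser g r') := by
  have h1 : HasSum (fun n : ℤ => ∫ r' in (0 : ℝ)..r, cis ((ν + n) * r') * g n)
      (∫ r' in (0 : ℝ)..r, ∑' n : ℤ, cis ((ν + n) * r') * g n) :=
    hasSum_integral_of_bound (fun n => by fun_prop) (fun n r => by simp [norm_cis])
      (summable_norm_of_hb hb0 hg) _ _
  have h2 : ∀ r, ∑' n : ℤ, cis ((ν + n) * r) * g n = cis (ν * r) * ser g r := by
    intro r
    rw [ser, ← tsum_mul_left]
    congr 1; ext n
    rw [add_mul, cis_add]; ring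
  simp_rw [h2, intervalIntegral.integral_mul_const] at h1
  exact h1

lemma ser_duh (ν : ℝ) {r : ℝ} (hr : |r| ≤ 1) :
    ser (duh ν g) r = ∫ r' in (0 : ℝ)..r, cis (ν * r') * ser g r' := by
  have hs : Summable (Function.uncurry fun n m : ℤ => intKer n (ν + m) * g m * cis (n * r)) := by
    refine Summable.of_norm ?_
    simpa [Function.uncurry_def, norm_cis] using summable_duh_prod hb0 hb1 hg ν
  rw [ser]
  simp_rw [duh, ← tsum_mul_right]
  rw [hs.tsum_comm.symm, ← (hasSum_integral_cis_mul_ser hb0 hg ν r).tsum_eq]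
  congr 1; ext m
  rw [← (hasSum_intKer (ν + m) hr).tsum_eq, ← tsum_mul_right]
  congr 1; ext n; ring

end duh

/-- Coefficients of the product of three series, the middle one conjugated. -/
def trip (a₁ a₂ a₃ : ℤ → ℤ → ℂ) (k : ℤ) (p : ℤ × ℤ) : ℤ → ℂ :=
  cv (cv (a₁ (k + p.1)) (cj (a₂ (k + p.1 + p.2)))) (a₃ (k + p.2))

lemma hb_trip_le {b : ℝ} (hb0 : 0 ≤ b) (a₁ a₂ a₃ : ℤ → ℤ → ℂ) (k : ℤ) (p : ℤ × ℤ) :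
    hb b (trip a₁ a₂ a₃ k p) ≤ algConst b ^ 2 *
      (hb b (a₁ (k + p.1)) * hb b (a₂ (k + p.1 + p.2)) * hb b (a₃ (k + p.2))) := by
  refine (hb_cv_le hb0).trans ?_
  calc _ ≤ algConst b * ((algConst b * (hb b (a₁ (k + p.1)) * hb b (cj (a₂ (k + p.1 + p.2))))) *
        hb b (a₃ (k + p.2))) := by gcongr; exact hb_cv_le hb0
    _ = _ := by rw [hb_cj]; ring

/-- The trilinear Duhamel operator, in time units of `T`. -/
def gop (α T : ℝ) (a₁ a₂ a₃ : ℤ → ℤ → ℂ) (k n : ℤ) : ℂ :=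
  T * ∑' p : ℤ × ℤ, duh (T * phase α k p.1 p.2) (trip a₁ a₂ a₃ k p) n

section gop
variable {α b s T : ℝ} (hb0 : 1 / 2 < b) (hb1 : b < 1)
include hb0 hb1

lemma hb_duh_trip_le (ν : ℝ) (a₁ a₂ a₃ : ℤ → ℤ → ℂ) (k : ℤ) (p : ℤ × ℤ) :
    hb b (duh ν (trip a₁ a₂ a₃ k p)) ≤ intC * duhC b * algConst b ^ 2 * (wt (b - 1) ν *
      (hb b (a₁ (k + p.1)) * hb b (a₂ (k + p.1 + p.2)) * hb b (a₃ (k + p.2)))) := by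
  refine (hb_duh_le hb0 hb1 _ _).trans ?_
  calc _ ≤ intC * duhC b * (wt (b - 1) ν * (algConst b ^ 2 *
      (hb b (a₁ (k + p.1)) * hb b (a₂ (k + p.1 + p.2)) * hb b (a₃ (k + p.2))))) := by
        gcongr; exact hb_trip_le (by linarith) _ _ _ _ _
    _ = _ := by ring

lemma hb_gop_le (hT : 0 < T) (hT1 : T ≤ 1) (a₁ a₂ a₃ : ℤ → ℤ → ℂ) (k : ℤ) :
    hb b (gop α T a₁ a₂ a₃ k) ≤ intC * duhC b * algConst b ^ 2 * ENNReal.ofReal (T ^ b) *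
      tri (fun k j l => wt (b - 1) (phase α k j l)) (fun k => hb b (a₁ k)) (fun k => hb b (a₂ k))
        (fun k => hb b (a₃ k)) k := by
  have h1 : hb b (gop α T a₁ a₂ a₃ k) ≤ ENNReal.ofReal T *
      ∑' p : ℤ × ℤ, hb b (duh (T * phase α k p.1 p.2) (trip a₁ a₂ a₃ k p)) := by
    rw [hb]
    calc _ ≤ sob b (fun n => ENNReal.ofReal T *
          ∑' p : ℤ × ℤ, ‖duh (T * phase α k p.1 p.2) (trip a₁ a₂ a₃ k p) n‖ₑ) := by
          refine sob_mono fun n => ?_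
          rw [gop, enorm_mul]
          gcongr
          · rw [← ofReal_norm, Complex.norm_real, Real.norm_of_nonneg hT.le]
          · exact enorm_tsum_le_tsum_enorm
      _ ≤ _ := by
          rw [sob_const_mul]
          gcongr
          refine le_trans (le_of_eq ?_) (l2_tsum_le _)
          rw [sob]
          congr 1; ext n
          rw [ENNReal.tsum_mul_left]
  refine h1.trans ?_
  rw [tri, ← ENNReal.tsum_mul_left, ← ENNReal.tsum_mul_left]
  refine ENNReal.tsum_le_tsum fun p => ?_
  -- Since b - 1 < 0 and ⟨TΦ⟩ ≥ T⟨Φ⟩, passing to the unscaled phase costs T^{b-1}. The surviving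
  -- factor T^b is the smallness behind the contraction.
  have h2 : ENNReal.ofReal T * wt (b - 1) (T * phase α k p.1 p.2) ≤
      ENNReal.ofReal (T ^ b) * wt (b - 1) (phase α k p.1 p.2) := by
    rw [wt, wt, ← ENNReal.ofReal_mul hT.le, ← ENNReal.ofReal_mul (by positivity)]
    refine ENNReal.ofReal_le_ofReal ?_
    calc T * jb (T * phase α k p.1 p.2) ^ (b - 1) ≤ T * (T * jb (phase α k p.1 p.2)) ^ (b - 1) := by
          gcongr ?_ * ?_
          exact Real.rpow_le_rpow_of_nonpos (mul_pos hT (jb_pos _)) (jb_mul_le hT hT1 _)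
            (by linarith)
      _ = _ := by
          rw [Real.mul_rpow hT.le (jb_pos _).le, ← mul_assoc]
          congr 1
          rw [Real.rpow_sub_one hT.ne']; field_simp
  calc _ ≤ ENNReal.ofReal T * (intC * duhC b * algConst b ^ 2 * (wt (b - 1) (T * phase α k p.1 p.2) *
      (hb b (a₁ (k + p.1)) * hb b (a₂ (k + p.1 + p.2)) * hb b (a₃ (k + p.2))))) := by
        gcongr; exact hb_duh_trip_le hb0 hb1 _ _ _ _ _ _
    _ = intC * duhC b * algConst b ^ 2 * (ENNReal.ofReal T * wt (b - 1) (T * phase α k p.1 p.2)) *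
      (hb b (a₁ (k + p.1)) * hb b (a₂ (k + p.1 + p.2)) * hb b (a₃ (k + p.2))) := by ring
    _ ≤ intC * duhC b * algConst b ^ 2 * (ENNReal.ofReal (T ^ b) * wt (b - 1) (phase α k p.1 p.2)) *
      (hb b (a₁ (k + p.1)) * hb b (a₂ (k + p.1 + p.2)) * hb b (a₃ (k + p.2))) := by gcongr
    _ = _ := by ring

variable {a₁ a₂ a₃ : ℤ → ℤ → ℂ}

omit hb1 in
lemma hb_trip_lt_top (hs : 0 ≤ s) (h₁ : xn s b a₁ < ∞) (h₂ : xn s b a₂ < ∞) (h₃ : xn s b a₃ < ∞)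
    (k : ℤ) (p : ℤ × ℤ) : hb b (trip a₁ a₂ a₃ k p) < ∞ := by
  refine (hb_trip_le (by linarith) _ _ _ _ _).trans_lt ?_
  exact ENNReal.mul_lt_top (ENNReal.pow_lt_top (algConst_lt_top hb0)) (ENNReal.mul_lt_top
    (ENNReal.mul_lt_top ((hb_le_xn hs b _ _).trans_lt h₁) ((hb_le_xn hs b _ _).trans_lt h₂))
    ((hb_le_xn hs b _ _).trans_lt h₃))

omit hb0 hb1 in
lemma tri_one_lt_top (hs : 1 / 4 < s) {X Y Z : ℤ → ℝ≥0∞} (hX : sob s X < ∞) (hY : sob s Y < ∞)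
    (hZ : sob s Z < ∞) (k : ℤ) : tri (fun _ _ _ => 1) X Y Z k < ∞ :=
  (tri_one_le (by linarith) X Y Z k).trans_lt (ENNReal.mul_lt_top (corrC_lt_top hs)
    (ENNReal.mul_lt_top (ENNReal.mul_lt_top hX hY) hZ))

variable (hs : 1 / 4 < s) (h₁ : xn s b a₁ < ∞) (h₂ : xn s b a₂ < ∞) (h₃ : xn s b a₃ < ∞)
include hs h₁ h₂ h₃

lemma summable_gop_prod (k : ℤ) (ν : ℤ × ℤ → ℝ) :
    Summable fun q : (ℤ × ℤ) × ℤ => ‖duh (ν q.1) (trip a₁ a₂ a₃ k q.1) q.2‖ := by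
  refine summable_norm_of_tsum_enorm_lt_top ?_
  rw [ENNReal.tsum_prod']
  calc _ ≤ ∑' p : ℤ × ℤ, bracketL2 b * (intC * duhC b * algConst b ^ 2 * (1 *
      (hb b (a₁ (k + p.1)) * hb b (a₂ (k + p.1 + p.2)) * hb b (a₃ (k + p.2))))) := by
        refine ENNReal.tsum_le_tsum fun p => (tsum_le_sob (b := b) (by linarith) _).trans ?_
        gcongr
        refine (hb_duh_trip_le hb0 hb1 (ν p) a₁ a₂ a₃ k p).trans ?_
        gcongr
        exact wt_le_one (by linarith) _
    _ = bracketL2 b * (intC * duhC b * algConst b ^ 2 * tri (fun _ _ _ => 1) (fun k => hb b (a₁ k))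
        (fun k => hb b (a₂ k)) (fun k => hb b (a₃ k)) k) := by
        rw [ENNReal.tsum_mul_left, ENNReal.tsum_mul_left, tri]
    _ < ∞ := ENNReal.mul_lt_top (bracketL2_lt_top hb0) (ENNReal.mul_lt_top (ENNReal.mul_lt_top
        (ENNReal.mul_lt_top intC_lt_top (duhC_lt_top hb0 hb1)) (ENNReal.pow_lt_top
          (algConst_lt_top hb0))) (tri_one_lt_top hs h₁ h₂ h₃ k))

lemma summable_gop (k n : ℤ) (ν : ℤ × ℤ → ℝ) :
    Summable fun p : ℤ × ℤ => duh (ν p) (trip a₁ a₂ a₃ k p) n := by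
  have := ((Equiv.prodComm _ _).summable_iff.mpr
    (summable_gop_prod hb0 hb1 hs h₁ h₂ h₃ k ν).of_norm).prod_factor n
  simpa [Function.comp_def] using this

omit hb1 in
lemma ser_trip (k : ℤ) (p : ℤ × ℤ) (r : ℝ) : ser (trip a₁ a₂ a₃ k p) r =
    ser (a₁ (k + p.1)) r * (starRingEnd ℂ) (ser (a₂ (k + p.1 + p.2)) r) * ser (a₃ (k + p.2)) r := by
  have e₁ := summable_norm_of_hb hb0 ((hb_le_xn (by linarith) b a₁ (k + p.1)).trans_lt h₁)
  have e₂ := summable_norm_of_hb hb0 ((hb_le_xn (by linarith) b a₂ (k + p.1 + p.2)).trans_lt h₂)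
  have e₃ := summable_norm_of_hb hb0 ((hb_le_xn (by linarith) b a₃ (k + p.2)).trans_lt h₃)
  rw [trip, ser_cv (summable_cv e₁ (summable_cj e₂)) e₃, ser_cv e₁ (summable_cj e₂), ser_cj]

omit hb1 in
lemma hasSum_integral_trip (k : ℤ) (ν : ℤ × ℤ → ℝ) (r : ℝ) :
    HasSum (fun p => ∫ r' in (0 : ℝ)..r, cis (ν p * r') * ser (trip a₁ a₂ a₃ k p) r')
      (∫ r' in (0 : ℝ)..r, ∑' p : ℤ × ℤ, cis (ν p * r') * ser (trip a₁ a₂ a₃ k p) r') := by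
  have hfin : ∀ p, bracketL2 b * hb b (trip a₁ a₂ a₃ k p) ≠ ∞ := fun p =>
    (ENNReal.mul_lt_top (bracketL2_lt_top hb0)
      (hb_trip_lt_top hb0 (by linarith) h₁ h₂ h₃ k p)).ne
  refine hasSum_integral_of_bound (B := fun p => (bracketL2 b * hb b (trip a₁ a₂ a₃ k p)).toReal)
    (fun p => ?_) (fun p t => ?_) ?_ _ _
  · exact (by fun_prop : Continuous fun r : ℝ => cis (ν p * r)).mul (continuous_ser
      (summable_norm_of_hb hb0 (hb_trip_lt_top hb0 (by linarith) h₁ h₂ h₃ k p)))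
  · rw [norm_mul, norm_cis, one_mul, ← toReal_enorm]
    exact ENNReal.toReal_mono (hfin p) (enorm_ser_le_hb (by linarith) t)
  · refine ENNReal.summable_toReal (ne_of_lt ?_)
    calc _ ≤ ∑' p : ℤ × ℤ, bracketL2 b * (algConst b ^ 2 * (1 *
      (hb b (a₁ (k + p.1)) * hb b (a₂ (k + p.1 + p.2)) * hb b (a₃ (k + p.2))))) := by
          refine ENNReal.tsum_le_tsum fun p => ?_
          gcongr
          rw [one_mul]
          exact hb_trip_le (by linarith) _ _ _ _ _
      _ = bracketL2 b * (algConst b ^ 2 * tri (fun _ _ _ => 1) (fun k => hb b (a₁ k))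
        (fun k => hb b (a₂ k)) (fun k => hb b (a₃ k)) k) := by
        rw [ENNReal.tsum_mul_left, ENNReal.tsum_mul_left, tri]
      _ < ∞ := ENNReal.mul_lt_top (bracketL2_lt_top hb0) (ENNReal.mul_lt_top (ENNReal.pow_lt_top
          (algConst_lt_top hb0)) (tri_one_lt_top hs h₁ h₂ h₃ k))

lemma ser_gop (k : ℤ) {r : ℝ} (hr : |r| ≤ 1) :
    ser (gop α T a₁ a₂ a₃ k) r = T * ∫ r' in (0 : ℝ)..r, ∑' p : ℤ × ℤ,
      cis (T * phase α k p.1 p.2 * r') * (ser (a₁ (k + p.1)) r' *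
        (starRingEnd ℂ) (ser (a₂ (k + p.1 + p.2)) r') * ser (a₃ (k + p.2)) r') := by
  simp_rw [← ser_trip hb0 hs h₁ h₂ h₃]
  rw [← (hasSum_integral_trip hb0 hs h₁ h₂ h₃ k (fun p => T * phase α k p.1 p.2) r).tsum_eq]
  simp_rw [← fun p => ser_duh hb0 hb1 (hb_trip_lt_top hb0 (by linarith) h₁ h₂ h₃ k p)
    (T * phase α k p.1 p.2) hr]
  have hsum : Summable (Function.uncurry fun (p : ℤ × ℤ) (n : ℤ) =>
      duh (T * phase α k p.1 p.2) (trip a₁ a₂ a₃ k p) n * cis (n * r)) := by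
    refine Summable.of_norm ?_
    simpa [Function.uncurry_def, norm_cis] using
      summable_gop_prod hb0 hb1 hs h₁ h₂ h₃ k (fun p => T * phase α k p.1 p.2)
  simp_rw [ser]
  rw [hsum.tsum_comm.symm, ← tsum_mul_left]
  congr 1; ext n
  rw [gop, mul_assoc, ← tsum_mul_right]

end gop

lemma cv_sub_left {f f' g : ℤ → ℂ} (hf : Summable fun n => ‖f n‖) (hf' : Summable fun n => ‖f' n‖)
    (hg : Summable fun n => ‖g n‖) : cv (f - f') g = cv f g - cv f' g := by
  ext n
  simp only [cv, Pi.sub_apply, sub_mul]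
  exact (summable_cv_term hf hg n).tsum_sub (summable_cv_term hf' hg n)

lemma cv_sub_right {f g g' : ℤ → ℂ} (hf : Summable fun n => ‖f n‖) (hg : Summable fun n => ‖g n‖)
    (hg' : Summable fun n => ‖g' n‖) : cv f (g - g') = cv f g - cv f g' := by
  ext n
  simp only [cv, Pi.sub_apply, mul_sub]
  exact (summable_cv_term hf hg n).tsum_sub (summable_cv_term hf hg' n)

lemma cj_sub (f g : ℤ → ℂ) : cj (f - g) = cj f - cj g := by ext n; simp [cj]

lemma hb_sub_le (b : ℝ) (f g : ℤ → ℂ) : hb b (f - g) ≤ hb b f + hb b g :=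
  (sob_mono fun _ => enorm_sub_le).trans (sob_add_le _ _ _)

lemma xn_sub_le (s b : ℝ) (f g : ℤ → ℤ → ℂ) : xn s b (f - g) ≤ xn s b f + xn s b g :=
  (sob_mono fun _ => hb_sub_le _ _ _).trans (sob_add_le _ _ _)

lemma hb_add_le (b : ℝ) (f g : ℤ → ℂ) : hb b (f + g) ≤ hb b f + hb b g :=
  (sob_mono fun _ => enorm_add_le _ _).trans (sob_add_le _ _ _)

lemma xn_add_le (s b : ℝ) (f g : ℤ → ℤ → ℂ) : xn s b (f + g) ≤ xn s b f + xn s b g :=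
  (sob_mono fun _ => hb_add_le _ _ _).trans (sob_add_le _ _ _)

/-- Trilinearity, replacing one slot at a time. The finite norms provide the absolute convergence
needed to subtract at each level of summation. -/
lemma gop_sub {α b s : ℝ} (T : ℝ) (hb0 : 1 / 2 < b) (hb1 : b < 1) (hs : 1 / 4 < s)
    {a c : ℤ → ℤ → ℂ} (ha : xn s b a < ∞) (hc : xn s b c < ∞) :
    gop α T a a a - gop α T c c c =
      gop α T (a - c) a a + gop α T c (a - c) a + gop α T c c (a - c) := by
  have hd : xn s b (a - c) < ∞ := (xn_sub_le s b a c).trans_lt (ENNReal.add_lt_top.mpr ⟨ha, hc⟩)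
  have hs0 : 0 ≤ s := by linarith
  have ea : ∀ k, Summable fun n => ‖a k n‖ := fun k =>
    summable_norm_of_hb hb0 ((hb_le_xn hs0 b a k).trans_lt ha)
  have ec : ∀ k, Summable fun n => ‖c k n‖ := fun k =>
    summable_norm_of_hb hb0 ((hb_le_xn hs0 b c k).trans_lt hc)
  have htrip : ∀ k p, trip a a a k p - trip c c c k p =
      trip (a - c) a a k p + trip c (a - c) a k p + trip c c (a - c) k p := by
    intro k p
    simp only [trip, Pi.sub_apply, cj_sub]
    rw [cv_sub_left (ea _) (ec _) (summable_cj (ea _)),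
      cv_sub_right (ec _) (summable_cj (ea _)) (summable_cj (ec _)),
      cv_sub_left (summable_cv (ea _) (summable_cj (ea _)))
        (summable_cv (ec _) (summable_cj (ea _))) (ea _),
      cv_sub_left (summable_cv (ec _) (summable_cj (ea _)))
        (summable_cv (ec _) (summable_cj (ec _))) (ea _),
      cv_sub_right (summable_cv (ec _) (summable_cj (ec _))) (ea _) (ec _)]
    ring
  have hduh : ∀ k p n ν, duh ν (trip a a a k p) n - duh ν (trip c c c k p) n =
      duh ν (trip (a - c) a a k p) n + duh ν (trip c (a - c) a k p) n +
        duh ν (trip c c (a - c) k p) n := by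
    intro k p n ν
    have s0 := summable_duh hb0 hb1 (hb_trip_lt_top hb0 hs0 ha ha ha k p) ν n
    have s1 := summable_duh hb0 hb1 (hb_trip_lt_top hb0 hs0 hc hc hc k p) ν n
    have s2 := summable_duh hb0 hb1 (hb_trip_lt_top hb0 hs0 hd ha ha k p) ν n
    have s3 := summable_duh hb0 hb1 (hb_trip_lt_top hb0 hs0 hc hd ha k p) ν n
    have s4 := summable_duh hb0 hb1 (hb_trip_lt_top hb0 hs0 hc hc hd k p) ν n
    simp only [duh]
    rw [← s0.tsum_sub s1, ← s2.tsum_add s3, ← (s2.add s3).tsum_add s4]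
    congr 1; ext m
    have := congrFun (htrip k p) m
    simp only [Pi.sub_apply, Pi.add_apply] at this
    rw [← mul_sub, this]; ring
  ext k n
  have s0 := summable_gop hb0 hb1 hs ha ha ha k n (fun p => T * phase α k p.1 p.2)
  have s1 := summable_gop hb0 hb1 hs hc hc hc k n (fun p => T * phase α k p.1 p.2)
  have s2 := summable_gop hb0 hb1 hs hd ha ha k n (fun p => T * phase α k p.1 p.2)
  have s3 := summable_gop hb0 hb1 hs hc hd ha k n (fun p => T * phase α k p.1 p.2)
  have s4 := summable_gop hb0 hb1 hs hc hc hd k n (fun p => T * phase α k p.1 p.2)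
  simp only [Pi.sub_apply, Pi.add_apply, gop]
  rw [← mul_sub, ← mul_add, ← mul_add, ← s0.tsum_sub s1, ← s2.tsum_add s3,
    ← (s2.add s3).tsum_add s4]
  congr 2; ext p
  exact hduh k p n _

lemma exists_xn_gop_le {α b s : ℝ} (hα : 1 / 2 < α) (hα' : α ≤ 1) (hb0 : 1 / 2 < b)
    (hb' : b < 1 - 1 / (4 * α)) (hs : 1 / 4 < s) :
    ∃ C : ℝ≥0∞, C < ∞ ∧ ∀ (T : ℝ) (a₁ a₂ a₃ : ℤ → ℤ → ℂ), 0 < T → T ≤ 1 →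
      xn s b (gop α T a₁ a₂ a₃) ≤
        C * ENNReal.ofReal (T ^ b) * (xn s b a₁ * xn s b a₂ * xn s b a₃) := by
  obtain ⟨C, hC, h⟩ := tri_phase_le hα hα' hb0 hb' hs
  have hb1 : b < 1 := by
    have : 0 < 1 / (4 * α) := by positivity
    linarith
  refine ⟨intC * duhC b * algConst b ^ 2 * C, ENNReal.mul_lt_top (ENNReal.mul_lt_top
    (ENNReal.mul_lt_top intC_lt_top (duhC_lt_top hb0 hb1)) (ENNReal.pow_lt_top
      (algConst_lt_top hb0))) hC, fun T a₁ a₂ a₃ hT hT1 => ?_⟩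
  rw [xn]
  refine (sob_mono fun k => hb_gop_le hb0 hb1 hT hT1 a₁ a₂ a₃ k).trans ?_
  rw [sob_const_mul]
  calc _ ≤ intC * duhC b * algConst b ^ 2 * ENNReal.ofReal (T ^ b) *
        (C * (xn s b a₁ * xn s b a₂ * xn s b a₃)) := by gcongr; exact h _ _ _
    _ = _ := by ring

/-! ### The contraction argument -/

lemma sob_tsum_le {ι : Type*} (s : ℝ) (X : ι → ℤ → ℝ≥0∞) :
    sob s (fun k => ∑' i, X i k) ≤ ∑' i, sob s (X i) := by
  refine le_trans (le_of_eq ?_) (l2_tsum_le _)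
  rw [sob]; congr 1; ext k; rw [ENNReal.tsum_mul_left]

lemma xn_tsum_le (s b : ℝ) (d : ℕ → ℤ → ℤ → ℂ) :
    xn s b (fun k n => ∑' i, d i k n) ≤ ∑' i, xn s b (d i) := by
  refine (sob_mono fun k => ?_).trans (sob_tsum_le s _)
  exact (sob_mono fun n => enorm_tsum_le_tsum_enorm).trans (sob_tsum_le b _)

lemma enorm_le_xn {s b : ℝ} (hs : 0 ≤ s) (hb0 : 0 ≤ b) (a : ℤ → ℤ → ℂ) (k n : ℤ) :
    ‖a k n‖ₑ ≤ xn s b a := (le_sob hb0 (fun n => ‖a k n‖ₑ) n).trans (hb_le_xn hs b a k)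

lemma xn_zero (s b : ℝ) : xn s b 0 = 0 := by simp [xn, hb, sob, l2]

lemma tendsto_half_pow_mul {x : ℝ≥0∞} (hx : x ≠ ∞) :
    Tendsto (fun N : ℕ => (2⁻¹ : ℝ≥0∞) ^ N * x) atTop (𝓝 0) := by
  have h := ENNReal.tendsto_pow_atTop_nhds_zero_of_lt_one (r := 2⁻¹) (by simp)
  simpa using ENNReal.Tendsto.mul_const h (Or.inr hx)

/-- Picard iteration from 0. The increments decay geometrically in `xn`, which dominates every entry
of an array, so the telescoping series converges entrywise; countable subadditivity of `xn` turns
this into convergence in norm. -/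
lemma exists_fixedPoint_of_halving {s b : ℝ} (hs : 0 ≤ s) (hb0 : 0 ≤ b)
    (Ψ : (ℤ → ℤ → ℂ) → ℤ → ℤ → ℂ) {ρ : ℝ≥0∞} (hρ : ρ < ∞)
    (hmap : ∀ a, xn s b a ≤ ρ → xn s b (Ψ a) ≤ ρ)
    (hlip : ∀ a c, xn s b a ≤ ρ → xn s b c ≤ ρ → xn s b (Ψ a - Ψ c) ≤ 2⁻¹ * xn s b (a - c)) :
    ∃ y, xn s b y ≤ ρ ∧ Ψ y = y := by
  set z : ℕ → ℤ → ℤ → ℂ := fun N => Ψ^[N] 0 with hz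
  have hz1 : ∀ N, z (N + 1) = Ψ (z N) := fun N => Function.iterate_succ_apply' _ _ _
  have hzρ : ∀ N, xn s b (z N) ≤ ρ := by
    intro N
    induction N with
    | zero => simp [hz, xn_zero]
    | succ N ih => rw [hz1]; exact hmap _ ih
  set d : ℕ → ℤ → ℤ → ℂ := fun i => z (i + 1) - z i with hd
  have hdle : ∀ i, xn s b (d i) ≤ 2⁻¹ ^ i * ρ := by
    intro i
    induction i with
    | zero => simpa [hd, hz] using hzρ 1
    | succ i ih =>
      calc xn s b (d (i + 1)) = xn s b (Ψ (z (i + 1)) - Ψ (z i)) := by rw [hd]; simp only [hz1]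
        _ ≤ 2⁻¹ * xn s b (d i) := hlip _ _ (hzρ _) (hzρ _)
        _ ≤ 2⁻¹ * (2⁻¹ ^ i * ρ) := by gcongr
        _ = _ := by ring
  have htail : ∀ N, ∑' i, xn s b (d (i + N)) ≤ 2⁻¹ ^ N * (2 * ρ) := by
    intro N
    calc _ ≤ ∑' i : ℕ, 2⁻¹ ^ i * (2⁻¹ ^ N * ρ) := by
          refine ENNReal.tsum_le_tsum fun i => (hdle _).trans (le_of_eq ?_)
          rw [pow_add]; ring
      _ = _ := by
          rw [ENNReal.tsum_mul_right, ENNReal.tsum_geometric, ENNReal.one_sub_inv_two, inv_inv]; ring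
  have hsum : ∀ k n, Summable fun i => d i k n := by
    intro k n
    refine (summable_norm_of_tsum_enorm_lt_top (lt_of_le_of_lt (ENNReal.tsum_le_tsum fun i =>
      enorm_le_xn hs hb0 (d i) k n) ((htail 0).trans_lt ?_))).of_norm
    exact ENNReal.mul_lt_top (by simp) (ENNReal.mul_lt_top (by simp) hρ)
  set y : ℤ → ℤ → ℂ := fun k n => ∑' i, d i k n with hy
  have hyz : ∀ N, y - z N = fun k n => ∑' i, d (i + N) k n := by
    intro N
    ext k n
    have h1 := (hsum k n).sum_add_tsum_nat_add N
    have h2 : ∑ i ∈ Finset.range N, d i k n = z N k n := by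
      have := Finset.sum_range_sub (fun i => z i k n) N
      simpa [hd, hz] using this
    simp only [Pi.sub_apply, hy]
    rw [← h1, h2, add_sub_cancel_left]
  have hconv : ∀ N, xn s b (y - z N) ≤ 2⁻¹ ^ N * (2 * ρ) := fun N => by
    rw [hyz]; exact (xn_tsum_le s b _).trans (htail N)
  have hlim := tendsto_half_pow_mul (ENNReal.mul_lt_top (by simp) hρ : 2 * ρ < ∞).ne
  have hyρ : xn s b y ≤ ρ := by
    have h1 : ∀ N, xn s b y ≤ 2⁻¹ ^ N * (2 * ρ) + ρ := by
      intro N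
      calc xn s b y = xn s b ((y - z N) + z N) := by rw [sub_add_cancel]
        _ ≤ _ := (xn_add_le s b _ _).trans (add_le_add (hconv N) (hzρ N))
    have h2 := hlim.add_const ρ
    rw [zero_add] at h2
    exact ge_of_tendsto' h2 h1
  refine ⟨y, hyρ, ?_⟩
  have hhalf : (2⁻¹ : ℝ≥0∞) ≤ 1 := by simp
  have h0 : xn s b (Ψ y - y) ≤ 0 := by
    have h1 : ∀ N, xn s b (Ψ y - y) ≤ 2⁻¹ ^ N * (2 * ρ) + 2⁻¹ ^ N * (2 * ρ) := by
      intro N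
      calc xn s b (Ψ y - y) = xn s b ((Ψ y - Ψ (z N)) - (y - z (N + 1))) := by
            rw [hz1]; congr 1; abel
        _ ≤ xn s b (Ψ y - Ψ (z N)) + xn s b (y - z (N + 1)) := xn_sub_le s b _ _
        _ ≤ 2⁻¹ * xn s b (y - z N) + 2⁻¹ ^ (N + 1) * (2 * ρ) :=
            add_le_add (hlip _ _ hyρ (hzρ N)) (hconv _)
        _ ≤ _ := by
            refine add_le_add ?_ ?_
            · exact (mul_le_of_le_one_left' hhalf).trans (hconv N)
            · rw [pow_succ', mul_assoc]
              exact mul_le_of_le_one_left' hhalf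
    have h2 := hlim.add hlim
    rw [add_zero] at h2
    exact ge_of_tendsto' h2 h1
  rw [← sub_eq_zero]
  ext k n
  have := (enorm_le_xn hs hb0 (Ψ y - y) k n).trans h0
  simpa using this

/-- The coefficient array of a function that is constant in time. -/
def dat (e : ℤ → ℂ) (k n : ℤ) : ℂ := if n = 0 then e k else 0

lemma hb_dat (b : ℝ) (e : ℤ → ℂ) (k : ℤ) : hb b (dat e k) = ‖e k‖ₑ := by
  rw [hb, sob, l2, tsum_eq_single 0]
  · rw [sq_rpow_half]; simp [dat, wt, jb_zero]
  · intro n hn; simp [dat, hn]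

lemma xn_dat (s b : ℝ) (e : ℤ → ℂ) : xn s b (dat e) = sob s fun k => ‖e k‖ₑ := by
  simp only [xn, hb_dat]

lemma ser_dat (e : ℤ → ℂ) (k : ℤ) (r : ℝ) : ser (dat e k) r = e k := by
  rw [ser, tsum_eq_single 0]
  · simp [dat, cis_zero]
  · intro n hn; simp [dat, hn]

/-- The cubic nonlinearity of the interaction profile. -/
def cubicSum (α T : ℝ) (c : ℤ → ℝ → ℂ) (k : ℤ) (r : ℝ) : ℂ :=
  ∑' p : ℤ × ℤ, cis (T * phase α k p.1 p.2 * r) *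
    (c (k + p.1) r * (starRingEnd ℂ) (c (k + p.1 + p.2) r) * c (k + p.2) r)

/-- The Picard map. -/
def picard (α T : ℝ) (θ : ℂ) (e : ℤ → ℂ) (a : ℤ → ℤ → ℂ) : ℤ → ℤ → ℂ :=
  dat e + θ • gop α T a a a

lemma hb_smul {θ : ℂ} (hθ : ‖θ‖ = 1) (b : ℝ) (g : ℤ → ℂ) : hb b (θ • g) = hb b g := by
  have : ‖θ‖ₑ = 1 := by rw [← ofReal_norm, hθ, ENNReal.ofReal_one]
  simp [hb, enorm_mul, this]

lemma xn_smul {θ : ℂ} (hθ : ‖θ‖ = 1) (s b : ℝ) (a : ℤ → ℤ → ℂ) : xn s b (θ • a) = xn s b a := by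
  simp [xn, hb_smul hθ]

lemma ser_add {f g : ℤ → ℂ} (hf : Summable fun n => ‖f n‖) (hg : Summable fun n => ‖g n‖) (r : ℝ) :
    ser (f + g) r = ser f r + ser g r := by
  rw [ser, ser, ser, ← (summable_ser hf r).tsum_add (summable_ser hg r)]
  congr 1; ext n; simp [add_mul]

lemma ser_smul (θ : ℂ) (g : ℤ → ℂ) (r : ℝ) : ser (θ • g) r = θ * ser g r := by
  rw [ser, ser, ← tsum_mul_left]; congr 1; ext n; simp [mul_assoc]

lemma ser_sub {f g : ℤ → ℂ} (hf : Summable fun n => ‖f n‖) (hg : Summable fun n => ‖g n‖) (r : ℝ) :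
    ser (f - g) r = ser f r - ser g r := by
  rw [ser, ser, ser, ← (summable_ser hf r).tsum_sub (summable_ser hg r)]
  congr 1; ext n; simp [sub_mul]

lemma abs_le_of_mem_uIcc_zero {r r' : ℝ} (h : r' ∈ Set.uIcc 0 r) : |r'| ≤ |r| := by
  have := Set.abs_sub_left_of_mem_uIcc h
  simpa using this

lemma ser_picard {α b s T : ℝ} {θ : ℂ} (hb0 : 1 / 2 < b) (hb1 : b < 1) (hs : 1 / 4 < s)
    {e : ℤ → ℂ} {a : ℤ → ℤ → ℂ} (he : sob s (fun k => ‖e k‖ₑ) < ∞) (ha : xn s b a < ∞)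
    (hg : xn s b (gop α T a a a) < ∞) (k : ℤ) {r : ℝ} (hr : |r| ≤ 1) :
    ser (picard α T θ e a k) r =
      e k + θ * (T * ∫ r' in (0 : ℝ)..r, cubicSum α T (fun k => ser (a k)) k r') := by
  have hs0 : 0 ≤ s := by linarith
  have h1 : Summable fun n => ‖dat e k n‖ := summable_norm_of_hb hb0
    ((hb_le_xn hs0 b (dat e) k).trans_lt (by rwa [xn_dat]))
  have hg' := (hb_le_xn hs0 b _ k).trans_lt hg
  have h2 : Summable fun n => ‖(θ • gop α T a a a k) n‖ := by
    simpa using (summable_norm_of_hb hb0 hg').mul_left ‖θ‖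
  have h3 : picard α T θ e a k = dat e k + θ • gop α T a a a k := rfl
  rw [h3, ser_add h1 h2, ser_dat, ser_smul, ser_gop hb0 hb1 hs ha ha ha k hr]
  rfl

/-- Local solutions on the level of coefficient arrays, and their uniqueness as functions. -/
theorem exists_local_array {α b s : ℝ} (hα : 1 / 2 < α) (hα' : α ≤ 1) (hb0 : 1 / 2 < b)
    (hb' : b < 1 - 1 / (4 * α)) (hs : 1 / 4 < s) :
    ∃ C : ℝ≥0∞, C < ∞ ∧ ∀ (T : ℝ) (θ : ℂ) (e : ℤ → ℂ) (ρ : ℝ≥0∞), 0 < T → T ≤ 1 → ‖θ‖ = 1 →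
      ρ < ∞ → sob s (fun k => ‖e k‖ₑ) + C * ENNReal.ofReal (T ^ b) * ρ ^ 3 ≤ ρ →
      3 * C * ENNReal.ofReal (T ^ b) * ρ ^ 2 ≤ 2⁻¹ →
      ∃ y, xn s b y ≤ ρ ∧ y = dat e + θ • gop α T y y y ∧
        xn s b (gop α T y y y) ≤ C * ENNReal.ofReal (T ^ b) * ρ ^ 3 ∧
        (∀ k r, |r| ≤ 1 → ser (y k) r =
          e k + θ * (T * ∫ r' in (0 : ℝ)..r, cubicSum α T (fun k => ser (y k)) k r')) ∧
        ∀ a, xn s b a ≤ ρ → (∀ k r, |r| ≤ 1 → ser (a k) r =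
          e k + θ * (T * ∫ r' in (0 : ℝ)..r, cubicSum α T (fun k => ser (a k)) k r')) →
          ∀ k r, |r| ≤ 1 → ser (a k) r = ser (y k) r := by
  obtain ⟨C, hC, hgop⟩ := exists_xn_gop_le hα hα' hb0 hb' hs
  have hb1 : b < 1 := by
    have : 0 < 1 / (4 * α) := by positivity
    linarith
  have hs0 : 0 ≤ s := by linarith
  have hbn : 0 ≤ b := by linarith
  refine ⟨C, hC, fun T θ e ρ hT hT1 hθ hρ h1 h2 => ?_⟩
  have hgρ : ∀ a, xn s b a ≤ ρ →
      xn s b (gop α T a a a) ≤ C * ENNReal.ofReal (T ^ b) * ρ ^ 3 := by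
    intro a ha
    refine (hgop T a a a hT hT1).trans ?_
    rw [pow_three, ← mul_assoc ρ]
    gcongr
  have hmap : ∀ a, xn s b a ≤ ρ → xn s b (picard α T θ e a) ≤ ρ := by
    intro a ha
    refine (xn_add_le s b _ _).trans (le_trans ?_ h1)
    rw [xn_dat, xn_smul hθ]
    exact add_le_add le_rfl (hgρ a ha)
  have hlip : ∀ a c, xn s b a ≤ ρ → xn s b c ≤ ρ →
      xn s b (picard α T θ e a - picard α T θ e c) ≤ 2⁻¹ * xn s b (a - c) := by
    intro a c ha hc
    have e1 : picard α T θ e a - picard α T θ e c = θ • (gop α T a a a - gop α T c c c) := by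
      simp only [picard, smul_sub]; abel
    rw [e1, xn_smul hθ, gop_sub T hb0 hb1 hs (ha.trans_lt hρ) (hc.trans_lt hρ)]
    refine (xn_add_le s b _ _).trans ((add_le_add (xn_add_le s b _ _) le_rfl).trans ?_)
    set D := C * ENNReal.ofReal (T ^ b)
    have g1 : xn s b (gop α T (a - c) a a) ≤ D * (xn s b (a - c) * ρ * ρ) :=
      (hgop T _ _ _ hT hT1).trans (by gcongr)
    have g2 : xn s b (gop α T c (a - c) a) ≤ D * (ρ * xn s b (a - c) * ρ) :=
      (hgop T _ _ _ hT hT1).trans (by gcongr)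
    have g3 : xn s b (gop α T c c (a - c)) ≤ D * (ρ * ρ * xn s b (a - c)) :=
      (hgop T _ _ _ hT hT1).trans (by gcongr)
    refine (add_le_add (add_le_add g1 g2) g3).trans ?_
    calc _ = 3 * C * ENNReal.ofReal (T ^ b) * ρ ^ 2 * xn s b (a - c) := by simp only [D]; ring
      _ ≤ _ := by gcongr
  obtain ⟨y, hy, hfix⟩ := exists_fixedPoint_of_halving hs0 hbn (picard α T θ e) hρ hmap hlip
  have he : sob s (fun k => ‖e k‖ₑ) < ∞ := (le_self_add.trans h1).trans_lt hρ
  have hfin : ∀ a, xn s b a ≤ ρ → xn s b (gop α T a a a) < ∞ := fun a ha =>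
    ((hgρ a ha).trans (le_add_self.trans h1)).trans_lt hρ
  refine ⟨y, hy, hfix.symm, hgρ y hy, fun k r hr => ?_, fun a ha haeq k r hr => ?_⟩
  · have := ser_picard (α := α) (T := T) (θ := θ) hb0 hb1 hs he (hy.trans_lt hρ) (hfin y hy) k hr
    rwa [hfix] at this
  -- An array solving the equation for |r| ≤ 1 need not be a fixed point, since different arrays can
  -- represent the same function there. But the Picard map does not change the represented function
  -- for |r| ≤ 1, while its iterates converge to y in norm; hence both represent the same function.
  · have hit : ∀ N, xn s b ((picard α T θ e)^[N] a) ≤ ρ ∧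
        xn s b ((picard α T θ e)^[N] a - y) ≤ 2⁻¹ ^ N * xn s b (a - y) ∧
        ∀ k r, |r| ≤ 1 → ser ((picard α T θ e)^[N] a k) r = ser (a k) r := by
      intro N
      induction N with
      | zero => exact ⟨ha, by simp, fun _ _ _ => rfl⟩
      | succ N ih =>
        obtain ⟨i1, i2, i3⟩ := ih
        rw [Function.iterate_succ_apply']
        refine ⟨hmap _ i1, ?_, fun k r hr => ?_⟩
        · have h3 := hlip _ _ i1 hy
          rw [hfix] at h3
          refine h3.trans ?_
          rw [pow_succ', mul_assoc]
          gcongr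
        · rw [ser_picard hb0 hb1 hs he (i1.trans_lt hρ) (hfin _ i1) k hr, haeq k r hr]
          congr 3
          refine intervalIntegral.integral_congr fun r' hr' => ?_
          have hr'' := (abs_le_of_mem_uIcc_zero hr').trans hr
          simp only [cubicSum, i3 _ r' hr'']
    have hsm : ∀ a, xn s b a ≤ ρ → Summable fun n => ‖a k n‖ := fun a ha =>
      summable_norm_of_hb hb0 ((hb_le_xn hs0 b a k).trans_lt (ha.trans_lt hρ))
    have hle : ∀ N : ℕ, ‖ser (a k) r - ser (y k) r‖ₑ ≤
        2⁻¹ ^ N * (bracketL2 b * xn s b (a - y)) := by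
      intro N
      obtain ⟨i1, i2, i3⟩ := hit N
      rw [← i3 k r hr, ← ser_sub (hsm _ i1) (hsm _ hy)]
      calc _ ≤ bracketL2 b * xn s b ((picard α T θ e)^[N] a - y) :=
            (enorm_ser_le_hb hbn r).trans (by
              gcongr; exact hb_le_xn hs0 b ((picard α T θ e)^[N] a - y) k)
        _ ≤ bracketL2 b * (2⁻¹ ^ N * xn s b (a - y)) := by gcongr
        _ = _ := by ring
    have hfin2 : bracketL2 b * xn s b (a - y) ≠ ∞ := (ENNReal.mul_lt_top (bracketL2_lt_top hb0)
      ((xn_sub_le s b a y).trans_lt (ENNReal.add_lt_top.mpr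
        ⟨ha.trans_lt hρ, hy.trans_lt hρ⟩))).ne
    have h0 := ge_of_tendsto' (tendsto_half_pow_mul hfin2) hle
    rw [← sub_eq_zero]
    simpa using h0

/-! ### Sobolev curves and Fourier coefficients -/

/-- The sequence of absolute values of the Fourier coefficients. -/
def fabs (f : L2) (k : ℤ) : ℝ≥0∞ := ‖fourierCoeff f k‖ₑ

lemma sobolevENorm_eq (σ : ℝ) (f : L2) : sobolevENorm σ f = sob σ (fabs f) := by
  rw [sobolevENorm, sob, l2]
  simp_rw [mul_pow, wt_eq_ofReal_one_add_sq, fabs]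

lemma memSobolev_iff {σ : ℝ} {f : L2} : MemSobolev σ f ↔ sob σ (fabs f) < ∞ := by
  rw [MemSobolev, sobolevENorm_eq]

lemma ext_fourierCoeff {f g : L2} (h : ∀ k, fourierCoeff f k = fourierCoeff g k) : f = g := by
  apply (fourierBasis (T := 2 * Real.pi)).repr.injective
  ext k
  rw [fourierBasis_repr, fourierBasis_repr, h]

lemma fourierCoeff_coe_sub (f g : L2) (k : ℤ) :
    fourierCoeff (f - g : L2) k = fourierCoeff f k - fourierCoeff g k := by
  rw [← fourierBasis_repr, ← fourierBasis_repr, ← fourierBasis_repr, map_sub]; rfl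

lemma fourierCoeff_coe_smul (c : ℂ) (f : L2) (k : ℤ) :
    fourierCoeff (c • f : L2) k = c * fourierCoeff f k := by
  rw [← fourierBasis_repr, ← fourierBasis_repr, map_smul]; rfl

open Classical in
/-- The function with given Fourier coefficients. -/
def mkL2 (c : ℤ → ℂ) : L2 :=
  if h : Memℓp c 2 then (fourierBasis (T := 2 * Real.pi)).repr.symm ⟨c, h⟩ else 0

lemma memlp_of_l2 {c : ℤ → ℂ} (hc : l2 (fun k => ‖c k‖ₑ) < ∞) : Memℓp c 2 := by
  rw [memℓp_gen_iff (by norm_num)]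
  have h1 : ∑' k, ‖‖c k‖ ^ 2‖ₑ ≠ ∞ := by
    simp_rw [enorm_pow, enorm_norm, ← l2_sq]
    exact (ENNReal.pow_lt_top hc).ne
  have h2 := tsum_enorm_ne_top_iff_summable_norm.mp h1
  simpa using h2

lemma fourierCoeff_mkL2 {c : ℤ → ℂ} (hc : l2 (fun k => ‖c k‖ₑ) < ∞) (k : ℤ) :
    fourierCoeff (mkL2 c) k = c k := by
  rw [← fourierBasis_repr, mkL2, dif_pos (memlp_of_l2 hc), LinearIsometryEquiv.apply_symm_apply]

/-- Dominated convergence in the weighted ℓ² space: continuity of each coefficient suffices once a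
majorant independent of time is available. This is why the nonlinear estimates are kept pointwise in
k. -/
lemma contSobolevOn_of_dominated {σ : ℝ} {J : Set ℝ} {u : ℝ → L2} {V : ℤ → ℝ≥0∞}
    (hV : sob σ V < ∞) (hle : ∀ t ∈ J, ∀ k, fabs (u t) k ≤ V k)
    (hc : ∀ k, ContinuousOn (fun t => fourierCoeff (u t) k) J) : ContSobolevOn σ J u := by
  refine ⟨fun t ht => memSobolev_iff.mpr ((sob_mono (hle t ht)).trans_lt hV), fun t₀ ht₀ => ?_⟩
  have h1 : Tendsto (fun t => ∫⁻ k, (wt σ (k : ℤ) * fabs (u t - u t₀) k) ^ 2 ∂Measure.count)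
      (𝓝[J] t₀) (𝓝 (∫⁻ _, 0 ∂(Measure.count : Measure ℤ))) := by
    refine tendsto_lintegral_filter_of_dominated_convergence
      (fun k : ℤ => (2 * (wt σ k * V k)) ^ 2) (Eventually.of_forall fun t => by fun_prop) ?_ ?_ ?_
    · filter_upwards [self_mem_nhdsWithin] with t ht
      refine ae_of_all _ fun k => ?_
      have : fabs (u t - u t₀) k ≤ 2 * V k := by
        rw [fabs, fourierCoeff_coe_sub, two_mul (V k)]
        exact enorm_sub_le.trans (add_le_add (hle t ht k) (hle t₀ ht₀ k))
      calc (wt σ k * fabs (u t - u t₀) k) ^ 2 ≤ (wt σ k * (2 * V k)) ^ 2 := by gcongr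
        _ = _ := by ring
    · rw [lintegral_count, ← l2_sq, l2_const_mul]
      exact (ENNReal.pow_lt_top (ENNReal.mul_lt_top (by simp) hV)).ne
    · refine ae_of_all _ fun k => ?_
      have h2 : Tendsto (fun t => fourierCoeff (u t) k - fourierCoeff (u t₀) k) (𝓝[J] t₀) (𝓝 0) := by
        have := (hc k t₀ ht₀).sub_const (fourierCoeff (u t₀) k)
        simpa using this
      have h3 := (continuous_enorm.tendsto _).comp h2
      simp only [enorm_zero] at h3
      have h4 := ENNReal.Tendsto.const_mul (a := wt σ k) h3 (Or.inr (wt_ne_top _ _))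
      rw [mul_zero] at h4
      have h5 := ((ENNReal.continuous_pow 2).tendsto _).comp h4
      simp only [fabs, fourierCoeff_coe_sub]
      simpa [Function.comp_def] using h5
  rw [lintegral_zero] at h1
  simp_rw [lintegral_count] at h1
  have h6 := (ENNReal.continuous_rpow_const (y := 1 / 2)).tendsto _ |>.comp h1
  rw [ENNReal.zero_rpow_of_pos (by norm_num)] at h6
  refine h6.congr fun t => ?_
  rw [sobolevENorm_eq]; rfl

/-- The profile of `u` relative to the center `t₀`, in time units of `T`. -/
def prof (α t₀ T : ℝ) (u : ℝ → L2) (k : ℤ) (r : ℝ) : ℂ :=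
  cis (-(r * T * symb α k)) * fourierCoeff (u (t₀ + r * T)) k

/-- Fourier coefficients of the nonlinearity. -/
def ncoef (f : L2) (k : ℤ) : ℂ := fourierCoeff (fun x : Torus => ((‖f x‖ ^ 2 : ℝ) : ℂ) * f x) k

/-- The linear phases of the three inputs, measured against that of the output, combine to e^{iTrΦ};
the rest is `fourierCoeff_cubic`. -/
lemma cubicSum_prof {α s : ℝ} (hs : 1 / 4 < s) {t₀ T r : ℝ} {u : ℝ → L2}
    (hu : sob s (fabs (u (t₀ + r * T))) < ∞) (k : ℤ) :
    cubicSum α T (prof α t₀ T u) k r = cis (-(r * T * symb α k)) * ncoef (u (t₀ + r * T)) k := by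
  rw [ncoef, fourierCoeff_cubic hs _ hu, cubicSum, ← tsum_mul_left]
  congr 1; ext p
  simp only [prof, map_mul, conj_cis, neg_neg]
  have : cis (-(r * T * symb α k)) = cis (T * phase α k p.1 p.2 * r) *
      (cis (-(r * T * symb α (k + p.1))) * cis (r * T * symb α (k + p.1 + p.2)) *
        cis (-(r * T * symb α (k + p.2)))) := by
    rw [← cis_add, ← cis_add, ← cis_add]; congr 1; rw [phase]; ring
  rw [this]; ring

lemma continuous_cubicSum {α b s : ℝ} (hb0 : 1 / 2 < b) (hs : 1 / 4 < s) (T : ℝ) {a : ℤ → ℤ → ℂ}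
    (ha : xn s b a < ∞) (k : ℤ) : Continuous (cubicSum α T (fun k => ser (a k)) k) := by
  have hs0 : 0 ≤ s := by linarith
  have hc : ∀ k, Continuous (ser (a k)) := fun k =>
    continuous_ser (summable_norm_of_hb hb0 ((hb_le_xn hs0 b a k).trans_lt ha))
  have hB : tri (fun _ _ _ => 1) (fun k => bracketL2 b * hb b (a k))
      (fun k => bracketL2 b * hb b (a k)) (fun k => bracketL2 b * hb b (a k)) k < ∞ := by
    have : sob s (fun k => bracketL2 b * hb b (a k)) < ∞ := by
      rw [sob_const_mul]; exact ENNReal.mul_lt_top (bracketL2_lt_top hb0) ha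
    exact tri_one_lt_top hs this this this k
  refine continuous_tsum (u := fun p : ℤ × ℤ => (1 * (bracketL2 b * hb b (a (k + p.1)) *
    (bracketL2 b * hb b (a (k + p.1 + p.2))) * (bracketL2 b * hb b (a (k + p.2))))).toReal)
    (fun p => ?_) (ENNReal.summable_toReal hB.ne) fun p r => ?_
  · have h1 := hc (k + p.1)
    have h2 := hc (k + p.1 + p.2)
    have h3 := hc (k + p.2)
    fun_prop
  · rw [← toReal_enorm]
    refine ENNReal.toReal_mono (ENNReal.ne_top_of_tsum_ne_top hB.ne p) ?_
    rw [enorm_mul, enorm_cis, enorm_mul, enorm_mul, ← ofReal_norm ((starRingEnd ℂ) _),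
      RCLike.norm_conj, ofReal_norm]
    gcongr <;> exact enorm_ser_le_hb (by linarith) r

/-- Translating τ by the symbol turns the X^{s,b} norm into H^b norms in time of the profiles. -/
lemma bourgainENorm_eq (α s b : ℝ) (U : ℤ → ℝ → ℂ) :
    bourgainENorm α s b U = sob s (fun k => lhb b fun σ => U k (σ + symb α k)) := by
  rw [bourgainENorm, sob, l2]
  congr 2; ext k
  rw [mul_pow, lhb_sq, wt_eq_ofReal_one_add_sq, ← lintegral_const_mul' _ _ ENNReal.ofReal_ne_top,
    ← lintegral_add_right_eq_self _ (symb α k)]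
  refine lintegral_congr fun σ => ?_
  rw [add_sub_cancel_right, ENNReal.ofReal_mul (by positivity), mul_pow, wt_eq_ofReal_one_add_sq,
    mul_assoc]

/-- Extensions in `X^{s,b}` give coefficient arrays around every center. -/
lemma exists_array_of_extension {b : ℝ} (hb0 : 1 / 2 < b) (hb1 : b < 1) (s : ℝ) (hs : 0 ≤ s) :
    ∃ M : ℝ≥0∞, M < ∞ ∧ ∀ (α T T' t₀ : ℝ) (u : ℝ → L2) (U : ℤ → ℝ → ℂ), 0 < T' → T' ≤ 1 →
      IsExtension T u U → bourgainENorm α s b U < ∞ →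
      ∃ a, xn s b a ≤ M * bourgainENorm α s b U ∧
        ∀ k r, |r| ≤ 1 → |t₀ + r * T'| ≤ T → ser (a k) r = prof α t₀ T' u k r := by
  obtain ⟨M, hM, h⟩ := exists_hb_discr_le hb0 hb1
  refine ⟨M, hM, fun α T T' t₀ u U hT' hT'1 hU hfin => ?_⟩
  -- The unimodular factor recentres time at t₀ without changing the norm, so the same constant
  -- serves every centre.
  set C : ℤ → ℝ → ℂ := fun k σ => cis (t₀ * (σ + symb α k)) * U k (σ + symb α k) with hC
  have hmp : ∀ c : ℝ, MeasurePreserving (fun σ : ℝ => σ + c) volume volume := fun c =>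
    measurePreserving_add_right volume c
  have hCm : ∀ k, AEStronglyMeasurable (C k) volume := fun k =>
    (by fun_prop : Continuous fun σ : ℝ => cis (t₀ * (σ + symb α k))).aestronglyMeasurable.mul
      ((hU.1 k).comp_measurePreserving (hmp _))
  have hCn : ∀ k, lhb b (C k) = lhb b fun σ => U k (σ + symb α k) := by
    intro k; simp only [lhb, hC, enorm_mul, enorm_cis, one_mul]
  have hxn : sob s (fun k => lhb b (C k)) = bourgainENorm α s b U := by
    simp_rw [hCn]; rw [bourgainENorm_eq]
  refine ⟨fun k => discr T' (C k), ?_, fun k r hr hrT => ?_⟩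
  · rw [← hxn, ← sob_const_mul]
    exact sob_mono fun k => h T' (C k) hT' hT'1 (hCm k)
  · have hlt : lhb b (C k) < ∞ := (le_sob hs (fun k => lhb b (C k)) k).trans_lt (by rwa [hxn])
    rw [ser_discr (integrable_of_lhb hb0 (hCm k) hlt) hr]
    rw [prof, hU.2 _ (abs_le.mp hrT) k]
    have e1 := integral_add_right_eq_self (μ := volume)
      (fun τ => cis (r * T' * (τ - symb α k)) * (cis (t₀ * τ) * U k τ)) (symb α k)
    simp only [add_sub_cancel_right] at e1
    simp only [hC]
    rw [e1, ← integral_const_mul]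
    congr 1; ext τ
    change _ = cis _ * (cis ((t₀ + r * T') * τ) * U k τ)
    rw [← mul_assoc, ← mul_assoc, ← cis_add, ← cis_add]
    congr 2; ring

lemma exists_array_of_extension_of_le {b : ℝ} (hb0 : 1 / 2 < b) (hb1 : b < 1) (s : ℝ)
    (hs : 0 ≤ s) :
    ∃ M : ℝ≥0∞, M < ∞ ∧ ∀ (α T T' t₀ : ℝ) (u : ℝ → L2) (U : ℤ → ℝ → ℂ), 0 < T' → T' ≤ 1 →
      |t₀| + T' ≤ T → IsExtension T u U → bourgainENorm α s b U < ∞ →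
      ∃ a, xn s b a ≤ M * bourgainENorm α s b U ∧
        ∀ k r, |r| ≤ 1 → ser (a k) r = prof α t₀ T' u k r := by
  obtain ⟨M, hM, h⟩ := exists_array_of_extension hb0 hb1 s hs
  refine ⟨M, hM, fun α T T' t₀ u U hT' hT'1 htT hU hfin => ?_⟩
  obtain ⟨a, ha, har⟩ := h α T T' t₀ u U hT' hT'1 hU hfin
  refine ⟨a, ha, fun k r hr => har k r hr ?_⟩
  refine (abs_add_le _ _).trans (le_trans ?_ htT)
  rw [abs_mul, abs_of_pos hT']
  nlinarith

/-! ### Solutions and their profiles -/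

lemma exists_extension {α s b T : ℝ} {u : ℝ → L2} {R : ℝ≥0∞} (h : bourgainENormOn α s b T u < R) :
    ∃ U, IsExtension T u U ∧ bourgainENorm α s b U < R := by
  rw [bourgainENormOn] at h
  obtain ⟨U, hU⟩ := iInf_lt_iff.mp h
  obtain ⟨hU1, hU2⟩ := iInf_lt_iff.mp hU
  exact ⟨U, hU1, hU2⟩

section profile
variable {α s b ε T : ℝ} {u₀ : L2} {u : ℝ → L2}

lemma IsSolution.sob_lt_top (h : IsSolution α s b ε T u₀ u) {t : ℝ} (ht : t ∈ Set.Icc (-T) T) :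
    sob s (fabs (u t)) < ∞ := memSobolev_iff.mp (h.cont.1 t ht)

lemma IsSolution.duhamel_profile (h : IsSolution α s b ε T u₀ u) {t : ℝ}
    (ht : t ∈ Set.Icc (-T) T) (k : ℤ) :
    cis (-(t * symb α k)) * fourierCoeff (u t) k = fourierCoeff u₀ k +
      -(Complex.I * ε) * ∫ t' in (0 : ℝ)..t, cis (-(t' * symb α k)) * ncoef (u t') k := by
  rw [h.duhamel t ht k]
  change cis (-(t * symb α k)) * (cis (t * symb α k) * fourierCoeff u₀ k - Complex.I * ε *
    ∫ t' in (0 : ℝ)..t, cis ((t - t') * symb α k) * ncoef (u t') k) = _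
  have e1 : ∫ t' in (0 : ℝ)..t, cis ((t - t') * symb α k) * ncoef (u t') k =
      cis (t * symb α k) * ∫ t' in (0 : ℝ)..t, cis (-(t' * symb α k)) * ncoef (u t') k := by
    rw [← intervalIntegral.integral_const_mul]
    congr 1; ext t'
    rw [← mul_assoc, ← cis_add]; congr 2; ring
  have e2 : cis (-(t * symb α k)) * cis (t * symb α k) = 1 := by
    rw [mul_comm, cis_mul_cis_neg]
  rw [e1]
  linear_combination (fourierCoeff u₀ k - Complex.I * ε *
    ∫ t' in (0 : ℝ)..t, cis (-(t' * symb α k)) * ncoef (u t') k) * e2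

variable (hs : 1 / 4 < s) (hb0 : 1 / 2 < b) (hT : 0 < T)
include hs hb0 hT

/-- The trilinear sum of the series of an array converges uniformly, so it is continuous in time.
This supplies the integrability without which the Duhamel integrals could not be split at an
intermediate time. -/
lemma IsSolution.continuousOn_ncoef (h : IsSolution α s b ε T u₀ u) {a : ℤ → ℤ → ℂ}
    (ha : xn s b a < ∞) (har : ∀ k r, |r| ≤ 1 → ser (a k) r = prof α 0 T u k r) (k : ℤ) :
    ContinuousOn (fun t => cis (-(t * symb α k)) * ncoef (u t) k) (Set.Icc (-T) T) := by
  have hc : Continuous fun t => cubicSum α T (fun k => ser (a k)) k (t / T) :=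
    (continuous_cubicSum hb0 hs T ha k).comp (by fun_prop)
  refine hc.continuousOn.congr fun t ht => ?_
  have htT : 0 + t / T * T = t := by field_simp; ring
  have hr : |t / T| ≤ 1 := by
    rw [abs_div, abs_of_pos hT, div_le_one hT]; exact abs_le.mpr ht
  have h1 := cubicSum_prof (α := α) hs (t₀ := 0) (T := T) (r := t / T) (u := u)
    (by rw [htT]; exact h.sob_lt_top ht) k
  rw [htT, show t / T * T = t by field_simp] at h1
  simp only
  rw [← h1]
  simp only [cubicSum, har _ _ hr]

variable (hb1 : b < 1) (hT1 : T ≤ 1)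
include hb1 hT1

lemma IsSolution.intervalIntegrable_ncoef (h : IsSolution α s b ε T u₀ u) (k : ℤ) {t t' : ℝ}
    (ht : t ∈ Set.Icc (-T) T) (ht' : t' ∈ Set.Icc (-T) T) :
    IntervalIntegrable (fun t => cis (-(t * symb α k)) * ncoef (u t) k) volume t t' := by
  obtain ⟨M, hM, hex⟩ := exists_array_of_extension_of_le hb0 hb1 s (by linarith)
  obtain ⟨U, hU, hUt⟩ := exists_extension h.mem_bourgain
  obtain ⟨a, ha, har⟩ := hex α T T 0 u U hT hT1 (by simp) hU hUt
  have := h.continuousOn_ncoef hs hb0 hT (ha.trans_lt (ENNReal.mul_lt_top hM hUt)) har k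
  refine (this.mono ?_).intervalIntegrable
  exact Set.uIcc_subset_Icc ht ht'

/-- Restarts the Duhamel formula at t₀: the formulas at t₀ and at t₀ + rT' are subtracted, and time
is rescaled by T'. -/
lemma IsSolution.prof_eq (h : IsSolution α s b ε T u₀ u) {t₀ T' : ℝ} (hT' : 0 < T')
    (htT : |t₀| + T' ≤ T) (k : ℤ) {r : ℝ} (hr : |r| ≤ 1) :
    prof α t₀ T' u k r = fourierCoeff (u t₀) k +
      -(Complex.I * ε) * (T' * ∫ r' in (0 : ℝ)..r, cubicSum α T' (prof α t₀ T' u) k r') := by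
  have hmem : ∀ r, |r| ≤ 1 → t₀ + r * T' ∈ Set.Icc (-T) T := by
    intro r hr
    rw [Set.mem_Icc, ← abs_le]
    refine (abs_add_le _ _).trans (le_trans ?_ htT)
    rw [abs_mul, abs_of_pos hT']
    nlinarith
  have ht₀ : t₀ ∈ Set.Icc (-T) T := by simpa using hmem 0 (by simp)
  have h0 : (0 : ℝ) ∈ Set.Icc (-T) T := ⟨by linarith, by linarith⟩
  set F := fun t => cis (-(t * symb α k)) * ncoef (u t) k with hF
  have e1 := h.duhamel_profile (hmem r hr) k
  have e2 := h.duhamel_profile ht₀ k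
  have e3 := intervalIntegral.integral_add_adjacent_intervals
    (h.intervalIntegrable_ncoef hs hb0 hT hb1 hT1 k h0 ht₀)
    (h.intervalIntegrable_ncoef hs hb0 hT hb1 hT1 k ht₀ (hmem r hr))
  have e4 : cis (t₀ * symb α k) * ∫ t in t₀..t₀ + r * T', F t =
      T' * ∫ r' in (0 : ℝ)..r, cubicSum α T' (prof α t₀ T' u) k r' := by
    have e5 := intervalIntegral.smul_integral_comp_add_mul (a := 0) (b := r) F T' t₀
    rw [mul_zero, add_zero, mul_comm T' r] at e5
    rw [← e5, Complex.real_smul, mul_left_comm, ← intervalIntegral.integral_const_mul]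
    congr 1
    refine intervalIntegral.integral_congr fun r' hr' => ?_
    have hr'' := (abs_le_of_mem_uIcc_zero hr').trans hr
    rw [cubicSum_prof hs (h.sob_lt_top (hmem r' hr'')) k, hF, mul_comm T' r']
    simp only
    rw [← mul_assoc, ← cis_add]; congr 2; ring
  have e6 : cis (t₀ * symb α k) * cis (-(t₀ * symb α k)) = 1 := cis_mul_cis_neg _
  have e7 : cis (-(r * T' * symb α k)) =
      cis (t₀ * symb α k) * cis (-((t₀ + r * T') * symb α k)) := by
    rw [← cis_add]; congr 1; ring
  rw [prof, e7, ← e4]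
  linear_combination cis (t₀ * symb α k) * e1 + fourierCoeff (u t₀) k * e6 -
    cis (t₀ * symb α k) * e2 - (-(Complex.I * ε)) * cis (t₀ * symb α k) * e3

end profile

lemma norm_neg_I_mul {ε : ℝ} (hε : ε = 1 ∨ ε = -1) : ‖-(Complex.I * (ε : ℂ))‖ = 1 := by
  rcases hε with rfl | rfl <;> simp

lemma exists_div_rpow_mul_le {b : ℝ} (hb : 0 < b) (T : ℝ) {q : ℝ≥0∞} (hq : q < ∞) :
    ∃ n : ℕ, 0 < n ∧ ENNReal.ofReal ((T / n) ^ b) * q ≤ 1 := by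
  have h1 : Tendsto (fun n : ℕ => (T / n) ^ b) atTop (𝓝 0) := by
    have := (tendsto_const_div_atTop_nhds_zero_nat T).rpow_const (p := b) (Or.inr hb.le)
    rwa [Real.zero_rpow hb.ne'] at this
  have h2 := ENNReal.Tendsto.mul_const (b := q) (ENNReal.tendsto_ofReal h1) (Or.inr hq.ne)
  rw [ENNReal.ofReal_zero, zero_mul] at h2
  have h3 := h2.eventually (gt_mem_nhds zero_lt_one)
  obtain ⟨n, hn, hn0⟩ := (h3.and (eventually_gt_atTop 0)).exists
  exact ⟨n, hn0, hn.le⟩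

/-- Two solutions have finite but arbitrary X^{s,b} size, so the contraction is available only on
short intervals. Both give arrays of norm at most ρ₀ around every centre, with ρ₀ independent of the
step T', so T/n with one large n works throughout and agreement is propagated step by step. -/
theorem IsSolution.eqOn {α s b ε T : ℝ} {u₀ : L2} {u v : ℝ → L2} (hα : 1 / 2 < α) (hα' : α ≤ 1)
    (hb0 : 1 / 2 < b) (hb' : b < 1 - 1 / (4 * α)) (hs : 1 / 4 < s) (hε : ε = 1 ∨ ε = -1)
    (hT : 0 < T) (hT1 : T ≤ 1) (hu : IsSolution α s b ε T u₀ u) (hv : IsSolution α s b ε T u₀ v) :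
    Set.EqOn u v (Set.Icc (-T) T) := by
  have hb1 : b < 1 := by
    have : 0 < 1 / (4 * α) := by positivity
    linarith
  have hs0 : 0 ≤ s := by linarith
  obtain ⟨C, hC, hloc⟩ := exists_local_array hα hα' hb0 hb' hs
  obtain ⟨M, hM, hex⟩ := exists_array_of_extension_of_le hb0 hb1 s hs0
  obtain ⟨U, hU, hUt⟩ := exists_extension hu.mem_bourgain
  obtain ⟨V, hV, hVt⟩ := exists_extension hv.mem_bourgain
  set ρ₀ := M * (bourgainENorm α s b U + bourgainENorm α s b V) with hρ₀
  have hρ₀t : ρ₀ < ∞ := ENNReal.mul_lt_top hM (ENNReal.add_lt_top.mpr ⟨hUt, hVt⟩)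
  -- The summand `bracketL2 b * ρ₀` bounds the data at any intermediate time, ρ₀ puts both arrays in
  -- the ball, and 1 leaves room for the cubic term.
  set ρ := (bracketL2 b + 1) * ρ₀ + 1 with hρ
  have hρt : ρ < ∞ := ENNReal.add_lt_top.mpr ⟨ENNReal.mul_lt_top (ENNReal.add_lt_top.mpr
    ⟨bracketL2_lt_top hb0, by simp⟩) hρ₀t, by simp⟩
  obtain ⟨n, hn, hnq⟩ := exists_div_rpow_mul_le (b := b) (by linarith) T
    (q := C * ρ ^ 3 + 2 * (3 * C * ρ ^ 2)) (by
      refine ENNReal.add_lt_top.mpr ⟨ENNReal.mul_lt_top hC (ENNReal.pow_lt_top hρt),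
        ENNReal.mul_lt_top (by simp) (ENNReal.mul_lt_top (ENNReal.mul_lt_top (by simp) hC)
          (ENNReal.pow_lt_top hρt))⟩)
  set T' := T / n with hT'
  have hn' : (0 : ℝ) < n := by exact_mod_cast hn
  have hT'0 : 0 < T' := by positivity
  have hT'1 : T' ≤ 1 := (div_le_self hT.le (by exact_mod_cast hn)).trans hT1
  have hnT : n * T' = T := by rw [hT']; field_simp
  have q1 : C * ENNReal.ofReal (T' ^ b) * ρ ^ 3 ≤ 1 :=
    le_trans (by rw [mul_add]; refine le_trans (le_of_eq ?_) le_self_add; ring) hnq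
  have q2 : 3 * C * ENNReal.ofReal (T' ^ b) * ρ ^ 2 ≤ 2⁻¹ := by
    rw [← ENNReal.mul_le_mul_iff_right (a := 2) (by simp) (by simp),
      ENNReal.mul_inv_cancel (by simp) (by simp)]
    exact le_trans (by rw [mul_add]; refine le_trans (le_of_eq ?_) le_add_self; ring) hnq
  have key : ∀ t₀, |t₀| + T' ≤ T → u t₀ = v t₀ → ∀ r, |r| ≤ 1 →
      u (t₀ + r * T') = v (t₀ + r * T') := by
    intro t₀ ht₀ heq r hr
    obtain ⟨a, ha, har⟩ := hex α T T' t₀ u U hT'0 hT'1 ht₀ hU hUt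
    obtain ⟨c, hc, hcr⟩ := hex α T T' t₀ v V hT'0 hT'1 ht₀ hV hVt
    have ha' : xn s b a ≤ ρ₀ := ha.trans (by rw [hρ₀]; gcongr; exact le_self_add)
    have hc' : xn s b c ≤ ρ₀ := hc.trans (by rw [hρ₀]; gcongr; exact le_add_self)
    have hρρ : ρ₀ ≤ ρ := by
      rw [hρ, add_mul, one_mul]; exact le_add_self.trans le_self_add
    have he : sob s (fun k => ‖fourierCoeff (u t₀) k‖ₑ) ≤ bracketL2 b * ρ₀ := by
      calc _ ≤ sob s (fun k => bracketL2 b * hb b (a k)) := by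
            refine sob_mono fun k => ?_
            have h1 := har k 0 (by simp)
            simp only [prof, zero_mul, neg_zero, cis_zero, one_mul, add_zero] at h1
            rw [← h1]
            exact enorm_ser_le_hb (by linarith) 0
        _ ≤ _ := by rw [sob_const_mul]; gcongr; exact ha'
    obtain ⟨y, -, -, -, -, hyu⟩ := hloc T' (-(Complex.I * ε)) (fun k => fourierCoeff (u t₀) k) ρ
      hT'0 hT'1 (norm_neg_I_mul hε) hρt (by
        refine (add_le_add he q1).trans ?_
        rw [hρ, add_mul]
        gcongr
        exact le_self_add) q2
    have hsol : ∀ (w : ℝ → L2) (a : ℤ → ℤ → ℂ), IsSolution α s b ε T u₀ w → w t₀ = u t₀ →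
        (∀ k r, |r| ≤ 1 → ser (a k) r = prof α t₀ T' w k r) → ∀ k r, |r| ≤ 1 → ser (a k) r =
          fourierCoeff (u t₀) k + -(Complex.I * ε) *
            (T' * ∫ r' in (0 : ℝ)..r, cubicSum α T' (fun k => ser (a k)) k r') := by
      intro w a hw hwu har k r hr
      rw [har k r hr, hw.prof_eq hs hb0 hT hb1 hT1 hT'0 ht₀ k hr, hwu]
      congr 3
      refine intervalIntegral.integral_congr fun r' hr' => ?_
      have hr'' := (abs_le_of_mem_uIcc_zero hr').trans hr
      simp only [cubicSum, har _ r' hr'']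
    have h1 := hyu a (ha'.trans hρρ) (hsol u a hu rfl har)
    have h2 := hyu c (hc'.trans hρρ) (hsol v c hv heq.symm hcr)
    refine ext_fourierCoeff fun k => ?_
    have h3 := (har k r hr).symm.trans ((h1 k r hr).trans ((h2 k r hr).symm.trans (hcr k r hr)))
    exact mul_left_cancel₀ (cis_ne_zero _) h3
  -- Each step extends the interval of agreement by T' on both sides, restarting at its two
  -- endpoints.
  have march : ∀ j : ℕ, j ≤ n → ∀ t, |t| ≤ j * T' → u t = v t := by
    intro j
    induction j with
    | zero =>
      intro _ t ht
      have : t = 0 := by simpa using ht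
      rw [this, hu.init, hv.init]
    | succ j ih =>
      intro hj t ht
      push_cast at ht
      have ih' := ih (by omega)
      have hj' : (j : ℝ) * T' + T' ≤ T := by
        rw [← hnT, ← add_one_mul]
        gcongr
        exact_mod_cast hj
      rcases le_or_gt |t| (j * T') with h1 | h1
      · exact ih' t h1
      have hjT : |(j : ℝ) * T'| = j * T' := abs_of_nonneg (by positivity)
      rcases le_total 0 t with h0 | h0
      · rw [abs_of_nonneg h0] at ht h1
        have h2 := key (j * T') (by rwa [hjT]) (ih' _ hjT.le) ((t - j * T') / T') (by
          rw [abs_of_nonneg (div_nonneg (by linarith) hT'0.le), div_le_one hT'0]; linarith)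
        rwa [div_mul_cancel₀ _ hT'0.ne', add_sub_cancel] at h2
      · rw [abs_of_nonpos h0] at ht h1
        have h2 := key (-(j * T')) (by rwa [abs_neg, hjT]) (ih' _ (by rw [abs_neg, hjT]))
          ((t + j * T') / T') (by
            rw [abs_of_nonpos (div_nonpos_of_nonpos_of_nonneg (by linarith) hT'0.le), ← neg_div,
              div_le_one hT'0]
            linarith)
        rwa [div_mul_cancel₀ _ hT'0.ne', neg_add_eq_sub, add_sub_cancel_right] at h2
  intro t ht
  exact march n le_rfl t (by rw [hnT]; exact abs_le.mpr ht)

/-! ### Local existence -/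

lemma lhb_add_le (b : ℝ) {f g : ℝ → ℂ} (hf : AEStronglyMeasurable f) :
    lhb b (fun σ => f σ + g σ) ≤ 2 * (lhb b f + lhb b g) := by
  refine le_of_sq_le_sq ?_
  rw [lhb_sq]
  have hsq : ∀ x y : ℝ≥0∞, (x + y) ^ 2 ≤ 4 * x ^ 2 + 4 * y ^ 2 := by
    intro x y
    rcases le_total x y with h | h
    · calc (x + y) ^ 2 ≤ (y + y) ^ 2 := by gcongr
        _ = 4 * y ^ 2 := by ring
        _ ≤ _ := le_add_self
    · calc (x + y) ^ 2 ≤ (x + x) ^ 2 := by gcongr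
        _ = 4 * x ^ 2 := by ring
        _ ≤ _ := le_self_add
  calc ∫⁻ σ, (wt b σ * ‖f σ + g σ‖ₑ) ^ 2 ≤
      ∫⁻ σ, (4 * (wt b σ * ‖f σ‖ₑ) ^ 2 + 4 * (wt b σ * ‖g σ‖ₑ) ^ 2) := by
        refine lintegral_mono fun σ => le_trans ?_ (hsq _ _)
        rw [← mul_add]
        gcongr
        exact enorm_add_le _ _
    _ = 4 * lhb b f ^ 2 + 4 * lhb b g ^ 2 := by
        rw [lintegral_add_left', lintegral_const_mul' _ _ (by simp),
          lintegral_const_mul' _ _ (by simp), lhb_sq, lhb_sq]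
        exact (((measurable_wt _).aemeasurable.mul hf.enorm).pow_const _).const_mul _
    _ ≤ (2 * (lhb b f + lhb b g)) ^ 2 := by
        calc _ ≤ 4 * lhb b f ^ 2 + 4 * lhb b g ^ 2 + 8 * (lhb b f * lhb b g) := le_self_add
          _ = _ := by ring

lemma integral_cis_mul_comp_sub (f : ℝ → ℂ) (t g : ℝ) :
    ∫ τ, cis (t * τ) * f (τ - g) = cis (t * g) * ∫ τ, cis (t * τ) * f τ := by
  have e := integral_sub_right_eq_self (μ := volume) (fun τ => cis (t * (τ + g)) * f τ) g
  simp only [sub_add_cancel] at e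
  rw [e, ← integral_const_mul]
  congr 1; ext τ
  rw [mul_add, cis_add]; ring

/-- The fixed point array defines û(k,t) for every t, and the linear phase is restored at the end.
The norm bound separates data and Duhamel term, since only the latter may carry the factor
T^{1/2-b}. -/
theorem exists_isSolution {α s b ε : ℝ} (hα : 1 / 2 < α) (hα' : α ≤ 1)
    (hb0 : 1 / 2 < b) (hb' : b < 1 - 1 / (4 * α)) (hs : 1 / 4 < s) (hε : ε = 1 ∨ ε = -1) :
    ∃ C M : ℝ≥0∞, C < ∞ ∧ M < ∞ ∧ ∀ (T : ℝ) (u₀ : L2) (ρ : ℝ≥0∞), 0 < T → T ≤ 1 → ρ < ∞ →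
      sob s (fabs u₀) + C * ENNReal.ofReal (T ^ b) * ρ ^ 3 ≤ ρ →
      3 * C * ENNReal.ofReal (T ^ b) * ρ ^ 2 ≤ 2⁻¹ →
      ∃ u, IsSolution α s b ε T u₀ u ∧ bourgainENormOn α s b T u ≤
        M * (sob s (fabs u₀) + ENNReal.ofReal (T ^ (1 / 2 - b)) *
          (C * ENNReal.ofReal (T ^ b) * ρ ^ 3)) := by
  have hb1 : b < 1 := by
    have : 0 < 1 / (4 * α) := by positivity
    linarith
  have hs0 : 0 ≤ s := by linarith
  obtain ⟨C, hC, hloc⟩ := exists_local_array hα hα' hb0 hb' hs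
  obtain ⟨M, hM, hund⟩ := exists_lhb_undiscr_le (b := b) (by linarith) hb1
  refine ⟨C, 2 * M, hC, ENNReal.mul_lt_top (by simp) hM, fun T u₀ ρ hT hT1 hρ h1 h2 => ?_⟩
  set θ : ℂ := -(Complex.I * ε) with hθ
  have hθ1 : ‖θ‖ = 1 := norm_neg_I_mul hε
  set e : ℤ → ℂ := fun k => fourierCoeff u₀ k with he
  obtain ⟨y, hy, hyeq, hyg, hyser, -⟩ := hloc T θ e ρ hT hT1 hθ1 hρ h1 h2
  have hyt : xn s b y < ∞ := hy.trans_lt hρ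
  have hsum : ∀ k, Summable fun n => ‖y k n‖ := fun k =>
    summable_norm_of_hb hb0 ((hb_le_xn hs0 b y k).trans_lt hyt)
  set V : ℤ → ℝ≥0∞ := fun k => bracketL2 b * hb b (y k) with hV
  have hVt : sob s V < ∞ := by
    rw [hV, sob_const_mul]; exact ENNReal.mul_lt_top (bracketL2_lt_top hb0) hyt
  set u : ℝ → L2 := fun t => mkL2 fun k => cis (t * symb α k) * ser (y k) (t / T) with hu
  have hcle : ∀ t k, ‖cis (t * symb α k) * ser (y k) (t / T)‖ₑ ≤ V k := by
    intro t k
    rw [enorm_mul, enorm_cis, one_mul]; exact enorm_ser_le_hb (by linarith) _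
  have hcoef : ∀ t k, fourierCoeff (u t) k = cis (t * symb α k) * ser (y k) (t / T) := by
    intro t k
    rw [hu]
    exact fourierCoeff_mkL2 (c := fun k => cis (t * symb α k) * ser (y k) (t / T))
      ((l2_mono (hcle t)).trans_lt ((l2_le_sob hs0 V).trans_lt hVt)) k
  have hfabs : ∀ t k, fabs (u t) k ≤ V k := fun t k => by
    rw [fabs, hcoef]; exact hcle t k
  have hprof : ∀ k r, prof α 0 T u k r = ser (y k) r := by
    intro k r
    rw [prof, hcoef, zero_add, mul_div_cancel_right₀ _ hT.ne', ← mul_assoc, mul_comm (cis _) (cis _),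
      cis_mul_cis_neg, one_mul]
  have hserT : ∀ k t, t ∈ Set.Icc (-T) T → ser (y k) (t / T) =
      e k + θ * ∫ t' in (0 : ℝ)..t, cis (-(t' * symb α k)) * ncoef (u t') k := by
    intro k t ht
    have hr : |t / T| ≤ 1 := by
      rw [abs_div, abs_of_pos hT, div_le_one hT]; exact abs_le.mpr ht
    rw [hyser k _ hr]
    congr 2
    have e5 := intervalIntegral.smul_integral_comp_mul_right (a := 0) (b := t / T)
      (fun t' => cis (-(t' * symb α k)) * ncoef (u t') k) T
    rw [zero_mul, div_mul_cancel₀ _ hT.ne'] at e5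
    rw [← e5, Complex.real_smul]
    congr 2; ext r'
    have e6 := cubicSum_prof (α := α) hs (t₀ := 0) (T := T) (r := r') (u := u)
      ((sob_mono (hfabs _)).trans_lt hVt) k
    rw [zero_add] at e6
    rw [← e6]
    simp only [cubicSum, hprof]
  have hXn : bourgainENormOn α s b T u ≤ 2 * M * (sob s (fabs u₀) +
      ENNReal.ofReal (T ^ (1 / 2 - b)) * (C * ENNReal.ofReal (T ^ b) * ρ ^ 3)) := by
    set g : ℤ → ℤ → ℂ := θ • gop α T y y y with hg
    have hgn : xn s b g ≤ C * ENNReal.ofReal (T ^ b) * ρ ^ 3 := by rw [hg, xn_smul hθ1]; exact hyg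
    have hgt : xn s b g < ∞ := hgn.trans_lt ((le_add_self.trans h1).trans_lt hρ)
    have hdt : xn s b (dat e) < ∞ := by
      rw [xn_dat]; exact (le_self_add.trans h1).trans_lt hρ
    have hgs : ∀ k, Summable fun n => ‖g k n‖ := fun k =>
      summable_norm_of_hb hb0 ((hb_le_xn hs0 b g k).trans_lt hgt)
    have hds : ∀ k, Summable fun n => ‖dat e k n‖ := fun k =>
      summable_norm_of_hb hb0 ((hb_le_xn hs0 b (dat e) k).trans_lt hdt)
    have hl1 : ∀ k, lhb b (undiscr 1 (dat e k)) ≤ M * hb b (dat e k) := fun k => by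
      simpa using hund 1 (dat e k) one_pos le_rfl
    have hl2 : ∀ k, lhb b (undiscr T (g k)) ≤ M * ENNReal.ofReal (T ^ (1 / 2 - b)) * hb b (g k) :=
      fun k => hund T (g k) hT hT1
    have hi1 : ∀ k, Integrable (undiscr 1 (dat e k)) := fun k =>
      integrable_of_lhb hb0 (measurable_undiscr _ _).aestronglyMeasurable ((hl1 k).trans_lt
        (ENNReal.mul_lt_top hM ((hb_le_xn hs0 b (dat e) k).trans_lt hdt)))
    have hi2 : ∀ k, Integrable (undiscr T (g k)) := fun k =>
      integrable_of_lhb hb0 (measurable_undiscr _ _).aestronglyMeasurable ((hl2 k).trans_lt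
        (ENNReal.mul_lt_top (ENNReal.mul_lt_top hM ENNReal.ofReal_lt_top)
          ((hb_le_xn hs0 b g k).trans_lt hgt)))
    have hcis : ∀ (t : ℝ) {f : ℝ → ℂ}, Integrable f → Integrable fun τ => cis (t * τ) * f τ := by
      intro t f hf
      exact hf.bdd_mul (c := 1) (by fun_prop : Continuous fun τ : ℝ => cis (t * τ)).aestronglyMeasurable
        (ae_of_all _ fun τ => (norm_cis _).le)
    -- The data are extended with time unit 1, which costs no power of T. The Duhamel part is
    -- extended with unit T, where T^{1/2-b} meets the factor T^b from the trilinear bound.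
    set W : ℤ → ℝ → ℂ := fun k σ => undiscr 1 (dat e k) σ + undiscr T (g k) σ with hW
    set U : ℤ → ℝ → ℂ := fun k τ => W k (τ - symb α k) with hU
    have hext : IsExtension T u U := by
      refine ⟨fun k => ?_, fun t ht k => ?_⟩
      · exact (((measurable_undiscr _ _).add (measurable_undiscr _ _)).comp
          (measurable_id.sub_const _)).aestronglyMeasurable
      · change _ = ∫ τ, cis (t * τ) * W k (τ - symb α k)
        rw [integral_cis_mul_comp_sub (W k), hcoef]
        congr 1
        simp only [hW, mul_add]
        rw [integral_add (hcis t (hi1 k)) (hcis t (hi2 k)),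
          integral_undiscr one_pos (hds k) ((abs_le.mpr ht).trans hT1),
          integral_undiscr hT (hgs k) (abs_le.mpr ht)]
        have : y k = dat e k + g k := congrFun hyeq k
        rw [this, ser_add (hds k) (hgs k), ser_dat, ser_dat]
    refine (iInf₂_le U hext).trans ?_
    rw [bourgainENorm_eq]
    simp only [hU, add_sub_cancel_right]
    calc sob s (fun k => lhb b (W k)) ≤ sob s (fun k => 2 * M * (hb b (dat e k) +
          ENNReal.ofReal (T ^ (1 / 2 - b)) * hb b (g k))) := by
          refine sob_mono fun k => ?_
          calc lhb b (W k) ≤ 2 * (M * hb b (dat e k) +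
                M * ENNReal.ofReal (T ^ (1 / 2 - b)) * hb b (g k)) :=
                (lhb_add_le b (measurable_undiscr _ _).aestronglyMeasurable).trans
                  (by gcongr; exacts [hl1 k, hl2 k])
            _ = _ := by ring
      _ ≤ _ := by
          rw [sob_const_mul]
          gcongr
          refine (sob_add_le _ _ _).trans ?_
          rw [sob_const_mul]
          gcongr
          · exact (xn_dat s b e).le
          · exact hgn
  refine ⟨u, ⟨?_, ?_, ?_, ?_⟩, hXn⟩
  · refine ext_fourierCoeff fun k => ?_
    have := hserT k 0 ⟨by linarith, hT.le⟩
    rw [hcoef, this]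
    simp [cis_zero, he]
  · refine contSobolevOn_of_dominated hVt (fun t _ => hfabs t) fun k => ?_
    simp_rw [hcoef]
    have := continuous_ser (hsum k)
    exact (by fun_prop : Continuous fun t => cis (t * symb α k) * ser (y k) (t / T)).continuousOn
  · refine hXn.trans_lt (ENNReal.mul_lt_top (ENNReal.mul_lt_top (by simp) hM)
      (ENNReal.add_lt_top.mpr ⟨(le_self_add.trans h1).trans_lt hρ, ENNReal.mul_lt_top
        ENNReal.ofReal_lt_top ((le_add_self.trans h1).trans_lt hρ)⟩))
  · intro t ht k
    rw [hcoef, hserT k t ht]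
    change _ = cis (t * symb α k) * e k - Complex.I * ε *
      ∫ t' in (0 : ℝ)..t, cis ((t - t') * symb α k) * ncoef (u t') k
    have e1 : ∫ t' in (0 : ℝ)..t, cis ((t - t') * symb α k) * ncoef (u t') k =
        cis (t * symb α k) * ∫ t' in (0 : ℝ)..t, cis (-(t' * symb α k)) * ncoef (u t') k := by
      rw [← intervalIntegral.integral_const_mul]
      congr 1; ext t'
      rw [← mul_assoc, ← cis_add]; congr 2; ring
    rw [e1, hθ]; ring

theorem exists_localExistenceTime {α s b ε : ℝ} (hα : 1 / 2 < α) (hα' : α ≤ 1)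
    (hb0 : 1 / 2 < b) (hb' : b < 1 - 1 / (4 * α)) (hs : 1 / 4 < s) (hε : ε = 1 ∨ ε = -1) :
    ∃ (K : ℝ) (τ : ℝ → ℝ), Antitone τ ∧ ∀ u₀ : L2, MemSobolev s u₀ →
      IsLocalExistenceTime α s b ε K u₀ (τ (sobolevNorm s u₀)) := by
  obtain ⟨C, M, hC, hM, hex⟩ := exists_isSolution (ε := ε) hα hα' hb0 hb' hs hε
  lift C to NNReal using hC.ne
  lift M to NNReal using hM.ne
  set q : ℝ := 1 + 24 * C with hq
  have hC0 : (0 : ℝ) ≤ C := C.2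
  have hq1 : 1 ≤ q := by rw [hq]; linarith
  -- With T = w² one has T^b ≤ T^{1/2} = w, and in the ball of radius 2N the contraction conditions
  -- reduce to 24 C w N² ≤ 1; this explains q. The truncation `max x 0` keeps the function antitone
  -- on all of ℝ.
  set τ : ℝ → ℝ := fun x => (q⁻¹ / (1 + max x 0) ^ 2) ^ 2 with hτ
  refine ⟨2 * M, τ, fun x y hxy => ?_, fun u₀ hu₀ => ?_⟩
  · have : max x 0 ≤ max y 0 := max_le_max_right 0 hxy
    have h0 : 0 ≤ max x 0 := le_max_right _ _
    simp only [hτ]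
    gcongr
  set N := sobolevNorm s u₀ with hN
  have hN0 : 0 ≤ N := ENNReal.toReal_nonneg
  have hNe : sob s (fabs u₀) = ENNReal.ofReal N := by
    rw [hN, sobolevNorm, ENNReal.ofReal_toReal hu₀.ne, sobolevENorm_eq]
  set w : ℝ := q⁻¹ / (1 + N) ^ 2 with hw
  have hw0 : 0 < w := by positivity
  have hτN : τ N = w ^ 2 := by simp only [hτ, hw, max_eq_left hN0]
  have hw1 : w ≤ 1 := by
    rw [hw, div_le_one (by positivity)]
    exact (inv_le_one_of_one_le₀ hq1).trans (by nlinarith)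
  have hT0 : 0 < w ^ 2 := by positivity
  have hT1 : w ^ 2 ≤ 1 := by nlinarith
  have hTb : (w ^ 2) ^ b ≤ w := by
    calc (w ^ 2) ^ b ≤ (w ^ 2) ^ (1 / 2 : ℝ) :=
          Real.rpow_le_rpow_of_exponent_ge hT0 hT1 hb0.le
      _ = w := by rw [← Real.sqrt_eq_rpow, Real.sqrt_sq hw0.le]
  have hCw : 24 * (C * w) * N ^ 2 ≤ 1 := by
    have h1 : w * (1 + N) ^ 2 = q⁻¹ := by rw [hw]; field_simp
    have h2 : 24 * C * q⁻¹ ≤ 1 := by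
      rw [← div_eq_mul_inv, div_le_one (by linarith)]; linarith
    have h3 : w * N ^ 2 ≤ q⁻¹ := by rw [← h1]; gcongr; linarith
    calc 24 * (C * w) * N ^ 2 = 24 * C * (w * N ^ 2) := by ring
      _ ≤ 24 * C * q⁻¹ := by gcongr
      _ ≤ 1 := h2
  have hCe : (C : ℝ≥0∞) = ENNReal.ofReal C := (ENNReal.ofReal_coe_nnreal).symm
  have hMe : (M : ℝ≥0∞) = ENNReal.ofReal M := (ENNReal.ofReal_coe_nnreal).symm
  have hcube : (C : ℝ≥0∞) * ENNReal.ofReal ((w ^ 2) ^ b) * ENNReal.ofReal (2 * N) ^ 3 ≤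
      ENNReal.ofReal N := by
    rw [hCe, ← ENNReal.ofReal_mul hC0, ← ENNReal.ofReal_pow (by positivity),
      ← ENNReal.ofReal_mul (by positivity)]
    refine ENNReal.ofReal_le_ofReal ?_
    calc C * (w ^ 2) ^ b * (2 * N) ^ 3 ≤ C * w * (2 * N) ^ 3 := by gcongr
      _ = 8 * (C * w) * N ^ 2 * N := by ring
      _ ≤ 1 * N := by gcongr; nlinarith [mul_nonneg (mul_nonneg hC0 hw0.le) (sq_nonneg N)]
      _ = N := one_mul N
  obtain ⟨u, hu, hub⟩ := hex (w ^ 2) u₀ (ENNReal.ofReal (2 * N)) hT0 hT1 ENNReal.ofReal_lt_top (by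
      rw [hNe, two_mul, ENNReal.ofReal_add hN0 hN0, ← ENNReal.ofReal_add hN0 hN0, ← two_mul]
      calc _ ≤ ENNReal.ofReal N + ENNReal.ofReal N := by gcongr
        _ = _ := by rw [← ENNReal.ofReal_add hN0 hN0, two_mul]) (by
      rw [hCe, ← ENNReal.ofReal_pow (by positivity), ← ENNReal.ofReal_ofNat,
        ← ENNReal.ofReal_mul (by norm_num), ← ENNReal.ofReal_mul (by positivity),
        ← ENNReal.ofReal_mul (by positivity), ← ENNReal.ofReal_ofNat,
        ← ENNReal.ofReal_inv_of_pos (by norm_num)]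
      refine ENNReal.ofReal_le_ofReal ?_
      calc 3 * C * (w ^ 2) ^ b * (2 * N) ^ 2 ≤ 3 * C * w * (2 * N) ^ 2 := by gcongr
        _ = 12 * (C * w) * N ^ 2 := by ring
        _ ≤ 2⁻¹ := by norm_num; linarith)
  rw [hτN]
  refine ⟨hT0, hT1, u, hu, hub.trans ?_, fun v hv =>
    hv.eqOn hα hα' hb0 hb' hs hε hT0 hT1 hu⟩
  have h5 : ENNReal.ofReal ((w ^ 2) ^ (1 / 2 - b)) *
      ((C : ℝ≥0∞) * ENNReal.ofReal ((w ^ 2) ^ b) * ENNReal.ofReal (2 * N) ^ 3) ≤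
      ENNReal.ofReal N := by
    rw [hCe, ← ENNReal.ofReal_mul hC0, ← ENNReal.ofReal_pow (by positivity),
      ← ENNReal.ofReal_mul (by positivity), ← ENNReal.ofReal_mul (by positivity)]
    refine ENNReal.ofReal_le_ofReal ?_
    -- The net power T^{1/2} of the Duhamel part is why K can be taken independent of the size of
    -- the data.
    have h6 : (w ^ 2) ^ (1 / 2 - b) * (w ^ 2) ^ b = w := by
      rw [← Real.rpow_add hT0, sub_add_cancel, ← Real.sqrt_eq_rpow, Real.sqrt_sq hw0.le]
    calc (w ^ 2) ^ (1 / 2 - b) * (C * (w ^ 2) ^ b * (2 * N) ^ 3) =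
        8 * (C * ((w ^ 2) ^ (1 / 2 - b) * (w ^ 2) ^ b)) * N ^ 2 * N := by ring
      _ ≤ 1 * N := by
          rw [h6]; gcongr; nlinarith [mul_nonneg (mul_nonneg hC0 hw0.le) (sq_nonneg N)]
      _ = N := one_mul N
  calc _ ≤ (M : ℝ≥0∞) * (ENNReal.ofReal N + ENNReal.ofReal N) := by rw [hNe]; gcongr
    _ = _ := by
        rw [← ENNReal.ofReal_add hN0 hN0, hMe, ← ENNReal.ofReal_mul M.coe_nonneg]
        congr 1; ring

/-! ### Norm estimates for the smoothing effect -/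

lemma l2_corr_shift_le (f x : ℤ → ℝ≥0∞) :
    l2 (fun k => ∑' j, f j * x (k + j)) ≤ (∑' j, f j) * l2 x := by
  refine (l2_tsum_le (fun j k => f j * x (k + j))).trans ?_
  rw [← ENNReal.tsum_mul_right]
  refine ENNReal.tsum_le_tsum fun j => ?_
  rw [l2_const_mul, ← l2_equiv (Equiv.addRight j) x]
  rfl

lemma jb_le_two_mul_of_abs_le {x y : ℝ} (h : |x| ≤ 2 * |y|) : jb x ≤ 2 * jb y := by
  refine Real.sqrt_le_iff.mpr ⟨by linarith [jb_pos y], ?_⟩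
  rw [mul_pow, jb_sq]
  nlinarith [abs_nonneg x, abs_nonneg y, sq_abs x, sq_abs y]

/-- With M and ⟨l⟩ comparable to ⟨k⟩, the bound M^{2-2α}⟨j⟩^{-1}⟨l⟩^{-1} becomes ⟨j⟩^{-1}⟨k⟩^{1-2α}.
Dividing by Φ therefore gains the full 2α - 1 derivatives. -/
lemma exists_hll_phase_inv_le {α : ℝ} (hα : 1 / 2 < α) (hα' : α ≤ 1) :
    ∃ D : ℝ, 0 < D ∧ ∀ k j l : ℤ, IsHLL k j l →
      |phase α k j l|⁻¹ ≤ D * (jb j ^ (-1 : ℝ) * jb k ^ (-(2 * α - 1))) := by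
  have hc : 0 < α * (2 * α - 1) := by nlinarith
  refine ⟨2 / (α * (2 * α - 1)) * (4 ^ (2 - 2 * α) * 2), by positivity, fun k j l h => ?_⟩
  obtain ⟨h1, h2, h3, -, -, h6⟩ := h.bounds
  refine (jb_phase_inv_le hα hα' h.1 h.2.1).trans ?_
  rw [mul_assoc]
  gcongr
  have pk := jb_pos k
  have pj := jb_pos j
  have pl := jb_pos l
  have b1 : jb (k : ℝ) ≤ 2 * jb l := jb_le_two_mul_of_abs_le h2
  have b2 : jb (l : ℝ) ≤ 2 * jb k := jb_le_two_mul_of_abs_le h3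
  have b3 : jb (j : ℝ) ≤ jb k := jb_le_of_abs_le h6
  have hM : freqMax k j l ^ (2 - 2 * α) ≤ 4 ^ (2 - 2 * α) * jb k ^ (2 - 2 * α) := by
    rw [← Real.mul_rpow (by norm_num) pk.le]
    refine Real.rpow_le_rpow (freqMax_pos _ _ _).le ?_ (by linarith)
    unfold freqMax; linarith
  have hl : jb (l : ℝ) ^ (-1 : ℝ) ≤ 2 * jb k ^ (-1 : ℝ) := by
    rw [Real.rpow_neg_one, Real.rpow_neg_one, ← div_eq_mul_inv, inv_eq_one_div,
      div_le_div_iff₀ pl pk]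
    linarith
  have p1 := jb_rpow_pos j (-1)
  have p2 := jb_rpow_pos l (-1)
  have p3 := jb_rpow_pos k (2 - 2 * α)
  calc kerBound (2 - 2 * α) k j l ≤ (4 ^ (2 - 2 * α) * jb k ^ (2 - 2 * α)) * jb j ^ (-1 : ℝ) *
        (2 * jb k ^ (-1 : ℝ)) := by
        unfold kerBound
        gcongr
    _ = _ := by
        rw [show -(2 * α - 1) = (2 - 2 * α) + -1 by ring, Real.rpow_add pk]; ring

open Classical in
/-- The kernel `|Φ|^{-1}` on the high-low-low interactions. -/
def hllInv (α : ℝ) (k j l : ℤ) : ℝ≥0∞ :=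
  if IsHLL k j l then ENNReal.ofReal |phase α k j l|⁻¹ else 0

open Classical in
/-- The kernel `⟨Φ⟩^{-1/2}` on the high-low-low interactions. -/
def hllHalf (α : ℝ) (k j l : ℤ) : ℝ≥0∞ :=
  if IsHLL k j l then wt (-(1 / 2)) (phase α k j l) else 0

open Classical in
/-- The kernel `⟨Φ⟩^{-1/2}` on the balanced interactions. -/
def balHalf (α : ℝ) (k j l : ℤ) : ℝ≥0∞ :=
  if IsBalanced k j l then wt (-(1 / 2)) (phase α k j l) else 0

/-- The kernel `⟨Φ⟩^{-1/2}` on the nonresonant interactions. -/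
def nrHalf (α : ℝ) (k j l : ℤ) : ℝ≥0∞ :=
  if j ≠ 0 ∧ l ≠ 0 then wt (-(1 / 2)) (phase α k j l) else 0

/-- Once the powers of ⟨k⟩ are spent, the kernel depends on j alone. Summing over l for fixed j
gives the correlation of the two low inputs at j, and what remains is a convolution of an ℓ¹ with an
ℓ² sequence. The low inputs need no individual norm, so one of them may be the rough `cubMaj`. -/
lemma exists_tri_hllInv_le {α s : ℝ} (hα : 1 / 2 < α) (hα' : α ≤ 1) (hs : 0 ≤ s) :
    ∃ C : ℝ≥0∞, C < ∞ ∧ ∀ X Y Z : ℤ → ℝ≥0∞,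
      sob (s + (2 * α - 1)) (tri (hllInv α) X Y Z) ≤
        C * ((∑' j : ℤ, wt (-1) j * corr Z Y j) * sob s X) := by
  obtain ⟨D, hD, hph⟩ := exists_hll_phase_inv_le hα hα'
  set E := ENNReal.ofReal D * ENNReal.ofReal (2 ^ s) with hE
  refine ⟨E, ENNReal.mul_lt_top ENNReal.ofReal_lt_top ENNReal.ofReal_lt_top, fun X Y Z => ?_⟩
  set x := fun k : ℤ => wt s k * X k with hx
  have key : ∀ k : ℤ, wt (s + (2 * α - 1)) k * tri (hllInv α) X Y Z k ≤
      E * ∑' j : ℤ, (fun j : ℤ => wt (-1) j * corr Z Y j) j * x (k + j) := by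
    intro k
    calc _ ≤ ∑' p : ℤ × ℤ, E * ((wt (-1) (p.1 : ℝ) * x (k + p.1)) *
          (Z (k + p.2) * Y (k + p.2 + p.1))) := by
          rw [tri, ← ENNReal.tsum_mul_left]
          refine ENNReal.tsum_le_tsum fun p => ?_
          rw [hllInv]
          split_ifs with hp
          · have q1 : ENNReal.ofReal |phase α k p.1 p.2|⁻¹ ≤
                ENNReal.ofReal D * (wt (-1) (p.1 : ℝ) * wt (-(2 * α - 1)) k) := by
              rw [wt, wt, ← ENNReal.ofReal_mul (jb_rpow_pos _ _).le, ← ENNReal.ofReal_mul hD.le]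
              exact ENNReal.ofReal_le_ofReal (hph k p.1 p.2 hp)
            have q2 : wt s k ≤ ENNReal.ofReal (2 ^ s) * wt s ((k + p.1 : ℤ) : ℝ) := by
              rw [wt, wt, ← ENNReal.ofReal_mul (by positivity), ← Real.mul_rpow (by norm_num)
                (jb_pos _).le]
              refine ENNReal.ofReal_le_ofReal (Real.rpow_le_rpow (jb_pos _).le ?_ hs)
              push_cast
              exact jb_le_two_mul_of_abs_le hp.bounds.2.2.2.1
            calc _ ≤ wt (s + (2 * α - 1)) k * (ENNReal.ofReal D * (wt (-1) (p.1 : ℝ) *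
                  wt (-(2 * α - 1)) k) * (X (k + p.1) * Y (k + p.1 + p.2) * Z (k + p.2))) := by
                  gcongr
              _ = wt s k * (wt (2 * α - 1) k * wt (-(2 * α - 1)) k) * (ENNReal.ofReal D *
                  wt (-1) (p.1 : ℝ) * (X (k + p.1) * Y (k + p.1 + p.2) * Z (k + p.2))) := by
                  rw [wt_add]; ring
              _ ≤ (ENNReal.ofReal (2 ^ s) * wt s ((k + p.1 : ℤ) : ℝ)) * (ENNReal.ofReal D *
                  wt (-1) (p.1 : ℝ) * (X (k + p.1) * Y (k + p.1 + p.2) * Z (k + p.2))) := by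
                  rw [wt_mul_wt_neg, mul_one]; gcongr
              _ = _ := by rw [hE, hx, add_right_comm k p.1 p.2]; ring
          · simp
      _ = _ := by
          rw [ENNReal.tsum_mul_left, ENNReal.tsum_prod']
          congr 2; ext j
          simp only
          rw [ENNReal.tsum_mul_left, tsum_int_shift (fun m => Z m * Y (m + j)) k, ← corr]
          ring
  refine (l2_mono key).trans ?_
  rw [l2_const_mul]
  gcongr
  exact l2_corr_shift_le (fun j : ℤ => wt (-1) j * corr Z Y j) x

lemma corr_comm (X Y : ℤ → ℝ≥0∞) (l : ℤ) : corr X Y l = corr Y X (-l) := by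
  rw [corr, corr, ← tsum_int_shift' (fun p => Y p * X (p + -l)) l]
  congr 1; ext p
  rw [add_neg_cancel_right, mul_comm]

lemma tsum_wt_corr_comm (X Y : ℤ → ℝ≥0∞) :
    ∑' j : ℤ, wt (-1) j * corr X Y j = ∑' j : ℤ, wt (-1) j * corr Y X j := by
  rw [← (Equiv.neg ℤ).tsum_eq]
  congr 1; ext j
  simp only [Equiv.neg_apply, Int.cast_neg, wt_neg_right]
  rw [corr_comm, neg_neg]

/-- Peetre's inequality for l = (p + l) - p moves the weight ⟨l⟩^δ to both factors, leaving
regularity s - δ for the ℓ² bound. -/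
lemma sob_corr_le {s δ : ℝ} (hδ : 0 ≤ δ) (hsδ : δ ≤ s) (A : ℤ → ℝ≥0∞) :
    sob δ (corr A A) ≤ ENNReal.ofReal (2 ^ δ) * corrC (s - δ) * sob s A ^ 2 := by
  set x := fun k : ℤ => wt δ k * A k with hx
  have hxs : sob (s - δ) x = sob s A := by
    rw [sob, sob]; congr 1; ext k
    rw [hx, ← mul_assoc, ← wt_add, sub_add_cancel]
  have h1 : ∀ l : ℤ, wt δ l * corr A A l ≤ ENNReal.ofReal (2 ^ δ) * corr x x l := by
    intro l
    rw [corr, corr, ← ENNReal.tsum_mul_left, ← ENNReal.tsum_mul_left]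
    refine ENNReal.tsum_le_tsum fun p => ?_
    have h2 := wt_add_le δ (-(p : ℝ)) ((p + l : ℤ) : ℝ)
    rw [abs_of_nonneg hδ, wt_neg_right] at h2
    push_cast at h2
    rw [neg_add_cancel_left] at h2
    calc wt δ l * (A p * A (p + l)) ≤ (ENNReal.ofReal (2 ^ δ) * wt δ p * wt δ ((p : ℝ) + l)) *
          (A p * A (p + l)) := by gcongr
      _ = _ := by rw [hx]; push_cast; ring
  refine (l2_mono h1).trans ?_
  rw [l2_const_mul, mul_assoc]
  gcongr
  refine (l2_corr_le (σ := s - δ) (by linarith) x x).trans (le_of_eq ?_)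
  rw [hxs, sq]

/-- The cubic majorant. -/
def cubMaj (A : ℤ → ℝ≥0∞) : ℤ → ℝ≥0∞ := tri (fun _ _ _ => 1) A A A

/-- Regrouping the four factors in pairs shows that A correlated with its cubic majorant is the
autocorrelation of A correlated with itself. No bound for the majorant alone is required. -/
lemma corr_cubMaj (A : ℤ → ℝ≥0∞) (j : ℤ) :
    corr A (cubMaj A) j = ∑' l, corr A A l * corr A A (j + l) := by
  rw [corr]
  simp_rw [cubMaj, tri_one_eq, ← ENNReal.tsum_mul_left]
  rw [ENNReal.tsum_comm]
  congr 1; ext l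
  rw [show corr A A (j + l) = ∑' p, A p * A (p + (j + l)) from rfl, ← ENNReal.tsum_mul_left]
  congr 1; ext p
  rw [add_assoc]; ring

lemma tsum_wt_corr_le (A : ℤ → ℝ≥0∞) :
    ∑' j : ℤ, wt (-1) j * corr A A j ≤ bracketL2 1 * l2 (corr A A) := by
  refine (tsum_mul_le_l2 _ _).trans ?_
  gcongr
  simpa using l2_wt_neg_add_le (b := 1) (by norm_num) 0

/-- The correlation of two ℓ² sequences is only bounded, and ⟨j⟩^{-1} just fails to be summable. A
little regularity δ of the autocorrelation improves the weight to ⟨j⟩^{-(1+δ)}. -/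
lemma tsum_wt_corr_cubMaj_le {δ : ℝ} (hδ : 0 ≤ δ) (A : ℤ → ℝ≥0∞) :
    ∑' j : ℤ, wt (-1) j * corr A (cubMaj A) j ≤
      ENNReal.ofReal (2 ^ δ) * bracketSum (1 + δ) * sob δ (corr A A) ^ 2 := by
  set x := fun k : ℤ => wt δ k * corr A A k with hx
  have h1 : ∀ j : ℤ, wt (-1) j * corr A (cubMaj A) j ≤
      ENNReal.ofReal (2 ^ δ) * (wt (-(1 + δ)) j * sob δ (corr A A) ^ 2) := by
    intro j
    rw [corr_cubMaj]
    calc wt (-1) j * ∑' l, corr A A l * corr A A (j + l)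
        ≤ ENNReal.ofReal (2 ^ δ) * (wt (-(1 + δ)) j * ∑' l, x l * x (j + l)) := by
          rw [← ENNReal.tsum_mul_left, ← ENNReal.tsum_mul_left, ← ENNReal.tsum_mul_left]
          refine ENNReal.tsum_le_tsum fun l => ?_
          have h2 := wt_add_le δ ((j + l : ℤ) : ℝ) (-(l : ℝ))
          rw [abs_of_nonneg hδ, wt_neg_right] at h2
          push_cast at h2
          rw [add_neg_cancel_right] at h2
          calc wt (-1) j * (corr A A l * corr A A (j + l))
              = wt (-(1 + δ)) j * wt δ j * (corr A A l * corr A A (j + l)) := by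
                rw [← wt_add]; congr 2; ring
            _ ≤ wt (-(1 + δ)) j * (ENNReal.ofReal (2 ^ δ) * wt δ ((j : ℝ) + l) * wt δ l) *
                (corr A A l * corr A A (j + l)) := by gcongr
            _ = _ := by rw [hx]; push_cast; ring
      _ ≤ _ := by
          gcongr
          refine (tsum_mul_le_l2 _ _).trans (le_of_eq ?_)
          rw [sq, sob]
          congr 1
          exact l2_equiv (Equiv.addLeft j) x
  refine (ENNReal.tsum_le_tsum h1).trans ?_
  rw [ENNReal.tsum_mul_left, ENNReal.tsum_mul_right, mul_assoc]
  gcongr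
  exact tsum_wt_int_le (by linarith)

/-- The majorant of the time derivative after one normal form step. -/
def smoothMaj (α : ℝ) (A : ℤ → ℝ≥0∞) (k : ℤ) : ℝ≥0∞ := tri (nrHalf α) A A A k + A k ^ 3

/-- The majorant of the high-low-low part. -/
def hllMaj (α : ℝ) (P : ℝ≥0∞) (A : ℤ → ℝ≥0∞) (k : ℤ) : ℝ≥0∞ :=
  (1 + P) * tri (hllInv α) A A A k + tri (hllInv α) A (cubMaj A) A k +
    tri (hllInv α) A A (cubMaj A) k + tri (hllHalf α) (smoothMaj α A) A A k

/-- The majorant of the nonlinear part. -/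
def nlMaj (α : ℝ) (P : ℝ≥0∞) (A : ℤ → ℝ≥0∞) (k : ℤ) : ℝ≥0∞ :=
  (1 + P) * tri (balHalf α) A A A k + 2 * hllMaj α P A k + A k ^ 3

/-- Distributing ⟨k⟩^{3s} over the three factors, two of them are bounded by the norm and the third
is summed. -/
lemma sob_cube_le {s σ : ℝ} (hσ : σ ≤ 3 * s) (A : ℤ → ℝ≥0∞) :
    sob σ (fun k => A k ^ 3) ≤ sob s A ^ 3 := by
  calc sob σ (fun k => A k ^ 3) ≤ sob (3 * s) (fun k => A k ^ 3) := sob_le_sob hσ _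
    _ ≤ l2 (fun k : ℤ => sob s A ^ 2 * (wt s k * A k)) := by
        refine l2_mono fun k => ?_
        calc wt (3 * s) k * A k ^ 3 = (wt s k * A k) ^ 2 * (wt s k * A k) := by
              rw [show 3 * s = s + (s + s) by ring, wt_add, wt_add]; ring
          _ ≤ _ := by gcongr; exact wt_mul_le_sob s A k
    _ = sob s A ^ 2 * sob s A := l2_const_mul _ _
    _ = _ := by ring

lemma exists_sob_hllMaj_le {α s : ℝ} (hα : 1 / 2 < α) (hα' : α ≤ 1) (hs : 1 / 4 < s) :
    ∃ C : ℝ≥0∞, C < ∞ ∧ ∀ (P : ℝ≥0∞) (A : ℤ → ℝ≥0∞),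
      sob (s + (2 * α - 1)) (hllMaj α P A) ≤ C * ((1 + P) * sob s A ^ 3 + sob s A ^ 5) := by
  have hs0 : 0 ≤ s := by linarith
  -- Half of the room above 1/4 is spent, so that both δ > 0 and s - δ > 1/4.
  set δ := (s - 1 / 4) / 2 with hδ
  have hδ0 : 0 < δ := by rw [hδ]; linarith
  have hδs : δ ≤ s := by rw [hδ]; linarith
  obtain ⟨C₁, hC₁, h₁⟩ := exists_tri_hllInv_le hα hα' hs0
  -- A gain of α - 1/2 starting from regularity s + α - 1/2. The next estimate puts `smoothMaj` at
  -- that level, and the two half gains add up to 2α - 1.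
  obtain ⟨C₂, hC₂, h₂⟩ := tri_hll_le (ρ := 2 - 2 * α) (g := α - 1 / 2) (s := s) (by linarith)
    (by linarith) hs (s + (α - 1 / 2)) (2 / (α * (2 * α - 1)))
  -- The extreme case 2a + ρ = 1; the exponent relation then gives η = 2s - 1/2, positive exactly
  -- for s > 1/4.
  obtain ⟨C₃, hC₃, h₃⟩ := tri_nonresonant_le (ρ := 2 - 2 * α) (a := α - 1 / 2) (s := s)
    (η := 2 * s - 1 / 2) (by linarith) (by linarith) hs (by linarith) (by linarith) (by ring)
    (by linarith) (2 / (α * (2 * α - 1)))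
  set E₁ := bracketL2 1 * corrC s with hE₁
  set E₂ := ENNReal.ofReal (2 ^ δ) * bracketSum (1 + δ) *
    (ENNReal.ofReal (2 ^ δ) * corrC (s - δ)) ^ 2 with hE₂
  have hE₁t : E₁ < ∞ := ENNReal.mul_lt_top (bracketL2_lt_top (by norm_num)) (corrC_lt_top hs)
  have hE₂t : E₂ < ∞ := ENNReal.mul_lt_top (ENNReal.mul_lt_top ENNReal.ofReal_lt_top
    (bracketSum_lt_top (by linarith))) (ENNReal.pow_lt_top (ENNReal.mul_lt_top
      ENNReal.ofReal_lt_top (corrC_lt_top (by rw [hδ]; linarith))))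
  refine ⟨C₁ * E₁ + (2 * (C₁ * E₂) + C₂ * (C₃ + 1)), ?_, fun P A => ?_⟩
  · exact ENNReal.add_lt_top.mpr ⟨ENNReal.mul_lt_top hC₁ hE₁t, ENNReal.add_lt_top.mpr
      ⟨ENNReal.mul_lt_top (by simp) (ENNReal.mul_lt_top hC₁ hE₂t), ENNReal.mul_lt_top hC₂
        (ENNReal.add_lt_top.mpr ⟨hC₃, by simp⟩)⟩⟩
  set N := sob s A with hN
  have b1 : sob (s + (2 * α - 1)) (tri (hllInv α) A A A) ≤ C₁ * E₁ * N ^ 3 := by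
    refine (h₁ A A A).trans ?_
    calc _ ≤ C₁ * ((bracketL2 1 * (corrC s * (N * N))) * N) := by
          gcongr
          refine (tsum_wt_corr_le A).trans ?_
          gcongr
          exact l2_corr_le hs0 A A
      _ = _ := by rw [hE₁]; ring
  have c2 : ∑' j : ℤ, wt (-1) j * corr A (cubMaj A) j ≤ E₂ * N ^ 4 := by
    refine (tsum_wt_corr_cubMaj_le hδ0.le A).trans ?_
    calc _ ≤ ENNReal.ofReal (2 ^ δ) * bracketSum (1 + δ) *
          (ENNReal.ofReal (2 ^ δ) * corrC (s - δ) * N ^ 2) ^ 2 := by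
          gcongr; exact sob_corr_le hδ0.le hδs A
      _ = _ := by rw [hE₂]; ring
  have b2 : sob (s + (2 * α - 1)) (tri (hllInv α) A (cubMaj A) A) ≤ C₁ * E₂ * N ^ 5 := by
    refine (h₁ A (cubMaj A) A).trans ?_
    calc _ ≤ C₁ * ((E₂ * N ^ 4) * N) := by gcongr
      _ = _ := by ring
  have b3 : sob (s + (2 * α - 1)) (tri (hllInv α) A A (cubMaj A)) ≤ C₁ * E₂ * N ^ 5 := by
    refine (h₁ A A (cubMaj A)).trans ?_
    rw [tsum_wt_corr_comm]
    calc _ ≤ C₁ * ((E₂ * N ^ 4) * N) := by gcongr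
      _ = _ := by ring
  have b4 : sob (s + (α - 1 / 2)) (smoothMaj α A) ≤ (C₃ + 1) * N ^ 3 := by
    refine (sob_add_le _ _ _).trans ?_
    rw [add_mul, one_mul]
    refine add_le_add ?_ (sob_cube_le (by linarith) A)
    refine (h₃ (fun k j l => wt (-(1 / 2)) (phase α k j l))
      (fun k j l hj hl => wt_phase_sq_le hα hα' hj hl) A A A).trans (le_of_eq ?_)
    ring
  have b5 : sob (s + (2 * α - 1)) (tri (hllHalf α) (smoothMaj α A) A A) ≤
      C₂ * (C₃ + 1) * N ^ 5 := by
    have := h₂ (fun k j l => wt (-(1 / 2)) (phase α k j l))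
      (fun k j l h => wt_phase_sq_le hα hα' h.1 h.2.1) (smoothMaj α A) A A
    rw [show s + (α - 1 / 2) + (α - 1 / 2) = s + (2 * α - 1) by ring] at this
    refine this.trans ?_
    calc _ ≤ C₂ * (((C₃ + 1) * N ^ 3) * N * N) := by gcongr
      _ = _ := by ring
  calc sob (s + (2 * α - 1)) (hllMaj α P A) ≤ (1 + P) * (C₁ * E₁ * N ^ 3) + C₁ * E₂ * N ^ 5 +
        C₁ * E₂ * N ^ 5 + C₂ * (C₃ + 1) * N ^ 5 := by
        refine (sob_add_le _ _ _).trans (add_le_add ?_ b5)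
        refine (sob_add_le _ _ _).trans (add_le_add ?_ b3)
        refine (sob_add_le _ _ _).trans (add_le_add ?_ b2)
        rw [sob_const_mul]
        gcongr
    _ = C₁ * E₁ * ((1 + P) * N ^ 3) + (2 * (C₁ * E₂) + C₂ * (C₃ + 1)) * N ^ 5 := by ring
    _ ≤ (C₁ * E₁ + (2 * (C₁ * E₂) + C₂ * (C₃ + 1))) * ((1 + P) * N ^ 3) +
        (C₁ * E₁ + (2 * (C₁ * E₂) + C₂ * (C₃ + 1))) * N ^ 5 := by
        exact add_le_add (mul_le_mul' le_self_add le_rfl) (mul_le_mul' le_add_self le_rfl)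
    _ = _ := by ring

lemma exists_sob_nlMaj_le {α s a : ℝ} (hα : 1 / 2 < α) (hα' : α ≤ 1) (hs : 1 / 4 < s)
    (ha0 : 0 ≤ a) (ha : a ≤ 2 * α - 1) (ha' : a < 2 * s + α - 1) :
    ∃ C : ℝ≥0∞, C < ∞ ∧ ∀ (P : ℝ≥0∞) (A : ℤ → ℝ≥0∞),
      sob (s + a) (nlMaj α P A) ≤ C * ((1 + P) * sob s A ^ 3 + sob s A ^ 5) := by
  obtain ⟨C₁, hC₁, h₁⟩ := exists_sob_hllMaj_le hα hα' hs
  -- The value of η is dictated by the exponent relation, and the strict bound a < 2s + α - 1 is its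
  -- positivity.
  obtain ⟨C₂, hC₂, h₂⟩ := tri_balanced_le (ρ := 2 - 2 * α) (a := a) (s := s)
    (η := 2 * s + α - 1 - a) ha0 (by linarith) (by linarith) (by linarith) (by ring)
    (2 / (α * (2 * α - 1)))
  refine ⟨C₂ + 2 * C₁ + 1, ENNReal.add_lt_top.mpr ⟨ENNReal.add_lt_top.mpr ⟨hC₂,
    ENNReal.mul_lt_top (by simp) hC₁⟩, by simp⟩, fun P A => ?_⟩
  set N := sob s A with hN
  have b1 : sob (s + a) (tri (balHalf α) A A A) ≤ C₂ * N ^ 3 := by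
    refine (h₂ (fun k j l => wt (-(1 / 2)) (phase α k j l))
      (fun k j l h => wt_phase_sq_le hα hα' h.1 h.2.1) A A A).trans (le_of_eq ?_)
    ring
  have b2 : sob (s + a) (hllMaj α P A) ≤ C₁ * ((1 + P) * N ^ 3 + N ^ 5) :=
    (sob_le_sob (by linarith) _).trans (h₁ P A)
  have b3 : sob (s + a) (fun k => A k ^ 3) ≤ N ^ 3 := sob_cube_le (by linarith) A
  calc sob (s + a) (nlMaj α P A) ≤ (1 + P) * (C₂ * N ^ 3) + 2 * (C₁ * ((1 + P) * N ^ 3 + N ^ 5)) +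
        N ^ 3 := by
        refine (sob_add_le _ _ _).trans (add_le_add ?_ b3)
        refine (sob_add_le _ _ _).trans ?_
        rw [sob_const_mul, sob_const_mul]
        gcongr
    _ ≤ C₂ * ((1 + P) * N ^ 3 + N ^ 5) + 2 * (C₁ * ((1 + P) * N ^ 3 + N ^ 5)) +
        ((1 + P) * N ^ 3 + N ^ 5) := by
        refine add_le_add (add_le_add ?_ le_rfl)
          (le_trans (le_mul_of_one_le_left' le_self_add) le_self_add)
        rw [mul_left_comm]
        exact mul_le_mul' le_rfl le_self_add
    _ = _ := by ring

/-! ### Conservation of mass and the resonant part of the nonlinearity -/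

/-- The constant in the pointwise bound for cubic interactions. -/
def cubC (b : ℝ) : ℝ≥0∞ := bracketL2 b * algConst b ^ 2

lemma cubC_lt_top {b : ℝ} (hb0 : 1 / 2 < b) : cubC b < ∞ :=
  ENNReal.mul_lt_top (bracketL2_lt_top hb0) (ENNReal.pow_lt_top (algConst_lt_top hb0))

/-- A weighted sum of oscillating cubic interactions. -/
def oscSum (q : ℤ × ℤ → ℂ) (ν : ℤ × ℤ → ℝ) (a : ℤ → ℤ → ℂ) (k : ℤ) (r : ℝ) : ℂ :=
  ∑' p : ℤ × ℤ, q p * (cis (ν p * r) * ser (trip a a a k p) r)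

lemma enorm_conj (z : ℂ) : ‖(starRingEnd ℂ) z‖ₑ = ‖z‖ₑ := by
  rw [← ofReal_norm, RCLike.norm_conj, ofReal_norm]

lemma enorm_ser_trip_le {b : ℝ} (hb0 : 0 ≤ b) (a : ℤ → ℤ → ℂ) (k : ℤ) (p : ℤ × ℤ) (r : ℝ) :
    ‖ser (trip a a a k p) r‖ₑ ≤ cubC b * (1 * (hb b (a (k + p.1)) * hb b (a (k + p.1 + p.2)) *
      hb b (a (k + p.2)))) := by
  refine (enorm_ser_le_hb hb0 r).trans ?_
  rw [cubC, mul_assoc, one_mul]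
  gcongr
  exact hb_trip_le hb0 a a a k p

lemma hasDerivAt_const_add_integral {f : ℝ → ℂ} (hf : Continuous f) (e θ : ℂ) (r : ℝ) :
    HasDerivAt (fun t => e + θ * ∫ r in (0 : ℝ)..t, f r) (θ * f r) r :=
  ((intervalIntegral.integral_hasDerivAt_right (hf.intervalIntegrable _ _)
    (hf.stronglyMeasurableAtFilter _ _) hf.continuousAt).const_mul θ).const_add e

section oscSum
variable {b s : ℝ} {a : ℤ → ℤ → ℂ} {q : ℤ × ℤ → ℂ} (hb0 : 1 / 2 < b)

lemma enorm_oscSum_term_le (hb0 : 0 ≤ b) (hq : ∀ p, ‖q p‖ₑ ≤ 1) (ν : ℤ × ℤ → ℝ) (k : ℤ)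
    (p : ℤ × ℤ) (r : ℝ) : ‖q p * (cis (ν p * r) * ser (trip a a a k p) r)‖ₑ ≤
      cubC b * (1 * (hb b (a (k + p.1)) * hb b (a (k + p.1 + p.2)) * hb b (a (k + p.2)))) := by
  rw [enorm_mul, enorm_mul, enorm_cis, one_mul]
  exact (mul_le_of_le_one_left' (hq p)).trans (enorm_ser_trip_le hb0 a k p r)

lemma tsum_cubC_mul (k : ℤ) : ∑' p : ℤ × ℤ, cubC b * (1 * (hb b (a (k + p.1)) *
    hb b (a (k + p.1 + p.2)) * hb b (a (k + p.2)))) = cubC b * cubMaj (fun k => hb b (a k)) k := by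
  rw [ENNReal.tsum_mul_left, cubMaj, tri]

lemma enorm_oscSum_le (hb0 : 0 ≤ b) (hq : ∀ p, ‖q p‖ₑ ≤ 1) (ν : ℤ × ℤ → ℝ) (k : ℤ) (r : ℝ) :
    ‖oscSum q ν a k r‖ₑ ≤ cubC b * cubMaj (fun k => hb b (a k)) k := by
  rw [← tsum_cubC_mul]
  exact enorm_tsum_le_tsum_enorm.trans (ENNReal.tsum_le_tsum fun p =>
    enorm_oscSum_term_le hb0 hq ν k p r)

variable (hs : 1 / 4 < s) (ha : xn s b a < ∞)
include hs ha

lemma cubMaj_lt_top (k : ℤ) : cubMaj (fun k => hb b (a k)) k < ∞ := tri_one_lt_top hs ha ha ha k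

include hb0

lemma summable_cubC_mul (k : ℤ) : Summable fun p : ℤ × ℤ => (cubC b * (1 * (hb b (a (k + p.1)) *
    hb b (a (k + p.1 + p.2)) * hb b (a (k + p.2))))).toReal := by
  refine ENNReal.summable_toReal ?_
  rw [tsum_cubC_mul]
  exact (ENNReal.mul_lt_top (cubC_lt_top hb0) (cubMaj_lt_top hs ha k)).ne

lemma norm_oscSum_term_le (hq : ∀ p, ‖q p‖ₑ ≤ 1) (ν : ℤ × ℤ → ℝ) (k : ℤ) (p : ℤ × ℤ) (r : ℝ) :
    ‖q p * (cis (ν p * r) * ser (trip a a a k p) r)‖ ≤ (cubC b * (1 * (hb b (a (k + p.1)) *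
      hb b (a (k + p.1 + p.2)) * hb b (a (k + p.2))))).toReal := by
  rw [← toReal_enorm]
  refine ENNReal.toReal_mono ?_ (enorm_oscSum_term_le (by linarith) hq ν k p r)
  refine ENNReal.ne_top_of_tsum_ne_top (f := fun p : ℤ × ℤ => cubC b * (1 * (hb b (a (k + p.1)) *
    hb b (a (k + p.1 + p.2)) * hb b (a (k + p.2))))) ?_ p
  rw [tsum_cubC_mul]
  exact (ENNReal.mul_lt_top (cubC_lt_top hb0) (cubMaj_lt_top hs ha k)).ne

lemma continuous_ser_array (k : ℤ) : Continuous (ser (a k)) :=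
  continuous_ser (summable_norm_of_hb hb0 ((hb_le_xn (by linarith) b a k).trans_lt ha))

lemma continuous_ser_trip (k : ℤ) (p : ℤ × ℤ) : Continuous (ser (trip a a a k p)) :=
  continuous_ser (summable_norm_of_hb hb0 (hb_trip_lt_top hb0 (by linarith) ha ha ha k p))

lemma continuous_oscSum_term (ν : ℤ × ℤ → ℝ) (k : ℤ) (p : ℤ × ℤ) :
    Continuous fun r => q p * (cis (ν p * r) * ser (trip a a a k p) r) := by
  have := continuous_ser_trip hb0 hs ha k p
  fun_prop

lemma continuous_oscSum (hq : ∀ p, ‖q p‖ₑ ≤ 1) (ν : ℤ × ℤ → ℝ) (k : ℤ) :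
    Continuous (oscSum q ν a k) :=
  continuous_tsum (continuous_oscSum_term hb0 hs ha ν k) (summable_cubC_mul hb0 hs ha k)
    (norm_oscSum_term_le hb0 hs ha hq ν k)

lemma summable_oscSum (hq : ∀ p, ‖q p‖ₑ ≤ 1) (ν : ℤ × ℤ → ℝ) (k : ℤ) (r : ℝ) :
    Summable fun p : ℤ × ℤ => q p * (cis (ν p * r) * ser (trip a a a k p) r) :=
  Summable.of_norm_bounded (summable_cubC_mul hb0 hs ha k)
    (norm_oscSum_term_le hb0 hs ha hq ν k · r)

lemma hasSum_integral_oscSum_mul (hq : ∀ p, ‖q p‖ₑ ≤ 1) (ν : ℤ × ℤ → ℝ) (k : ℤ) {m : ℝ → ℂ}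
    (hm : Continuous m) {M : ℝ} (hM : ∀ r, ‖m r‖ ≤ M) (t : ℝ) :
    HasSum (fun p => ∫ r in (0 : ℝ)..t, q p * (cis (ν p * r) * ser (trip a a a k p) r) * m r)
      (∫ r in (0 : ℝ)..t, oscSum q ν a k r * m r) := by
  have h := hasSum_integral_of_bound (F := fun p r => q p * (cis (ν p * r) *
    ser (trip a a a k p) r) * m r) (fun p => (continuous_oscSum_term hb0 hs ha ν k p).mul hm)
    (fun p r => by
      rw [norm_mul]
      exact mul_le_mul (norm_oscSum_term_le hb0 hs ha hq ν k p r) (hM r) (norm_nonneg _)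
        ENNReal.toReal_nonneg) ((summable_cubC_mul hb0 hs ha k).mul_right M) 0 t
  simp_rw [tsum_mul_right] at h
  exact h

lemma cubicSum_eq_oscSum (α : ℝ) (k : ℤ) : cubicSum α 1 (fun k => ser (a k)) k =
    oscSum 1 (fun p => phase α k p.1 p.2) a k := by
  ext r
  simp only [cubicSum, oscSum, ser_trip hb0 hs ha ha ha, one_mul, Pi.one_apply]

end oscSum

/-- The symmetry of the quadruples `(k, k + j, k + j + l, k + l)`. -/
def quadSymm : ℤ × ℤ × ℤ ≃ ℤ × ℤ × ℤ where
  toFun p := (p.1 + p.2.1, -p.2.1, p.2.2)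
  invFun p := (p.1 + p.2.1, -p.2.1, p.2.2)
  left_inv p := by ext <;> simp
  right_inv p := by ext <;> simp

lemma corr_cubMaj_zero (A : ℤ → ℝ≥0∞) : ∑' k, A k * cubMaj A k = l2 (corr A A) ^ 2 := by
  have h := corr_cubMaj A 0
  rw [l2_sq]
  simpa [corr, sq] using h

section mass
variable {α b s ε T : ℝ} {a : ℤ → ℤ → ℂ} {e : ℤ → ℂ} (hb0 : 1 / 2 < b) (hs : 1 / 4 < s)
  (ha : xn s b a < ∞)
include hb0 hs ha

/-- The pairing of the cubic nonlinearity with the function is real. -/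
lemma conj_tsum_conj_mul_cubicSum (r : ℝ) :
    (starRingEnd ℂ) (∑' k, (starRingEnd ℂ) (ser (a k) r) * cubicSum α 1 (fun k => ser (a k)) k r) =
      ∑' k, (starRingEnd ℂ) (ser (a k) r) * cubicSum α 1 (fun k => ser (a k)) k r := by
  set c := fun k => ser (a k) r with hc
  set F : ℤ × ℤ × ℤ → ℂ := fun p => (starRingEnd ℂ) (c p.1) * (cis (1 * phase α p.1 p.2.1 p.2.2 * r) *
    (c (p.1 + p.2.1) * (starRingEnd ℂ) (c (p.1 + p.2.1 + p.2.2)) * c (p.1 + p.2.2))) with hF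
  set B := bracketL2 b
  have hcB : ∀ k, ‖c k‖ₑ ≤ B * hb b (a k) := fun k => enorm_ser_le_hb (by linarith) r
  have hBA : sob s (fun k => B * hb b (a k)) < ∞ := by
    rw [sob_const_mul]; exact ENNReal.mul_lt_top (bracketL2_lt_top hb0) ha
  have hsum : Summable F := by
    refine (summable_norm_of_tsum_enorm_lt_top ?_).of_norm
    rw [ENNReal.tsum_prod']
    calc _ ≤ ∑' k, (B * hb b (a k)) * cubMaj (fun k => B * hb b (a k)) k := by
          refine ENNReal.tsum_le_tsum fun k => ?_
          rw [cubMaj, tri, ← ENNReal.tsum_mul_left]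
          refine ENNReal.tsum_le_tsum fun p => ?_
          simp only [hF, enorm_mul, enorm_cis, enorm_conj]
          gcongr <;> exact hcB _
      _ < ∞ := by
          rw [corr_cubMaj_zero]
          exact ENNReal.pow_lt_top ((l2_corr_le (by linarith) _ _).trans_lt
            (ENNReal.mul_lt_top (corrC_lt_top hs) (ENNReal.mul_lt_top hBA hBA)))
  have e1 : ∑' k, (starRingEnd ℂ) (ser (a k) r) * cubicSum α 1 (fun k => ser (a k)) k r =
      ∑' p, F p := by
    rw [hsum.tsum_prod]
    congr 1; ext k
    rw [cubicSum, ← tsum_mul_left]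
  rw [e1, Complex.conj_tsum, ← quadSymm.tsum_eq]
  congr 1; ext p
  obtain ⟨k, j, l⟩ := p
  -- `quadSymm` exchanges k with k + j and k + l with k + j + l. It reverses the phase and matches
  -- each summand with the conjugate of another.
  have hph : phase α (k + j) (-j) l = -phase α k j l := by
    unfold phase
    rw [add_neg_cancel_right]; ring
  simp only [hF, quadSymm, Equiv.coe_fn_mk, map_mul, conj_cis, Complex.conj_conj, hph,
    add_neg_cancel_right]
  rw [show -(1 * -phase α k j l * r) = 1 * phase α k j l * r by ring]
  ring

/-- Conservation of mass. -/
lemma hasSum_normSq_sub (hsol : ∀ k t, |t| ≤ T → ser (a k) t = e k + -(Complex.I * ε) *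
      ∫ r in (0 : ℝ)..t, cubicSum α 1 (fun k => ser (a k)) k r) {t : ℝ} (ht : |t| ≤ T) :
    HasSum (fun k => ((‖ser (a k) t‖ ^ 2 - ‖e k‖ ^ 2 : ℝ) : ℂ)) 0 := by
  set θ : ℂ := -(Complex.I * ε) with hθ
  set N := fun k => cubicSum α 1 (fun k => ser (a k)) k with hN
  set c := fun k => ser (a k) with hc
  have hNc : ∀ k, Continuous (N k) := fun k => continuous_cubicSum hb0 hs 1 ha k
  have hcc : ∀ k, Continuous (c k) := continuous_ser_array hb0 hs ha
  set z := fun k r => (starRingEnd ℂ) (c k r) * (θ * N k r) with hz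
  have hzc : ∀ k, Continuous fun r => z k r + (starRingEnd ℂ) (z k r) := by
    intro k
    have h1 := hNc k
    have h2 := hcc k
    fun_prop
  have key : ∀ k, ((‖c k t‖ ^ 2 - ‖e k‖ ^ 2 : ℝ) : ℂ) =
      ∫ r in (0 : ℝ)..t, (z k r + (starRingEnd ℂ) (z k r)) := by
    intro k
    -- The series satisfies the equation only for |t| ≤ T. The right-hand side is differentiable at
    -- every time and agrees with it there, so derivatives are taken of `y`.
    set y := fun t => e k + θ * ∫ r in (0 : ℝ)..t, N k r with hy
    have hyd : ∀ r, HasDerivAt y (θ * N k r) r := hasDerivAt_const_add_integral (hNc k) (e k) θ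
    have hyc : Continuous y := continuous_iff_continuousAt.mpr fun r => (hyd r).continuousAt
    have hcd : ∀ r, HasDerivAt (fun r => (starRingEnd ℂ) (y r)) ((starRingEnd ℂ) (θ * N k r)) r :=
      fun r => (hyd r).star
    have hd : ∀ r, HasDerivAt (fun r => (starRingEnd ℂ) (y r) * y r)
        ((starRingEnd ℂ) (θ * N k r) * y r + (starRingEnd ℂ) (y r) * (θ * N k r)) r :=
      fun r => (hcd r).mul (hyd r)
    have hcont : Continuous fun r =>
        (starRingEnd ℂ) (θ * N k r) * y r + (starRingEnd ℂ) (y r) * (θ * N k r) := by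
      have h1 := hNc k
      fun_prop
    have h1 := intervalIntegral.integral_eq_sub_of_hasDerivAt (a := 0) (b := t)
      (fun r _ => hd r) (hcont.intervalIntegrable _ _)
    have hy0 : y 0 = e k := by simp [hy]
    have hyt : y t = c k t := (hsol k t ht).symm
    rw [hy0, hyt] at h1
    have h2 : ∀ w : ℂ, (starRingEnd ℂ) w * w = ((‖w‖ ^ 2 : ℝ) : ℂ) := fun w => by
      rw [← Complex.normSq_eq_conj_mul_self, Complex.normSq_eq_norm_sq]
    rw [h2, h2, ← Complex.ofReal_sub] at h1
    rw [← h1]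
    refine intervalIntegral.integral_congr fun r hr => ?_
    have hyr : y r = c k r := (hsol k r ((abs_le_of_mem_uIcc_zero hr).trans ht)).symm
    simp only [hz, hyr, map_mul, Complex.conj_conj]
    ring
  set A := fun k => hb b (a k) with hA
  set B := bracketL2 b with hB
  set Bd := fun k => 2 * ‖θ‖ₑ * B * cubC b * (A k * cubMaj A k) with hBd
  have hBdt : ∑' k, Bd k < ∞ := by
    rw [hBd, ENNReal.tsum_mul_left, corr_cubMaj_zero]
    exact ENNReal.mul_lt_top (ENNReal.mul_lt_top (ENNReal.mul_lt_top (ENNReal.mul_lt_top (by simp)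
      enorm_lt_top) (bracketL2_lt_top hb0)) (cubC_lt_top hb0)) (ENNReal.pow_lt_top
      ((l2_corr_le (by linarith) _ _).trans_lt
            (ENNReal.mul_lt_top (corrC_lt_top hs) (ENNReal.mul_lt_top ha ha))))
  have hzB : ∀ k r, ‖z k r‖ₑ ≤ ‖θ‖ₑ * B * cubC b * (A k * cubMaj A k) := by
    intro k r
    calc ‖z k r‖ₑ ≤ (B * A k) * (‖θ‖ₑ * (cubC b * cubMaj A k)) := by
          rw [hz, enorm_mul, enorm_mul, enorm_conj]
          gcongr
          · exact enorm_ser_le_hb (by linarith) r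
          · have := congrFun (cubicSum_eq_oscSum hb0 hs ha α k) r
            rw [show N k r = _ from this]
            exact enorm_oscSum_le (by linarith) (by simp) _ _ _
      _ = _ := by ring
  have h3 := hasSum_integral_of_bound (F := fun k r => z k r + (starRingEnd ℂ) (z k r))
    (B := fun k => (Bd k).toReal) hzc (fun k r => by
      rw [← toReal_enorm]
      refine ENNReal.toReal_mono (ENNReal.ne_top_of_tsum_ne_top hBdt.ne k) ?_
      refine (enorm_add_le _ _).trans ?_
      rw [enorm_conj]
      calc _ ≤ ‖θ‖ₑ * B * cubC b * (A k * cubMaj A k) + ‖θ‖ₑ * B * cubC b * (A k * cubMaj A k) :=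
            add_le_add (hzB k r) (hzB k r)
        _ = _ := by rw [hBd]; ring) (ENNReal.summable_toReal hBdt.ne) 0 t
  have hzs : ∀ r, Summable fun k => z k r := fun r =>
    (summable_norm_of_tsum_enorm_lt_top (lt_of_le_of_lt (ENNReal.tsum_le_tsum fun k =>
      (hzB k r).trans (show _ ≤ Bd k by
        rw [hBd]; simp only; rw [mul_assoc 2, mul_assoc 2, mul_assoc 2, two_mul]
        exact le_self_add)) hBdt)).of_norm
  -- The pairing with the cubic term is real and θ is purely imaginary, so the summed time
  -- derivative of the mass vanishes.
  have h4 : ∀ r, ∑' k, (z k r + (starRingEnd ℂ) (z k r)) = 0 := by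
    intro r
    have h5 := conj_tsum_conj_mul_cubicSum (α := α) hb0 hs ha r
    have h6 : ∑' k, z k r = θ * ∑' k, (starRingEnd ℂ) (c k r) * N k r := by
      rw [← tsum_mul_left]; congr 1; ext k; simp only [hz]; ring
    have hcs : Summable fun k => (starRingEnd ℂ) (z k r) := (hzs r).star
    rw [(hzs r).tsum_add hcs, ← Complex.conj_tsum, h6, map_mul, h5]
    have hθc : (starRingEnd ℂ) θ = -θ := by simp [hθ]
    rw [hθc]; ring
  simp_rw [h4, intervalIntegral.integral_zero, ← key] at h3
  exact h3

lemma summable_normSq_ser (t : ℝ) : Summable fun k => ‖ser (a k) t‖ ^ 2 := by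
  have h1 : ∑' k, ‖ser (a k) t‖ₑ ^ 2 < ∞ := by
    rw [← l2_sq]
    refine ENNReal.pow_lt_top (lt_of_le_of_lt ((l2_le_sob (s := s) (by linarith) _).trans
      (sob_mono fun k => enorm_ser_le_hb (b := b) (by linarith) t)) ?_)
    rw [sob_const_mul]
    exact ENNReal.mul_lt_top (bracketL2_lt_top hb0) ha
  simpa using ENNReal.summable_toReal h1.ne

lemma tsum_normSq_ser (hsol : ∀ k t, |t| ≤ T → ser (a k) t = e k + -(Complex.I * ε) *
      ∫ r in (0 : ℝ)..t, cubicSum α 1 (fun k => ser (a k)) k r) {t : ℝ} (ht : |t| ≤ T) :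
    HasSum (fun k => ‖ser (a k) t‖ ^ 2) (∑' k, ‖e k‖ ^ 2) := by
  have h0 : ∀ k, ser (a k) 0 = e k := fun k => by
    simpa using hsol k 0 (by simpa using (abs_nonneg t).trans ht)
  have h1 : Summable fun k => ‖e k‖ ^ 2 := by
    simpa [h0] using summable_normSq_ser hb0 hs ha 0
  have h2 := hasSum_normSq_sub hb0 hs ha hsol ht
  rw [← Complex.ofReal_zero, Complex.hasSum_ofReal] at h2
  simpa using h2.add h1.hasSum

end mass

/-! ### The gauge transform and differentiation by parts -/

/-- The weights of the interactions that remain after the gauge transform. -/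
def resQ (p : ℤ × ℤ) : ℂ := if p.1 ≠ 0 ∧ p.2 ≠ 0 then 1 else if p = 0 then -1 else 0

lemma enorm_resQ_le (p : ℤ × ℤ) : ‖resQ p‖ₑ ≤ 1 := by
  unfold resQ; split_ifs <;> simp

/-- The time derivative of the gauged profile, up to a unimodular factor. -/
def gaugeD (α μ : ℝ) (a : ℤ → ℤ → ℂ) (k : ℤ) : ℝ → ℂ :=
  oscSum resQ (fun p => phase α k p.1 p.2 + μ) a k

lemma phase_zero_left (α : ℝ) (k l : ℤ) : phase α k 0 l = 0 := by
  unfold phase; rw [add_zero]; ring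

lemma phase_zero_right (α : ℝ) (k j : ℤ) : phase α k j 0 = 0 := by
  rw [phase_swap, phase_zero_left]

lemma oscSum_add_const (q : ℤ × ℤ → ℂ) (ν : ℤ × ℤ → ℝ) (μ : ℝ) (a : ℤ → ℤ → ℂ) (k : ℤ) (r : ℝ) :
    oscSum q (fun p => ν p + μ) a k r = cis (μ * r) * oscSum q ν a k r := by
  rw [oscSum, oscSum, ← tsum_mul_left]
  congr 1; ext p
  rw [add_mul, cis_add]; ring

lemma enorm_integral_le_of_bound {f : ℝ → ℂ} {C : ℝ≥0∞} (h : ∀ r, ‖f r‖ₑ ≤ C) {t : ℝ}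
    (ht : |t| ≤ 1) : ‖∫ r in (0 : ℝ)..t, f r‖ₑ ≤ C := by
  rcases eq_or_ne C ∞ with rfl | hC
  · exact le_top
  have h1 := intervalIntegral.norm_integral_le_of_norm_le_const (a := 0) (b := t) (f := f)
    (C := C.toReal) fun r _ => by
      rw [← toReal_enorm]; exact ENNReal.toReal_mono hC (h r)
  rw [sub_zero] at h1
  rw [← ofReal_norm]
  refine ENNReal.ofReal_le_of_le_toReal (h1.trans ?_)
  exact mul_le_of_le_one_right ENNReal.toReal_nonneg ht

lemma enorm_gaugeD_le {b : ℝ} (hb0 : 0 ≤ b) (α μ : ℝ) (a : ℤ → ℤ → ℂ) (k : ℤ) (r : ℝ) :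
    ‖gaugeD α μ a k r‖ₑ ≤ cubC b * cubMaj (fun k => hb b (a k)) k :=
  enorm_oscSum_le hb0 enorm_resQ_le _ k r

section gauge
variable {α b s ε P T μ : ℝ} {θ : ℂ} {a : ℤ → ℤ → ℂ} {e : ℤ → ℂ} (hb0 : 1 / 2 < b) (hs : 1 / 4 < s)
  (ha : xn s b a < ∞)
include hb0 hs ha

/-- The resonant interactions sum up to a multiple of the mass. -/
lemma cubicSum_eq_of_mass {r : ℝ} (hP : HasSum (fun k => ‖ser (a k) r‖ ^ 2) (P / 2)) (k : ℤ) :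
    cubicSum α 1 (fun k => ser (a k)) k r = P * ser (a k) r +
      oscSum resQ (fun p => phase α k p.1 p.2) a k r := by
  rw [cubicSum_eq_oscSum hb0 hs ha]
  set f := fun p : ℤ × ℤ => cis (phase α k p.1 p.2 * r) * ser (trip a a a k p) r with hf
  have h0 : HasSum f (oscSum 1 (fun p => phase α k p.1 p.2) a k r) := by
    have := (summable_oscSum hb0 hs ha (q := 1) (by simp) (fun p => phase α k p.1 p.2) k r).hasSum
    simpa [f, oscSum] using this
  have hm : HasSum (fun l : ℤ => ser (a k) r * ((‖ser (a (k + l)) r‖ ^ 2 : ℝ) : ℂ))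
      (ser (a k) r * ((P / 2 : ℝ) : ℂ)) := by
    refine HasSum.mul_left _ (Complex.hasSum_ofReal.mpr ?_)
    exact (Equiv.addLeft k).hasSum_iff.mpr hP
  have hsq : ∀ w : ℂ, w * (starRingEnd ℂ) w = ((‖w‖ ^ 2 : ℝ) : ℂ) := fun w => by
    rw [Complex.mul_conj, Complex.normSq_eq_norm_sq]
  -- On j = 0 the phase vanishes and the summand is c_k |c_{k+l}|², which sums over l to c_k P/2; l
  -- = 0 is symmetric.
  have h1 : HasSum (fun p : ℤ × ℤ => if p.1 = 0 then f p else 0)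
      (ser (a k) r * ((P / 2 : ℝ) : ℂ)) := by
    refine (Function.Injective.hasSum_iff (g := fun l : ℤ => ((0 : ℤ), l))
      (fun x y h => by simpa using h) ?_).mp ?_
    · rintro ⟨j, l⟩ hp
      have : j ≠ 0 := by rintro rfl; exact hp ⟨l, rfl⟩
      simp [this]
    · refine (congrArg (fun f => HasSum f _) (funext fun l => ?_)).mpr hm
      simp only [Function.comp, if_true, hf, phase_zero_left, zero_mul, cis_zero, one_mul,
        ser_trip hb0 hs ha ha ha, add_zero]
      rw [← hsq]; ring
  have h2 : HasSum (fun p : ℤ × ℤ => if p.2 = 0 then f p else 0)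
      (ser (a k) r * ((P / 2 : ℝ) : ℂ)) := by
    refine (Function.Injective.hasSum_iff (g := fun j : ℤ => (j, (0 : ℤ)))
      (fun x y h => by simpa using h) ?_).mp ?_
    · rintro ⟨j, l⟩ hp
      have : l ≠ 0 := by rintro rfl; exact hp ⟨j, rfl⟩
      simp [this]
    · refine (congrArg (fun f => HasSum f _) (funext fun l => ?_)).mpr hm
      simp only [Function.comp, if_true, hf, phase_zero_right, zero_mul, cis_zero, one_mul,
        ser_trip hb0 hs ha ha ha, add_zero]
      rw [← hsq]; ring
  have h3 := (h0.sub h1).sub h2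
  -- Both lines contain j = l = 0, so that term is removed twice. This is the weight -1 in `resQ`.
  have h4 : oscSum resQ (fun p => phase α k p.1 p.2) a k r =
      ∑' p, (f p - (if p.1 = 0 then f p else 0) - if p.2 = 0 then f p else 0) := by
    rw [oscSum]
    congr 1; ext ⟨j, l⟩
    by_cases hj : j = 0 <;> by_cases hl : l = 0 <;> simp [resQ, hj, hl, hf]
  rw [h4, h3.tsum_eq]
  push_cast; ring

lemma continuous_gaugeD (k : ℤ) : Continuous (gaugeD α μ a k) :=
  continuous_oscSum hb0 hs ha enorm_resQ_le _ k

/-- The equation for the gauged profile. -/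
lemma gauge_eq (hsol : ∀ k t, |t| ≤ T → ser (a k) t = e k + -(Complex.I * ε) *
      ∫ r in (0 : ℝ)..t, cubicSum α 1 (fun k => ser (a k)) k r)
    (hP : ∀ t, |t| ≤ T → HasSum (fun k => ‖ser (a k) t‖ ^ 2) (P / 2)) (k : ℤ) {t : ℝ}
    (ht : |t| ≤ T) : cis (ε * P * t) * ser (a k) t =
      e k + -(Complex.I * ε) * ∫ r in (0 : ℝ)..t, gaugeD α (ε * P) a k r := by
  set θ : ℂ := -(Complex.I * ε) with hθ
  set N := cubicSum α 1 (fun k => ser (a k)) k with hN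
  have hNc : Continuous N := continuous_cubicSum hb0 hs 1 ha k
  set y := fun t => e k + θ * ∫ r in (0 : ℝ)..t, N r with hy
  have hyd : ∀ r, HasDerivAt y (θ * N r) r := hasDerivAt_const_add_integral hNc (e k) θ
  have hyc : Continuous y := continuous_iff_continuousAt.mpr fun r => (hyd r).continuousAt
  have hcd : ∀ r : ℝ, HasDerivAt (fun r => cis (ε * P * r))
      (Complex.I * (ε * P) * cis (ε * P * r)) r := by
    intro r
    have h1 : HasDerivAt (fun r : ℝ => ε * P * r) (ε * P) r := by
      simpa using (hasDerivAt_id r).const_mul (ε * P)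
    refine ((hasDerivAt_cis (ε * P * r)).scomp r h1).congr_deriv ?_
    rw [Complex.real_smul]; push_cast; ring
  have hd := fun r => (hcd r).mul (hyd r)
  have hcont : Continuous fun r : ℝ => Complex.I * (ε * P) * cis (ε * P * r) * y r +
      cis (ε * P * r) * (θ * N r) := by fun_prop
  have h1 := intervalIntegral.integral_eq_sub_of_hasDerivAt (a := 0) (b := t)
    (fun r _ => hd r) (hcont.intervalIntegrable _ _)
  have hyt : ∀ t, |t| ≤ T → y t = ser (a k) t := fun t ht => (hsol k t ht).symm
  simp only [Pi.mul_apply, hyt t ht, mul_zero, cis_zero, one_mul] at h1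
  have hy0 : y 0 = e k := by simp [hy]
  rw [hy0] at h1
  rw [← intervalIntegral.integral_const_mul, ← sub_eq_iff_eq_add', ← h1]
  refine intervalIntegral.integral_congr fun r hr => ?_
  have hr' := (abs_le_of_mem_uIcc_zero hr).trans ht
  rw [hyt r hr', hN, cubicSum_eq_of_mass hb0 hs ha (hP r hr') k, gaugeD, oscSum_add_const, hθ]
  ring

/-- Differentiation by parts. -/
lemma phase_mul_integral_eq
    (hw : ∀ k t, |t| ≤ T → cis (μ * t) * ser (a k) t = e k + θ * ∫ r in (0 : ℝ)..t, gaugeD α μ a k r)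
    (k : ℤ) (p : ℤ × ℤ) (ν : ℝ) {t : ℝ} (ht : |t| ≤ T) :
    Complex.I * ν * ∫ r in (0 : ℝ)..t, cis ((ν + μ) * r) * ser (trip a a a k p) r =
      cis ((ν + μ) * t) * ser (trip a a a k p) t - ser (trip a a a k p) 0 -
        (θ * ∫ r in (0 : ℝ)..t, gaugeD α μ a (k + p.1) r * (cis (ν * r) *
          ((starRingEnd ℂ) (ser (a (k + p.1 + p.2)) r) * ser (a (k + p.2)) r))) -
        (∫ r in (0 : ℝ)..t, cis (ν * r) * ((cis (μ * r) * ser (a (k + p.1)) r) *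
          (starRingEnd ℂ) (θ * gaugeD α μ a (k + p.1 + p.2) r) *
          (cis (μ * r) * ser (a (k + p.2)) r))) -
        ∫ r in (0 : ℝ)..t, cis (ν * r) * (ser (a (k + p.1)) r *
          (starRingEnd ℂ) (ser (a (k + p.1 + p.2)) r) * (θ * gaugeD α μ a (k + p.2) r)) := by
  have hDc : ∀ k, Continuous (gaugeD α μ a k) := continuous_gaugeD hb0 hs ha
  have hcc : ∀ k, Continuous (ser (a k)) := continuous_ser_array hb0 hs ha
  set y := fun k t => e k + θ * ∫ r in (0 : ℝ)..t, gaugeD α μ a k r with hy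
  have hyd : ∀ k r, HasDerivAt (y k) (θ * gaugeD α μ a k r) r := fun k =>
    hasDerivAt_const_add_integral (hDc k) (e k) θ
  have hyc : ∀ k, Continuous (y k) := fun k =>
    continuous_iff_continuousAt.mpr fun r => (hyd k r).continuousAt
  have hyt : ∀ k t, |t| ≤ T → y k t = cis (μ * t) * ser (a k) t := fun k t ht => (hw k t ht).symm
  have hcd : ∀ r : ℝ, HasDerivAt (fun r => cis (ν * r)) (Complex.I * ν * cis (ν * r)) r := by
    intro r
    have h1 : HasDerivAt (fun r : ℝ => ν * r) ν r := by simpa using (hasDerivAt_id r).const_mul ν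
    refine ((hasDerivAt_cis (ν * r)).scomp r h1).congr_deriv ?_
    rw [Complex.real_smul]; ring
  have hstar : ∀ k r, HasDerivAt (fun r => (starRingEnd ℂ) (y k r))
      ((starRingEnd ℂ) (θ * gaugeD α μ a k r)) r := fun k r => (hyd k r).star
  have hd := fun r => (hcd r).mul
    (((hyd (k + p.1) r).mul (hstar (k + p.1 + p.2) r)).mul (hyd (k + p.2) r))
  have c1 := hyc (k + p.1)
  have c2 := hyc (k + p.1 + p.2)
  have c3 := hyc (k + p.2)
  have d1 := hDc (k + p.1)
  have d2 := hDc (k + p.1 + p.2)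
  have d3 := hDc (k + p.2)
  have e1 := hcc (k + p.1)
  have e2 := hcc (k + p.1 + p.2)
  have e3 := hcc (k + p.2)
  have hst := ser_trip hb0 hs ha ha ha k p
  have htc := continuous_ser_trip hb0 hs ha k p
  have h1 := intervalIntegral.integral_eq_sub_of_hasDerivAt (a := 0) (b := t)
    (fun r _ => hd r) (Continuous.intervalIntegrable (by
      simp only [Pi.mul_apply]
      fun_prop) _ _)
  have h0T : |(0 : ℝ)| ≤ T := by rw [abs_zero]; exact (abs_nonneg t).trans ht
  have hunit : ∀ r : ℝ, cis (-(μ * r)) * cis (μ * r) = 1 := fun r => by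
    rw [mul_comm, cis_mul_cis_neg]
  simp only [Pi.mul_apply, hyt _ t ht, hyt _ 0 h0T, map_mul, conj_cis] at h1
  -- Two gauge factors and one conjugate leave a single e^{iμt}, hence the frequency ν + μ.
  -- Differentiating the gauged factors keeps the large term P c_k out of the derivatives, and the
  -- explicit divisor is ν rather than ν + μ.
  have hb1 : cis (ν * t) * (cis (μ * t) * ser (a (k + p.1)) t *
      (cis (-(μ * t)) * (starRingEnd ℂ) (ser (a (k + p.1 + p.2)) t)) *
        (cis (μ * t) * ser (a (k + p.2)) t)) = cis ((ν + μ) * t) * ser (trip a a a k p) t := by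
    rw [hst, add_mul, cis_add]
    linear_combination cis (ν * t) * cis (μ * t) * (ser (a (k + p.1)) t *
      (starRingEnd ℂ) (ser (a (k + p.1 + p.2)) t) * ser (a (k + p.2)) t) * hunit t
  have hb2 : cis (ν * 0) * (cis (μ * 0) * ser (a (k + p.1)) 0 *
      (cis (-(μ * 0)) * (starRingEnd ℂ) (ser (a (k + p.1 + p.2)) 0)) *
        (cis (μ * 0) * ser (a (k + p.2)) 0)) = ser (trip a a a k p) 0 := by
    rw [hst]; simp [cis_zero]
  rw [hb1, hb2] at h1
  rw [← h1, ← intervalIntegral.integral_const_mul, ← intervalIntegral.integral_const_mul,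
    ← intervalIntegral.integral_sub, ← intervalIntegral.integral_sub,
    ← intervalIntegral.integral_sub]
  · refine intervalIntegral.integral_congr fun r hr => ?_
    have hr' := (abs_le_of_mem_uIcc_zero hr).trans ht
    simp only [hyt _ r hr', map_mul, conj_cis, hst, add_mul, cis_add]
    set x := cis (-(μ * r))
    set z := cis (μ * r)
    have hu : x * z = 1 := hunit r
    set A1 := ser (a (k + p.1)) r
    set A2 := (starRingEnd ℂ) (ser (a (k + p.1 + p.2)) r)
    set A3 := ser (a (k + p.2)) r
    set D1 := gaugeD α μ a (k + p.1) r
    set D3 := gaugeD α μ a (k + p.2) r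
    linear_combination (-(Complex.I * ν * cis (ν * r) * z * A1 * A2 * A3) -
      cis (ν * r) * θ * D1 * A2 * A3 - cis (ν * r) * θ * D3 * A1 * A2) * hu
  all_goals
    refine Continuous.intervalIntegrable ?_ _ _
    fun_prop

/-- The contribution of the highest frequency after differentiation by parts. -/
lemma enorm_integral_gaugeD_mul_le (k k₂ k₃ : ℤ) (ν : ℝ) {t : ℝ} (ht : |t| ≤ 1) :
    ‖∫ r in (0 : ℝ)..t, gaugeD α μ a k r * (cis (ν * r) *
        ((starRingEnd ℂ) (ser (a k₂) r) * ser (a k₃) r))‖ₑ ≤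
      4 * oscConst b * ENNReal.ofReal (2 ^ (1 / 2 : ℝ)) * algConst b ^ 4 * (wt (1 / 2) (ν + μ) *
        (smoothMaj α (fun k => hb b (a k)) k * hb b (a k₂) * hb b (a k₃))) := by
  have hs0 : 0 ≤ s := by linarith
  set A := fun k => hb b (a k) with hA
  have hfin : ∀ k, hb b (a k) < ∞ := fun k => (hb_le_xn hs0 b a k).trans_lt ha
  have hsm : ∀ k, Summable fun n => ‖a k n‖ := fun k => summable_norm_of_hb hb0 (hfin k)
  set g := cv (cj (a k₂)) (a k₃) with hg
  have hgs : Summable fun n => ‖g n‖ := summable_cv (summable_cj (hsm _)) (hsm _)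
  have hgser : ∀ r, ser g r = (starRingEnd ℂ) (ser (a k₂) r) * ser (a k₃) r := fun r => by
    rw [hg, ser_cv (summable_cj (hsm _)) (hsm _), ser_cj]
  have hgb : hb b g ≤ algConst b * (A k₂ * A k₃) := by
    refine (hb_cv_le (by linarith)).trans ?_
    rw [hb_cj]
  have hgt : hb b g < ∞ := hgb.trans_lt (ENNReal.mul_lt_top (algConst_lt_top hb0)
    (ENNReal.mul_lt_top (hfin _) (hfin _)))
  have hgc := continuous_ser hgs
  simp_rw [← hgser]
  have hsum := hasSum_integral_oscSum_mul hb0 hs ha (q := resQ) enorm_resQ_le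
    (fun p => phase α k p.1 p.2 + μ) k (m := fun r => cis (ν * r) * ser g r) (by fun_prop)
    (M := (bracketL2 b * hb b g).toReal) (fun r => by
      rw [norm_mul, norm_cis, one_mul, ← toReal_enorm]
      exact ENNReal.toReal_mono (ENNReal.mul_lt_top (bracketL2_lt_top hb0) hgt).ne
        (enorm_ser_le_hb (by linarith) r)) t
  rw [show (fun r => gaugeD α μ a k r * (cis (ν * r) * ser g r)) = fun r =>
    oscSum resQ (fun p => phase α k p.1 p.2 + μ) a k r * (cis (ν * r) * ser g r) from rfl,
    ← hsum.tsum_eq]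
  refine enorm_tsum_le_tsum_enorm.trans ?_
  set E := 4 * oscConst b * ENNReal.ofReal (2 ^ (1 / 2 : ℝ)) * algConst b ^ 4 with hE
  have hterm : ∀ p : ℤ × ℤ, ‖∫ r in (0 : ℝ)..t, resQ p * (cis ((phase α k p.1 p.2 + μ) * r) *
      ser (trip a a a k p) r) * (cis (ν * r) * ser g r)‖ₑ ≤ E * wt (1 / 2) (ν + μ) * A k₂ * A k₃ *
        (nrHalf α k p.1 p.2 * (A (k + p.1) * A (k + p.1 + p.2) * A (k + p.2)) +
          if p = 0 then A k ^ 3 else 0) := by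
    intro p
    have hts : Summable fun n => ‖trip a a a k p n‖ :=
      summable_norm_of_hb hb0 (hb_trip_lt_top hb0 hs0 ha ha ha k p)
    have e1 : ∫ r in (0 : ℝ)..t, resQ p * (cis ((phase α k p.1 p.2 + μ) * r) *
        ser (trip a a a k p) r) * (cis (ν * r) * ser g r) = resQ p *
        ∫ r in (0 : ℝ)..t, cis ((phase α k p.1 p.2 + (ν + μ)) * r) *
          ser (cv (trip a a a k p) g) r := by
      rw [← intervalIntegral.integral_const_mul]
      congr 1; ext r
      rw [ser_cv hts hgs, show (phase α k p.1 p.2 + (ν + μ)) * r =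
        (phase α k p.1 p.2 + μ) * r + ν * r by ring, cis_add]
      ring
    have hcvb : hb b (cv (trip a a a k p) g) ≤ algConst b ^ 4 *
        (A (k + p.1) * A (k + p.1 + p.2) * A (k + p.2)) * (A k₂ * A k₃) := by
      refine (hb_cv_le (by linarith)).trans ?_
      calc _ ≤ algConst b * ((algConst b ^ 2 * (A (k + p.1) * A (k + p.1 + p.2) * A (k + p.2))) *
            (algConst b * (A k₂ * A k₃))) := by
            gcongr; exact hb_trip_le (by linarith) a a a k p
        _ = _ := by ring
    have hcvt : hb b (cv (trip a a a k p) g) < ∞ := hcvb.trans_lt (ENNReal.mul_lt_top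
      (ENNReal.mul_lt_top (ENNReal.pow_lt_top (algConst_lt_top hb0)) (ENNReal.mul_lt_top
        (ENNReal.mul_lt_top (hfin _) (hfin _)) (hfin _))) (ENNReal.mul_lt_top (hfin _) (hfin _)))
    -- The total frequency is the inner phase plus ν + μ. Peetre's inequality keeps decay of order
    -- 1/2 in the inner phase, which feeds `smoothMaj`, at the price of growth ⟨ν+μ⟩^{1/2}.
    have hw := wt_add_le (-(1 / 2)) (phase α k p.1 p.2) (ν + μ)
    rw [abs_neg, abs_of_pos (by norm_num : (0 : ℝ) < 1 / 2)] at hw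
    have hq : ‖resQ p‖ₑ * wt (-(1 / 2)) (phase α k p.1 p.2) *
        (A (k + p.1) * A (k + p.1 + p.2) * A (k + p.2)) ≤
        nrHalf α k p.1 p.2 * (A (k + p.1) * A (k + p.1 + p.2) * A (k + p.2)) +
          if p = 0 then A k ^ 3 else 0 := by
      obtain ⟨j, l⟩ := p
      unfold resQ nrHalf
      by_cases h1 : j ≠ 0 ∧ l ≠ 0
      · simp [h1]
      · by_cases h2 : (j, l) = (0 : ℤ × ℤ)
        · obtain ⟨rfl, rfl⟩ := Prod.mk.inj h2
          simp [phase_zero_left, wt, jb_zero, pow_succ]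
        · simp [h1, h2]
    rw [e1, enorm_mul]
    calc _ ≤ ‖resQ p‖ₑ * (4 * oscConst b * wt (-(1 / 2)) (phase α k p.1 p.2 + (ν + μ)) *
          hb b (cv (trip a a a k p) g)) := by
          gcongr; exact enorm_integral_cis_mul_ser_le hb0 hcvt _ ht
      _ ≤ ‖resQ p‖ₑ * (4 * oscConst b * (ENNReal.ofReal (2 ^ (1 / 2 : ℝ)) *
          wt (-(1 / 2)) (phase α k p.1 p.2) * wt (1 / 2) (ν + μ)) * (algConst b ^ 4 *
        (A (k + p.1) * A (k + p.1 + p.2) * A (k + p.2)) * (A k₂ * A k₃))) := by gcongr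
      _ = E * wt (1 / 2) (ν + μ) * A k₂ * A k₃ * (‖resQ p‖ₑ * wt (-(1 / 2)) (phase α k p.1 p.2) *
        (A (k + p.1) * A (k + p.1 + p.2) * A (k + p.2))) := by rw [hE]; ring
      _ ≤ _ := by gcongr
  refine (ENNReal.tsum_le_tsum hterm).trans (le_of_eq ?_)
  rw [ENNReal.tsum_mul_left, ENNReal.tsum_add, tsum_ite_eq, smoothMaj, tri]
  ring

end gauge

/-! ### Pointwise bounds for the nonlinear part -/

/-- The majorant of a single high-low-low interaction. -/
def hllTerm (α : ℝ) (Q : ℝ≥0∞) (A : ℤ → ℝ≥0∞) (k j l : ℤ) : ℝ≥0∞ :=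
  (1 + Q) * (hllInv α k j l * (A (k + j) * A (k + j + l) * A (k + l))) +
    hllInv α k j l * (A (k + j) * cubMaj A (k + j + l) * A (k + l)) +
    hllInv α k j l * (A (k + j) * A (k + j + l) * cubMaj A (k + l)) +
    hllHalf α k j l * (smoothMaj α A (k + j) * A (k + j + l) * A (k + l))

lemma tsum_hllTerm (α : ℝ) (Q : ℝ≥0∞) (A : ℤ → ℝ≥0∞) (k : ℤ) :
    ∑' p : ℤ × ℤ, hllTerm α Q A k p.1 p.2 = hllMaj α Q A k := by
  simp only [hllTerm, hllMaj, tri, ENNReal.tsum_add, ENNReal.tsum_mul_left]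

/-- On high-low-low interactions |Φ| is bounded below, so it is comparable to ⟨Φ⟩; and |μ| ≤ |Φ|
gives ⟨Φ+μ⟩ ≤ 2⟨Φ⟩. The growth produced by the second oscillation thus costs half of the gain 1/Φ.
-/
lemma exists_hll_inv_mul_wt_le {α : ℝ} (hα : 1 / 2 < α) (hα' : α ≤ 1) :
    ∃ C : ℝ≥0∞, C < ∞ ∧ ∀ (μ : ℝ) (k j l : ℤ), IsHLL k j l → |μ| ≤ |phase α k j l| →
      ENNReal.ofReal |phase α k j l|⁻¹ * wt (1 / 2) (phase α k j l + μ) ≤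
        C * wt (-(1 / 2)) (phase α k j l) := by
  obtain ⟨D, hD, hph⟩ := exists_hll_phase_inv_le hα hα'
  refine ⟨ENNReal.ofReal ((D + 1) * 2 ^ (1 / 2 : ℝ)), ENNReal.ofReal_lt_top, fun μ k j l h hμ => ?_⟩
  set Φ := phase α k j l with hΦ
  have hΦ0 : 0 < |Φ| := abs_pos.mpr (phase_ne_zero hα hα' h.1 h.2.1)
  have h1 : |Φ|⁻¹ ≤ D := by
    refine (hph k j l h).trans (mul_le_of_le_one_right hD.le ?_)
    refine mul_le_one₀ ?_ (jb_rpow_pos _ _).le ?_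
    · exact Real.rpow_le_one_of_one_le_of_nonpos (one_le_jb _) (by norm_num)
    · exact Real.rpow_le_one_of_one_le_of_nonpos (one_le_jb _) (by linarith)
  have h2 : jb Φ ≤ (D + 1) * |Φ| := by
    have h3 : 1 ≤ D * |Φ| := by rwa [inv_le_iff_one_le_mul₀ hΦ0] at h1
    linarith [jb_le_one_add Φ]
  have h3 : jb (Φ + μ) ≤ 2 * jb Φ :=
    jb_le_two_mul_of_abs_le ((abs_add_le _ _).trans (by linarith))
  have h4 : |Φ|⁻¹ ≤ (D + 1) * (jb Φ)⁻¹ := by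
    rw [inv_eq_one_div, ← div_eq_mul_inv, div_le_div_iff₀ hΦ0 (jb_pos _)]
    linarith
  rw [wt, wt, ← ENNReal.ofReal_mul (by positivity), ← ENNReal.ofReal_mul (by positivity)]
  refine ENNReal.ofReal_le_ofReal ?_
  have hp := jb_pos Φ
  calc |Φ|⁻¹ * jb (Φ + μ) ^ (1 / 2 : ℝ) ≤ ((D + 1) * (jb Φ)⁻¹) * (2 * jb Φ) ^ (1 / 2 : ℝ) := by
        gcongr
        · exact (jb_rpow_pos _ _).le
        · exact (jb_pos _).le
    _ = _ := by
        rw [Real.mul_rpow (by norm_num) hp.le, show -(1 / 2 : ℝ) = -1 + 1 / 2 by norm_num,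
          Real.rpow_add hp, Real.rpow_neg_one]
        ring

/-- Differentiation by parts for one interaction. Boundary terms and derivatives of the low inputs
are bounded with absolute values and the kernel 1/|Φ|; the derivative of the high input is estimated
by a second use of oscillation. -/
lemma exists_hll_integral_le {α b : ℝ} (hα : 1 / 2 < α) (hα' : α ≤ 1) (hb0 : 1 / 2 < b) :
    ∃ C : ℝ≥0∞, C < ∞ ∧ ∀ (s T μ : ℝ) (θ : ℂ) (a : ℤ → ℤ → ℂ) (e : ℤ → ℂ), 1 / 4 < s →
      xn s b a < ∞ → T ≤ 1 → ‖θ‖ₑ = 1 →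
      (∀ k t, |t| ≤ T → cis (μ * t) * ser (a k) t =
        e k + θ * ∫ r in (0 : ℝ)..t, gaugeD α μ a k r) →
      ∀ (k j l : ℤ) (t : ℝ), IsHLL k j l → |t| ≤ T →
        ‖∫ r in (0 : ℝ)..t, cis ((phase α k j l + μ) * r) * ser (trip a a a k (j, l)) r‖ₑ ≤
          C * hllTerm α (ENNReal.ofReal |μ|) (fun k => hb b (a k)) k j l := by
  obtain ⟨C₀, hC₀, hwt⟩ := exists_hll_inv_mul_wt_le hα hα'
  set E := 4 * oscConst b * ENNReal.ofReal (2 ^ (1 / 2 : ℝ)) * algConst b ^ 4 with hE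
  set B := bracketL2 b with hB
  have hBt : B < ∞ := bracketL2_lt_top hb0
  have hEt : E < ∞ := ENNReal.mul_lt_top (ENNReal.mul_lt_top (ENNReal.mul_lt_top (by simp)
    (oscConst_lt_top hb0)) ENNReal.ofReal_lt_top) (ENNReal.pow_lt_top (algConst_lt_top hb0))
  set C := 2 * cubC b + B * cubC b * B + C₀ * E with hC
  refine ⟨C, ENNReal.add_lt_top.mpr ⟨ENNReal.add_lt_top.mpr ⟨ENNReal.mul_lt_top (by simp)
    (cubC_lt_top hb0), ENNReal.mul_lt_top (ENNReal.mul_lt_top hBt (cubC_lt_top hb0)) hBt⟩,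
    ENNReal.mul_lt_top hC₀ hEt⟩, fun s T μ θ a e hs ha hT hθ hw k j l t hhll ht => ?_⟩
  have c1 : 2 * cubC b ≤ C := le_self_add.trans le_self_add
  have c2 : B * cubC b * B ≤ C := le_add_self.trans le_self_add
  have c3 : C₀ * E ≤ C := le_add_self
  have ht1 := ht.trans hT
  set A := fun k => hb b (a k) with hA
  set Φ := phase α k j l with hΦ
  have hΦ0 : 0 < |Φ| := abs_pos.mpr (phase_ne_zero hα hα' hhll.1 hhll.2.1)
  set J := ∫ r in (0 : ℝ)..t, cis ((Φ + μ) * r) * ser (trip a a a k (j, l)) r with hJ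
  set x := ENNReal.ofReal |Φ|⁻¹ with hx
  have hxx : ENNReal.ofReal |Φ| * x = 1 := by
    rw [hx, ← ENNReal.ofReal_mul hΦ0.le, mul_inv_cancel₀ hΦ0.ne', ENNReal.ofReal_one]
  set Y := A (k + j) * A (k + j + l) * A (k + l) with hY
  have htrip : ∀ r, ‖ser (trip a a a k (j, l)) r‖ₑ ≤ cubC b * Y := fun r => by
    have := enorm_ser_trip_le (b := b) (by linarith) a k (j, l) r
    rwa [one_mul] at this
  have hterm : hllTerm α (ENNReal.ofReal |μ|) A k j l = (1 + ENNReal.ofReal |μ|) * (x * Y) +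
      x * (A (k + j) * cubMaj A (k + j + l) * A (k + l)) +
      x * (A (k + j) * A (k + j + l) * cubMaj A (k + l)) +
      wt (-(1 / 2)) Φ * (smoothMaj α A (k + j) * A (k + j + l) * A (k + l)) := by
    simp only [hllTerm, hllInv, hllHalf, if_pos hhll]
    rfl
  rw [hterm]
  -- A gauge frequency above |Φ| makes integration by parts unnecessary: 1 ≤ |μ|/|Φ| brings in the
  -- same kernel at the price of a factor |μ|.
  rcases le_or_gt |μ| |Φ| with hμ | hμ
  · have hid := phase_mul_integral_eq hb0 hs ha hw k (j, l) Φ ht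
    simp only at hid
    rw [← hJ] at hid
    set X₁ := ∫ r in (0 : ℝ)..t, gaugeD α μ a (k + j) r * (cis (Φ * r) *
          ((starRingEnd ℂ) (ser (a (k + j + l)) r) * ser (a (k + l)) r)) with hX₁
    set X₂ := ∫ r in (0 : ℝ)..t, cis (Φ * r) * ((cis (μ * r) * ser (a (k + j)) r) *
          (starRingEnd ℂ) (θ * gaugeD α μ a (k + j + l) r) *
          (cis (μ * r) * ser (a (k + l)) r)) with hX₂
    set X₃ := ∫ r in (0 : ℝ)..t, cis (Φ * r) * (ser (a (k + j)) r *
          (starRingEnd ℂ) (ser (a (k + j + l)) r) * (θ * gaugeD α μ a (k + l) r)) with hX₃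
    have b1 : ‖X₁‖ₑ ≤ E * (wt (1 / 2) (Φ + μ) *
        (smoothMaj α A (k + j) * A (k + j + l) * A (k + l))) :=
      enorm_integral_gaugeD_mul_le hb0 hs ha _ _ _ _ ht1
    have hser : ∀ k r, ‖ser (a k) r‖ₑ ≤ B * A k := fun k r => enorm_ser_le_hb (by linarith) r
    have hgD := enorm_gaugeD_le (b := b) (by linarith) α μ a
    have b2 : ‖X₂‖ₑ ≤ B * cubC b * B * (A (k + j) * cubMaj A (k + j + l) * A (k + l)) := by
      refine enorm_integral_le_of_bound (fun r => ?_) ht1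
      simp only [enorm_mul, enorm_cis, enorm_conj, hθ, one_mul]
      calc _ ≤ (B * A (k + j)) * (cubC b * cubMaj A (k + j + l)) * (B * A (k + l)) := by
            gcongr
            · exact hser _ _
            · exact hgD _ _
            · exact hser _ _
        _ = _ := by ring
    have b3 : ‖X₃‖ₑ ≤ B * cubC b * B * (A (k + j) * A (k + j + l) * cubMaj A (k + l)) := by
      refine enorm_integral_le_of_bound (fun r => ?_) ht1
      simp only [enorm_mul, enorm_cis, enorm_conj, hθ, one_mul]
      calc _ ≤ (B * A (k + j)) * (B * A (k + j + l)) * (cubC b * cubMaj A (k + l)) := by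
            gcongr
            · exact hser _ _
            · exact hser _ _
            · exact hgD _ _
        _ = _ := by ring
    have b0 : ENNReal.ofReal |Φ| * ‖J‖ₑ ≤ cubC b * Y + cubC b * Y + ‖X₁‖ₑ + ‖X₂‖ₑ + ‖X₃‖ₑ := by
      have e1 : ENNReal.ofReal |Φ| * ‖J‖ₑ = ‖Complex.I * Φ * J‖ₑ := by
        rw [enorm_mul, enorm_mul, ← ofReal_norm Complex.I, Complex.norm_I, ENNReal.ofReal_one,
          one_mul, ← ofReal_norm (Φ : ℂ), Complex.norm_real, Real.norm_eq_abs]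
      rw [e1, hid]
      refine enorm_sub_le.trans (add_le_add ?_ le_rfl)
      refine enorm_sub_le.trans (add_le_add ?_ le_rfl)
      refine enorm_sub_le.trans (add_le_add ?_ (le_of_eq (by rw [enorm_mul, hθ, one_mul])))
      refine enorm_sub_le.trans (add_le_add ?_ (htrip 0))
      rw [enorm_mul, enorm_cis, one_mul]
      exact htrip t
    calc ‖J‖ₑ = x * (ENNReal.ofReal |Φ| * ‖J‖ₑ) := by
          rw [← mul_assoc, mul_comm x, hxx, one_mul]
      _ ≤ x * (cubC b * Y + cubC b * Y + E * (wt (1 / 2) (Φ + μ) *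
        (smoothMaj α A (k + j) * A (k + j + l) * A (k + l))) +
        B * cubC b * B * (A (k + j) * cubMaj A (k + j + l) * A (k + l)) +
        B * cubC b * B * (A (k + j) * A (k + j + l) * cubMaj A (k + l))) := by
          gcongr
          refine b0.trans ?_
          gcongr
      _ = 2 * cubC b * (x * Y) + B * cubC b * B * (x * (A (k + j) * cubMaj A (k + j + l) *
        A (k + l))) + B * cubC b * B * (x * (A (k + j) * A (k + j + l) * cubMaj A (k + l))) +
        E * (x * wt (1 / 2) (Φ + μ)) * (smoothMaj α A (k + j) * A (k + j + l) * A (k + l)) := by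
          ring
      _ ≤ C * ((1 + ENNReal.ofReal |μ|) * (x * Y)) + C * (x * (A (k + j) * cubMaj A (k + j + l) *
        A (k + l))) + C * (x * (A (k + j) * A (k + j + l) * cubMaj A (k + l))) +
        C * (wt (-(1 / 2)) Φ * (smoothMaj α A (k + j) * A (k + j + l) * A (k + l))) := by
          refine add_le_add (add_le_add (add_le_add ?_ (mul_le_mul' c2 le_rfl))
            (mul_le_mul' c2 le_rfl)) ?_
          · exact mul_le_mul' c1 (le_mul_of_one_le_left' le_self_add)
          · rw [← mul_assoc C]
            refine mul_le_mul' ?_ le_rfl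
            calc _ ≤ E * (C₀ * wt (-(1 / 2)) Φ) := mul_le_mul' le_rfl (hwt μ k j l hhll hμ)
              _ = C₀ * E * wt (-(1 / 2)) Φ := by ring
              _ ≤ _ := mul_le_mul' c3 le_rfl
      _ = _ := by ring
  · have h1 : ‖J‖ₑ ≤ cubC b * Y := by
      refine enorm_integral_le_of_bound (fun r => ?_) ht1
      rw [enorm_mul, enorm_cis, one_mul]
      exact htrip r
    have h2 : (1 : ℝ≥0∞) ≤ ENNReal.ofReal |μ| * x := by
      rw [← hxx]
      exact mul_le_mul' (ENNReal.ofReal_le_ofReal hμ.le) le_rfl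
    have c4 : cubC b ≤ C := le_trans (by rw [two_mul]; exact le_self_add) c1
    calc ‖J‖ₑ ≤ cubC b * Y := h1
      _ ≤ C * ((ENNReal.ofReal |μ| * x) * Y) := mul_le_mul' c4 (le_mul_of_one_le_left' h2)
      _ = C * (ENNReal.ofReal |μ| * (x * Y)) := by ring
      _ ≤ C * ((1 + ENNReal.ofReal |μ|) * (x * Y)) :=
          mul_le_mul' le_rfl (mul_le_mul' le_add_self le_rfl)
      _ ≤ _ := mul_le_mul' le_rfl (le_self_add.trans (le_self_add.trans le_self_add))

lemma wt_half_le_one_add (μ : ℝ) : wt (1 / 2) μ ≤ 1 + ENNReal.ofReal |μ| := by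
  rw [← ENNReal.ofReal_one, ← ENNReal.ofReal_add zero_le_one (abs_nonneg _), wt]
  refine ENNReal.ofReal_le_ofReal (le_trans ?_ (jb_le_one_add μ))
  simpa using jb_rpow_le_rpow (by norm_num : (1 / 2 : ℝ) ≤ 1) μ

/-- The interactions are treated one by one and then summed. Balanced ones use only the decay
⟨Φ+μ⟩^{-1/2} ≲ ⟨Φ⟩^{-1/2}(1+|μ|), high-low-low ones use differentiation by parts in either order of
the outer inputs, and the diagonal one is bounded trivially. -/
theorem exists_integral_gaugeD_le {α b : ℝ} (hα : 1 / 2 < α) (hα' : α ≤ 1) (hb0 : 1 / 2 < b) :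
    ∃ C : ℝ≥0∞, C < ∞ ∧ ∀ (s T μ : ℝ) (θ : ℂ) (a : ℤ → ℤ → ℂ) (e : ℤ → ℂ), 1 / 4 < s →
      xn s b a < ∞ → T ≤ 1 → ‖θ‖ₑ = 1 →
      (∀ k t, |t| ≤ T → cis (μ * t) * ser (a k) t =
        e k + θ * ∫ r in (0 : ℝ)..t, gaugeD α μ a k r) →
      ∀ (k : ℤ) (t : ℝ), |t| ≤ T → ‖∫ r in (0 : ℝ)..t, gaugeD α μ a k r‖ₑ ≤
        C * nlMaj α (ENNReal.ofReal |μ|) (fun k => hb b (a k)) k := by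
  obtain ⟨C₁, hC₁, hhll⟩ := exists_hll_integral_le hα hα' hb0
  set E := 4 * oscConst b * ENNReal.ofReal (2 ^ (1 / 2 : ℝ)) * algConst b ^ 2 with hE
  have hEt : E < ∞ := ENNReal.mul_lt_top (ENNReal.mul_lt_top (ENNReal.mul_lt_top (by simp)
    (oscConst_lt_top hb0)) ENNReal.ofReal_lt_top) (ENNReal.pow_lt_top (algConst_lt_top hb0))
  set C := C₁ + E + cubC b with hC
  have c1 : C₁ ≤ C := le_self_add.trans le_self_add
  have c2 : E ≤ C := le_add_self.trans le_self_add
  have c3 : cubC b ≤ C := le_add_self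
  refine ⟨C, ENNReal.add_lt_top.mpr ⟨ENNReal.add_lt_top.mpr ⟨hC₁, hEt⟩, cubC_lt_top hb0⟩,
    fun s T μ θ a e hs ha hT hθ hw k t ht => ?_⟩
  have hhll' := hhll s T μ θ a e hs ha hT hθ hw
  have ht1 := ht.trans hT
  set A := fun k => hb b (a k) with hA
  set Q := ENNReal.ofReal |μ| with hQ
  have hsum := hasSum_integral_oscSum_mul hb0 hs ha (q := resQ) enorm_resQ_le
    (fun p => phase α k p.1 p.2 + μ) k (m := fun _ => 1) continuous_const (M := 1) (by simp) t
  simp only [mul_one, intervalIntegral.integral_const_mul] at hsum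
  rw [show (fun r => gaugeD α μ a k r) = fun r =>
    oscSum resQ (fun p => phase α k p.1 p.2 + μ) a k r from rfl, ← hsum.tsum_eq]
  refine enorm_tsum_le_tsum_enorm.trans ?_
  have hterm : ∀ p : ℤ × ℤ, ‖resQ p * ∫ r in (0 : ℝ)..t, cis ((phase α k p.1 p.2 + μ) * r) *
      ser (trip a a a k p) r‖ₑ ≤ C * ((1 + Q) * (balHalf α k p.1 p.2 *
        (A (k + p.1) * A (k + p.1 + p.2) * A (k + p.2))) + hllTerm α Q A k p.1 p.2 +
        hllTerm α Q A k p.2 p.1 + if p = 0 then A k ^ 3 else 0) := by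
    rintro ⟨j, l⟩
    have hle : ‖resQ (j, l) * ∫ r in (0 : ℝ)..t, cis ((phase α k j l + μ) * r) *
        ser (trip a a a k (j, l)) r‖ₑ ≤ ‖∫ r in (0 : ℝ)..t, cis ((phase α k j l + μ) * r) *
        ser (trip a a a k (j, l)) r‖ₑ := by
      rw [enorm_mul]
      exact mul_le_of_le_one_left' (enorm_resQ_le _)
    by_cases h0 : j ≠ 0 ∧ l ≠ 0
    · refine hle.trans ?_
      by_cases h1 : IsHLL k j l
      · refine (hhll' k j l t h1 ht).trans (mul_le_mul' c1 ?_)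
        exact le_add_self.trans (le_self_add.trans le_self_add)
      by_cases h2 : IsHLL k l j
      · have hsym : ∀ r, ser (trip a a a k (j, l)) r = ser (trip a a a k (l, j)) r := fun r => by
          rw [ser_trip hb0 hs ha ha ha, ser_trip hb0 hs ha ha ha]
          simp only
          rw [add_right_comm k j l]; ring
        simp only [hsym, phase_swap α k j l]
        refine (hhll' k l j t h2 ht).trans (mul_le_mul' c1 ?_)
        exact le_add_self.trans le_self_add
      have hbal : IsBalanced k j l := ⟨h0.1, h0.2, h1, h2⟩
      have hfin := hb_trip_lt_top hb0 (by linarith : 0 ≤ s) ha ha ha k (j, l)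
      have hw := wt_add_le (-(1 / 2)) (phase α k j l) μ
      rw [abs_neg, abs_of_pos (by norm_num : (0 : ℝ) < 1 / 2)] at hw
      calc _ ≤ 4 * oscConst b * wt (-(1 / 2)) (phase α k j l + μ) *
            hb b (trip a a a k (j, l)) := enorm_integral_cis_mul_ser_le hb0 hfin _ ht1
        _ ≤ 4 * oscConst b * (ENNReal.ofReal (2 ^ (1 / 2 : ℝ)) * wt (-(1 / 2)) (phase α k j l) *
            (1 + Q)) * (algConst b ^ 2 * (A (k + j) * A (k + j + l) * A (k + l))) := by
            gcongr
            · exact hw.trans (mul_le_mul' le_rfl (wt_half_le_one_add μ))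
            · exact hb_trip_le (by linarith) a a a k (j, l)
        _ = E * ((1 + Q) * (balHalf α k j l * (A (k + j) * A (k + j + l) * A (k + l)))) := by
            rw [hE, balHalf, if_pos hbal]; ring
        _ ≤ _ := mul_le_mul' c2 (le_self_add.trans (le_self_add.trans le_self_add))
    · by_cases h1 : (j, l) = (0 : ℤ × ℤ)
      · refine hle.trans ?_
        refine le_trans ?_ (mul_le_mul' c3 le_add_self)
        refine enorm_integral_le_of_bound (fun r => ?_) ht1
        rw [enorm_mul, enorm_cis, one_mul, if_pos h1]
        refine (enorm_ser_trip_le (b := b) (by linarith) a k (j, l) r).trans (le_of_eq ?_)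
        obtain ⟨rfl, rfl⟩ := Prod.mk.inj h1
        simp only [add_zero, one_mul, hA]
        ring
      · simp [resQ, h0, h1]
  refine (ENNReal.tsum_le_tsum hterm).trans (le_of_eq ?_)
  have hswap : ∑' p : ℤ × ℤ, hllTerm α Q A k p.2 p.1 = hllMaj α Q A k := by
    rw [← tsum_hllTerm, ← (Equiv.prodComm ℤ ℤ).tsum_eq]; rfl
  rw [ENNReal.tsum_mul_left, ENNReal.tsum_add, ENNReal.tsum_add, ENNReal.tsum_add, hswap,
    tsum_hllTerm, tsum_ite_eq, ENNReal.tsum_mul_left, nlMaj, tri]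
  ring

/-! ### The smoothing effect -/

lemma massP_eq (f : L2) : massP f = 2 * ∑' k, ‖fourierCoeff f k‖ ^ 2 := by
  rw [massP, tsum_sq_fourierCoeff, AddCircle.volume_eq_smul_haarAddCircle,
    integral_smul_measure, ENNReal.toReal_ofReal Real.two_pi_pos.le, smul_eq_mul]
  field_simp

lemma massP_nonneg (f : L2) : 0 ≤ massP f := by
  rw [massP_eq]; positivity

lemma massP_le {s : ℝ} (hs : 0 ≤ s) {f : L2} (hf : MemSobolev s f) :
    massP f ≤ 2 * sobolevNorm s f ^ 2 := by
  have h1 : l2 (fabs f) ^ 2 ≤ sobolevENorm s f ^ 2 := by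
    rw [sobolevENorm_eq]; gcongr; exact l2_le_sob hs _
  have h2 := ENNReal.toReal_mono (ENNReal.pow_lt_top hf).ne h1
  rw [l2_sq, ENNReal.tsum_toReal_eq fun k => by simp [fabs]] at h2
  rw [massP_eq, sobolevNorm]
  simpa [fabs] using h2

lemma bourgainENormOn_congr {α s b T : ℝ} {u v : ℝ → L2} (h : Set.EqOn u v (Set.Icc (-T) T)) :
    bourgainENormOn α s b T u = bourgainENormOn α s b T v := by
  have : ∀ U, IsExtension T u U ↔ IsExtension T v U := fun U =>
    and_congr_right fun _ => forall₂_congr fun t ht => by rw [h ht]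
  simp only [bourgainENormOn, this]

lemma fourierCoeff_nonlinearPart (α ε : ℝ) (u₀ : L2) (u : ℝ → L2) (t : ℝ) (k : ℤ) :
    fourierCoeff (nonlinearPart α ε u₀ u t) k = fourierCoeff (u t) k -
      cis (-(ε * massP u₀ * t)) * (cis (t * symb α k) * fourierCoeff u₀ k) := by
  rw [nonlinearPart, fourierCoeff_coe_sub, fourierCoeff_coe_smul, linProp,
    fourierCoeff_phaseMultiplier]
  congr 2
  rw [cis]; push_cast; ring_nf

lemma fabs_nonlinearPart (α ε : ℝ) (u₀ : L2) (u : ℝ → L2) (t : ℝ) (k : ℤ) :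
    fabs (nonlinearPart α ε u₀ u t) k = ‖cis (ε * massP u₀ * t) *
      (cis (-(t * symb α k)) * fourierCoeff (u t) k) - fourierCoeff u₀ k‖ₑ := by
  rw [fabs, fourierCoeff_nonlinearPart]
  set x := fourierCoeff (u t) k
  set y := fourierCoeff u₀ k
  have h1 := cis_mul_cis_neg (ε * massP u₀ * t)
  have h2 := cis_mul_cis_neg (t * symb α k)
  have : x - cis (-(ε * massP u₀ * t)) * (cis (t * symb α k) * y) =
      cis (-(ε * massP u₀ * t)) * (cis (t * symb α k) *
        (cis (ε * massP u₀ * t) * (cis (-(t * symb α k)) * x) - y)) := by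
    linear_combination -x * h1 - x * cis (ε * massP u₀ * t) * cis (-(ε * massP u₀ * t)) * h2
  rw [this, enorm_mul, enorm_mul, enorm_cis, enorm_cis, one_mul, one_mul]

lemma ContSobolevOn.continuousOn_fourierCoeff {s : ℝ} (hs : 0 ≤ s) {J : Set ℝ} {u : ℝ → L2}
    (h : ContSobolevOn s J u) (k : ℤ) : ContinuousOn (fun t => fourierCoeff (u t) k) J := by
  intro t₀ ht₀
  refine tendsto_iff_edist_tendsto_0.mpr (tendsto_of_tendsto_of_tendsto_of_le_of_le
    tendsto_const_nhds (h.2 t₀ ht₀) (fun _ => by positivity) fun t => ?_)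
  simp only
  rw [edist_eq_enorm_sub, ← fourierCoeff_coe_sub, sobolevENorm_eq]
  exact le_sob hs (fabs (u t - u t₀)) k

/-- Up to unimodular factors the coefficients of the nonlinear part are the integrals of `gaugeD`.
The majorant A consists of the H^b norms of the profiles, so it does not depend on t. -/
theorem exists_fabs_nonlinearPart_le {α s b ε : ℝ} (hα : 1 / 2 < α) (hα' : α ≤ 1)
    (hb0 : 1 / 2 < b) (hb1 : b < 1) (hs : 1 / 4 < s) (hε : ε = 1 ∨ ε = -1) :
    ∃ C M : ℝ≥0∞, C < ∞ ∧ M < ∞ ∧ ∀ (u₀ : L2) (u : ℝ → L2) (T : ℝ) (R : ℝ≥0∞), 0 < T → T ≤ 1 →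
      IsSolution α s b ε T u₀ u → bourgainENormOn α s b T u < R → R < ∞ →
      ∃ A : ℤ → ℝ≥0∞, sob s A ≤ M * R ∧ ∀ t ∈ Set.Icc (-T) T, ∀ k,
        fabs (nonlinearPart α ε u₀ u t) k ≤ C * nlMaj α (ENNReal.ofReal (massP u₀)) A k := by
  obtain ⟨C, hC, hmain⟩ := exists_integral_gaugeD_le hα hα' hb0
  obtain ⟨M, hM, hex⟩ := exists_array_of_extension hb0 hb1 s (by linarith)
  refine ⟨C, M, hC, hM, fun u₀ u T R hT hT1 hu hR hRt => ?_⟩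
  obtain ⟨U, hU, hUR⟩ := exists_extension hR
  -- Time unit 1 is used even when T is smaller; the series then represents the profile only for |t|
  -- ≤ T, which is all that is needed, and no constant depends on T.
  obtain ⟨a, ha, har⟩ := hex α T 1 0 u U one_pos le_rfl hU (hUR.trans hRt)
  have ha' : xn s b a ≤ M * R := ha.trans (by gcongr)
  have hat : xn s b a < ∞ := ha'.trans_lt (ENNReal.mul_lt_top hM hRt)
  have har' : ∀ k t, |t| ≤ T → ser (a k) t = prof α 0 1 u k t := fun k t ht =>
    har k t (ht.trans hT1) (by simpa using ht)
  have hprof : ∀ k t, prof α 0 1 u k t = cis (-(t * symb α k)) * fourierCoeff (u t) k := by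
    intro k t; simp [prof]
  set θ : ℂ := -(Complex.I * ε) with hθ
  have hsol : ∀ k t, |t| ≤ T → ser (a k) t = fourierCoeff u₀ k + -(Complex.I * ε) *
      ∫ r in (0 : ℝ)..t, cubicSum α 1 (fun k => ser (a k)) k r := by
    intro k t ht
    rw [har' k t ht, hprof, hu.duhamel_profile (abs_le.mp ht) k]
    congr 2
    refine intervalIntegral.integral_congr fun r hr => ?_
    have hr' := (abs_le_of_mem_uIcc_zero hr).trans ht
    have h1 := cubicSum_prof (α := α) hs (t₀ := 0) (T := 1) (r := r) (u := u)
      (by simpa using hu.sob_lt_top (abs_le.mp hr')) k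
    simp only [mul_one, zero_add] at h1
    rw [← h1]
    simp only [cubicSum, har' _ r hr']
  have hP : ∀ t, |t| ≤ T → HasSum (fun k => ‖ser (a k) t‖ ^ 2) (massP u₀ / 2) := by
    intro t ht
    rw [massP_eq, mul_div_cancel_left₀ _ two_ne_zero]
    exact tsum_normSq_ser hb0 hs hat hsol ht
  have hw := fun k t (ht : |t| ≤ T) => gauge_eq hb0 hs hat hsol hP k ht
  have hθ1 : ‖θ‖ₑ = 1 := by rw [← ofReal_norm, norm_neg_I_mul hε, ENNReal.ofReal_one]
  have hQ : |ε * massP u₀| = massP u₀ := by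
    rcases hε with rfl | rfl <;> simp [massP_nonneg]
  refine ⟨fun k => hb b (a k), ha', fun t ht k => ?_⟩
  have ht' := abs_le.mpr ht
  rw [fabs_nonlinearPart, ← hprof, ← har' k t ht', hw k t ht', add_sub_cancel_left, enorm_mul, hθ1,
    one_mul]
  have := hmain s T (ε * massP u₀) θ a _ hs hat hT1 hθ1 hw k t ht'
  rwa [hQ] at this

theorem exists_smoothing {α s b ε a : ℝ} (hα : 1 / 2 < α) (hα' : α ≤ 1) (hb0 : 1 / 2 < b)
    (hb1 : b < 1) (hs : 1 / 4 < s) (hsα : 0 < 2 * s + α - 1) (hε : ε = 1 ∨ ε = -1)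
    (ha : a ≤ 2 * α - 1) (ha' : a < 2 * s + α - 1) (K : ℝ) :
    ∃ C : ℝ, ∀ (u₀ : L2) (T : ℝ) (u : ℝ → L2), MemSobolev s u₀ →
      IsLocalExistenceTime α s b ε K u₀ T → IsSolution α s b ε T u₀ u →
      ContSobolevOn (s + a) (Set.Icc (-T) T) (nonlinearPart α ε u₀ u) ∧
        ∀ t ∈ Set.Icc (-T) T, sobolevENorm (s + a) (nonlinearPart α ε u₀ u t) ≤
          ENNReal.ofReal (C * (sobolevNorm s u₀ ^ 3 + sobolevNorm s u₀ ^ 5)) := by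
  obtain ⟨C₁, M, hC₁, hM, h₁⟩ := exists_fabs_nonlinearPart_le hα hα' hb0 hb1 hs hε
  -- Negative a is reduced to a = 0, which is admissible because both upper bounds for a are
  -- positive.
  obtain ⟨C₂, hC₂, h₂⟩ := exists_sob_nlMaj_le (a := max a 0) hα hα' hs (le_max_right _ _)
    (max_le ha (by linarith)) (max_lt ha' hsα)
  set c := (C₁ * C₂).toReal with hc
  have hcC : C₁ * C₂ = ENNReal.ofReal c :=
    (ENNReal.ofReal_toReal (ENNReal.mul_lt_top hC₁ hC₂).ne).symm
  set m := M.toReal with hm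
  have hmM : M = ENNReal.ofReal m := (ENNReal.ofReal_toReal hM.ne).symm
  have hc0 : 0 ≤ c := ENNReal.toReal_nonneg
  have hm0 : 0 ≤ m := ENNReal.toReal_nonneg
  refine ⟨c * (2 * (m * |K|) ^ 3 + (m * |K|) ^ 5), fun u₀ T u hu₀ hloc hu => ?_⟩
  obtain ⟨hT, hT1, v, hv, hvK, huniq⟩ := hloc
  set n := sobolevNorm s u₀ with hn
  have hn0 : 0 ≤ n := ENNReal.toReal_nonneg
  have huK : bourgainENormOn α s b T u ≤ ENNReal.ofReal (K * n) := by
    -- The bound with K is stated for some solution; uniqueness and the locality of the restriction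
    -- norm transfer it to `u`.
    rwa [bourgainENormOn_congr (huniq u hu)]
  -- Choosing an extension requires a bound strictly above the infimum. The slack ρ is sent to 0 in
  -- the norm estimate, so that the result is homogeneous in the size of the data; continuity needs
  -- only ρ = 1.
  have key : ∀ ρ : ℝ, 0 < ρ → ∃ V : ℤ → ℝ≥0∞,
      sob (s + a) V ≤ ENNReal.ofReal (c * ((1 + 2 * n ^ 2) * (m * (|K| * n + ρ)) ^ 3 +
        (m * (|K| * n + ρ)) ^ 5)) ∧
      ∀ t ∈ Set.Icc (-T) T, ∀ k, fabs (nonlinearPart α ε u₀ u t) k ≤ V k := by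
    intro ρ hρ
    have hR : 0 < |K| * n + ρ := by positivity
    obtain ⟨A, hA, hle⟩ := h₁ u₀ u T (ENNReal.ofReal (|K| * n + ρ)) hT hT1 hu (huK.trans_lt (by
      rw [ENNReal.ofReal_lt_ofReal_iff hR]
      nlinarith [mul_le_mul_of_nonneg_right (le_abs_self K) hn0])) ENNReal.ofReal_lt_top
    refine ⟨fun k => C₁ * nlMaj α (ENNReal.ofReal (massP u₀)) A k, ?_, hle⟩
    rw [sob_const_mul]
    have hA' : sob s A ≤ ENNReal.ofReal (m * (|K| * n + ρ)) := by
      rwa [ENNReal.ofReal_mul hm0, ← hmM]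
    have hP : ENNReal.ofReal (massP u₀) ≤ ENNReal.ofReal (2 * n ^ 2) :=
      ENNReal.ofReal_le_ofReal (massP_le (by linarith) hu₀)
    set y := m * (|K| * n + ρ) with hy
    have hy0 : 0 ≤ y := by positivity
    calc C₁ * sob (s + a) (nlMaj α (ENNReal.ofReal (massP u₀)) A)
        ≤ C₁ * sob (s + max a 0) (nlMaj α (ENNReal.ofReal (massP u₀)) A) := by
          gcongr
          exact sob_le_sob (by linarith [le_max_left a 0]) _
      _ ≤ C₁ * (C₂ * ((1 + ENNReal.ofReal (massP u₀)) * sob s A ^ 3 + sob s A ^ 5)) := by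
          gcongr; exact h₂ _ _
      _ ≤ C₁ * (C₂ * ((1 + ENNReal.ofReal (2 * n ^ 2)) * ENNReal.ofReal y ^ 3 +
            ENNReal.ofReal y ^ 5)) := by gcongr
      _ = _ := by
          rw [← mul_assoc, hcC, ← ENNReal.ofReal_one, ← ENNReal.ofReal_add zero_le_one (by positivity),
            ← ENNReal.ofReal_pow hy0, ← ENNReal.ofReal_pow hy0, ← ENNReal.ofReal_mul (by positivity),
            ← ENNReal.ofReal_add (by positivity) (by positivity), ← ENNReal.ofReal_mul hc0]
  refine ⟨?_, fun t ht => ?_⟩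
  · obtain ⟨V, hV, hle⟩ := key 1 one_pos
    refine contSobolevOn_of_dominated (hV.trans_lt ENNReal.ofReal_lt_top) hle fun k => ?_
    have h3 := hu.cont.continuousOn_fourierCoeff (by linarith) k
    simp only [fourierCoeff_nonlinearPart]
    fun_prop
  · have hlim : Tendsto (fun ρ : ℝ => ENNReal.ofReal (c * ((1 + 2 * n ^ 2) *
        (m * (|K| * n + ρ)) ^ 3 + (m * (|K| * n + ρ)) ^ 5))) (𝓝[>] 0)
        (𝓝 (ENNReal.ofReal (c * ((1 + 2 * n ^ 2) * (m * (|K| * n + 0)) ^ 3 +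
          (m * (|K| * n + 0)) ^ 5)))) := by
      refine ENNReal.tendsto_ofReal (Tendsto.mono_left ?_ nhdsWithin_le_nhds)
      exact Continuous.tendsto (by fun_prop) 0
    refine (ge_of_tendsto hlim (eventually_nhdsWithin_of_forall fun ρ hρ => ?_)).trans ?_
    · obtain ⟨V, hV, hle⟩ := key ρ hρ
      rw [sobolevENorm_eq]
      exact (sob_mono (hle t ht)).trans hV
    · refine ENNReal.ofReal_le_ofReal ?_
      rw [add_zero, mul_assoc]
      gcongr
      have hK := abs_nonneg K
      have e1 : (1 + 2 * n ^ 2) * (m * (|K| * n)) ^ 3 + (m * (|K| * n)) ^ 5 =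
          (m * |K|) ^ 3 * (n ^ 3 + 2 * n ^ 5) + (m * |K|) ^ 5 * n ^ 5 := by ring
      have p3 : 0 ≤ (m * |K|) ^ 3 := by positivity
      have p5 : 0 ≤ (m * |K|) ^ 5 := by positivity
      have q3 : 0 ≤ n ^ 3 := by positivity
      have q5 : 0 ≤ n ^ 5 := by positivity
      rw [e1]
      -- The factor 1 + P ≤ 1 + 2n² is what raises part of the cubic bound to fifth order.
      nlinarith [mul_nonneg p3 q3, mul_nonneg p5 q3]

end FracNLS

end

theorem theorem1 (α s ε : ℝ) (hα : 1 / 2 < α) (hα' : α ≤ 1) (hs : 3 / 4 - α / 2 < s)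
    (hε : ε = 1 ∨ ε = -1) :
    ∃ b₀ : ℝ, 1 / 2 < b₀ ∧ ∀ b : ℝ, 1 / 2 < b → b < b₀ →
      -- local existence times exist, and can be chosen to depend on the size of the datum only
      (∃ (K : ℝ) (τ : ℝ → ℝ), Antitone τ ∧ ∀ u₀ : FracNLS.L2, FracNLS.MemSobolev s u₀ →
        FracNLS.IsLocalExistenceTime α s b ε K u₀ (τ (FracNLS.sobolevNorm s u₀))) ∧
      -- smoothing on every local existence interval
      ∀ a : ℝ, a ≤ min (2 * α - 1) (2 * s + α - 1) →
        (min (2 * α - 1) (2 * s + α - 1) = 2 * s + α - 1 → a < 2 * s + α - 1) →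
        ∀ K : ℝ, ∃ C : ℝ, ∀ (u₀ : FracNLS.L2) (T : ℝ) (u : ℝ → FracNLS.L2),
          FracNLS.MemSobolev s u₀ →
          FracNLS.IsLocalExistenceTime α s b ε K u₀ T →
          FracNLS.IsSolution α s b ε T u₀ u →
          FracNLS.ContSobolevOn (s + a) (Set.Icc (-T) T) (FracNLS.nonlinearPart α ε u₀ u) ∧
          ∀ t ∈ Set.Icc (-T) T,
            FracNLS.sobolevENorm (s + a) (FracNLS.nonlinearPart α ε u₀ u t) ≤
              ENNReal.ofReal
                (C * (FracNLS.sobolevNorm s u₀ ^ 3 + FracNLS.sobolevNorm s u₀ ^ 5)) := by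
  have hs' : 1 / 4 < s := by linarith
  have hb₀ : 1 / (4 * α) < 1 / 2 := by
    rw [div_lt_div_iff₀ (by linarith) (by norm_num)]; linarith
  -- The bound for b comes from the local theory, which needs α(2 - 2b) > 1/2; it exceeds 1/2
  -- because α > 1/2.
  refine ⟨1 - 1 / (4 * α), by linarith, fun b hb0 hb' =>
    ⟨FracNLS.exists_localExistenceTime hα hα' hb0 hb' hs' hε, fun a ha ha' K => ?_⟩⟩
  have hb1 : b < 1 := by
    have : 0 < 1 / (4 * α) := by positivity
    linarith
  have ha1 : a ≤ 2 * α - 1 := ha.trans (min_le_left _ _)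
  -- If 2s + α - 1 is not the minimum, the bound by 2α - 1 already makes the inequality strict; in
  -- the case of equality the strictness hypothesis applies.
  have ha2 : a < 2 * s + α - 1 := by
    rcases le_total (2 * s + α - 1) (2 * α - 1) with h | h
    · exact ha' (min_eq_right h)
    · rcases h.lt_or_eq with h1 | h1
      · exact ha1.trans_lt h1
      · exact ha' (min_eq_right h1.ge)
  exact FracNLS.exists_smoothing hα hα' hb0 hb1 hs' (by linarith) hε ha1 ha2 K
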